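/- Let $X\subset\mathbb C^d$ be a homogeneous Siegel domain of genus $1$ or $2$: in suitable complex linear coordinates $X=\{(x,w)\in\mathbb C^n\times\mathbb C^m : \operatorname{Im}x-F(w,w)\in\Omega\}$ with $\Omega\subset\mathbb R^n$ an open convex cone that is proper ($\overline\Omega\cap-\overline\Omega=\{0\}$) and $F:\mathbb C^m\times\mathbb C^m\to\mathbb C^n$ an $\Omega$-Hermitian map ($\mathbb C$-linear in the first argument, $F(w,w')=\overline{F(w',w)}$, $F(w,w)\in\overline\Omega$, and $F(w,w)=0$ only for $w=0$), and the group $\operatorname{Aut}_{\mathcal O}(X)$ of holomorphic automorphisms acts transitively on $X$. Let $J$ be the complex structure and $\omega$ the Kähler form of the Bergman metric of $X$. Let $B$ be a maximal connected split solvable subgroup of $\operatorname{Aut}_{\mathcal O}(X)$, where a connected subgroup is called split solvable if its adjoint action on the Lie algebra of $\operatorname{Aut}_{\mathcal O}(X)$ is by upper triangular matrices in a suitable real basis. Let $H$ be a closed subgroup of $B$ with Lie algebra $\mathfrak h$, and let $\mu_H:X\to\mathfrak h^*$ be a momentum map for the action of $H$, i.e. an $H$-equivariant map (for the coadjoint action)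 with $d\mu_H^\xi=\omega(\xi_X,\cdot)$ for all $\xi\in\mathfrak h$, where $\mu_H^\xi(x)=\mu_H(x)(\xi)$ and $\xi_X(x)=\frac{d}{dt}\big|_{t=0}\exp(t\xi)\cdot x$. Put $\mathcal M_H:=\mu_H^{-1}(0)$ and $W_x:=T_x\mathcal M_H\cap J\,T_x\mathcal M_H$ for $x\in\mathcal M_H$. Assume that $H$ fulfils the Lie condition: 1. $\mathcal M_H$ is connected; 2. there are a point $x_0\in\mathcal M_H$ and a Lie subalgebra $\mathfrak s$ of the Lie algebra of $B$ with $W_{x_0}=\mathfrak s\cdot x_0:=\{\xi_X(x_0):\xi\in\mathfrak s\}$; 3. for these, $\exp(\mathfrak s)\cdot x_0\subset\mathcal M_H$. Then $\mathcal M_H$ is a real analytic submanifold of $X$ and it is Levi flat. That is, $W=T\mathcal M_H\cap J\,T\mathcal M_H$ is a real analytic distribution of constant rank on $\mathcal M_H$, it is involutive, and every leaf of the induced foliation is locally a complex manifold: each point $q$ of a leaf has arbitrarily small open neighbourhoods $U$ in $\mathbb C^d$ such that the leaf through $q$ of the restriction of $W$ to $\mathcal M_H\cap U$ is a complex submanifold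 with tangent space $W_y$ at each of its points $y$. -/

import Mathlib

open scoped Topology ContDiff ComplexConjugate
open MeasureTheory

noncomputable section

/-! ## Siegel domains -/

/-- A proper open convex cone in `ℝⁿ`: an open convex cone whose closure contains no line (and
whose closure contains the origin, so that the cone is not empty). -/
structure IsProperOpenConvexCone {n : ℕ} (Ω : Set (Fin n → ℝ)) : Prop where
  isOpen : IsOpen Ω
  convex : Convex ℝ Ω
  smul_mem : ∀ x ∈ Ω, ∀ t : ℝ, 0 < t → t • x ∈ Ω
  proper : closure Ω ∩ -closure Ω = {0}

/-- An `Ω`-Hermitian map `F : W × W → V ⊗ ℂ` for `V = ℝⁿ` and `W = ℂᵐ`. -/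
structure IsConeHermitian {n m : ℕ} (Ω : Set (Fin n → ℝ))
    (F : (Fin m → ℂ) → (Fin m → ℂ) → (Fin n → ℂ)) : Prop where
  linear_left : ∀ w, IsLinearMap ℂ fun v => F v w
  conj_symm : ∀ v w i, F v w i = conj (F w v i)
  diag_mem : ∀ w, (fun i => (F w w i).re) ∈ closure Ω
  definite : ∀ w, F w w = 0 ↔ w = 0

/-- `D(Ω, F) = {(x, w) | Im x - F(w, w) ∈ Ω}`.  The value `F(w, w)` is real, so that it equals its
real part.  For `m = 0` this is the tube domain `ℝⁿ + iΩ`. -/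
def siegelSet {n m : ℕ} (Ω : Set (Fin n → ℝ)) (F : (Fin m → ℂ) → (Fin m → ℂ) → (Fin n → ℂ)) :
    Set ((Fin n → ℂ) × (Fin m → ℂ)) :=
  {p | (fun i => (p.1 i).im - (F p.2 p.2 i).re) ∈ Ω}

/-- A Siegel domain (of genus 1 or 2) in `ℂᵈ`: in suitable complex linear coordinates
`ℂᵈ ≃ ℂⁿ × ℂᵐ` it is `D(Ω, F)`. -/
def IsSiegelDomain {d : ℕ} (X : Set (Fin d → ℂ)) : Prop :=
  ∃ (n m : ℕ) (Ω : Set (Fin n → ℝ)) (F : (Fin m → ℂ) → (Fin m → ℂ) → (Fin n → ℂ))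
    (e : (Fin d → ℂ) ≃ₗ[ℂ] (Fin n → ℂ) × (Fin m → ℂ)),
    IsProperOpenConvexCone Ω ∧ IsConeHermitian Ω F ∧ X = e ⁻¹' siegelSet Ω F

/-! ## The group of holomorphic automorphisms and Lie algebras of its subgroups -/

/-- The holomorphic automorphisms of an open set `X ⊆ ℂᵈ`, each of them recorded as a permutation
of `ℂᵈ` that is the identity off `X` (so that it maps `X` onto `X`). -/
def holAutSubgroup {d : ℕ} (X : Set (Fin d → ℂ)) : Subgroup (Equiv.Perm (Fin d → ℂ)) where
  carrier := {g | (∀ x, x ∉ X → g x = x) ∧ DifferentiableOn ℂ g X ∧ DifferentiableOn ℂ g.symm X}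
  one_mem' := ⟨fun _ _ => rfl, differentiableOn_id, differentiableOn_id⟩
  mul_mem' := by
    have key : ∀ g : Equiv.Perm (Fin d → ℂ), (∀ x, x ∉ X → g x = x) → Set.MapsTo g X X := by
      intro g hg x hx
      by_contra h
      have h2 : g x = x := g.injective (hg _ h)
      rw [h2] at h
      exact h hx
    have key' : ∀ g : Equiv.Perm (Fin d → ℂ), (∀ x, x ∉ X → g x = x) →
        ∀ x, x ∉ X → g.symm x = x := by
      intro g hg x hx
      rw [Equiv.symm_apply_eq]
      exact (hg x hx).symm
    rintro a b ⟨ha, ha1, ha2⟩ ⟨hb, hb1, hb2⟩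
    refine ⟨fun x hx => ?_, ha1.comp hb1 (key b hb), hb2.comp ha2 (key _ (key' a ha))⟩
    rw [Equiv.Perm.mul_apply, hb x hx, ha x hx]
  inv_mem' := by
    rintro a ⟨ha, ha1, ha2⟩
    refine ⟨fun x hx => ?_, ha2, ha1⟩
    exact (Equiv.symm_apply_eq a).2 (ha x hx).symm

/-- The group of holomorphic automorphisms of `X`. -/
def HolAut {d : ℕ} (X : Set (Fin d → ℂ)) : Type := ↥(holAutSubgroup X)

instance {d : ℕ} (X : Set (Fin d → ℂ)) : Group (HolAut X) :=
  inferInstanceAs (Group ↥(holAutSubgroup X))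

/-- The restriction of an automorphism to `X`, as a continuous map. -/
def HolAut.restrict {d : ℕ} {X : Set (Fin d → ℂ)} (g : HolAut X) : C(X, Fin d → ℂ) where
  toFun x := g.1 x
  continuous_toFun := continuousOn_iff_continuous_domRestrict.1 g.2.2.1.continuousOn

/-- The automorphism group carries the compact-open topology. -/
instance {d : ℕ} (X : Set (Fin d → ℂ)) : TopologicalSpace (HolAut X) :=
  TopologicalSpace.induced HolAut.restrict inferInstance

/-- `X` is homogeneous: the automorphism group acts transitively. -/
def IsHomogeneousDomain {d : ℕ} (X : Set (Fin d → ℂ)) : Prop :=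
  ∀ x ∈ X, ∀ y ∈ X, ∃ g : HolAut X, g.1 x = y

/-- `φ` is the one-parameter group `t ↦ exp (t ξ)` of automorphisms of `X` that is generated by
the holomorphic vector field `ξ` on `X`.  Vector fields on `X` are recorded as maps on `ℂᵈ` that
vanish off `X`. -/
structure IsOneParameterGroup {d : ℕ} {X : Set (Fin d → ℂ)} (φ : ℝ → HolAut X)
    (ξ : (Fin d → ℂ) → (Fin d → ℂ)) : Prop where
  eq_zero : ∀ x, x ∉ X → ξ x = 0
  holomorphic : DifferentiableOn ℂ ξ X
  map_add : ∀ s t, φ (s + t) = φ s * φ t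
  hasDerivAt : ∀ x ∈ X, ∀ t, HasDerivAt (fun s => (φ s).1 x) (ξ ((φ t).1 x)) t

/-- The holomorphic vector fields `ξ` on `X` with `exp (t ξ) ∈ Γ` for all `t`.  An element of the
Lie algebra of `Γ` is identified with its fundamental vector field on `X`, which determines it,
because the action on `X` is effective. -/
def lieSet {d : ℕ} {X : Set (Fin d → ℂ)} (Γ : Subgroup (HolAut X)) :
    Set ((Fin d → ℂ) → (Fin d → ℂ)) :=
  {ξ | ∃ φ : ℝ → HolAut X, IsOneParameterGroup φ ξ ∧ ∀ t, φ t ∈ Γ}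

/-- The Lie algebra of a closed subgroup `Γ`, as a real vector space of vector fields.
(For closed `Γ` the set `lieSet Γ` is itself a linear subspace, by the classical theory of Lie
groups; the span only spares a proof of this here.) -/
def lieAlg {d : ℕ} {X : Set (Fin d → ℂ)} (Γ : Subgroup (HolAut X)) :
    Submodule ℝ ((Fin d → ℂ) → (Fin d → ℂ)) :=
  Submodule.span ℝ (lieSet Γ)

/-- The adjoint action `Ad(g) ξ = g_* ξ` on vector fields. -/
def adAct {d : ℕ} {X : Set (Fin d → ℂ)} (g : HolAut X) (ξ : (Fin d → ℂ) → (Fin d → ℂ)) :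
    (Fin d → ℂ) → (Fin d → ℂ) :=
  fun x => fderiv ℂ g.1 (g.1.symm x) (ξ (g.1.symm x))

/-- The bracket of vector fields on `X` (again extended by zero).  It is the negative of the bracket
of the corresponding Lie algebra elements; the Lie subalgebras are the same. -/
def fieldBracket {d : ℕ} (X : Set (Fin d → ℂ)) (ξ η : (Fin d → ℂ) → (Fin d → ℂ)) :
    (Fin d → ℂ) → (Fin d → ℂ) :=
  X.indicator (VectorField.lieBracket ℂ ξ η)

/-- A connected split solvable (that is, connected triangular) subgroup `B` of the automorphism
group `G`: in a suitable real basis of the Lie algebra of `G`, all operators `Ad(b)`, `b ∈ B`, are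
upper triangular. -/
def IsConnectedSplitSolvable {d : ℕ} {X : Set (Fin d → ℂ)} (B : Subgroup (HolAut X)) : Prop :=
  IsConnected (B : Set (HolAut X)) ∧
    ∃ (n : ℕ) (e : Module.Basis (Fin n) ℝ (lieAlg (⊤ : Subgroup (HolAut X)))), ∀ b ∈ B, ∀ i,
      adAct b (e i : (Fin d → ℂ) → (Fin d → ℂ)) ∈ Submodule.span ℝ
        ((fun j => (e j : (Fin d → ℂ) → (Fin d → ℂ))) '' Set.Iic i)

/-! ## The Bergman form and momentum maps -/

/-- The Bergman space: square integrable holomorphic functions on `X`. -/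
def bergmanSpace {d : ℕ} (X : Set (Fin d → ℂ)) : Set ((Fin d → ℂ) → ℂ) :=
  {f | DifferentiableOn ℂ f X ∧ MemLp f 2 (volume.restrict X)}

/-- `K` is a reproducing kernel of the Bergman space of `X`. -/
def IsBergmanKernel {d : ℕ} (X : Set (Fin d → ℂ)) (K : (Fin d → ℂ) → (Fin d → ℂ) → ℂ) : Prop :=
  ∀ w ∈ X, (fun z => K z w) ∈ bergmanSpace X ∧
    ∀ f ∈ bergmanSpace X, f w = ∫ z in X, f z * conj (K z w)

/-- The Bergman kernel of `X`, i.e. the reproducing kernel of the Bergman space (it exists for each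
open `X`, and it is unique on `X × X`). -/
def bergmanKernel {d : ℕ} (X : Set (Fin d → ℂ)) : (Fin d → ℂ) → (Fin d → ℂ) → ℂ :=
  Classical.epsilon (IsBergmanKernel X)

/-- The potential `ρ(x) = log K(x, x)` of the Bergman metric. -/
def bergmanPotential {d : ℕ} (X : Set (Fin d → ℂ)) (x : Fin d → ℂ) : ℝ :=
  Real.log (bergmanKernel X x x).re

/-- The Kähler form `ω = -d dᶜ ρ` of the Bergman metric at the point `x`, where `dᶜ ρ = dρ ∘ J` and
`J` is multiplication by `i`. With constant vector fields `u`, `v` this is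
`ω(u, v) = - D_u (D_{Jv} ρ) + D_v (D_{Ju} ρ)`. -/
def bergmanForm {d : ℕ} (X : Set (Fin d → ℂ)) (x u v : Fin d → ℂ) : ℝ :=
  - fderiv ℝ (fderiv ℝ (bergmanPotential X)) x u (Complex.I • v)
    + fderiv ℝ (fderiv ℝ (bergmanPotential X)) x v (Complex.I • u)

/-- `μ : X → 𝔥*` is a momentum map for the action of `H` on `(X, ω)`: it satisfies
`dμ^ξ = ω(ξ, ·)`, and it is equivariant for the coadjoint action.  Only the values of `μ` on `X`
matter. -/
structure IsMomentumMap {d : ℕ} {X : Set (Fin d → ℂ)} (H : Subgroup (HolAut X))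
    (μ : (Fin d → ℂ) → Module.Dual ℝ (lieAlg H)) : Prop where
  differentiableAt : ∀ (ξ : lieAlg H), ∀ x ∈ X, DifferentiableAt ℝ (fun y => μ y ξ) x
  fderiv_eq : ∀ (ξ : lieAlg H), ∀ x ∈ X, ∀ v,
    fderiv ℝ (fun y => μ y ξ) x v = bergmanForm X x (ξ.1 x) v
  equivariant : ∀ h ∈ H, ∀ ξ η : lieAlg H, η.1 = adAct h ξ.1 → ∀ x ∈ X, μ (h.1 x) η = μ x ξ

/-- The zero level set `μ⁻¹(0)` in `X`. -/
def zeroLevel {d : ℕ} {X : Set (Fin d → ℂ)} {H : Subgroup (HolAut X)}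
    (μ : (Fin d → ℂ) → Module.Dual ℝ (lieAlg H)) : Set (Fin d → ℂ) :=
  {x | x ∈ X ∧ μ x = 0}

/-! ## Submanifolds, the distribution `TM ∩ J TM`, and Levi flatness -/

/-- `M` is a (locally closed, embedded) analytic submanifold over `𝕜`: locally the zero set of an
analytic submersion to `𝕜ᵏ`.  For `𝕜 = ℝ` these are the real analytic submanifolds of `ℂᵈ`, for
`𝕜 = ℂ` the complex submanifolds. -/
def IsAnalyticSubmanifold (𝕜 : Type) [NontriviallyNormedField 𝕜] {E : Type}
    [NormedAddCommGroup E] [NormedSpace 𝕜 E] (M : Set E) : Prop :=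
  ∃ k : ℕ, ∀ p ∈ M, ∃ U : Set E, IsOpen U ∧ p ∈ U ∧ ∃ f : E → (Fin k → 𝕜),
    AnalyticOnNhd 𝕜 f U ∧ (∀ x ∈ U, Function.Surjective (fderiv 𝕜 f x)) ∧
      M ∩ U = {x | x ∈ U ∧ f x = 0}

/-- The tangent vectors of `M` at `x`: the velocities of curves in `M` through `x`. -/
def tangentVectors {d : ℕ} (M : Set (Fin d → ℂ)) (x : Fin d → ℂ) : Set (Fin d → ℂ) :=
  {v | ∃ γ : ℝ → (Fin d → ℂ), γ 0 = x ∧ (∀ᶠ t in 𝓝 0, γ t ∈ M) ∧ HasDerivAt γ v 0}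

/-- `W_x = T_x M ∩ J T_x M`. -/
def leviDistribution {d : ℕ} (M : Set (Fin d → ℂ)) (x : Fin d → ℂ) : Set (Fin d → ℂ) :=
  tangentVectors M x ∩ (fun v => Complex.I • v) '' tangentVectors M x

/-- `D` is a real analytic distribution of constant rank on `M`: near each point of `M` it is
spanned by a real analytic frame. -/
def IsAnalyticDistribution {d : ℕ} (M : Set (Fin d → ℂ)) (D : (Fin d → ℂ) → Set (Fin d → ℂ)) :
    Prop :=
  ∃ r : ℕ, ∀ p ∈ M, ∃ U : Set (Fin d → ℂ), IsOpen U ∧ p ∈ U ∧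
    ∃ e : Fin r → (Fin d → ℂ) → (Fin d → ℂ), (∀ i, AnalyticOnNhd ℝ (e i) U) ∧
      ∀ x ∈ M ∩ U, LinearIndependent ℝ (fun i => e i x) ∧
        (Submodule.span ℝ (Set.range fun i => e i x) : Set (Fin d → ℂ)) = D x

/-- `D` is involutive: the bracket of two local sections of `D` is a local section of `D`.  Local
sections over `M ∩ U` are written as restrictions of smooth vector fields on the open set `U`. -/
def IsInvolutive {d : ℕ} (M : Set (Fin d → ℂ)) (D : (Fin d → ℂ) → Set (Fin d → ℂ)) : Prop :=
  ∀ U : Set (Fin d → ℂ), IsOpen U → ∀ ξ η : (Fin d → ℂ) → (Fin d → ℂ),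
    ContDiffOn ℝ ∞ ξ U → ContDiffOn ℝ ∞ η U →
      (∀ x ∈ M ∩ U, ξ x ∈ D x) → (∀ x ∈ M ∩ U, η x ∈ D x) →
        ∀ x ∈ M ∩ U, VectorField.lieBracket ℝ ξ η x ∈ D x

/-- The leaf of `D` in `N` through `p`: all points of `N` that can be joined to `p` by a `C¹` curve
in `N` tangent to `D`. -/
def leaf {d : ℕ} (D : (Fin d → ℂ) → Set (Fin d → ℂ)) (N : Set (Fin d → ℂ)) (p : Fin d → ℂ) :
    Set (Fin d → ℂ) :=
  {q | ∃ γ : ℝ → (Fin d → ℂ), ContDiffOn ℝ 1 γ (Set.Icc 0 1) ∧ γ 0 = p ∧ γ 1 = q ∧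
    ∀ t ∈ Set.Icc (0 : ℝ) 1, γ t ∈ N ∧ derivWithin γ (Set.Icc 0 1) t ∈ D (γ t)}

/-- `M` is Levi flat: `W = TM ∩ J TM` is an involutive (real analytic) distribution on `M`, and each
leaf `L` of the induced foliation is locally a complex manifold.  The latter means that each `q ∈ L`
has arbitrarily small open neighbourhoods `U` in `ℂᵈ` for which the plaque of `L` through `q`, that
is the leaf through `q` of the restriction of `W` to `M ∩ U`, is a complex submanifold with tangent
spaces `W`. -/
structure IsLeviFlat {d : ℕ} (M : Set (Fin d → ℂ)) : Prop where
  distribution : IsAnalyticDistribution M (leviDistribution M)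
  involutive : IsInvolutive M (leviDistribution M)
  leaves : ∀ p ∈ M, ∀ q ∈ leaf (leviDistribution M) M p, ∀ O : Set (Fin d → ℂ), IsOpen O → q ∈ O →
    ∃ U : Set (Fin d → ℂ), IsOpen U ∧ q ∈ U ∧ U ⊆ O ∧
      IsAnalyticSubmanifold ℂ (leaf (leviDistribution M) (M ∩ U) q) ∧
      ∀ y ∈ leaf (leviDistribution M) (M ∩ U) q,
        tangentVectors (leaf (leviDistribution M) (M ∩ U) q) y = leviDistribution M y

/-! ## The Lie condition -/

/-- The action of `H ≤ B` with momentum map `μ` fulfils the Lie condition: the zero level set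
`M = μ⁻¹(0)` is connected, and for some `x₀ ∈ M` and some Lie subalgebra `s` of the Lie algebra of
`B` we have `W_{x₀} = s · x₀` and `exp(s) · x₀ ⊆ M`. -/
def LieCondition {d : ℕ} {X : Set (Fin d → ℂ)} (B : Subgroup (HolAut X)) {H : Subgroup (HolAut X)}
    (μ : (Fin d → ℂ) → Module.Dual ℝ (lieAlg H)) : Prop :=
  IsConnected (zeroLevel μ) ∧
    ∃ x₀ ∈ zeroLevel μ, ∃ s : Submodule ℝ ((Fin d → ℂ) → (Fin d → ℂ)),
      (∀ ξ ∈ s, ξ ∈ lieSet B) ∧ (∀ ξ ∈ s, ∀ η ∈ s, fieldBracket X ξ η ∈ s) ∧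
      leviDistribution (zeroLevel μ) x₀ = {v | ∃ ξ ∈ s, ξ x₀ = v} ∧
      ∀ ξ ∈ s, ∀ φ : ℝ → HolAut X, IsOneParameterGroup φ ξ → (φ 1).1 x₀ ∈ zeroLevel μ

end

/-!
The zero level `M` of the momentum map is Levi flat because its Levi form vanishes, and the Levi form
vanishes because the Lie condition makes `exp(s) x₀` an integral manifold of the distribution `W`, whose
translates under `H` fill a neighbourhood of `x₀` in `M`.

*The Bergman metric.*  On an open set the evaluation `ev_x` on the Bergman space is holomorphic in `x`,
and the Bergman potential is `log ‖ev_x‖²`.  On a Siegel domain square integrable rational functions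
separate `1`-jets (`IsSiegelDomain.separatesJets`), so that the Bergman form is real analytic and
positive definite (`bergmanForm_pos`).  It is invariant under automorphisms (`bergmanForm_holAut`).

*Freeness.*  A vector field of a split solvable group that vanishes at `x` has a linear part at `x`
that is skew for the Bergman metric, and also triangular with real entries in a flag that spans the
tangent space over `ℂ`; such a map is zero.  A field with vanishing `1`-jet is zero, so the group acts
freely at the level of Lie algebras (`eq_zero_of_mem_lieAlg_of_apply_eq_zero`).

*The zero level.*  On `M` the `H`-orbits are isotropic.  Definiteness of the metric and freeness make
the complex differential of the momentum coordinates `f` surjective along `M`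
(`IsMomentumMap.isGenericLevelSet`).  So `M` is a generic real analytic submanifold, with
`W = ker ∂f` of constant rank, and the fields of `H` together with their multiples by `i` span a
complement of `W`.

*Vanishing of the Levi form.*  Let `s` be the subalgebra of the Lie condition.  Its fields span a
complex subspace at `x₀`, hence, as flows are holomorphic, at each point of `exp(s) x₀ ⊆ M`; by
freeness this subspace has the dimension of `W`, so it is `W`.  Since `s` is closed under brackets, the
Levi form vanishes along `exp(s) x₀` (`IsGenericLevelSet.leviVanishesAt_exp`).  The translates of this
set under `H` cover a neighbourhood of `x₀` in `M` (`IsMomentumMap.eventually_leviVanishesAt`), the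
vanishing is `H`-invariant, and analytic continuation spreads it over the connected set `M`
(`IsGenericLevelSet.leviVanishesAt_of_eventually`).

*Levi flatness.*  If the Levi form vanishes, differentiation of `df = 0` on `W` shows that `W` is
involutive.  A real analytic family of projections `P x` onto `W_x` along a fixed complement gives
frame fields `x ↦ P x a` that commute along `M`; their unit time trajectories from `q` parametrize the
plaque through `q` by a map with complex linear differentials, so the plaque is a complex submanifold
(`IsGenericLevelSet.isLeviFlat`).
-/

open scoped Topology ContDiff ComplexConjugate
open MeasureTheory

noncomputable section

/-! ### Holomorphic maps of several variables -/

section SeveralComplexVariables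

variable {E F : Type} [NormedAddCommGroup E] [NormedSpace ℂ E] [NormedAddCommGroup F]
  [NormedSpace ℂ F]

open Metric in
theorem line_mapsTo_ball {z u : E} {r ρ : ℝ} (hu : ρ * ‖u‖ ≤ r) {ζ : ℂ} (hζ : ζ ∈ ball (0 : ℂ) ρ)
    (hr : 0 < r) : z + ζ • u ∈ ball z r := by
  rw [mem_ball_zero_iff] at hζ
  rw [mem_ball_iff_norm, add_sub_cancel_left, norm_smul]
  rcases eq_or_ne u 0 with rfl | h
  · simpa using hr
  · exact (mul_lt_mul_of_pos_right hζ (norm_pos_iff.2 h)).trans_le hu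

open Metric in
theorem differentiableOn_line {f : E → F} {z u : E} {r ρ : ℝ} (hu : ρ * ‖u‖ ≤ r) (hr : 0 < r)
    (hf : DifferentiableOn ℂ f (ball z r)) :
    DifferentiableOn ℂ (fun ζ : ℂ => f (z + ζ • u)) (ball 0 ρ) :=
  hf.comp (by fun_prop) fun _ hζ => line_mapsTo_ball hu hζ hr

open Metric in
theorem deriv_line {f : E → F} {z u : E} (hf : DifferentiableAt ℂ f z) :
    deriv (fun ζ : ℂ => f (z + ζ • u)) 0 = fderiv ℂ f z u := by
  have h1 : HasDerivAt (fun ζ : ℂ => z + ζ • u) u 0 := by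
    simpa using ((hasDerivAt_id (0 : ℂ)).smul_const u).const_add z
  have h2 : HasFDerivAt f (fderiv ℂ f z) (z + (0 : ℂ) • u) := by simpa using hf.hasFDerivAt
  exact (h2.comp_hasDerivAt (0 : ℂ) h1).deriv

open Metric in
/-- Cauchy's estimate for the differential of a bounded holomorphic map. -/
theorem norm_fderiv_le_of_bounded_on_ball {f : E → F} {z : E} {r M : ℝ} (hr : 0 < r)
    (hf : DifferentiableOn ℂ f (ball z r)) (hM : ∀ y ∈ ball z r, ‖f y‖ ≤ M) :
    ‖fderiv ℂ f z‖ ≤ 2 * M / r := by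
  have hM0 : 0 ≤ M := (norm_nonneg _).trans (hM z (mem_ball_self hr))
  refine ContinuousLinearMap.opNorm_le_bound _ (by positivity) fun u => ?_
  rcases eq_or_ne u 0 with rfl | h
  · simp
  have hu : 0 < ‖u‖ := norm_pos_iff.2 h
  have hd := differentiableOn_line (u := u) (ρ := r / ‖u‖) (by field_simp; rfl) hr hf
  have hρ : 0 < r / ‖u‖ / 2 := by positivity
  have hsub : closedBall (0 : ℂ) (r / ‖u‖ / 2) ⊆ ball 0 (r / ‖u‖) :=
    closedBall_subset_ball (by linarith)
  rw [← deriv_line (hf.differentiableAt (ball_mem_nhds z hr))]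
  have := Complex.norm_deriv_le_of_forall_mem_sphere_norm_le (C := M) hρ
    (hd.diffContOnCl_ball hsub) (fun ζ hζ => hM _ (line_mapsTo_ball (r := r) (by field_simp; rfl)
      (hsub (sphere_subset_closedBall hζ)) hr))
  refine this.trans (le_of_eq ?_)
  field_simp

open Metric in
/-- The second order Taylor estimate for a bounded holomorphic map. -/
theorem norm_sub_fderiv_le_of_bounded_on_ball [CompleteSpace F] {f : E → F} {z u : E} {r M : ℝ}
    (hr : 0 < r) (hf : DifferentiableOn ℂ f (ball z r)) (hM : ∀ y ∈ ball z r, ‖f y‖ ≤ M)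
    (hu : ‖u‖ ≤ r / 4) :
    ‖f (z + u) - f z - fderiv ℂ f z u‖ ≤ 8 * M / r ^ 2 * ‖u‖ ^ 2 := by
  have hM0 : 0 ≤ M := (norm_nonneg _).trans (hM z (mem_ball_self hr))
  rcases eq_or_ne u 0 with rfl | h
  · simp
  have hu0 : 0 < ‖u‖ := norm_pos_iff.2 h
  have hd := differentiableOn_line (u := u) (ρ := r / ‖u‖) (by field_simp; rfl) hr hf
  have hρ : 0 < r / ‖u‖ / 2 := by positivity
  have hρ2 : 2 ≤ r / ‖u‖ / 2 := by rw [div_div, le_div_iff₀ (by positivity)]; linarith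
  have hsub : closedBall (0 : ℂ) (r / ‖u‖ / 2) ⊆ ball 0 (r / ‖u‖) :=
    closedBall_subset_ball (by linarith)
  set φ : ℂ → F := fun ζ => f (z + ζ • u) with hφ
  set ρ := r / ‖u‖ / 2 with hρdef
  have hit : ∀ n : ℕ, ‖iteratedDeriv n φ 0‖ ≤ n.factorial * M / ρ ^ n := fun n =>
    Complex.norm_iteratedDeriv_le_of_forall_mem_sphere_norm_le n hρ
      (hd.diffContOnCl_ball hsub) (fun ζ hζ => hM _ (line_mapsTo_ball (r := r) (by field_simp; rfl)
      (hsub (sphere_subset_closedBall hζ)) hr))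
  have hs := Complex.hasSum_taylorSeries_on_ball (c := (0 : ℂ)) (r := ρ)
    (hd.mono (ball_subset_ball (by linarith))) (z := 1) (by
      rw [mem_ball_zero_iff, norm_one]; linarith)
  rw [← hasSum_nat_add_iff' 2] at hs
  have hg : HasSum (fun n : ℕ => M / ρ ^ 2 * (1 / 2 : ℝ) ^ n) (M / ρ ^ 2 * 2) :=
    hasSum_geometric_two.mul_left _
  have := hs.norm_le_of_bounded hg (fun n => by
    rw [norm_smul, norm_smul]
    simp only [sub_zero, one_pow, norm_one, one_mul, norm_inv, RCLike.norm_natCast]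
    have h1 := hit (n + 2)
    have h2 : ((n + 2).factorial : ℝ) ≠ 0 := by positivity
    calc ((n + 2).factorial : ℝ)⁻¹ * ‖iteratedDeriv (n + 2) φ 0‖
        ≤ ((n + 2).factorial : ℝ)⁻¹ * ((n + 2).factorial * M / ρ ^ (n + 2)) := by gcongr
      _ = M / ρ ^ 2 * (1 / ρ) ^ n := by rw [one_div_pow]; field_simp; ring
      _ ≤ M / ρ ^ 2 * (1 / 2) ^ n := by gcongr)
  rw [Finset.sum_range_succ, Finset.sum_range_one] at this
  simp only [iteratedDeriv_zero, iteratedDeriv_one] at this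
  rw [hφ, deriv_line (hf.differentiableAt (ball_mem_nhds z hr))] at this
  simp only [sub_zero, one_pow, Nat.factorial, mul_one, Nat.cast_one, inv_one,
    one_smul, zero_smul, add_zero] at this
  rw [← sub_sub] at this
  refine this.trans (le_of_eq ?_)
  rw [hρdef]; field_simp; ring

open Metric in
/-- A pointwise limit of holomorphic maps that are locally uniformly Cauchy, in the quantitative
form `‖f n y - g y‖ ≤ a n` on a ball, is differentiable at the centre of the ball. -/
theorem differentiableAt_of_uniform_limit [CompleteSpace F] {f : ℕ → E → F} {g : E → F} {z : E}
    {r : ℝ} (hr : 0 < r) (hf : ∀ n, DifferentiableOn ℂ (f n) (ball z r))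
    (hfg : TendstoUniformlyOn f g Filter.atTop (ball z r)) : DifferentiableAt ℂ g z := by
  have hc : UniformCauchySeqOn f Filter.atTop (ball z r) := hfg.uniformCauchySeqOn
  have hc' : UniformCauchySeqOn (fun n => fderiv ℂ (f n)) Filter.atTop (ball z (r / 2)) := by
    rw [Metric.uniformCauchySeqOn_iff] at hc ⊢
    intro ε hε
    obtain ⟨N, hN⟩ := hc (ε * r / 8) (by positivity)
    refine ⟨N, fun m hm n hn x hx => ?_⟩
    have hsub : ball x (r / 2) ⊆ ball z r := by
      apply ball_subset_ball'
      rw [mem_ball] at hx; linarith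
    have hdm := fun k => (hf k).mono hsub
    have hx' := ball_mem_nhds x (half_pos hr)
    rw [dist_eq_norm, ← fderiv_sub ((hdm m).differentiableAt hx') ((hdm n).differentiableAt hx')]
    have := norm_fderiv_le_of_bounded_on_ball (M := ε * r / 8) (half_pos hr)
      ((hdm m).sub (hdm n)) (fun y hy => by
        have := hN m hm n hn y (hsub hy)
        rw [dist_eq_norm] at this
        exact this.le)
    refine lt_of_le_of_lt this ?_
    have : 2 * (ε * r / 8) / (r / 2) = ε / 2 := by field_simp; norm_num
    rw [this]; linarith
  have hz : ∀ x ∈ ball z (r / 2), ∃ g', Filter.Tendsto (fun n => fderiv ℂ (f n) x) Filter.atTop (𝓝 g') :=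
    fun x hx => cauchySeq_tendsto_of_complete (hc'.cauchySeq hx)
  choose! g' hg' using hz
  have := hasFDerivAt_of_tendstoLocallyUniformlyOn (x := z) isOpen_ball
    (hc'.tendstoUniformlyOn_of_tendsto hg').tendstoLocallyUniformlyOn
    (fun n x hx => ((hf n).differentiableAt
      (isOpen_ball.mem_nhds (ball_subset_ball (by linarith) hx))).hasFDerivAt)
    (fun x hx => (hfg.tendsto_at (ball_subset_ball (by linarith) hx))) (mem_ball_self (half_pos hr))
  exact this.differentiableAt

open Metric in
/-- The difference quotients of a bounded holomorphic map converge uniformly to its directional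
derivative, which is therefore holomorphic. -/
theorem differentiableAt_fderiv_apply [CompleteSpace F] {f : E → F} {z : E} {r M : ℝ}
    (hr : 0 < r) (hf : DifferentiableOn ℂ f (ball z r)) (hM : ∀ y ∈ ball z r, ‖f y‖ ≤ M)
    (v : E) : DifferentiableAt ℂ (fun y => fderiv ℂ f y v) z := by
  have hM0 : 0 ≤ M := (norm_nonneg _).trans (hM z (mem_ball_self hr))
  -- the difference quotients with step `a n` converge uniformly on the ball of radius `r / 2`
  obtain ⟨K, hK, hKv⟩ : ∃ K : ℝ, 0 < K ∧ ‖v‖ ≤ K := ⟨‖v‖ + 1, by positivity, by linarith⟩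
  set a : ℕ → ℂ := fun n => ((r / (8 * K) / (n + 1) : ℝ) : ℂ) with ha
  have han : ∀ n, ‖a n‖ = r / (8 * K) / (n + 1) := fun n => by
    rw [ha]; simp only [Complex.norm_real]; exact Real.norm_of_nonneg (by positivity)
  have ha0 : ∀ n, a n ≠ 0 := fun n => by
    rw [← norm_pos_iff, han]; positivity
  have hav : ∀ n, ‖a n • v‖ ≤ r / 8 := fun n => by
    rw [norm_smul, han]
    calc r / (8 * K) / (n + 1) * ‖v‖ ≤ r / (8 * K) / 1 * K := by
          gcongr; linarith [Nat.cast_nonneg (α := ℝ) n]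
      _ = r / 8 := by field_simp
  refine differentiableAt_of_uniform_limit (f := fun n y => (a n)⁻¹ • (f (y + a n • v) - f y))
    (half_pos hr) (fun n => ?_) ?_
  · refine DifferentiableOn.const_smul (DifferentiableOn.sub ?_ (hf.mono (ball_subset_ball (by linarith)))) _
    refine hf.comp (by fun_prop) fun y hy => ?_
    rw [mem_ball, dist_eq_norm] at hy ⊢
    calc ‖y + a n • v - z‖ = ‖(y - z) + a n • v‖ := by congr 1; abel
      _ ≤ ‖y - z‖ + ‖a n • v‖ := norm_add_le _ _
      _ < r := by linarith [hav n]
  · rw [Metric.tendstoUniformlyOn_iff]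
    intro ε hε
    have hlim : Filter.Tendsto (fun n => 8 * M / (r / 2) ^ 2 * (‖a n‖ * ‖v‖ ^ 2)) Filter.atTop (𝓝 0) := by
      have : Filter.Tendsto (fun n : ℕ => ‖a n‖) Filter.atTop (𝓝 0) := by
        simp only [han]
        exact tendsto_const_div_atTop_nhds_zero_nat (r / (8 * K)) |>.comp (Filter.tendsto_add_atTop_nat 1)
          |>.congr fun n => by simp
      simpa using (this.mul_const (‖v‖ ^ 2)).const_mul (8 * M / (r / 2) ^ 2)
    filter_upwards [hlim.eventually (gt_mem_nhds hε)] with n hn y hy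
    refine lt_of_le_of_lt ?_ hn
    have hsub : ball y (r / 2) ⊆ ball z r := by
      apply ball_subset_ball'
      rw [mem_ball] at hy; linarith
    have := norm_sub_fderiv_le_of_bounded_on_ball (u := a n • v) (half_pos hr) (hf.mono hsub)
      (fun x hx => hM x (hsub hx)) (by linarith [hav n])
    rw [dist_eq_norm, ← norm_neg, neg_sub]
    have e1 : (a n)⁻¹ • (f (y + a n • v) - f y) - fderiv ℂ f y v
        = (a n)⁻¹ • (f (y + a n • v) - f y - fderiv ℂ f y (a n • v)) := by
      rw [map_smul, smul_sub _ _ (a n • _), inv_smul_smul₀ (ha0 n)]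
    rw [e1, norm_smul, norm_inv]
    rw [norm_smul] at this
    have hp : 0 < ‖a n‖ := norm_pos_iff.2 (ha0 n)
    calc ‖a n‖⁻¹ * _ ≤ ‖a n‖⁻¹ * (8 * M / (r / 2) ^ 2 * (‖a n‖ * ‖v‖) ^ 2) := by gcongr
      _ = _ := by field_simp

/-- A holomorphic map is locally bounded on a ball. -/
theorem DifferentiableOn.exists_ball_bound {f : E → F} {s : Set E} (hs : IsOpen s)
    (hf : DifferentiableOn ℂ f s) {z : E} (hz : z ∈ s) :
    ∃ r > 0, ∃ M, Metric.ball z r ⊆ s ∧ ∀ y ∈ Metric.ball z r, ‖f y‖ ≤ M := by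
  have h1 : ∀ᶠ y in 𝓝 z, ‖f y‖ < ‖f z‖ + 1 :=
    (hf.differentiableAt (hs.mem_nhds hz)).continuousAt.norm.eventually (gt_mem_nhds (by linarith))
  obtain ⟨r, hr, h⟩ := Metric.eventually_nhds_iff_ball.1 (h1.and (hs.mem_nhds hz))
  exact ⟨r, hr, _, fun y hy => (h y hy).2, fun y hy => (h y hy).1.le⟩

/-- The differential of a holomorphic map of several variables is holomorphic. -/
theorem DifferentiableOn.fderiv_holomorphic [FiniteDimensional ℂ E] [CompleteSpace F] {f : E → F}
    {s : Set E} (hs : IsOpen s) (hf : DifferentiableOn ℂ f s) :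
    DifferentiableOn ℂ (fderiv ℂ f) s := by
  intro z hz
  obtain ⟨r, hr, M, hrs, hM⟩ := hf.exists_ball_bound hs hz
  refine DifferentiableAt.differentiableWithinAt ?_
  let b := Module.finBasis ℂ E
  have key : fderiv ℂ f = fun y => ∑ i, (LinearMap.toContinuousLinearMap (b.coord i)).smulRight
      (fderiv ℂ f y (b i)) := by
    funext y
    ext v
    conv_lhs => rw [← b.sum_repr v, map_sum]
    simp only [map_smul, sum_apply, ContinuousLinearMap.smulRight_apply,
      LinearMap.coe_toContinuousLinearMap', Module.Basis.coord_apply]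
  rw [key]
  refine DifferentiableAt.fun_sum fun i _ => ?_
  exact ((ContinuousLinearMap.smulRightL ℂ E F
    (LinearMap.toContinuousLinearMap (b.coord i))).differentiableAt).comp z
    (differentiableAt_fderiv_apply hr (hf.mono hrs) hM (b i))

theorem DifferentiableOn.contDiffOn_nat [FiniteDimensional ℂ E] {s : Set E} (hs : IsOpen s)
    (n : ℕ) : ∀ {F : Type} [NormedAddCommGroup F] [NormedSpace ℂ F] [CompleteSpace F] {f : E → F},
    DifferentiableOn ℂ f s → ContDiffOn ℂ n f s := by
  induction n with
  | zero => intro F _ _ _ f hf; exact contDiffOn_zero.2 hf.continuousOn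
  | succ n ih =>
    intro F _ _ _ f hf
    have := (contDiffOn_succ_iff_fderiv_of_isOpen (n := n) hs).2
      ⟨hf, by simp, ih (hf.fderiv_holomorphic hs)⟩
    exact_mod_cast this

theorem DifferentiableOn.iteratedFDeriv_holomorphic [FiniteDimensional ℂ E] [CompleteSpace F]
    {f : E → F} {s : Set E} (hs : IsOpen s) (hf : DifferentiableOn ℂ f s) (n : ℕ) :
    DifferentiableOn ℂ (iteratedFDeriv ℂ n f) s := fun x hx =>
  (((hf.contDiffOn_nat hs (n + 1)).contDiffAt (hs.mem_nhds hx)).differentiableAt_iteratedFDeriv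
    (by exact_mod_cast Nat.lt_succ_self n)).differentiableWithinAt

open Metric in
/-- Cauchy's estimate for higher derivatives, by `n` steps that each lose `δ` of the radius. -/
theorem norm_iteratedFDeriv_le_of_bounded_on_ball [FiniteDimensional ℂ E] [CompleteSpace F]
    {f : E → F} {z : E} {R M δ : ℝ} (hδ : 0 < δ) (hf : DifferentiableOn ℂ f (ball z R))
    (hM : ∀ y ∈ ball z R, ‖f y‖ ≤ M) (n : ℕ) :
    ∀ x ∈ ball z (R - n * δ), ‖iteratedFDeriv ℂ n f x‖ ≤ M * (2 / δ) ^ n := by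
  induction n with
  | zero => intro x hx; simpa using hM x (by simpa using hx)
  | succ n ih =>
    intro x hx
    rw [← norm_fderiv_iteratedFDeriv]
    rw [mem_ball] at hx
    push_cast at hx
    have hsub : ball x δ ⊆ ball z (R - n * δ) := ball_subset_ball' (by linarith)
    have hsub' : ball z (R - n * δ) ⊆ ball z R := ball_subset_ball (by
      have : 0 ≤ n * δ := by positivity
      linarith)
    refine (norm_fderiv_le_of_bounded_on_ball hδ
      ((hf.iteratedFDeriv_holomorphic isOpen_ball n).mono (hsub.trans hsub'))
      (fun y hy => ih y (hsub hy))).trans (le_of_eq ?_)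
    rw [pow_succ]; ring

open Metric in
/-- Iterated derivatives along a complex line. -/
theorem iteratedDeriv_line [FiniteDimensional ℂ E] [CompleteSpace F]
    {f : E → F} {z u : E} {r ρ : ℝ} (hu : ρ * ‖u‖ ≤ r) (hr : 0 < r)
    (hf : DifferentiableOn ℂ f (ball z r)) (n : ℕ) : ∀ ζ ∈ ball (0 : ℂ) ρ,
    iteratedDeriv n (fun ζ : ℂ => f (z + ζ • u)) ζ
      = iteratedFDeriv ℂ n f (z + ζ • u) (fun _ => u) := by
  induction n with
  | zero => intro ζ _; simp
  | succ n ih =>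
    intro ζ hζ
    have hev : iteratedDeriv n (fun ζ : ℂ => f (z + ζ • u)) =ᶠ[𝓝 ζ]
        fun ζ => iteratedFDeriv ℂ n f (z + ζ • u) (fun _ => u) := by
      filter_upwards [isOpen_ball.mem_nhds hζ] with x hx using ih x hx
    rw [iteratedDeriv_succ, hev.deriv_eq, iteratedFDeriv_succ_apply_left]
    have h1 : HasDerivAt (fun ζ : ℂ => z + ζ • u) u ζ := by
      simpa using ((hasDerivAt_id ζ).smul_const u).const_add z
    have h2 := ((hf.iteratedFDeriv_holomorphic isOpen_ball n).differentiableAt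
      (isOpen_ball.mem_nhds (line_mapsTo_ball hu hζ hr))).hasFDerivAt
    have h3 := h2.comp_hasDerivAt ζ h1
    exact ((ContinuousMultilinearMap.apply ℂ (fun _ : Fin n => E) F
      (fun _ => u)).hasFDerivAt.comp_hasDerivAt ζ h3).deriv

open Metric in
/-- Holomorphic maps of several variables are analytic.  The power series is the Taylor series: it
converges along complex lines, and Cauchy's estimate on `n` nested balls bounds its terms. -/
theorem DifferentiableOn.analyticOnNhd_of_finiteDimensional [FiniteDimensional ℂ E]
    [CompleteSpace F] {f : E → F} {s : Set E} (hs : IsOpen s) (hf : DifferentiableOn ℂ f s) :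
    AnalyticOnNhd ℂ f s := by
  intro z hz
  obtain ⟨R, hR, M, hRs, hM⟩ := hf.exists_ball_bound hs hz
  replace hf := hf.mono hRs
  have hM0 : 0 ≤ M := (norm_nonneg _).trans (hM z (mem_ball_self hR))
  let p : FormalMultilinearSeries ℂ E F := fun n => ((n.factorial : ℂ)⁻¹) • iteratedFDeriv ℂ n f z
  have hρ : 0 < R / (2 * Real.exp 1) := by positivity
  set ρ : NNReal := ⟨R / (2 * Real.exp 1), hρ.le⟩ with hρd
  have hrad : (ρ : ENNReal) ≤ p.radius := by
    refine p.le_radius_of_bound (M * Real.exp 1) fun n => ?_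
    have h1 := norm_iteratedFDeriv_le_of_bounded_on_ball (δ := R / (n + 1)) (by positivity) hf hM n z
      (mem_ball_self (by
        have : n * (R / (n + 1)) = R - R / (n + 1) := by field_simp; ring
        have h : 0 < R / ((n : ℝ) + 1) := by positivity
        linarith))
    have h2 := Real.pow_div_factorial_le_exp (x := (n : ℝ) + 1) (by positivity) n
    rw [norm_smul, norm_inv, RCLike.norm_natCast]
    calc ((n.factorial : ℝ)⁻¹ * ‖iteratedFDeriv ℂ n f z‖) * (R / (2 * Real.exp 1)) ^ n
        ≤ ((n.factorial : ℝ)⁻¹ * (M * (2 / (R / (n + 1))) ^ n)) * (R / (2 * Real.exp 1)) ^ n := by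
          gcongr
      _ = M * (((n : ℝ) + 1) ^ n / n.factorial) * ((Real.exp 1) ^ n)⁻¹ := by
          have : 2 / (R / ((n : ℝ) + 1)) * (R / (2 * Real.exp 1)) = (n + 1) * (Real.exp 1)⁻¹ := by
            field_simp
          calc _ = (n.factorial : ℝ)⁻¹ * M
                * (2 / (R / ((n : ℝ) + 1)) * (R / (2 * Real.exp 1))) ^ n := by rw [mul_pow]; ring
            _ = _ := by rw [this, mul_pow, inv_pow]; ring
      _ ≤ M * Real.exp (n + 1) * ((Real.exp 1) ^ n)⁻¹ := by gcongr
      _ = M * Real.exp 1 := by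
          rw [Real.exp_add, ← Real.exp_nat_mul, mul_one]; field_simp
  refine ⟨p, ρ, ⟨hrad, by exact_mod_cast hρ, fun {y} hy => ?_⟩⟩
  have hyR : ‖y‖ < R := by
    have : ‖y‖ < ρ := by simpa [Metric.eball_coe] using hy
    refine this.trans_le ?_
    change R / (2 * Real.exp 1) ≤ R
    apply div_le_self hR.le
    have := Real.add_one_le_exp (1 : ℝ)
    linarith
  obtain ⟨ρ', h1, h2⟩ : ∃ ρ' : ℝ, 1 < ρ' ∧ ρ' * ‖y‖ ≤ R := by
    rcases eq_or_ne y 0 with rfl | h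
    · exact ⟨2, by norm_num, by simpa using hR.le⟩
    · have := norm_pos_iff.2 h
      exact ⟨R / ‖y‖, by rwa [one_lt_div this], by field_simp; rfl⟩
  have hsum := Complex.hasSum_taylorSeries_on_ball (c := (0 : ℂ)) (r := ρ')
    (differentiableOn_line h2 hR hf) (z := 1) (by simpa using h1)
  simp only [sub_zero, one_pow, one_smul] at hsum
  refine hsum.congr_fun fun n => ?_
  rw [iteratedDeriv_line h2 hR hf n 0 (mem_ball_self (by linarith))]
  simp [p]

theorem DifferentiableOn.contDiffOn_real [FiniteDimensional ℂ E] [CompleteSpace F] {f : E → F}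
    {s : Set E} (hs : IsOpen s) (hf : DifferentiableOn ℂ f s) : ContDiffOn ℝ ω f s := fun x hx =>
  (((hf.analyticOnNhd_of_finiteDimensional hs x hx).contDiffAt).restrict_scalars
    ℝ).contDiffWithinAt

theorem fderiv_real_eq {f : E → F} {x : E} (hf : DifferentiableAt ℂ f x) (v : E) :
    fderiv ℝ f x v = fderiv ℂ f x v := by
  rw [hf.fderiv_restrictScalars ℝ]; rfl

end SeveralComplexVariables

/-! ### The mean value property on balls and weakly holomorphic families of functionals -/

section MeanValue

variable {d : ℕ}

theorem measurePreserving_circleMap_smul (θ : ℝ) :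
    MeasurePreserving (fun u : Fin d → ℂ => circleMap 0 1 θ • u) := by
  have h := volume_preserving_pi (ι := Fin d) (α' := fun _ => ℂ) (β' := fun _ => ℂ)
    (f := fun _ => (rotation (Circle.exp θ) : ℂ → ℂ))
    (fun _ => (rotation (Circle.exp θ)).measurePreserving)
  convert! h using 2
  ext i
  simp [circleMap]

open Metric in
/-- The mean value property over balls: rotating the ball by `e^{iθ}` preserves Lebesgue measure,
and the mean over `θ` is the mean value property on complex lines. -/
theorem setIntegral_ball_eq_of_holomorphic {f : (Fin d → ℂ) → ℂ} {z : Fin d → ℂ} {r R : ℝ}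
    (hr : 0 < r) (hrR : r < R) (hf : DifferentiableOn ℂ f (ball z R)) :
    ∫ y in ball z r, f y = (volume.real (ball z r) : ℂ) * f z := by
  have hcont : ContinuousOn f (ball z R) := hf.continuousOn
  have hcirc : ∀ θ : ℝ, ∀ u : Fin d → ℂ, ‖circleMap 0 1 θ • u‖ = ‖u‖ := fun θ u => by
    rw [norm_smul, norm_circleMap_zero, abs_one, one_mul]
  have hrot : ∀ θ : ℝ, ∫ u in ball (0 : Fin d → ℂ) r, f (z + circleMap 0 1 θ • u)
      = ∫ u in ball (0 : Fin d → ℂ) r, f (z + u) := by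
    intro θ
    have hne : circleMap 0 1 θ ≠ 0 := circleMap_ne_center one_ne_zero
    have h := (measurePreserving_circleMap_smul (d := d) θ).setIntegral_preimage_emb
      (MeasurableEquiv.smul₀ _ hne).measurableEmbedding (fun u => f (z + u)) (ball 0 r)
    rw [← h]
    congr 2
    ext u
    simp [hcirc]
  have htrans : ∫ y in ball z r, f y = ∫ u in ball (0 : Fin d → ℂ) r, f (z + u) := by
    have h := (measurePreserving_add_left (volume : Measure (Fin d → ℂ)) z).setIntegral_preimage_emb
      (MeasurableEquiv.addLeft z).measurableEmbedding f (ball z r)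
    rw [← h]
    congr 2
    ext u; simp
  have hline : ∀ u ∈ ball (0 : Fin d → ℂ) r,
      ∫ θ in (0 : ℝ)..2 * Real.pi, f (z + circleMap 0 1 θ • u) = (2 * Real.pi : ℝ) * f z := by
    intro u hu
    rw [mem_ball_zero_iff] at hu
    have hd := differentiableOn_line (z := z) (u := u) (ρ := R / r) (r := R)
      (by rw [div_mul_eq_mul_div, div_le_iff₀ hr]; exact mul_le_mul_of_nonneg_left hu.le (by linarith)) (by linarith) hf
    have h := DiffContOnCl.circleAverage (f := fun ζ : ℂ => f (z + ζ • u)) (c := 0) (R := 1)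
      (hd.diffContOnCl_ball (by
        rw [abs_one]; exact closedBall_subset_ball (by rwa [one_lt_div hr])))
    rw [Real.circleAverage_def] at h
    have h2 : (2 * Real.pi : ℝ) • ((2 * Real.pi)⁻¹ • ∫ θ in (0 : ℝ)..2 * Real.pi,
        f (z + circleMap 0 1 θ • u)) = (2 * Real.pi : ℝ) • f (z + (0 : ℂ) • u) := by rw [h]
    rw [smul_inv_smul₀ (by positivity)] at h2
    rw [h2]; simp
  have hcomp : IsCompact (closedBall z r) := isCompact_closedBall z r
  obtain ⟨C, hC⟩ := hcomp.exists_bound_of_continuousOn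
    (hcont.mono (closedBall_subset_ball hrR))
  have hmem : ∀ θ : ℝ, ∀ u ∈ ball (0 : Fin d → ℂ) r, z + circleMap 0 1 θ • u ∈ ball z r := by
    intro θ u hu
    rw [mem_ball_zero_iff] at hu
    rwa [mem_ball_iff_norm, add_sub_cancel_left, hcirc]
  have hswap := intervalIntegral_integral_swap (a := 0) (b := 2 * Real.pi)
    (μ := volume.restrict (ball (0 : Fin d → ℂ) r))
    (f := fun θ u => f (z + circleMap 0 1 θ • u)) (by
      rw [Measure.prod_restrict]
      refine IntegrableOn.of_bound (C := C) ?_ ?_ ?_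
      · rw [Measure.prod_prod]
        exact ENNReal.mul_lt_top (by simp [Set.uIoc]) measure_ball_lt_top
      · refine ContinuousOn.aestronglyMeasurable ?_ (measurableSet_uIoc.prod measurableSet_ball)
        refine (hcont.comp (s := Set.univ ×ˢ ball 0 r) (by fun_prop) ?_).mono
          (Set.prod_mono (Set.subset_univ _) le_rfl)
        rintro ⟨θ, u⟩ ⟨-, hu⟩
        exact ball_subset_ball hrR.le (hmem θ u hu)
      · refine ae_restrict_of_forall_mem (measurableSet_uIoc.prod measurableSet_ball) ?_
        rintro ⟨θ, u⟩ ⟨-, hu⟩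
        exact hC _ (ball_subset_closedBall (hmem θ u hu)))
  rw [setIntegral_congr_fun measurableSet_ball hline] at hswap
  simp only [hrot] at hswap
  rw [← htrans] at hswap
  simp only [intervalIntegral.integral_const, setIntegral_const, sub_zero] at hswap
  have hvol : volume.real (ball (0 : Fin d → ℂ) r) = volume.real (ball z r) := by
    rw [measureReal_def, measureReal_def, Measure.addHaar_ball_center _ z]
  rw [hvol] at hswap
  have hpi : (2 * Real.pi : ℝ) ≠ 0 := by positivity
  refine smul_right_injective _ hpi ?_
  simp only
  rw [hswap]
  simp only [Complex.real_smul]; push_cast; ring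

/-- A quadratic remainder estimate gives differentiability. -/
theorem hasFDerivAt_of_quadratic_bound {𝕜 E F : Type*} [NontriviallyNormedField 𝕜]
    [NormedAddCommGroup E] [NormedSpace 𝕜 E] [NormedAddCommGroup F] [NormedSpace 𝕜 F]
    {f : E → F} {L : E →L[𝕜] F} {z : E} {r K : ℝ} (hr : 0 < r)
    (h : ∀ u, ‖u‖ < r → ‖f (z + u) - f z - L u‖ ≤ K * ‖u‖ ^ 2) : HasFDerivAt f L z := by
  rw [hasFDerivAt_iff_isLittleO_nhds_zero]
  have h1 : (fun u : E => f (z + u) - f z - L u) =O[𝓝 0] fun u => ‖u‖ ^ 2 := by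
    refine Asymptotics.IsBigO.of_bound K ?_
    filter_upwards [Metric.ball_mem_nhds (0 : E) hr] with u hu
    rw [norm_pow, norm_norm]
    exact h u (by simpa using hu)
  refine h1.trans_isLittleO ?_
  have := (Asymptotics.isLittleO_norm_pow_id (E' := E) (n := 2) (by norm_num))
  exact this

open Metric in
/-- A weakly holomorphic, bounded family of continuous functionals is holomorphic in norm. -/
theorem differentiableAt_of_weakly_holomorphic {E H : Type} [NormedAddCommGroup E]
    [NormedSpace ℂ E] [NormedAddCommGroup H] [NormedSpace ℂ H] {e : E → (H →L[ℂ] ℂ)} {z : E}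
    {r C : ℝ} (hr : 0 < r) (hw : ∀ F, DifferentiableOn ℂ (fun y => e y F) (ball z r))
    (hC : ∀ y ∈ ball z r, ‖e y‖ ≤ C) : DifferentiableAt ℂ e z := by
  have hd : ∀ F, DifferentiableAt ℂ (fun y => e y F) z := fun F =>
    (hw F).differentiableAt (ball_mem_nhds z hr)
  have hb : ∀ F, ∀ y ∈ ball z r, ‖e y F‖ ≤ C * ‖F‖ := fun F y hy =>
    (e y).le_of_opNorm_le (hC y hy) F
  have hC0 : 0 ≤ C := (norm_nonneg _).trans (hC z (mem_ball_self hr))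
  let D : E →L[ℂ] (H →L[ℂ] ℂ) := LinearMap.mkContinuous₂
    (LinearMap.mk₂ ℂ (fun u F => fderiv ℂ (fun y => e y F) z u)
      (fun u v F => map_add _ _ _) (fun c u F => map_smul _ _ _)
      (fun u F G => by
        have : (fun y => e y (F + G)) = fun y => e y F + e y G := by ext; simp
        rw [this, fderiv_fun_add (hd F) (hd G)]; rfl)
      (fun c u F => by
        have : (fun y => e y (c • F)) = fun y => c • e y F := by ext; simp
        rw [this, fderiv_fun_const_smul (hd F)]; rfl)) (2 * C / r) (fun u F => by
    have h1 := norm_fderiv_le_of_bounded_on_ball hr (hw F) (hb F)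
    have h2 := (fderiv ℂ (fun y => e y F) z).le_of_opNorm_le h1 u
    simp only [LinearMap.mk₂_apply]
    refine h2.trans (le_of_eq ?_); ring)
  refine (hasFDerivAt_of_quadratic_bound (L := D) (r := r / 4) (K := 8 * C / r ^ 2)
    (by positivity) fun u hu => ?_).differentiableAt
  refine ContinuousLinearMap.opNorm_le_bound _ (by positivity) fun F => ?_
  have := norm_sub_fderiv_le_of_bounded_on_ball hr (hw F) (hb F) hu.le
  refine this.trans (le_of_eq ?_); ring

/-! ### The Bergman space and its reproducing kernel -/

section Bergman

variable {X : Set (Fin d → ℂ)}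

/-- The Bergman space as a subspace of `L²(X)`: the classes that have a holomorphic
representative. -/
def bergmanSubmodule (X : Set (Fin d → ℂ)) : Submodule ℂ (Lp ℂ 2 (volume.restrict X)) where
  carrier := {F | ∃ f, DifferentiableOn ℂ f X ∧ F =ᵐ[volume.restrict X] f}
  zero_mem' := ⟨0, differentiableOn_const 0, Lp.coeFn_zero _ _ _⟩
  add_mem' := by
    rintro F G ⟨f, hf, hF⟩ ⟨g, hg, hG⟩
    exact ⟨f + g, hf.add hg, (Lp.coeFn_add F G).trans (hF.add hG)⟩
  smul_mem' := by
    rintro c F ⟨f, hf, hF⟩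
    exact ⟨c • f, hf.const_smul c, (Lp.coeFn_smul c F).trans (hF.const_smul c)⟩

/-- The norm bound `‖f z‖ ≤ bergmanConst d R * ‖f‖` for points `z` at distance at least `R` from
the boundary. -/
def bergmanConst (d : ℕ) (R : ℝ) : ℝ :=
  (volume.real (Metric.ball (0 : Fin d → ℂ) (R / 2)))⁻¹ *
    volume.real (Metric.ball (0 : Fin d → ℂ) (R / 2)) ^ (1 / 2 : ℝ)

open Metric in
/-- Point evaluations are bounded in the `L²` norm, by the mean value property. -/
theorem norm_le_of_mem_bergmanSubmodule {F : Lp ℂ 2 (volume.restrict X)}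
    {f : (Fin d → ℂ) → ℂ} (hf : DifferentiableOn ℂ f X) (hF : F =ᵐ[volume.restrict X] f)
    {z : Fin d → ℂ} {R : ℝ} (hR : 0 < R) (hz : ball z R ⊆ X) :
    ‖f z‖ ≤ bergmanConst d R * ‖F‖ := by
  have hsub : ball z (R / 2) ⊆ X := (ball_subset_ball (by linarith)).trans hz
  have hrestr : (volume.restrict X).restrict (ball z (R / 2)) = volume.restrict (ball z (R / 2)) :=
    Measure.restrict_restrict_of_subset hsub
  have hmz : (volume.restrict X) (ball z (R / 2)) = volume (ball z (R / 2)) := by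
    rw [Measure.restrict_apply measurableSet_ball, Set.inter_eq_left.2 hsub]
  have hm : (volume.restrict X) (ball z (R / 2)) ≠ ⊤ := by
    rw [hmz]; exact measure_ball_lt_top.ne
  have h1 := setIntegral_ball_eq_of_holomorphic (r := R / 2) (half_pos hR) (by linarith)
    (hf.mono hz)
  have h2 := L2.inner_indicatorConstLp_one (𝕜 := ℂ) (measurableSet_ball (x := z) (ε := R / 2)) hm F
  have h3 : ∫ y in ball z (R / 2), f y = ∫ y in ball z (R / 2), F y ∂(volume.restrict X) := by
    rw [hrestr]
    refine integral_congr_ae ?_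
    have : F =ᵐ[(volume.restrict X).restrict (ball z (R / 2))] f := ae_restrict_of_ae hF
    rw [hrestr] at this
    exact this.symm
  have hv : volume.real (ball z (R / 2)) = volume.real (ball (0 : Fin d → ℂ) (R / 2)) := by
    rw [measureReal_def, measureReal_def, Measure.addHaar_ball_center _ z]
  have hpos : 0 < volume.real (ball (0 : Fin d → ℂ) (R / 2)) :=
    ENNReal.toReal_pos (measure_ball_pos _ _ (half_pos hR)).ne' measure_ball_lt_top.ne
  rw [h3, ← h2, hv] at h1
  have h4 := norm_inner_le_norm (𝕜 := ℂ) (indicatorConstLp 2 measurableSet_ball hm (1 : ℂ)) F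
  rw [h1, norm_mul, Complex.norm_real, Real.norm_of_nonneg hpos.le,
    norm_indicatorConstLp (by norm_num) (by norm_num), measureReal_def (volume.restrict X), hmz,
    ← measureReal_def volume, hv] at h4
  rw [bergmanConst, mul_assoc, inv_mul_eq_div, le_div_iff₀' hpos]
  simpa using h4

theorem ball_half_subset {z : Fin d → ℂ} {R : ℝ} (hz : Metric.ball z R ⊆ X) {y : Fin d → ℂ}
    (hy : y ∈ Metric.ball z (R / 2)) : Metric.ball y (R / 2) ⊆ X :=
  (Metric.ball_subset_ball' (by rw [Metric.mem_ball] at hy; linarith)).trans hz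

/-- An `L²` limit of holomorphic functions is also a locally uniform limit, because point evaluations
are locally uniformly bounded. -/
theorem isClosed_bergmanSubmodule (hX : IsOpen X) :
    IsClosed (bergmanSubmodule X : Set (Lp ℂ 2 (volume.restrict X))) := by
  refine IsSeqClosed.isClosed fun {Fn F} hmem hlim => ?_
  choose f hf hF using hmem
  have hdiff : ∀ n m, ∀ z R, 0 < R → Metric.ball z R ⊆ X →
      ‖f n z - f m z‖ ≤ bergmanConst d R * ‖Fn n - Fn m‖ := fun n m z R hR hz =>
    norm_le_of_mem_bergmanSubmodule ((hf n).sub (hf m))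
      ((Lp.coeFn_sub _ _).trans ((hF n).sub (hF m))) hR hz
  have huc : ∀ z R, 0 < R → Metric.ball z R ⊆ X →
      UniformCauchySeqOn f Filter.atTop (Metric.ball z (R / 2)) := by
    intro z R hR hz
    rw [Metric.uniformCauchySeqOn_iff]
    intro ε hε
    have hc := hlim.cauchySeq
    rw [Metric.cauchySeq_iff] at hc
    have hC0 : 0 ≤ bergmanConst d (R / 2) := by unfold bergmanConst; positivity
    obtain ⟨N, hN⟩ := hc (ε / (bergmanConst d (R / 2) + 1)) (by positivity)
    refine ⟨N, fun m hm n hn x hx => ?_⟩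
    rw [dist_eq_norm]
    have h1 := hN m hm n hn
    rw [dist_eq_norm, lt_div_iff₀ (by positivity)] at h1
    have h2 := hdiff m n x (R / 2) (half_pos hR) (ball_half_subset hz hx)
    nlinarith [norm_nonneg (Fn m - Fn n)]
  have hpt : ∀ z ∈ X, ∃ w, Filter.Tendsto (fun n => f n z) Filter.atTop (𝓝 w) := by
    intro z hz
    obtain ⟨R, hR, hzR⟩ := Metric.isOpen_iff.1 hX z hz
    exact cauchySeq_tendsto_of_complete
      ((huc z R hR hzR).cauchySeq (Metric.mem_ball_self (half_pos hR)))
  choose! g hg using hpt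
  refine ⟨g, fun z hz => ?_, ?_⟩
  · obtain ⟨R, hR, hzR⟩ := Metric.isOpen_iff.1 hX z hz
    have hsub : Metric.ball z (R / 2) ⊆ X := (Metric.ball_subset_ball (by linarith)).trans hzR
    exact (differentiableAt_of_uniform_limit (half_pos hR) (fun n => (hf n).mono hsub)
      ((huc z R hR hzR).tendstoUniformlyOn_of_tendsto fun x hx =>
        hg x (hsub hx))).differentiableWithinAt
  · obtain ⟨ns, hns, hae⟩ := (tendstoInMeasure_of_tendsto_Lp hlim).exists_seq_tendsto_ae
    have hall : ∀ᵐ x ∂volume.restrict X, ∀ n, Fn n x = f n x := ae_all_iff.2 hF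
    filter_upwards [hae, hall, ae_restrict_mem hX.measurableSet] with x h1 h2 hx
    refine tendsto_nhds_unique h1 ?_
    simp only [h2]
    exact (hg x hx).comp hns.tendsto_atTop

/-- Evaluation at `z` on the Bergman space (zero for `z ∉ X`). -/
def bergmanEval (X : Set (Fin d → ℂ)) (z : Fin d → ℂ) : bergmanSubmodule X →L[ℂ] ℂ :=
  open Classical in
  if h : ∃ ℓ : bergmanSubmodule X →L[ℂ] ℂ, ∀ F : bergmanSubmodule X, ∀ f, DifferentiableOn ℂ f X →
    (F : Lp ℂ 2 (volume.restrict X)) =ᵐ[volume.restrict X] f → ℓ F = f z then h.choose else 0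

theorem bergmanEval_apply (hX : IsOpen X) {z : Fin d → ℂ} (hz : z ∈ X) (F : bergmanSubmodule X)
    {f : (Fin d → ℂ) → ℂ} (hf : DifferentiableOn ℂ f X)
    (hF : (F : Lp ℂ 2 (volume.restrict X)) =ᵐ[volume.restrict X] f) : bergmanEval X z F = f z := by
  have h : ∃ ℓ : bergmanSubmodule X →L[ℂ] ℂ, ∀ F : bergmanSubmodule X, ∀ f, DifferentiableOn ℂ f X →
      (F : Lp ℂ 2 (volume.restrict X)) =ᵐ[volume.restrict X] f → ℓ F = f z := by
    obtain ⟨R, hR, hzR⟩ := Metric.isOpen_iff.1 hX z hz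
    have huniq : ∀ F : bergmanSubmodule X, ∀ f g, DifferentiableOn ℂ f X → DifferentiableOn ℂ g X →
        (F : Lp ℂ 2 (volume.restrict X)) =ᵐ[volume.restrict X] f →
        (F : Lp ℂ 2 (volume.restrict X)) =ᵐ[volume.restrict X] g → f z = g z := by
      intro F f g hf hg hF hG
      have := norm_le_of_mem_bergmanSubmodule (hf.sub hg) (((Lp.coeFn_sub F.1 F.1).trans
        (hF.sub hG))) hR hzR
      rw [sub_self, norm_zero, mul_zero] at this
      exact sub_eq_zero.1 (norm_le_zero_iff.1 this)
    refine ⟨LinearMap.mkContinuous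
      { toFun := fun F => F.2.choose z
        map_add' := fun F G => ?_
        map_smul' := fun c F => ?_ } (bergmanConst d R) fun F => ?_, fun F f hf hF => ?_⟩
    · exact huniq (F + G) _ _ (F + G).2.choose_spec.1 (F.2.choose_spec.1.add G.2.choose_spec.1)
        (F + G).2.choose_spec.2
        ((Lp.coeFn_add F.1 G.1).trans (F.2.choose_spec.2.add G.2.choose_spec.2))
    · exact huniq (c • F) _ _ (c • F).2.choose_spec.1 (F.2.choose_spec.1.const_smul c)
        (c • F).2.choose_spec.2
        ((Lp.coeFn_smul c F.1).trans (F.2.choose_spec.2.const_smul c))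
    · exact norm_le_of_mem_bergmanSubmodule F.2.choose_spec.1 F.2.choose_spec.2 hR hzR
    · exact huniq F _ _ F.2.choose_spec.1 hf F.2.choose_spec.2 hF
  rw [bergmanEval, dif_pos h]
  exact h.choose_spec F f hf hF

theorem norm_bergmanEval_le (hX : IsOpen X) {z : Fin d → ℂ} {R : ℝ} (hR : 0 < R)
    (hz : Metric.ball z R ⊆ X) : ‖bergmanEval X z‖ ≤ bergmanConst d R := by
  refine ContinuousLinearMap.opNorm_le_bound _ (by unfold bergmanConst; positivity) fun F => ?_
  obtain ⟨f, hf, hF⟩ := F.2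
  rw [bergmanEval_apply hX (hz (Metric.mem_ball_self hR)) F hf hF]
  exact norm_le_of_mem_bergmanSubmodule hf hF hR hz

/-- Point evaluation depends holomorphically, in the norm of the dual space, on the point. -/
theorem differentiableOn_bergmanEval (hX : IsOpen X) :
    DifferentiableOn ℂ (bergmanEval X) X := by
  intro z hz
  obtain ⟨R, hR, hzR⟩ := Metric.isOpen_iff.1 hX z hz
  have hsub : Metric.ball z (R / 2) ⊆ X := (Metric.ball_subset_ball (by linarith)).trans hzR
  refine (differentiableAt_of_weakly_holomorphic (C := bergmanConst d (R / 2)) (half_pos hR) (fun F => ?_)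
    fun y hy => norm_bergmanEval_le hX (half_pos hR) (ball_half_subset hzR hy)).differentiableWithinAt
  obtain ⟨f, hf, hF⟩ := F.2
  exact (hf.mono hsub).congr fun y hy => bergmanEval_apply hX (hsub hy) F hf hF

end Bergman

end MeanValue

/-! ### The Bergman kernel and its potential -/

section BergmanKernel

variable {d : ℕ} {X : Set (Fin d → ℂ)}

theorem completeSpace_bergmanSubmodule (hX : IsOpen X) : CompleteSpace (bergmanSubmodule X) :=
  (isClosed_bergmanSubmodule hX).completeSpace_coe

/-- The vector of the Bergman space that represents evaluation at `z`. -/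
def bergmanVec (X : Set (Fin d → ℂ)) [CompleteSpace (bergmanSubmodule X)] (z : Fin d → ℂ) :
    bergmanSubmodule X :=
  (InnerProductSpace.toDual ℂ (bergmanSubmodule X)).symm (bergmanEval X z)

theorem inner_bergmanVec [CompleteSpace (bergmanSubmodule X)] (z : Fin d → ℂ)
    (F : bergmanSubmodule X) : inner ℂ (bergmanVec X z) F = bergmanEval X z F := by
  rw [bergmanVec, InnerProductSpace.toDual_symm_apply]

theorem norm_bergmanVec [CompleteSpace (bergmanSubmodule X)] (z : Fin d → ℂ) :
    ‖bergmanVec X z‖ = ‖bergmanEval X z‖ := by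
  rw [bergmanVec, LinearIsometryEquiv.norm_map]

/-- The class in `L²(X)` of an element of the Bergman space. -/
def bergmanClass {f : (Fin d → ℂ) → ℂ} (hf : f ∈ bergmanSpace X) : bergmanSubmodule X :=
  ⟨hf.2.toLp f, f, hf.1, hf.2.coeFn_toLp⟩

theorem bergmanEval_class (hX : IsOpen X) {f : (Fin d → ℂ) → ℂ} (hf : f ∈ bergmanSpace X)
    {z : Fin d → ℂ} (hz : z ∈ X) : bergmanEval X z (bergmanClass hf) = f z :=
  bergmanEval_apply hX hz _ hf.1 hf.2.coeFn_toLp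

theorem inner_bergmanClass {f g : (Fin d → ℂ) → ℂ} (hf : f ∈ bergmanSpace X)
    (hg : g ∈ bergmanSpace X) :
    inner ℂ (bergmanClass hf) (bergmanClass hg) = ∫ z in X, g z * conj (f z) := by
  rw [Submodule.coe_inner, L2.inner_def]
  refine integral_congr_ae ?_
  filter_upwards [hf.2.coeFn_toLp, hg.2.coeFn_toLp] with z h1 h2
  simp only [bergmanClass, h1, h2, RCLike.inner_apply]

/-- The reproducing kernel exists: it is given by the Riesz representatives of the point evaluations. -/
theorem exists_isBergmanKernel (hX : IsOpen X) : ∃ K, IsBergmanKernel X K := by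
  have := completeSpace_bergmanSubmodule hX
  have hmem : ∀ F : bergmanSubmodule X, F.2.choose ∈ bergmanSpace X := fun F =>
    ⟨F.2.choose_spec.1, (Lp.memLp F.1).ae_eq F.2.choose_spec.2⟩
  have hcl : ∀ F : bergmanSubmodule X, bergmanClass (hmem F) = F := fun F => by
    apply Subtype.ext
    apply Lp.ext
    exact (hmem F).2.coeFn_toLp.trans F.2.choose_spec.2.symm
  refine ⟨fun z w => (bergmanVec X w).2.choose z, fun w hw => ⟨hmem _, fun f hf => ?_⟩⟩
  rw [← inner_bergmanClass (hmem _) hf, hcl, inner_bergmanVec, bergmanEval_class hX hf hw]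

theorem isBergmanKernel_bergmanKernel (hX : IsOpen X) : IsBergmanKernel X (bergmanKernel X) :=
  Classical.epsilon_spec (exists_isBergmanKernel hX)

/-- The chosen kernel is the Gram kernel of the Riesz representatives, by uniqueness. -/
theorem bergmanKernel_eq_inner (hX : IsOpen X) [CompleteSpace (bergmanSubmodule X)]
    {z w : Fin d → ℂ} (hz : z ∈ X) (hw : w ∈ X) :
    bergmanKernel X z w = inner ℂ (bergmanVec X z) (bergmanVec X w) := by
  obtain ⟨h1, h2⟩ := isBergmanKernel_bergmanKernel hX w hw
  have : bergmanClass h1 = bergmanVec X w := by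
    refine ext_inner_right ℂ fun G => ?_
    obtain ⟨g, hg, hG⟩ := G.2
    have hgm : g ∈ bergmanSpace X := ⟨hg, (Lp.memLp G.1).ae_eq hG⟩
    have hGc : G = bergmanClass hgm := by
      apply Subtype.ext
      apply Lp.ext
      exact hG.trans hgm.2.coeFn_toLp.symm
    rw [hGc, inner_bergmanClass, ← h2 g hgm, inner_bergmanVec, bergmanEval_class hX hgm hw]
  rw [← this, inner_bergmanVec, bergmanEval_class hX h1 hz]

/-- The potential is `log ‖ev_z‖²` for the evaluation `ev_z` at `z`. -/
theorem bergmanPotential_eq (hX : IsOpen X) {z : Fin d → ℂ} (hz : z ∈ X) :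
    bergmanPotential X z = Real.log (‖bergmanEval X z‖ ^ 2) := by
  have := completeSpace_bergmanSubmodule hX
  have h := inner_self_eq_norm_sq (𝕜 := ℂ) (bergmanVec X z)
  rw [RCLike.re_eq_complex_re] at h
  rw [bergmanPotential, bergmanKernel_eq_inner hX hz hz, h, norm_bergmanVec]

/-- The Bergman space separates `1`-jets: at each point of `X` some function of the Bergman space does
not vanish, and for each direction some function that vanishes at the point has non-zero derivative
in this direction. -/
def SeparatesJets (X : Set (Fin d → ℂ)) : Prop :=
  ∀ x ∈ X, (∃ f ∈ bergmanSpace X, f x ≠ 0) ∧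
    ∀ v ≠ 0, ∃ f ∈ bergmanSpace X, f x = 0 ∧ fderiv ℂ f x v ≠ 0

theorem hasDerivAt_line {F : Type*} [NormedAddCommGroup F] [NormedSpace ℝ F]
    {E : Type*} [NormedAddCommGroup E] [NormedSpace ℝ E] {f : E → F} {x u : E}
    (hf : DifferentiableAt ℝ f x) : HasDerivAt (fun t : ℝ => f (x + t • u)) (fderiv ℝ f x u) 0 := by
  have h1 : HasDerivAt (fun t : ℝ => x + t • u) u 0 := by
    simpa using ((hasDerivAt_id (0 : ℝ)).smul_const u).const_add x
  have h2 : HasFDerivAt f (fderiv ℝ f x) (x + (0 : ℝ) • u) := by simpa using hf.hasFDerivAt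
  exact h2.comp_hasDerivAt (0 : ℝ) h1

/-- The second derivative of `ρ = log ‖k‖²` in a direction `u`. -/
theorem fderiv_fderiv_log_norm_sq {E H : Type*} [NormedAddCommGroup E] [NormedSpace ℝ E]
    [NormedAddCommGroup H] [InnerProductSpace ℂ H] {k : E → H} {ρ : E → ℝ} {X : Set E}
    (hX : IsOpen X) (hk : ContDiffOn ℝ ω k X) (hk0 : ∀ x ∈ X, k x ≠ 0)
    (hρ : ∀ x ∈ X, ρ x = Real.log (inner ℂ (k x) (k x) : ℂ).re) {x : E} (hx : x ∈ X) (u : E) :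
    fderiv ℝ (fderiv ℝ ρ) x u u =
      2 * (‖fderiv ℝ k x u‖ ^ 2 + (inner ℂ (k x) (fderiv ℝ (fderiv ℝ k) x u u) : ℂ).re) / ‖k x‖ ^ 2
        - 4 * (inner ℂ (k x) (fderiv ℝ k x u) : ℂ).re ^ 2 / ‖k x‖ ^ 4 := by
  have hsq : ∀ a : H, (inner ℂ a a : ℂ).re = ‖a‖ ^ 2 := fun a => inner_self_eq_norm_sq (𝕜 := ℂ) a
  have hkd : ∀ y ∈ X, DifferentiableAt ℝ k y := fun y hy =>
    (hk.contDiffAt (hX.mem_nhds hy)).differentiableAt (by simp)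
  have hfd : ContDiffOn ℝ ω (fderiv ℝ k) X := hk.fderiv_of_isOpen hX (by simp)
  have hfdd : ∀ y ∈ X, DifferentiableAt ℝ (fderiv ℝ k) y := fun y hy =>
    (hfd.contDiffAt (hX.mem_nhds hy)).differentiableAt (by simp)
  have hρs : ContDiffOn ℝ ω ρ X := by
    have h2 : ContDiffOn ℝ ω (fun z => (inner ℂ (k z) (k z) : ℂ).re) X :=
      Complex.reCLM.contDiff.comp_contDiffOn (hk.inner ℂ hk)
    refine (h2.log fun x hx => ?_).congr hρ
    rw [hsq]
    have := norm_pos_iff.2 (hk0 x hx)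
    positivity
  -- the first derivative at all points of `X`
  have hfirst : ∀ y ∈ X, fderiv ℝ ρ y u = 2 * (inner ℂ (k y) (fderiv ℝ k y u) : ℂ).re / ‖k y‖ ^ 2 := by
    intro y hy
    have h0 := norm_pos_iff.2 (hk0 y hy)
    have hl := hasDerivAt_line (u := u) (hkd y hy)
    have h1 := Complex.reCLM.hasFDerivAt.comp_hasDerivAt (0 : ℝ) (hl.inner ℂ hl)
    have h2 := h1.log (by
      simp only [Function.comp, zero_smul, add_zero, Complex.reCLM_apply, hsq]; positivity)
    have h3 := hasDerivAt_line (u := u) ((hρs.contDiffAt (hX.mem_nhds hy)).differentiableAt (by simp))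
    have hev : (fun t : ℝ => ρ (y + t • u)) =ᶠ[𝓝 0]
        fun t => Real.log ((Complex.reCLM ∘ fun t : ℝ => inner ℂ (k (y + t • u)) (k (y + t • u))) t) := by
      have : ∀ᶠ t : ℝ in 𝓝 0, y + t • u ∈ X := by
        have hc : ContinuousAt (fun t : ℝ => y + t • u) 0 := by fun_prop
        exact hc.eventually_mem (by simpa using hX.mem_nhds hy)
      filter_upwards [this] with t ht
      rw [hρ _ ht]; rfl
    rw [h3.unique (h2.congr_of_eventuallyEq hev)]
    simp only [Function.comp, zero_smul, add_zero, Complex.reCLM_apply, Complex.add_re, hsq]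
    have hsym : (inner ℂ (fderiv ℝ k y u) (k y) : ℂ).re = (inner ℂ (k y) (fderiv ℝ k y u) : ℂ).re :=
      inner_re_symm (𝕜 := ℂ) _ _
    rw [hsym]; ring
  have h0 := norm_pos_iff.2 (hk0 x hx)
  have hρf : ContDiffOn ℝ ω (fderiv ℝ ρ) X := hρs.fderiv_of_isOpen hX (by simp)
  have hl := hasDerivAt_line (u := u) (hkd x hx)
  have hl2 := (hasDerivAt_line (u := u) (hfdd x hx)).clm_apply (hasDerivAt_const (0 : ℝ) u)
  have hA := (Complex.reCLM.hasFDerivAt.comp_hasDerivAt (0 : ℝ) (hl.inner ℂ hl2)).const_mul 2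
  have hB := Complex.reCLM.hasFDerivAt.comp_hasDerivAt (0 : ℝ) (hl.inner ℂ hl)
  have hq := hA.fun_div hB (by
    simp only [Function.comp, zero_smul, add_zero, Complex.reCLM_apply, hsq]; positivity)
  have hL := (hasDerivAt_line (u := u) ((hρf.contDiffAt (hX.mem_nhds hx)).differentiableAt
    (by simp))).clm_apply (hasDerivAt_const (0 : ℝ) u)
  have hev : (fun t : ℝ => fderiv ℝ ρ (x + t • u) u) =ᶠ[𝓝 0] fun t =>
      2 * (Complex.reCLM ∘ fun t : ℝ => inner ℂ (k (x + t • u)) (fderiv ℝ k (x + t • u) u)) t /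
        (Complex.reCLM ∘ fun t : ℝ => inner ℂ (k (x + t • u)) (k (x + t • u))) t := by
    have : ∀ᶠ t : ℝ in 𝓝 0, x + t • u ∈ X := by
      have hc : ContinuousAt (fun t : ℝ => x + t • u) 0 := by fun_prop
      exact hc.eventually_mem (by simpa using hX.mem_nhds hx)
    filter_upwards [this] with t ht
    rw [hfirst _ ht]
    simp only [Function.comp, Complex.reCLM_apply, hsq]
  have := hL.unique (hq.congr_of_eventuallyEq hev)
  simp only [Function.comp, zero_smul, add_zero, Complex.reCLM_apply, Complex.add_re, hsq,
    map_zero, add_zero] at this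
  rw [this]
  have hsym : (inner ℂ (fderiv ℝ k x u) (k x) : ℂ).re = (inner ℂ (k x) (fderiv ℝ k x u) : ℂ).re :=
    inner_re_symm (𝕜 := ℂ) _ _
  rw [hsym]
  field_simp
  ring

theorem fderiv_eval_apply {E H : Type} [NormedAddCommGroup E] [NormedSpace ℂ E]
    [NormedAddCommGroup H] [NormedSpace ℂ H] {ev : E → (H →L[ℂ] ℂ)} {x : E}
    (hev : DifferentiableAt ℂ ev x) (v : E) (F : H) :
    fderiv ℂ (fun y => ev y F) x v = fderiv ℂ ev x v F := by
  have h2 := (ContinuousLinearMap.apply ℂ ℂ F).hasFDerivAt.comp x hev.hasFDerivAt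
  have h3 : HasFDerivAt (fun y => ev y F) _ x := h2
  rw [h3.fderiv]; rfl

/-! ### The potential `log ‖ev‖²` of a holomorphic family of functionals -/

section RieszPotential

variable {E H : Type} [NormedAddCommGroup E] [NormedSpace ℂ E] [FiniteDimensional ℂ E]
  [NormedAddCommGroup H] [InnerProductSpace ℂ H] [CompleteSpace H] {Y : Set E}
  {ev : E → (H →L[ℂ] ℂ)} {ρ : E → ℝ}

/-- The Riesz isomorphism as a real linear map. -/
def realRiesz (H : Type) [NormedAddCommGroup H] [InnerProductSpace ℂ H] [CompleteSpace H] :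
    (H →L[ℂ] ℂ) →L[ℝ] H where
  toFun ℓ := (InnerProductSpace.toDual ℂ H).symm ℓ
  map_add' := map_add _
  map_smul' c ℓ := by
    have h : c • ℓ = (c : ℂ) • ℓ := by ext F; simp
    rw [h, map_smulₛₗ]; simp
  cont := (InnerProductSpace.toDual ℂ H).symm.continuous

theorem realRiesz_apply (ℓ : H →L[ℂ] ℂ) :
    realRiesz H ℓ = (InnerProductSpace.toDual ℂ H).symm ℓ := rfl

theorem inner_realRiesz (ℓ : H →L[ℂ] ℂ) (F : H) : inner ℂ (realRiesz H ℓ) F = ℓ F := by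
  rw [realRiesz_apply, InnerProductSpace.toDual_symm_apply]

theorem norm_realRiesz (ℓ : H →L[ℂ] ℂ) : ‖realRiesz H ℓ‖ = ‖ℓ‖ := by
  rw [realRiesz_apply, LinearIsometryEquiv.norm_map]

theorem contDiffOn_realRiesz_comp (hY : IsOpen Y) (hev : DifferentiableOn ℂ ev Y) :
    ContDiffOn ℝ ω (fun z => realRiesz H (ev z)) Y :=
  (realRiesz H).contDiff.comp_contDiffOn (hev.contDiffOn_real hY)

theorem log_norm_sq_eq (ℓ : H →L[ℂ] ℂ) :
    Real.log (‖ℓ‖ ^ 2) = Real.log (inner ℂ (realRiesz H ℓ) (realRiesz H ℓ) : ℂ).re := by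
  have h := inner_self_eq_norm_sq (𝕜 := ℂ) (realRiesz H ℓ)
  rw [RCLike.re_eq_complex_re] at h
  rw [h, norm_realRiesz]

theorem contDiffOn_log_norm_sq (hY : IsOpen Y) (hev : DifferentiableOn ℂ ev Y)
    (h0 : ∀ x ∈ Y, ev x ≠ 0) (hρ : ∀ x ∈ Y, ρ x = Real.log (‖ev x‖ ^ 2)) :
    ContDiffOn ℝ ω ρ Y := by
  have hk := contDiffOn_realRiesz_comp hY hev
  have h2 : ContDiffOn ℝ ω (fun z => (inner ℂ (realRiesz H (ev z)) (realRiesz H (ev z)) : ℂ).re) Y :=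
    Complex.reCLM.contDiff.comp_contDiffOn (hk.inner ℂ hk)
  refine (h2.log fun x hx => ?_).congr fun x hx => by rw [hρ x hx, log_norm_sq_eq]
  have h := inner_self_eq_norm_sq (𝕜 := ℂ) (realRiesz H (ev x))
  rw [RCLike.re_eq_complex_re] at h
  rw [h, norm_realRiesz]
  have := norm_pos_iff.2 (h0 x hx)
  positivity

/-- Strict plurisubharmonicity of `log ‖ev‖²`: by the Cauchy–Schwarz inequality the Laplacian in a
complex direction `v` is nonnegative, and it vanishes only if the derivative of `ev` along `v` is
proportional to `ev`. -/
theorem laplacian_log_norm_sq_pos (hY : IsOpen Y) (hev : DifferentiableOn ℂ ev Y)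
    (h0 : ∀ x ∈ Y, ev x ≠ 0) (hρ : ∀ x ∈ Y, ρ x = Real.log (‖ev x‖ ^ 2)) {x v : E} (hx : x ∈ Y)
    (hv : ∃ F, ev x F = 0 ∧ fderiv ℂ ev x v F ≠ 0) :
    0 < fderiv ℝ (fderiv ℝ ρ) x v v
      + fderiv ℝ (fderiv ℝ ρ) x (Complex.I • v) (Complex.I • v) := by
  have hkC := contDiffOn_realRiesz_comp hY hev
  have hk0 : ∀ y ∈ Y, realRiesz H (ev y) ≠ 0 := fun y hy => by
    rw [← norm_ne_zero_iff, norm_realRiesz, norm_ne_zero_iff]; exact h0 y hy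
  have hd := fderiv_fderiv_log_norm_sq (ρ := ρ) hY hkC hk0
    (fun x hx => by rw [hρ x hx, log_norm_sq_eq]) hx
  have hev1 : ∀ y ∈ Y, DifferentiableAt ℂ ev y := fun y hy =>
    hev.differentiableAt (hY.mem_nhds hy)
  have hev2 : ∀ u, DifferentiableAt ℂ (fun y => fderiv ℂ ev y u) x := fun u =>
    ((hev.fderiv_holomorphic hY).differentiableAt (hY.mem_nhds hx)).clm_apply
      (differentiableAt_const u)
  have hk1 : ∀ y ∈ Y, ∀ u, fderiv ℝ (fun z => realRiesz H (ev z)) y u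
      = realRiesz H (fderiv ℂ ev y u) := by
    intro y hy u
    have h := (realRiesz H).hasFDerivAt.comp y ((hev1 y hy).hasFDerivAt.restrictScalars ℝ)
    rw [show (fun z => realRiesz H (ev z)) = realRiesz H ∘ ev from rfl, h.fderiv]; rfl
  have hk2 : ∀ u, fderiv ℝ (fderiv ℝ (fun z => realRiesz H (ev z))) x u u
      = realRiesz H (fderiv ℂ (fun y => fderiv ℂ ev y u) x u) := by
    intro u
    have hkk : DifferentiableAt ℝ (fderiv ℝ (fun z => realRiesz H (ev z))) x :=
      ((hkC.fderiv_of_isOpen hY (m := ω) (by simp)).contDiffAt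
        (hY.mem_nhds hx)).differentiableAt (by simp)
    have hL := (hasDerivAt_line (u := u) hkk).clm_apply (hasDerivAt_const (0 : ℝ) u)
    have hR := hasDerivAt_line (u := u) ((hev2 u).restrictScalars ℝ)
    have hR2 := (realRiesz H).hasFDerivAt.comp_hasDerivAt (0 : ℝ) hR
    have hevq : (fun t : ℝ => fderiv ℝ (fun z => realRiesz H (ev z)) (x + t • u) u) =ᶠ[𝓝 0] fun t =>
        realRiesz H (fderiv ℂ ev (x + t • u) u) := by
      have : ∀ᶠ t : ℝ in 𝓝 0, x + t • u ∈ Y := by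
        have hc : ContinuousAt (fun t : ℝ => x + t • u) 0 := by fun_prop
        exact hc.eventually_mem (by simpa using hY.mem_nhds hx)
      filter_upwards [this] with t ht using hk1 _ ht u
    have := hL.unique (hR2.congr_of_eventuallyEq hevq)
    simp only [map_zero, add_zero] at this
    rw [this, fderiv_real_eq (hev2 u)]
  set k := realRiesz H (ev x) with hkdef
  set a := realRiesz H (fderiv ℂ ev x v) with ha
  have hI : realRiesz H (fderiv ℂ ev x (Complex.I • v)) = -Complex.I • a := by
    rw [map_smul, realRiesz_apply, map_smulₛₗ, ha, realRiesz_apply]; simp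
  have hII : realRiesz H (fderiv ℂ (fun y => fderiv ℂ ev y (Complex.I • v)) x (Complex.I • v))
      = - realRiesz H (fderiv ℂ (fun y => fderiv ℂ ev y v) x v) := by
    have : (fun y => fderiv ℂ ev y (Complex.I • v)) = fun y => Complex.I • fderiv ℂ ev y v := by
      ext1 y; rw [map_smul]
    rw [this, fderiv_fun_const_smul (hev2 v), map_smul]
    have h2 : ∀ ℓ : H →L[ℂ] ℂ, realRiesz H (Complex.I • Complex.I • ℓ) = -realRiesz H ℓ := by
      intro ℓ
      have h3 : Complex.I • Complex.I • ℓ = -ℓ := by ext F; simp [← mul_assoc]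
      rw [h3, map_neg]
    exact h2 _
  have hkpos : 0 < ‖k‖ := norm_pos_iff.2 (hk0 x hx)
  have hform : fderiv ℝ (fderiv ℝ ρ) x v v
      + fderiv ℝ (fderiv ℝ ρ) x (Complex.I • v) (Complex.I • v) =
      4 * (‖a‖ ^ 2 * ‖k‖ ^ 2 - ‖(inner ℂ k a : ℂ)‖ ^ 2) / ‖k‖ ^ 4 := by
    rw [hd, hd, hk2, hk2, hk1 x hx, hk1 x hx, hI, hII, ← ha, norm_smul, inner_smul_right,
      inner_neg_right, ← Complex.normSq_eq_norm_sq (inner ℂ k a), Complex.normSq_apply]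
    simp only [norm_neg, Complex.norm_I, one_mul, Complex.neg_re, Complex.mul_re, Complex.I_re,
      Complex.I_im, Complex.neg_im]
    field_simp
    ring
  rw [hform]
  have hne : ¬ (∃ c : ℂ, a = c • k) := by
    rintro ⟨c, hc⟩
    obtain ⟨F, hF0, hFv⟩ := hv
    apply hFv
    rw [← inner_realRiesz, ← ha, hc, inner_smul_left, hkdef, inner_realRiesz, hF0, mul_zero]
  have hcs : ‖(inner ℂ k a : ℂ)‖ < ‖k‖ * ‖a‖ := by
    refine lt_of_le_of_ne (norm_inner_le_norm k a) fun h => hne ?_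
    have h' : k = 0 ∨ ∃ r : ℂ, a = r • k := (norm_inner_eq_norm_tfae ℂ k a |>.out 0 2).1 h
    obtain ⟨c, hc⟩ := h'.resolve_left (norm_pos_iff.1 hkpos)
    exact ⟨c, hc⟩
  have : 0 < ‖a‖ ^ 2 * ‖k‖ ^ 2 - ‖(inner ℂ k a : ℂ)‖ ^ 2 := by
    have := pow_lt_pow_left₀ hcs (norm_nonneg _) (n := 2) (by norm_num)
    rw [mul_pow] at this
    linarith
  positivity

end RieszPotential

theorem bergmanEval_ne_zero (hX : IsOpen X) (hs : SeparatesJets X) {x : Fin d → ℂ} (hx : x ∈ X) :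
    bergmanEval X x ≠ 0 := by
  obtain ⟨f, hf, hfx⟩ := (hs x hx).1
  intro h
  apply hfx
  rw [← bergmanEval_class hX hf hx, h]; rfl

theorem contDiffOn_bergmanPotential (hX : IsOpen X) (hs : SeparatesJets X) :
    ContDiffOn ℝ ω (bergmanPotential X) X := by
  have := completeSpace_bergmanSubmodule hX
  exact contDiffOn_log_norm_sq (H := bergmanSubmodule X) hX (differentiableOn_bergmanEval hX)
    (fun x hx => bergmanEval_ne_zero hX hs hx) fun x hx => bergmanPotential_eq hX hx

/-- The Bergman metric `ω(v, iv)` is positive definite. -/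
theorem bergmanForm_pos (hX : IsOpen X) (hs : SeparatesJets X) {x v : Fin d → ℂ} (hx : x ∈ X)
    (hv : v ≠ 0) : 0 < bergmanForm X x v (Complex.I • v) := by
  have := completeSpace_bergmanSubmodule hX
  have e : bergmanForm X x v (Complex.I • v) = fderiv ℝ (fderiv ℝ (bergmanPotential X)) x v v
      + fderiv ℝ (fderiv ℝ (bergmanPotential X)) x (Complex.I • v) (Complex.I • v) := by
    rw [bergmanForm, smul_smul, Complex.I_mul_I]; simp
  rw [e]
  refine laplacian_log_norm_sq_pos (H := bergmanSubmodule X) hX (differentiableOn_bergmanEval hX)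
    (fun x hx => bergmanEval_ne_zero hX hs hx) (fun x hx => bergmanPotential_eq hX hx) hx ?_
  obtain ⟨f, hf, hfx, hfv⟩ := (hs x hx).2 v hv
  refine ⟨bergmanClass hf, by rw [bergmanEval_class hX hf hx, hfx], ?_⟩
  have h1 : fderiv ℂ f x v = fderiv ℂ (bergmanEval X) x v (bergmanClass hf) := by
    have h2 := fderiv_eval_apply (H := bergmanSubmodule X) (ev := bergmanEval X)
      ((differentiableOn_bergmanEval hX).differentiableAt (hX.mem_nhds hx)) v (bergmanClass hf)
    rw [← h2]
    have h3 : f =ᶠ[𝓝 x] fun y => bergmanEval X y (bergmanClass hf) := by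
      filter_upwards [hX.mem_nhds hx] with y hy using (bergmanEval_class hX hf hy).symm
    rw [h3.fderiv_eq]
  rwa [← h1]

end BergmanKernel

/-! ### The Levi form of a real function -/

section LeviForm

variable {E E' : Type} [NormedAddCommGroup E] [NormedSpace ℂ E] [NormedAddCommGroup E']
  [NormedSpace ℂ E']

/-- The Levi form `-d dᶜ g` of a real function `g`, with the sign and normalization of the Bergman
form. -/
def leviForm (g : E → ℝ) (x u v : E) : ℝ :=
  - fderiv ℝ (fderiv ℝ g) x u (Complex.I • v) + fderiv ℝ (fderiv ℝ g) x v (Complex.I • u)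

theorem bergmanForm_eq_leviForm {d : ℕ} (X : Set (Fin d → ℂ)) (x u v : Fin d → ℂ) :
    bergmanForm X x u v = leviForm (bergmanPotential X) x u v := rfl

theorem leviForm_congr {g g' : E → ℝ} {x : E} (h : g =ᶠ[𝓝 x] g') (u v : E) :
    leviForm g x u v = leviForm g' x u v := by
  unfold leviForm
  rw [(h.fderiv (𝕜 := ℝ)).fderiv_eq]

theorem leviForm_add {g g' : E → ℝ} {x : E} (hg : ContDiffAt ℝ ω g x) (hg' : ContDiffAt ℝ ω g' x)
    (u v : E) : leviForm (fun y => g y + g' y) x u v = leviForm g x u v + leviForm g' x u v := by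
  have h1 : fderiv ℝ (fun y => g y + g' y) =ᶠ[𝓝 x] fun y => fderiv ℝ g y + fderiv ℝ g' y := by
    filter_upwards [hg.eventually (by simp), hg'.eventually (by simp)] with y hy hy'
    exact fderiv_fun_add (hy.differentiableAt (by simp)) (hy'.differentiableAt (by simp))
  have h2 : ∀ {f : E → ℝ}, ContDiffAt ℝ ω f x → DifferentiableAt ℝ (fderiv ℝ f) x := fun hf =>
    (hf.fderiv_right (m := ω) (by simp)).differentiableAt (by simp)
  unfold leviForm
  rw [h1.fderiv_eq, fderiv_fun_add (h2 hg) (h2 hg')]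
  simp only [add_apply]
  ring

theorem hasFDerivAt_fderiv_apply {F : Type} [NormedAddCommGroup F] [NormedSpace ℝ F]
    {E : Type} [NormedAddCommGroup E] [NormedSpace ℝ E] {f : E → F} {x : E}
    (hf : DifferentiableAt ℝ (fderiv ℝ f) x) (w : E) :
    HasFDerivAt (fun y => fderiv ℝ f y w) ((fderiv ℝ (fderiv ℝ f) x).flip w) x := by
  have := hf.hasFDerivAt.clm_apply (hasFDerivAt_const w x)
  refine this.congr_fderiv ?_
  ext u; simp

theorem fderiv_fderiv_symm_complex [FiniteDimensional ℂ E] [CompleteSpace E'] {φ : E → E'} {x : E}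
    {s : Set E} (hs : IsOpen s) (hφ : DifferentiableOn ℂ φ s) (hx : x ∈ s) (u v : E) :
    fderiv ℂ (fderiv ℂ φ) x u v = fderiv ℂ (fderiv ℂ φ) x v u := by
  have h : ContDiffAt ℂ 2 φ x := (hφ.contDiffOn_nat hs 2).contDiffAt (hs.mem_nhds hx)
  exact (h.isSymmSndFDerivAt (by simp)) u v

/-- The second derivative of the composition with a holomorphic map. -/
theorem fderiv_fderiv_comp_holomorphic [FiniteDimensional ℂ E] [CompleteSpace E'] {g : E' → ℝ}
    {φ : E → E'} {s : Set E} (hs : IsOpen s) (hφ : DifferentiableOn ℂ φ s) {x : E} (hx : x ∈ s)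
    (hg : ContDiffAt ℝ ω g (φ x)) (u w : E) :
    fderiv ℝ (fderiv ℝ fun y => g (φ y)) x u w =
      fderiv ℝ (fderiv ℝ g) (φ x) (fderiv ℂ φ x u) (fderiv ℂ φ x w)
        + fderiv ℝ g (φ x) (fderiv ℂ (fderiv ℂ φ) x u w) := by
  have hφd : ∀ y ∈ s, DifferentiableAt ℂ φ y := fun y hy => hφ.differentiableAt (hs.mem_nhds hy)
  have hφr : ContDiffAt ℝ ω φ x := (hφ.contDiffOn_real hs).contDiffAt (hs.mem_nhds hx)
  have hcomp : ContDiffAt ℝ ω (fun y => g (φ y)) x := hg.comp x hφr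
  have hd2 : DifferentiableAt ℝ (fderiv ℝ fun y => g (φ y)) x :=
    (hcomp.fderiv_right (m := ω) (by simp)).differentiableAt (by simp)
  have h1 := hasFDerivAt_fderiv_apply hd2 w
  have hg2 : DifferentiableAt ℝ (fderiv ℝ g) (φ x) :=
    (hg.fderiv_right (m := ω) (by simp)).differentiableAt (by simp)
  have hφ2 : HasFDerivAt (fun y => fderiv ℂ φ y w) ((fderiv ℂ (fderiv ℂ φ) x).flip w) x := by
    have := ((hφ.fderiv_holomorphic hs).differentiableAt (hs.mem_nhds hx)).hasFDerivAt.clm_apply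
      (hasFDerivAt_const w x)
    refine this.congr_fderiv ?_
    ext u; simp
  have hA := hg2.hasFDerivAt.comp x ((hφd x hx).hasFDerivAt.restrictScalars ℝ)
  have h2 := hA.clm_apply (hφ2.restrictScalars ℝ)
  have hev : (fun y => fderiv ℝ (fun y => g (φ y)) y w) =ᶠ[𝓝 x]
      fun y => (fderiv ℝ g ∘ φ) y (fderiv ℂ φ y w) := by
    have hgd : ∀ᶠ y in 𝓝 x, DifferentiableAt ℝ g (φ y) :=
      hφr.continuousAt.eventually ((hg.eventually (by simp)).mono fun y hy =>
        hy.differentiableAt (by simp))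
    filter_upwards [hgd, hs.mem_nhds hx] with y hy hys
    have := hy.hasFDerivAt.comp y ((hφd y hys).hasFDerivAt.restrictScalars ℝ)
    change fderiv ℝ (g ∘ φ) y w = _
    rw [this.fderiv]; rfl
  have h3 := h1.unique (h2.congr_of_eventuallyEq hev)
  have h4 := congrArg (fun L : E →L[ℝ] ℝ => L u) h3
  simp only [ContinuousLinearMap.flip_apply, add_apply, ContinuousLinearMap.comp_apply,
    Function.comp] at h4
  rw [h4, add_comm]
  rfl

/-- The Levi form is natural under holomorphic maps. -/
theorem leviForm_comp_holomorphic [FiniteDimensional ℂ E] [CompleteSpace E'] {g : E' → ℝ}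
    {φ : E → E'} {s : Set E} (hs : IsOpen s) (hφ : DifferentiableOn ℂ φ s) {x : E} (hx : x ∈ s)
    (hg : ContDiffAt ℝ ω g (φ x)) (u v : E) :
    leviForm (fun y => g (φ y)) x u v = leviForm g (φ x) (fderiv ℂ φ x u) (fderiv ℂ φ x v) := by
  unfold leviForm
  rw [fderiv_fderiv_comp_holomorphic hs hφ hx hg, fderiv_fderiv_comp_holomorphic hs hφ hx hg]
  simp only [map_smul]
  rw [fderiv_fderiv_symm_complex hs hφ hx v u]
  ring

/-- `log |h|²` is pluriharmonic for a nowhere vanishing holomorphic function `h`. -/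
theorem leviForm_log_norm_sq_holomorphic [FiniteDimensional ℂ E] {h : E → ℂ} {s : Set E}
    (hs : IsOpen s) (hh : DifferentiableOn ℂ h s) {x : E} (hx : x ∈ s) (h0 : h x ≠ 0) (u v : E) :
    leviForm (fun y => Real.log (‖h y‖ ^ 2)) x u v = 0 ∧
      ContDiffAt ℝ ω (fun y => Real.log (‖h y‖ ^ 2)) x := by
  -- a branch of the logarithm of `h y / h x` near `x`
  have hcont : ContinuousAt (fun y => h y / h x) x :=
    (hh.differentiableAt (hs.mem_nhds hx)).continuousAt.div_const _
  have hslit : ∀ᶠ y in 𝓝 x, h y / h x ∈ Complex.slitPlane :=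
    hcont.eventually_mem (Complex.isOpen_slitPlane.mem_nhds (by
      simp [div_self h0]))
  obtain ⟨t, hts, hto, hxt⟩ := mem_nhds_iff.1 (Filter.inter_mem hslit (hs.mem_nhds hx))
  have hG : DifferentiableOn ℂ (fun y => Complex.log (h y / h x)) t := by
    intro y hy
    have h1 : DifferentiableAt ℂ (fun y => h y / h x) y := by
      simp only [div_eq_mul_inv]
      exact (hh.differentiableAt (hs.mem_nhds (hts hy).2)).mul_const _
    exact (h1.clog (hts hy).1).differentiableWithinAt
  let g : ℂ → ℝ := fun ζ => 2 * Complex.reCLM ζ + Real.log (‖h x‖ ^ 2)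
  have hg : ContDiff ℝ ω g := (contDiff_const.mul Complex.reCLM.contDiff).add contDiff_const
  have hev : (fun y => Real.log (‖h y‖ ^ 2)) =ᶠ[𝓝 x] fun y => g (Complex.log (h y / h x)) := by
    filter_upwards [hto.mem_nhds hxt] with y hy
    have h1 := Complex.slitPlane_ne_zero (hts hy).1
    have h2 : h y ≠ 0 := fun h => h1 (by rw [h, zero_div])
    simp only [g, Complex.reCLM_apply, Complex.log_re, norm_div]
    rw [Real.log_div (norm_ne_zero_iff.2 h2) (norm_ne_zero_iff.2 h0), Real.log_pow, Real.log_pow]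
    push_cast; ring
  constructor
  · rw [leviForm_congr hev, leviForm_comp_holomorphic hto hG hxt hg.contDiffAt]
    have hg1 : fderiv ℝ g = fun _ => (2 : ℝ) • Complex.reCLM := by
      ext1 ζ
      have : HasFDerivAt g ((2 : ℝ) • Complex.reCLM) ζ :=
        (Complex.reCLM.hasFDerivAt.const_mul 2).add_const _
      exact this.fderiv
    unfold leviForm
    rw [hg1]; simp
  · exact (hg.contDiffAt.comp x ((hG.contDiffOn_real hto).contDiffAt
      (hto.mem_nhds hxt))).congr_of_eventuallyEq hev

theorem leviForm_antisymm (g : E → ℝ) (x u v : E) : leviForm g x u v = - leviForm g x v u := by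
  unfold leviForm; ring

theorem leviForm_smul_I {g : E → ℝ} {x : E} (hg : ContDiffAt ℝ ω g x) (u v : E) :
    leviForm g x (Complex.I • u) (Complex.I • v) = leviForm g x u v := by
  have h := hg.isSymmSndFDerivAt (by simp)
  unfold leviForm
  rw [smul_smul, smul_smul, Complex.I_mul_I, neg_one_smul, neg_one_smul, map_neg, map_neg,
    h.eq (Complex.I • u) v, h.eq (Complex.I • v) u]
  ring

/-- Precomposition with the complex structure. -/
def mulI (E : Type) [NormedAddCommGroup E] [NormedSpace ℂ E] : E →L[ℝ] E :=
  (Complex.I • ContinuousLinearMap.id ℂ E).restrictScalars ℝ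


/-- The Levi form as a bilinear map. -/
def leviFormL (g : E → ℝ) (x : E) : E →L[ℝ] E →L[ℝ] ℝ :=
  -(((ContinuousLinearMap.compL ℝ E E ℝ).flip (mulI E)).comp (fderiv ℝ (fderiv ℝ g) x))
    + (((ContinuousLinearMap.compL ℝ E E ℝ).flip (mulI E)).comp (fderiv ℝ (fderiv ℝ g) x)).flip

theorem leviFormL_apply (g : E → ℝ) (x u v : E) : leviFormL g x u v = leviForm g x u v := rfl

theorem contDiffOn_leviFormL {g : E → ℝ} {s : Set E} (hs : IsOpen s) (hg : ContDiffOn ℝ ω g s) :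
    ContDiffOn ℝ ω (leviFormL g) s := by
  have h2 : ContDiffOn ℝ ω (fderiv ℝ (fderiv ℝ g)) s :=
    (hg.fderiv_of_isOpen hs (m := ω) (by simp)).fderiv_of_isOpen hs (by simp)
  have h3 : ContDiffOn ℝ ω (fun x => ((ContinuousLinearMap.compL ℝ E E ℝ).flip (mulI E)).comp
      (fderiv ℝ (fderiv ℝ g) x)) s := contDiffOn_const.clm_comp h2
  let e : (E →L[ℝ] E →L[ℝ] ℝ) →L[ℝ] (E →L[ℝ] E →L[ℝ] ℝ) :=
    (ContinuousLinearMap.flipₗᵢ ℝ E E ℝ).toContinuousLinearEquiv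
  have he : ContDiff ℝ ω e := ContinuousLinearMap.contDiff (𝕜 := ℝ) (E := E →L[ℝ] E →L[ℝ] ℝ)
    (F := E →L[ℝ] E →L[ℝ] ℝ) e
  exact h3.neg.add (he.comp_contDiffOn h3)

end LeviForm

/-! ### Invariance of the Bergman form under automorphisms -/

section Invariance

variable {d : ℕ} {X : Set (Fin d → ℂ)}

theorem HolAut.mapsTo (g : HolAut X) : Set.MapsTo g.1 X X := by
  intro x hx
  by_contra h
  have h2 : g.1 x = x := g.1.injective (g.2.1 _ h)
  rw [h2] at h
  exact h hx

theorem HolAut.symm_mapsTo (g : HolAut X) : Set.MapsTo g.1.symm X X :=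
  HolAut.mapsTo (g⁻¹ : HolAut X)

theorem HolAut.image_eq (g : HolAut X) : g.1 '' X = X :=
  Set.Subset.antisymm g.mapsTo.image_subset fun x hx =>
    ⟨g.1.symm x, g.symm_mapsTo hx, g.1.apply_symm_apply x⟩

theorem HolAut.differentiableAt (g : HolAut X) (hX : IsOpen X) {x : Fin d → ℂ} (hx : x ∈ X) :
    DifferentiableAt ℂ g.1 x := g.2.2.1.differentiableAt (hX.mem_nhds hx)

theorem HolAut.fderiv_symm_comp (g : HolAut X) (hX : IsOpen X) {x : Fin d → ℂ} (hx : x ∈ X) :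
    (fderiv ℂ g.1.symm (g.1 x)).comp (fderiv ℂ g.1 x) = ContinuousLinearMap.id ℂ _ := by
  have h1 := (g.2.2.2.differentiableAt (hX.mem_nhds (g.mapsTo hx))).hasFDerivAt.comp x
    (g.differentiableAt hX hx).hasFDerivAt
  have h2 : g.1.symm ∘ g.1 = id := by ext1 y; simp
  rw [h2] at h1
  exact h1.unique (hasFDerivAt_id x)

/-- The complex Jacobian determinant. -/
def jac (g : HolAut X) (x : Fin d → ℂ) : ℂ := (fderiv ℂ g.1 x).det

theorem jac_symm_mul (g : HolAut X) (hX : IsOpen X) {x : Fin d → ℂ} (hx : x ∈ X) :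
    jac g⁻¹ (g.1 x) * jac g x = 1 := by
  have h0 : ∀ A B : (Fin d → ℂ) →L[ℂ] (Fin d → ℂ), (A.comp B).det = A.det * B.det := fun A B =>
    LinearMap.det_comp A.toLinearMap B.toLinearMap
  have h := congrArg ContinuousLinearMap.det (g.fderiv_symm_comp hX hx)
  exact (h0 _ _).symm.trans (h.trans LinearMap.det_id)

theorem jac_ne_zero (g : HolAut X) (hX : IsOpen X) {x : Fin d → ℂ} (hx : x ∈ X) : jac g x ≠ 0 :=
  right_ne_zero_of_mul_eq_one (jac_symm_mul g hX hx)

theorem differentiableOn_jac (g : HolAut X) (hX : IsOpen X) : DifferentiableOn ℂ (jac g) X := by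
  have h1 : jac g = fun x => Matrix.det (LinearMap.toMatrix' (fderiv ℂ g.1 x).toLinearMap) := by
    ext1 x
    rw [LinearMap.det_toMatrix']; rfl
  rw [h1]
  simp only [Matrix.det_apply]
  intro x hx
  refine DifferentiableAt.differentiableWithinAt ?_
  refine DifferentiableAt.fun_sum fun σ _ => DifferentiableAt.const_smul (𝕜 := ℂ) ?_ _
  have hprod : ∀ i, DifferentiableAt ℂ
      (fun y => LinearMap.toMatrix' (fderiv ℂ g.1 y).toLinearMap (σ i) i) x := ?_
  · exact (HasFDerivAt.finsetProd fun i _ => (hprod i).hasFDerivAt).differentiableAt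
  intro i
  simp only [LinearMap.toMatrix'_apply, ContinuousLinearMap.coe_coe]
  have h2 := ((g.2.2.1.fderiv_holomorphic hX).differentiableAt (hX.mem_nhds hx)).clm_apply
    (differentiableAt_const (Pi.single i (1 : ℂ) : Fin d → ℂ))
  exact (differentiableAt_pi.1 h2) (σ i)

theorem abs_det_real_fderiv (g : HolAut X) (x : Fin d → ℂ) :
    |((fderiv ℂ g.1 x).restrictScalars ℝ).det| = ‖jac g x‖ ^ 2 := by
  have h := LinearMap.det_restrictScalars (R := ℝ) (f := (fderiv ℂ g.1 x).toLinearMap)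
  change |LinearMap.det ((fderiv ℂ g.1 x).toLinearMap.restrictScalars ℝ)| = _
  rw [h, Algebra.norm_complex_eq]
  simp only [jac]
  rw [← Complex.normSq_eq_norm_sq]
  exact abs_of_nonneg (Complex.normSq_nonneg _)

/-- Change of variables: `f ↦ (f ∘ g) jac g` preserves the `L²` norm on `X`. -/
theorem lintegral_comp_holAut (g : HolAut X) (hX : IsOpen X) (f : (Fin d → ℂ) → ℂ) :
    ∫⁻ x in X, ‖f (g.1 x) * jac g x‖ₑ ^ (2 : ℝ) = ∫⁻ x in X, ‖f x‖ₑ ^ (2 : ℝ) := by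
  have h := lintegral_image_eq_lintegral_abs_det_fderiv_mul volume hX.measurableSet
    (f := g.1) (f' := fun x => (fderiv ℂ g.1 x).restrictScalars ℝ)
    (fun x hx => ((g.differentiableAt hX hx).hasFDerivAt.restrictScalars ℝ).hasFDerivWithinAt)
    g.1.injective.injOn (fun x => ‖f x‖ₑ ^ (2 : ℝ))
  rw [g.image_eq] at h
  rw [h]
  refine setLIntegral_congr_fun hX.measurableSet fun x _ => ?_
  rw [abs_det_real_fderiv, enorm_mul, ENNReal.mul_rpow_of_nonneg _ _ (by norm_num), mul_comm,
    ENNReal.ofReal_pow (norm_nonneg _), ofReal_norm]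
  norm_num

theorem comp_mul_jac_mem (g : HolAut X) (hX : IsOpen X) {f : (Fin d → ℂ) → ℂ}
    (hf : f ∈ bergmanSpace X) : (fun x => f (g.1 x) * jac g x) ∈ bergmanSpace X ∧
      eLpNorm (fun x => f (g.1 x) * jac g x) 2 (volume.restrict X)
        = eLpNorm f 2 (volume.restrict X) := by
  have hd : DifferentiableOn ℂ (fun x => f (g.1 x) * jac g x) X :=
    (hf.1.comp g.2.2.1 g.mapsTo).mul (differentiableOn_jac g hX)
  have hn : eLpNorm (fun x => f (g.1 x) * jac g x) 2 (volume.restrict X)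
        = eLpNorm f 2 (volume.restrict X) := by
    rw [eLpNorm_eq_lintegral_rpow_enorm_toReal (by norm_num) (by norm_num),
      eLpNorm_eq_lintegral_rpow_enorm_toReal (by norm_num) (by norm_num)]
    simp only [ENNReal.toReal_ofNat]
    rw [lintegral_comp_holAut g hX]
  exact ⟨⟨hd, hd.continuousOn.aestronglyMeasurable hX.measurableSet, by rw [hn]; exact hf.2.2⟩, hn⟩

theorem norm_jac_mul_bergmanEval_le (g : HolAut X) (hX : IsOpen X) {x : Fin d → ℂ} (hx : x ∈ X) :
    ‖bergmanEval X (g.1 x)‖ * ‖jac g x‖ ≤ ‖bergmanEval X x‖ := by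
  rw [← le_div_iff₀ (norm_pos_iff.2 (jac_ne_zero g hX hx))]
  refine ContinuousLinearMap.opNorm_le_bound _ (by positivity) fun F => ?_
  obtain ⟨f, hf, hF⟩ := F.2
  have hfm : f ∈ bergmanSpace X := ⟨hf, (Lp.memLp F.1).ae_eq hF⟩
  obtain ⟨hm, hn⟩ := comp_mul_jac_mem g hX hfm
  rw [bergmanEval_apply hX (g.mapsTo hx) F hf hF]
  have h1 := (bergmanEval X x).le_opNorm (bergmanClass hm)
  rw [bergmanEval_class hX hm hx, norm_mul] at h1
  have h2 : ‖bergmanClass hm‖ = ‖F‖ := by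
    change ‖hm.2.toLp _‖ = ‖F.1‖
    rw [Lp.norm_toLp, hn, Lp.norm_def, eLpNorm_congr_ae hF]
  rw [h2] at h1
  rw [div_mul_eq_mul_div, le_div_iff₀ (norm_pos_iff.2 (jac_ne_zero g hX hx))]
  exact h1

/-- The transformation law of the Bergman kernel on the diagonal. -/
theorem norm_bergmanEval_holAut (g : HolAut X) (hX : IsOpen X) {x : Fin d → ℂ} (hx : x ∈ X) :
    ‖bergmanEval X x‖ = ‖bergmanEval X (g.1 x)‖ * ‖jac g x‖ := by
  refine le_antisymm ?_ (norm_jac_mul_bergmanEval_le g hX hx)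
  have h1 := norm_jac_mul_bergmanEval_le (g⁻¹ : HolAut X) hX (g.mapsTo hx)
  have h2 : (g⁻¹ : HolAut X).1 (g.1 x) = x := g.1.symm_apply_apply x
  rw [h2] at h1
  have h3 := congrArg norm (jac_symm_mul g hX hx)
  rw [norm_mul, norm_one] at h3
  calc ‖bergmanEval X x‖ = ‖bergmanEval X x‖ * ‖jac g⁻¹ (g.1 x)‖ * ‖jac g x‖ := by
        rw [mul_assoc, h3, mul_one]
    _ ≤ _ := by gcongr

/-- Holomorphic automorphisms preserve the Bergman form: they change the potential by
`log |jac g|²`, which is pluriharmonic. -/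
theorem bergmanForm_holAut (hX : IsOpen X) (hs : SeparatesJets X) (g : HolAut X)
    {x : Fin d → ℂ} (hx : x ∈ X) (u v : Fin d → ℂ) :
    bergmanForm X (g.1 x) (fderiv ℂ g.1 x u) (fderiv ℂ g.1 x v) = bergmanForm X x u v := by
  have hρ := contDiffOn_bergmanPotential hX hs
  have hρg : ContDiffAt ℝ ω (bergmanPotential X) (g.1 x) :=
    hρ.contDiffAt (hX.mem_nhds (g.mapsTo hx))
  have hlog := leviForm_log_norm_sq_holomorphic hX (differentiableOn_jac g hX) hx
    (jac_ne_zero g hX hx) u v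
  have hev : bergmanPotential X =ᶠ[𝓝 x]
      fun y => bergmanPotential X (g.1 y) + Real.log (‖jac g y‖ ^ 2) := by
    filter_upwards [hX.mem_nhds hx] with y hy
    have h1 : ‖bergmanEval X (g.1 y)‖ ≠ 0 := fun h =>
      bergmanEval_ne_zero hX hs (g.mapsTo hy) ((norm_eq_zero (E := bergmanSubmodule X →L[ℂ] ℂ)).1 h)
    have h2 := norm_ne_zero_iff.2 (jac_ne_zero g hX hy)
    rw [bergmanPotential_eq hX hy, bergmanPotential_eq hX (g.mapsTo hy),
      norm_bergmanEval_holAut g hX hy, mul_pow, Real.log_mul (pow_ne_zero _ h1) (pow_ne_zero _ h2)]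
  have hg : ContDiffAt ℝ ω g.1 x := (g.2.2.1.contDiffOn_real hX).contDiffAt (hX.mem_nhds hx)
  have h1 : leviForm (bergmanPotential X) x u v = _ := leviForm_congr hev u v
  have h2 := leviForm_add (hρg.comp x hg) hlog.2 u v
  have h3 := leviForm_comp_holomorphic hX g.2.2.1 hx hρg u v
  rw [bergmanForm_eq_leviForm, bergmanForm_eq_leviForm, h1]
  exact (h2.trans (by rw [hlog.1, add_zero]; exact h3)).symm

end Invariance

/-! ### Proper cones -/

section Cones

variable {n : ℕ} {Ω : Set (Fin n → ℝ)}

theorem IsProperOpenConvexCone.add_closure_mem (hΩ : IsProperOpenConvexCone Ω) {x y : Fin n → ℝ}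
    (hx : x ∈ Ω) (hy : y ∈ closure Ω) : x + y ∈ Ω := by
  have h := hΩ.convex.combo_interior_closure_mem_interior (x := x) (y := y)
    (by rwa [hΩ.isOpen.interior_eq]) hy (a := 1 / 2) (b := 1 / 2) (by norm_num) (by norm_num)
    (by norm_num)
  rw [hΩ.isOpen.interior_eq] at h
  have := hΩ.smul_mem _ h 2 (by norm_num)
  rw [smul_add, smul_smul, smul_smul] at this
  norm_num at this
  exact this

theorem IsProperOpenConvexCone.smul_closure_mem (hΩ : IsProperOpenConvexCone Ω) {y : Fin n → ℝ}
    (hy : y ∈ closure Ω) {t : ℝ} (ht : 0 < t) : t • y ∈ closure Ω :=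
  map_mem_closure (continuous_const_smul t) hy fun x hx => hΩ.smul_mem x hx t ht

theorem IsProperOpenConvexCone.zero_mem_closure (hΩ : IsProperOpenConvexCone Ω) :
    (0 : Fin n → ℝ) ∈ closure Ω := by
  have : (0 : Fin n → ℝ) ∈ closure Ω ∩ -closure Ω := by rw [hΩ.proper]; rfl
  exact this.1

/-- A linear functional that is positive on the closure of a proper cone, away from the origin. -/
theorem IsProperOpenConvexCone.exists_positive_functional (hΩ : IsProperOpenConvexCone Ω) :
    ∃ (f : (Fin n → ℝ) →L[ℝ] ℝ) (c : ℝ), 0 < c ∧ ∀ y ∈ closure Ω, c * ‖y‖ ≤ f y := by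
  set K := closure Ω ∩ Metric.sphere (0 : Fin n → ℝ) 1 with hK
  have hKc : IsCompact K := (isCompact_sphere _ _).inter_left isClosed_closure
  obtain ⟨f, hf0, hfK⟩ : ∃ f : (Fin n → ℝ) →L[ℝ] ℝ, (∀ b ∈ closure Ω, 0 ≤ f b) ∧ ∀ y ∈ K, 0 < f y := by
    refine hKc.induction_on (p := fun S => ∃ f : (Fin n → ℝ) →L[ℝ] ℝ, (∀ b ∈ closure Ω, 0 ≤ f b) ∧
      ∀ y ∈ S ∩ K, 0 < f y) ⟨0, by simp⟩ ?_ ?_ ?_ |>.imp fun f hf => ⟨hf.1, fun y hy => hf.2 y ⟨hy, hy⟩⟩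
    · rintro s t hst ⟨f, hf, hf'⟩
      exact ⟨f, hf, fun y hy => hf' y ⟨hst hy.1, hy.2⟩⟩
    · rintro s t ⟨f, hf, hf'⟩ ⟨g, hg, hg'⟩
      refine ⟨f + g, fun b hb => add_nonneg (hf b hb) (hg b hb), fun y hy => ?_⟩
      rcases hy.1 with h | h
      · exact add_pos_of_pos_of_nonneg (hf' y ⟨h, hy.2⟩) (hg y hy.2.1)
      · exact add_pos_of_nonneg_of_pos (hf y hy.2.1) (hg' y ⟨h, hy.2⟩)
    · intro y hy
      have hneg : -y ∉ closure Ω := fun h => by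
        have h1 : y ∈ closure Ω ∩ -closure Ω := ⟨hy.1, by simpa using h⟩
        rw [hΩ.proper] at h1
        have h2 : ‖y‖ = 1 := by simpa using hy.2
        rw [Set.mem_singleton_iff.1 h1, norm_zero] at h2
        exact zero_ne_one h2
      obtain ⟨f, u, hfu, hu⟩ := geometric_hahn_banach_point_closed hΩ.convex.closure
        isClosed_closure hneg
      have hu0 : u < 0 := by simpa using hu 0 hΩ.zero_mem_closure
      have hf : ∀ b ∈ closure Ω, 0 ≤ f b := by
        intro b hb
        by_contra hlt
        push Not at hlt
        have h1 := hu _ (hΩ.smul_closure_mem hb (t := u / f b) (div_pos_of_neg_of_neg hu0 hlt))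
        rw [map_smul, smul_eq_mul, div_mul_cancel₀ _ hlt.ne] at h1
        exact lt_irrefl _ h1
      refine ⟨{z | 0 < f z} ∩ K, Filter.inter_mem (mem_nhdsWithin_of_mem_nhds ?_) self_mem_nhdsWithin, f, hf,
        fun z hz => hz.1.1⟩
      refine (isOpen_lt continuous_const f.continuous).mem_nhds ?_
      rw [map_neg] at hfu
      change 0 < f y
      linarith
  rcases K.eq_empty_or_nonempty with he | hne
  · refine ⟨f, 1, one_pos, fun y hy => ?_⟩
    rcases eq_or_ne y 0 with rfl | h0
    · simp
    · exfalso
      have h1 : (‖y‖⁻¹ : ℝ) • y ∈ K :=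
        ⟨hΩ.smul_closure_mem hy (by positivity), by simp [norm_smul, h0]⟩
      rw [he] at h1; exact h1
  · obtain ⟨y0, hy0, hmin⟩ := hKc.exists_isMinOn hne f.continuous.continuousOn
    refine ⟨f, f y0, hfK y0 hy0, fun y hy => ?_⟩
    rcases eq_or_ne y 0 with rfl | h0
    · simp
    · have h1 : (‖y‖⁻¹ : ℝ) • y ∈ K :=
        ⟨hΩ.smul_closure_mem hy (by positivity), by simp [norm_smul, h0]⟩
      have h2 : f y0 ≤ f ((‖y‖⁻¹ : ℝ) • y) := hmin h1
      rw [map_smul, smul_eq_mul, inv_mul_eq_div, le_div_iff₀ (norm_pos_iff.2 h0)] at h2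
      exact h2

end Cones

/-! ### Siegel domains -/

section Siegel

variable {n m : ℕ} {Ω : Set (Fin n → ℝ)} {F : (Fin m → ℂ) → (Fin m → ℂ) → (Fin n → ℂ)}

namespace IsConeHermitian

variable (hF : IsConeHermitian Ω F)
include hF

theorem map_add_left (v v' w : Fin m → ℂ) : F (v + v') w = F v w + F v' w :=
  (hF.linear_left w).map_add v v'

theorem map_smul_left (c : ℂ) (v w : Fin m → ℂ) : F (c • v) w = c • F v w :=
  (hF.linear_left w).map_smul c v

theorem map_add_right (v w w' : Fin m → ℂ) : F v (w + w') = F v w + F v w' := by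
  ext i
  rw [hF.conj_symm, hF.map_add_left, Pi.add_apply, map_add, ← hF.conj_symm, ← hF.conj_symm]; rfl

theorem map_smul_right (c : ℂ) (v w : Fin m → ℂ) : F v (c • w) = conj c • F v w := by
  ext i
  rw [hF.conj_symm, hF.map_smul_left, Pi.smul_apply, smul_eq_mul, map_mul, ← hF.conj_symm]; rfl

theorem diag_im (w : Fin m → ℂ) (i : Fin n) : (F w w i).im = 0 :=
  Complex.conj_eq_iff_im.1 (hF.conj_symm w w i).symm

theorem re_symm (v w : Fin m → ℂ) (i : Fin n) : (F v w i).re = (F w v i).re := by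
  rw [hF.conj_symm v w i, Complex.conj_re]

theorem continuous_left (w : Fin m → ℂ) : Continuous fun v => F v w :=
  LinearMap.continuous_of_finiteDimensional (hF.linear_left w).mk'

theorem differentiable_left (w : Fin m → ℂ) : Differentiable ℂ fun v => F v w :=
  (LinearMap.toContinuousLinearMap (hF.linear_left w).mk').differentiable

theorem continuous_diag : Continuous fun w => F w w := by
  have hexp : ∀ w, F w w = ∑ j, w j • F (Pi.single j 1) w := by
    intro w
    conv_lhs => enter [1]; rw [pi_eq_sum_univ' w]
    have := map_sum (hF.linear_left w).mk' (fun j => w j • (Pi.single j 1 : Fin m → ℂ)) Finset.univ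
    simp only [IsLinearMap.mk'_apply, hF.map_smul_left] at this
    simpa using this
  have h2 : ∀ j, Continuous fun w => F (Pi.single j 1) w := by
    intro j
    have : (fun w => F (Pi.single j 1) w) = fun w i => conj (F w (Pi.single j 1) i) := by
      ext w i; rw [hF.conj_symm]
    rw [this]
    have := hF.continuous_left (Pi.single j 1)
    fun_prop
  rw [show (fun w => F w w) = _ from funext hexp]
  fun_prop

/-- The vector-valued quadratic form `w ↦ F(w, w)` satisfies `‖F(w, w)‖ ≥ κ ‖w‖²`. -/
theorem exists_lower_bound : ∃ κ > 0, ∀ w, κ * ‖w‖ ^ 2 ≤ ‖fun i => (F w w i).re‖ := by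
  have hc : Continuous fun w => ‖fun i => (F w w i).re‖ := by
    exact (continuous_pi fun i => Complex.continuous_re.comp
      ((continuous_apply i).comp hF.continuous_diag)).norm
  have hpos : ∀ w, w ≠ 0 → 0 < ‖fun i => (F w w i).re‖ := by
    intro w hw
    rw [norm_pos_iff]
    intro h
    apply hw
    rw [← hF.definite]
    ext i
    apply Complex.ext
    · exact congrFun h i
    · exact hF.diag_im w i
  have hhom : ∀ (t : ℝ) w, (fun i => (F (t • w) (t • w) i).re) = t ^ 2 • fun i => (F w w i).re := by
    intro t w
    have : t • w = (t : ℂ) • w := by ext i; simp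
    ext i
    rw [this, hF.map_smul_left, hF.map_smul_right]
    simp [sq, mul_assoc]
  rcases (Metric.sphere (0 : Fin m → ℂ) 1).eq_empty_or_nonempty with he | hne
  · refine ⟨1, one_pos, fun w => ?_⟩
    rcases eq_or_ne w 0 with rfl | h0
    · simp
    · exfalso
      have h1 : (‖w‖⁻¹ : ℝ) • w ∈ Metric.sphere (0 : Fin m → ℂ) 1 := by simp [norm_smul, h0]
      rw [he] at h1; exact h1
  · obtain ⟨w0, hw0, hmin⟩ := (isCompact_sphere (0 : Fin m → ℂ) 1).exists_isMinOn hne hc.continuousOn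
    refine ⟨_, hpos w0 (fun h => by rw [h] at hw0; simp at hw0), fun w => ?_⟩
    rcases eq_or_ne w 0 with rfl | h0
    · simp
    · have h1 : (‖w‖⁻¹ : ℝ) • w ∈ Metric.sphere (0 : Fin m → ℂ) 1 := by simp [norm_smul, h0]
      have h2 := hmin h1
      simp only [Set.mem_ofPred_eq] at h2
      rw [hhom, norm_smul, norm_pow, norm_inv, norm_norm, inv_pow, inv_mul_eq_div,
        le_div_iff₀ (by positivity)] at h2
      exact h2

theorem diag_add_smul (w b : Fin m → ℂ) (t : ℝ) (i : Fin n) :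
    (F (w + (t : ℂ) • b) (w + (t : ℂ) • b) i).re =
      (F w w i).re + 2 * t * (F w b i).re + t ^ 2 * (F b b i).re := by
  rw [hF.map_add_left, hF.map_add_right, hF.map_add_right, hF.map_smul_left, hF.map_smul_left,
    hF.map_smul_right, hF.map_smul_right]
  simp only [Pi.add_apply, Pi.smul_apply, smul_eq_mul, Complex.conj_ofReal, Complex.add_re,
    Complex.re_ofReal_mul]
  rw [hF.re_symm b w]
  ring

end IsConeHermitian

theorem isOpen_siegelSet (hΩ : IsProperOpenConvexCone Ω) (hF : IsConeHermitian Ω F) :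
    IsOpen (siegelSet Ω F) := by
  have h := hF.continuous_diag
  refine hΩ.isOpen.preimage (f := fun p : (Fin n → ℂ) × (Fin m → ℂ) =>
    fun i => (p.1 i).im - (F p.2 p.2 i).re) ?_
  have h2 : Continuous fun p : (Fin n → ℂ) × (Fin m → ℂ) => F p.2 p.2 := h.comp continuous_snd
  exact continuous_pi fun i => (Complex.continuous_im.comp ((continuous_apply i).comp
    continuous_fst)).sub (Complex.continuous_re.comp ((continuous_apply i).comp h2))

theorem convex_siegelSet (hΩ : IsProperOpenConvexCone Ω) (hF : IsConeHermitian Ω F) :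
    Convex ℝ (siegelSet Ω F) := by
  rintro ⟨x, w⟩ hx ⟨x', w'⟩ hx' s t hs ht hst
  simp only [siegelSet, Set.mem_ofPred_eq] at hx hx' ⊢
  have h1 := hΩ.convex hx hx' hs ht hst
  have h2 : (s * t) • (fun i => (F (w' - w) (w' - w) i).re) ∈ closure Ω := by
    rcases (mul_nonneg hs ht).eq_or_lt with h | h
    · rw [← h, zero_smul]; exact hΩ.zero_mem_closure
    · exact hΩ.smul_closure_mem (hF.diag_mem _) h
  convert! hΩ.add_closure_mem h1 h2 using 1
  ext i
  have e1 : s • w + t • w' = w + (t : ℂ) • (w' - w) := by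
    ext k
    simp only [Pi.add_apply, Pi.smul_apply, Complex.real_smul, Pi.sub_apply, smul_eq_mul]
    have : (s : ℂ) = 1 - t := by rw [eq_sub_iff_add_eq]; exact_mod_cast hst
    rw [this]; ring
  have e2 := hF.diag_add_smul w (w' - w) t i
  have e3 := hF.diag_add_smul w (w' - w) 1 i
  simp only [Complex.ofReal_one, one_smul, add_sub_cancel, mul_one, one_pow, one_mul] at e3
  simp only [Prod.smul_fst, Prod.smul_snd, Prod.fst_add, Prod.snd_add, e1, e2, Pi.add_apply,
    Pi.smul_apply, Complex.add_im, Complex.real_smul, Complex.im_ofReal_mul, smul_eq_mul, e3]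
  have : s = 1 - t := by linarith
  rw [this]; ring

/-- A product of linear polynomials of absolute value at least `1` on the Siegel domain, whose
absolute value grows at least linearly. -/
theorem exists_denominator_siegelSet (hΩ : IsProperOpenConvexCone Ω) (hF : IsConeHermitian Ω F) :
    ∃ (P : (Fin n → ℂ) × (Fin m → ℂ) → ℂ), Differentiable ℂ P ∧
      ∃ C > 0, ∀ p ∈ siegelSet Ω F, 1 + ‖p‖ ≤ C * ‖P p‖ := by
  obtain ⟨f, c, hc, hf⟩ := hΩ.exists_positive_functional
  obtain ⟨κ, hκ, hκF⟩ := hF.exists_lower_bound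
  -- complexification of the functionals `f` and `f_j = f + (c / 2) y_j`
  let fc : (Fin n → ℂ) → ℂ := fun x => ∑ k, (f (Pi.single k 1) : ℂ) * x k
  have hsum : ∀ y : Fin n → ℝ, ∑ k, f (Pi.single k 1) * y k = f y := by
    intro y
    conv_rhs => rw [pi_eq_sum_univ' y, map_sum]
    refine Finset.sum_congr rfl fun k _ => ?_
    rw [map_smul, smul_eq_mul, mul_comm]
  have hre : ∀ x, (fc x).re = f fun k => (x k).re := fun x => by
    rw [← hsum]; simp [fc]
  have him : ∀ x, (fc x).im = f fun k => (x k).im := fun x => by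
    rw [← hsum]; simp [fc]
  let g : Option (Fin n) → (Fin n → ℂ) → ℂ := fun o x =>
    fc x + (match o with | none => 0 | some j => (c / 2 : ℝ) * x j) + Complex.I
  have hgd : ∀ o, Differentiable ℂ fun p : (Fin n → ℂ) × (Fin m → ℂ) => g o p.1 := by
    intro o
    cases o <;> simp only [g, fc] <;> fun_prop
  refine ⟨fun p => ∏ o, g o p.1, ?_, ?_⟩
  · intro p
    classical
    exact (HasFDerivAt.finsetProd fun o _ => (hgd o p).hasFDerivAt).differentiableAt
  set C := 1 + 1 + 1 / c + 4 / c + 1 / (κ * c) with hC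
  have hCpos : 0 < C := by positivity
  refine ⟨C, hCpos, ?_⟩
  rintro ⟨x, w⟩ hp
  simp only [siegelSet, Set.mem_ofPred_eq] at hp
  have hq := hF.diag_mem w
  have hIm : (fun i => (x i).im) ∈ Ω := by
    have := hΩ.add_closure_mem hp hq
    convert! this using 1
    ext i; simp
  have hIm' := subset_closure hIm
  have h1 : c * ‖fun i => (x i).im‖ ≤ f fun i => (x i).im := hf _ hIm'
  have h2 : c * (κ * ‖w‖ ^ 2) ≤ f fun i => (x i).im := by
    have e : (fun i => (x i).im) = (fun i => (x i).im - (F w w i).re) + fun i => (F w w i).re := by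
      ext i; simp
    rw [e, map_add]
    have h3 := hf _ (subset_closure hp)
    have h4 := hf _ hq
    have h5 := mul_le_mul_of_nonneg_left (hκF w) hc.le
    have h6 : 0 ≤ c * ‖fun i => (x i).im - (F w w i).re‖ := by positivity
    linarith
  have hgim : ∀ o, 1 ≤ ‖g o x‖ := by
    intro o
    refine le_trans ?_ (Complex.abs_im_le_norm _)
    refine le_trans ?_ (le_abs_self _)
    cases o with
    | none =>
      have h0 : 0 ≤ f fun i => (x i).im := le_trans (by positivity) h1
      simp only [g, add_zero, Complex.add_im, Complex.I_im, him]
      linarith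
    | some j =>
      simp only [g, Complex.add_im, Complex.I_im, him, Complex.im_ofReal_mul]
      have h3 : |(x j).im| ≤ ‖fun i => (x i).im‖ := norm_le_pi_norm (fun i => (x i).im) j
      have h4 := neg_abs_le (x j).im
      have h5 : c / 2 * -‖fun i => (x i).im‖ ≤ c / 2 * (x j).im := by gcongr; linarith
      have h6 : 0 ≤ c * ‖fun i => (x i).im‖ := by positivity
      linarith
  have hPge : ∀ o, ‖g o x‖ ≤ ‖∏ o, g o x‖ := by
    intro o
    rw [norm_prod, ← Finset.mul_prod_erase Finset.univ _ (Finset.mem_univ o)]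
    exact le_mul_of_one_le_right (norm_nonneg _)
      (Finset.prod_induction _ (fun a : ℝ => 1 ≤ a) (fun _ _ => one_le_mul_of_one_le_of_one_le) le_rfl
        fun i _ => hgim i)
  set P := ‖∏ o, g o x‖ with hP
  have hP1 : 1 ≤ P := (hgim none).trans (hPge none)
  have hfIm : f (fun i => (x i).im) ≤ P := by
    refine le_trans ?_ (hPge none)
    refine le_trans ?_ (Complex.abs_im_le_norm _)
    refine le_trans ?_ (le_abs_self _)
    simp only [g, add_zero, Complex.add_im, Complex.I_im, him]
    linarith
  have hImx : ‖fun i => (x i).im‖ ≤ 1 / c * P := by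
    rw [one_div, inv_mul_eq_div, le_div_iff₀ hc]; linarith
  have hRe : ∀ j, |(x j).re| ≤ 4 / c * P := by
    intro j
    have a1 := (Complex.abs_re_le_norm (g none x)).trans (hPge none)
    have a2 := (Complex.abs_re_le_norm (g (some j) x)).trans (hPge (some j))
    simp only [g, add_zero, Complex.add_re, Complex.I_re, Complex.re_ofReal_mul] at a1 a2
    have a3 : |c / 2 * (x j).re| ≤ 2 * P := by
      have : c / 2 * (x j).re = ((fc x).re + c / 2 * (x j).re) - (fc x).re := by ring
      rw [this]
      exact (abs_sub _ _).trans (by linarith)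
    rw [abs_mul, abs_of_pos (half_pos hc)] at a3
    rw [div_mul_eq_mul_div, le_div_iff₀ hc]; linarith
  have hx : ‖x‖ ≤ (4 / c + 1 / c) * P := by
    refine (pi_norm_le_iff_of_nonneg (by positivity)).2 fun j => ?_
    have a1 := Complex.norm_le_abs_re_add_abs_im (x j)
    have a2 : |(x j).im| ≤ ‖fun i => (x i).im‖ := norm_le_pi_norm (fun i => (x i).im) j
    have a3 := hRe j
    linarith
  have hw : ‖w‖ ≤ (1 + 1 / (κ * c)) * P := by
    have a1 : ‖w‖ ^ 2 ≤ 1 / (κ * c) * P := by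
      rw [one_div, inv_mul_eq_div, le_div_iff₀ (by positivity)]; linarith
    have a2 : ‖w‖ ≤ 1 + ‖w‖ ^ 2 := by nlinarith [sq_nonneg (‖w‖ - 1)]
    linarith
  have hmax : ‖(x, w)‖ ≤ (4 / c + 1 / c) * P + (1 + 1 / (κ * c)) * P := by
    rw [Prod.norm_def]
    exact max_le (by have : 0 ≤ (1 + 1 / (κ * c)) * P := by positivity
                     simp only; linarith)
      (by have : 0 ≤ (4 / c + 1 / c) * P := by positivity
          simp only; linarith)
  rw [hC]
  linarith

end Siegel

/-! ### The Bergman space of a Siegel domain -/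

section SiegelDomains

variable {d : ℕ} {X : Set (Fin d → ℂ)}

theorem IsSiegelDomain.isOpen (hX : IsSiegelDomain X) : IsOpen X := by
  obtain ⟨n, m, Ω, F, e, hΩ, hF, rfl⟩ := hX
  exact (isOpen_siegelSet hΩ hF).preimage e.toContinuousLinearEquiv.continuous

theorem IsSiegelDomain.convex (hX : IsSiegelDomain X) : Convex ℝ X := by
  obtain ⟨n, m, Ω, F, e, hΩ, hF, rfl⟩ := hX
  exact (convex_siegelSet hΩ hF).is_linear_preimage
    ⟨fun x y => map_add e x y, fun c x => (e.restrictScalars ℝ).map_smul c x⟩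

/-- A holomorphic function on `X ⊆ ℂᵈ` that decays like `(1 + |x|)^{-(d+1)}` is square
integrable. -/
theorem mem_bergmanSpace_of_decay (hX : IsOpen X) {f : (Fin d → ℂ) → ℂ}
    (hf : DifferentiableOn ℂ f X) {C : ℝ} (h : ∀ x ∈ X, ‖f x‖ * (1 + ‖x‖) ^ (d + 1) ≤ C) :
    f ∈ bergmanSpace X := by
  have hm : AEStronglyMeasurable f (volume.restrict X) :=
    hf.continuousOn.aestronglyMeasurable hX.measurableSet
  refine ⟨hf, (memLp_two_iff_integrable_sq_norm hm).2 ?_⟩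
  have hi : Integrable (fun x : Fin d → ℂ => (1 + ‖x‖) ^ (-(2 * d + 2 : ℝ))) volume := by
    refine integrable_one_add_norm ?_
    rw [Module.finrank_pi_fintype]
    simp [Complex.finrank_real_complex]
    linarith
  refine ((hi.const_mul (C ^ 2)).mono_measure Measure.restrict_le_self).mono'
    (hm.norm.pow 2) ?_
  refine (ae_restrict_iff' hX.measurableSet).2 (Filter.Eventually.of_forall fun x hx => ?_)
  have h1 : 0 < 1 + ‖x‖ := by positivity
  rw [Real.norm_of_nonneg (by positivity), Real.rpow_neg h1.le, ← div_eq_mul_inv,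
    le_div_iff₀ (by positivity)]
  have h2 : (1 + ‖x‖) ^ (2 * d + 2 : ℝ) = ((1 + ‖x‖) ^ (d + 1)) ^ 2 := by
    rw [← pow_mul, ← Real.rpow_natCast]; push_cast; ring_nf
  rw [h2, ← mul_pow]
  exact pow_le_pow_left₀ (by positivity) (h x hx) 2

/-- The Bergman space of a Siegel domain separates `1`-jets.  Powers of the reciprocal of a product of
linear polynomials without zeros on the domain, multiplied by affine functions, decay fast enough to
be square integrable. -/
theorem IsSiegelDomain.separatesJets (hX : IsSiegelDomain X) : SeparatesJets X := by
  have hXo := hX.isOpen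
  obtain ⟨n, m, Ω, F, e, hΩ, hF, hXe⟩ := hX
  obtain ⟨P, hP, C, hC, hPC⟩ := exists_denominator_siegelSet hΩ hF
  set e' := e.toContinuousLinearEquiv with he'
  set Q : (Fin d → ℂ) → ℂ := fun y => P (e' y) with hQ
  have hQd : Differentiable ℂ Q := hP.comp e'.differentiable
  obtain ⟨C', hC', hQC⟩ : ∃ C' > 0, ∀ y ∈ X, 1 + ‖y‖ ≤ C' * ‖Q y‖ := by
    refine ⟨(1 + ‖(e'.symm : (Fin n → ℂ) × (Fin m → ℂ) →L[ℂ] (Fin d → ℂ))‖) * C, by positivity,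
      fun y hy => ?_⟩
    have h1 : ‖y‖ ≤ ‖(e'.symm : (Fin n → ℂ) × (Fin m → ℂ) →L[ℂ] (Fin d → ℂ))‖ * ‖e' y‖ := by
      simpa using (e'.symm : (Fin n → ℂ) × (Fin m → ℂ) →L[ℂ] (Fin d → ℂ)).le_opNorm (e' y)
    have h2 : 1 + ‖e' y‖ ≤ C * ‖Q y‖ := hPC _ (by rw [hXe] at hy; exact hy)
    rw [mul_assoc]
    refine le_trans ?_ (mul_le_mul_of_nonneg_left h2 (by positivity))
    have h3 := norm_nonneg (e' y)
    have h4 := norm_nonneg (e'.symm : (Fin n → ℂ) × (Fin m → ℂ) →L[ℂ] (Fin d → ℂ))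
    nlinarith
  have hQ0 : ∀ y ∈ X, Q y ≠ 0 := fun y hy h => by
    have := hQC y hy
    rw [h, norm_zero, mul_zero] at this
    have := norm_nonneg y
    linarith
  have hQi : DifferentiableOn ℂ (fun y => (Q y)⁻¹ ^ (d + 2)) X :=
    (hQd.differentiableOn.inv hQ0).pow _
  have hdec : ∀ y ∈ X, ‖(Q y)⁻¹ ^ (d + 2)‖ * (1 + ‖y‖) ^ (d + 2) ≤ C' ^ (d + 2) := by
    intro y hy
    rw [norm_pow, norm_inv, ← mul_pow]
    refine pow_le_pow_left₀ (by positivity) ?_ _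
    rw [inv_mul_le_iff₀ (norm_pos_iff.2 (hQ0 y hy)), mul_comm]
    exact hQC y hy
  intro x hx
  refine ⟨⟨_, mem_bergmanSpace_of_decay hXo hQi (C := C' ^ (d + 2)) fun y hy => ?_,
    pow_ne_zero _ (inv_ne_zero (hQ0 x hx))⟩, fun v hv => ?_⟩
  · refine le_trans ?_ (hdec y hy)
    gcongr 2
    · linarith [norm_nonneg y]
    · omega
  · obtain ⟨j, hj⟩ : ∃ j, v j ≠ 0 := by
      by_contra! h
      exact hv (funext h)
    have hl : ∀ y, HasFDerivAt (fun y : Fin d → ℂ => y j - x j)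
        (ContinuousLinearMap.proj j : (Fin d → ℂ) →L[ℂ] ℂ) y := fun y =>
      (ContinuousLinearMap.proj j : (Fin d → ℂ) →L[ℂ] ℂ).hasFDerivAt.sub_const _
    refine ⟨fun y => (y j - x j) * (Q y)⁻¹ ^ (d + 2), mem_bergmanSpace_of_decay hXo
      (DifferentiableOn.mul (fun y _ => (hl y).differentiableAt.differentiableWithinAt) hQi)
      (C := (1 + ‖x‖) * C' ^ (d + 2)) fun y hy => ?_, by simp, ?_⟩
    · have h1 : ‖y j - x j‖ ≤ (1 + ‖x‖) * (1 + ‖y‖) := by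
        have h2 := norm_sub_le (y j) (x j)
        have h3 := norm_le_pi_norm y j
        have h4 := norm_le_pi_norm x j
        have := mul_nonneg (norm_nonneg x) (norm_nonneg y)
        linarith
      rw [norm_mul]
      calc ‖y j - x j‖ * ‖(Q y)⁻¹ ^ (d + 2)‖ * (1 + ‖y‖) ^ (d + 1)
          ≤ (1 + ‖x‖) * (1 + ‖y‖) * ‖(Q y)⁻¹ ^ (d + 2)‖ * (1 + ‖y‖) ^ (d + 1) := by gcongr
        _ = (1 + ‖x‖) * (‖(Q y)⁻¹ ^ (d + 2)‖ * (1 + ‖y‖) ^ (d + 2)) := by ring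
        _ ≤ _ := by gcongr; exact hdec y hy
    · have h2 := (hQi x hx).differentiableAt (hXo.mem_nhds hx)
      have h3 : HasFDerivAt (fun y => (y j - x j) * (Q y)⁻¹ ^ (d + 2)) _ x :=
        (hl x).mul h2.hasFDerivAt
      rw [h3.fderiv]
      simpa using ⟨hQ0 x hx, hj⟩

/-! ### Affine automorphisms of Siegel domains -/

open Classical in
/-- The automorphism of `X` given by the restriction to `X` of a bijection `T` of `ℂᵈ` with inverse
`T'`. -/
def HolAut.ofMaps (T T' : (Fin d → ℂ) → (Fin d → ℂ)) (h1 : ∀ y, T' (T y) = y)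
    (h2 : ∀ y, T (T' y) = y) (hT : Differentiable ℂ T) (hT' : Differentiable ℂ T')
    (hX : Set.MapsTo T X X) (hX' : Set.MapsTo T' X X) : HolAut X :=
  ⟨{  toFun := fun y => if y ∈ X then T y else y
      invFun := fun y => if y ∈ X then T' y else y
      left_inv := fun y => by
        by_cases hy : y ∈ X
        · simp [hy, hX hy, h1]
        · simp [hy]
      right_inv := fun y => by
        by_cases hy : y ∈ X
        · simp [hy, hX' hy, h2]
        · simp [hy] },
    fun y hy => if_neg hy, hT.differentiableOn.congr fun y hy => if_pos hy,
    hT'.differentiableOn.congr fun y hy => if_pos hy⟩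

theorem HolAut.ofMaps_apply {T T' : (Fin d → ℂ) → (Fin d → ℂ)} {h1 : ∀ y, T' (T y) = y}
    {h2 : ∀ y, T (T' y) = y} {hT : Differentiable ℂ T} {hT' : Differentiable ℂ T'}
    {hX : Set.MapsTo T X X} {hX' : Set.MapsTo T' X X} {y : Fin d → ℂ} (hy : y ∈ X) :
    (HolAut.ofMaps T T' h1 h2 hT hT' hX hX').1 y = T y :=
  if_pos hy

theorem HolAut.ext' {g h : HolAut X} (H : ∀ x ∈ X, g.1 x = h.1 x) : g = h := by
  refine Subtype.ext (Equiv.ext fun x => ?_)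
  by_cases hx : x ∈ X
  · exact H x hx
  · exact (g.2.1 x hx).trans (h.2.1 x hx).symm

/-- A one-parameter group of entire transformations that preserve `X` gives an element of the Lie
algebra of the automorphism group. -/
theorem indicator_mem_lieSet_top (T : ℝ → (Fin d → ℂ) → (Fin d → ℂ)) {V : (Fin d → ℂ) → (Fin d → ℂ)}
    (hV : Differentiable ℂ V) (hT : ∀ t, Differentiable ℂ (T t))
    (h0 : ∀ y, T 0 y = y) (hadd : ∀ s t y, T (s + t) y = T s (T t y))
    (hX : ∀ t, Set.MapsTo (T t) X X)
    (hder : ∀ x t, HasDerivAt (fun s => T s x) (V (T t x)) t) :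
    X.indicator V ∈ lieSet (⊤ : Subgroup (HolAut X)) := by
  let φ : ℝ → HolAut X := fun t => HolAut.ofMaps (T t) (T (-t))
    (fun y => by rw [← hadd]; simp [h0]) (fun y => by rw [← hadd]; simp [h0]) (hT _) (hT _) (hX _)
    (hX _)
  have hφ : ∀ t, ∀ x ∈ X, (φ t).1 x = T t x := fun t x hx => HolAut.ofMaps_apply hx
  refine ⟨φ, ⟨fun x hx => Set.indicator_of_notMem hx _,
    hV.differentiableOn.congr fun x hx => Set.indicator_of_mem hx _, fun s t => ?_,
    fun x hx t => ?_⟩, fun _ => trivial⟩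
  · refine HolAut.ext' fun x hx => (hφ _ x hx).trans ?_
    have h1 : (φ s * φ t).1 x = T s (T t x) :=
      (congrArg (φ s).1 (hφ t x hx)).trans (hφ s _ (hX t hx))
    exact (hadd s t x).trans h1.symm
  · rw [hφ t x hx, Set.indicator_of_mem (hX t hx)]
    exact (hder x t).congr_of_eventuallyEq (Filter.Eventually.of_forall fun s => hφ s x hx)

/-- The complex span of the values of the complete holomorphic vector fields at a point of a Siegel
domain is everything: the affine transformations `(x, w) ↦ (x + a + 2i F(w, b) + i F(b, b), w + b)`
with real `a` preserve the domain. -/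
theorem IsSiegelDomain.eq_zero_of_apply_lieSet (hX : IsSiegelDomain X) {x : Fin d → ℂ} (hx : x ∈ X)
    {A : (Fin d → ℂ) →L[ℂ] (Fin d → ℂ)}
    (hA : ∀ η ∈ lieSet (⊤ : Subgroup (HolAut X)), A (η x) = 0) : A = 0 := by
  obtain ⟨n, m, Ω, F, e, hΩ, hF, hXe⟩ := hX
  set e' := e.toContinuousLinearEquiv with he'
  have key : ∀ (a : Fin n → ℝ) (b : Fin m → ℂ),
      A (e'.symm ((fun i => (a i : ℂ)) + (2 * Complex.I) • F (e' x).2 b, b)) = 0 := by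
    intro a b
    set T₀ : ℝ → (Fin n → ℂ) × (Fin m → ℂ) → (Fin n → ℂ) × (Fin m → ℂ) := fun t p =>
      (p.1 + (t : ℂ) • (fun i => (a i : ℂ)) + (2 * Complex.I * t) • F p.2 b +
        (Complex.I * t ^ 2) • F b b, p.2 + (t : ℂ) • b) with hT₀
    set V₀ : (Fin n → ℂ) × (Fin m → ℂ) → (Fin n → ℂ) × (Fin m → ℂ) := fun p =>
      ((fun i => (a i : ℂ)) + (2 * Complex.I) • F p.2 b, b) with hV₀
    have hFd : Differentiable ℂ fun p : (Fin n → ℂ) × (Fin m → ℂ) => F p.2 b :=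
      (hF.differentiable_left b).comp differentiable_snd
    have hmem := indicator_mem_lieSet_top (X := X) (fun t y => e'.symm (T₀ t (e' y)))
      (V := fun y => e'.symm (V₀ (e' y))) ?_ ?_ ?_ ?_ ?_ ?_
    · have := hA _ hmem
      rwa [Set.indicator_of_mem hx] at this
    · have : Differentiable ℂ V₀ := by
        refine Differentiable.prodMk ?_ (differentiable_const _)
        exact (hFd.const_smul (2 * Complex.I)).const_add _
      exact e'.symm.differentiable.comp (this.comp e'.differentiable)
    · intro t
      have : Differentiable ℂ (T₀ t) := by
        refine Differentiable.prodMk ?_ (differentiable_snd.add_const _)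
        have h1 : Differentiable ℂ fun p : (Fin n → ℂ) × (Fin m → ℂ) =>
            (2 * Complex.I * t) • F p.2 b := hFd.const_smul (2 * Complex.I * t)
        fun_prop
      exact e'.symm.differentiable.comp (this.comp e'.differentiable)
    · intro y; simp [T₀]
    · intro s t y
      simp only [ContinuousLinearEquiv.apply_symm_apply]
      congr 1
      simp only [T₀]
      ext i
      · simp only [hF.map_add_left, hF.map_smul_left, Pi.add_apply, Pi.smul_apply, smul_eq_mul]
        push_cast; ring
      · simp only [Pi.add_apply, Pi.smul_apply, smul_eq_mul]; push_cast; ring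
    · intro t y hy
      rw [hXe] at hy ⊢
      have hy' : (fun i => ((e' y).1 i).im - (F (e' y).2 (e' y).2 i).re) ∈ Ω := hy
      change e (e'.symm (T₀ t (e' y))) ∈ siegelSet Ω F
      have : e (e'.symm (T₀ t (e' y))) = T₀ t (e' y) := e'.apply_symm_apply _
      rw [this]
      change (fun i => _) ∈ Ω
      convert! hy' using 1
      ext i
      simp only [T₀, hF.diag_add_smul]
      have e1 := hF.diag_im b i
      simp only [Pi.add_apply, Pi.smul_apply, smul_eq_mul, Complex.add_im]
      simp [e1, ← Complex.ofReal_pow]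
    · intro y t
      refine e'.symm.hasFDerivAt.restrictScalars ℝ |>.comp_hasDerivAt t ?_
      simp only [ContinuousLinearEquiv.apply_symm_apply, T₀, V₀, hF.map_add_left, hF.map_smul_left]
      have h1 : HasDerivAt (fun s : ℝ => (s : ℂ)) 1 t := Complex.ofRealCLM.hasDerivAt
      have h2 : HasDerivAt (fun s : ℝ => (s : ℂ) ^ 2) (2 * (t : ℂ)) t := by
        have h3 := h1.pow 2
        simp only [Nat.cast_ofNat, Nat.add_one_sub_one, pow_one, mul_one] at h3
        exact h3
      refine HasDerivAt.prodMk ?_ ?_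
      · have := (((h1.smul_const (fun i => (a i : ℂ))).const_add (e' y).1).add
          ((h1.const_mul (2 * Complex.I)).smul_const (F (e' y).2 b))).add
          ((h2.const_mul Complex.I).smul_const (F b b))
        convert! this using 1
        ext i
        simp; ring
      · simpa using (h1.smul_const b).const_add (e' y).2
  have h0 : ∀ a : Fin n → ℝ, A (e'.symm ((fun i => (a i : ℂ)), 0)) = 0 := by
    intro a
    have h := key a 0
    have : F (e' x).2 0 = 0 := by
      have := hF.map_smul_right 0 (e' x).2 0
      simpa using this
    rwa [this, smul_zero, add_zero] at h
  have h1 : ∀ c : Fin n → ℂ, A (e'.symm (c, 0)) = 0 := by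
    intro c
    have : (c, (0 : Fin m → ℂ)) = ((fun i => ((c i).re : ℂ)), 0) +
        Complex.I • ((fun i => ((c i).im : ℂ)), 0) := by
      ext i <;> simp
      rw [mul_comm, Complex.re_add_im]
    rw [this, map_add, map_add, map_smul, map_smul, h0, h0]; simp
  ext1 v
  have h2 := key 0 (e' v).2
  have : v = e'.symm ((fun i => ((0 : Fin n → ℝ) i : ℂ)) + (2 * Complex.I) • F (e' x).2 (e' v).2, (e' v).2)
      + e'.symm ((e' v).1 - (2 * Complex.I) • F (e' x).2 (e' v).2, 0) := by
    rw [← map_add, ContinuousLinearEquiv.eq_symm_apply]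
    ext i <;> simp
  rw [this, map_add, h2, h1]; simp

end SiegelDomains

/-! ### Flows of holomorphic vector fields -/

section Flows

/-- A trajectory of a vector field of norm less than `M` on a ball moves by at most `M t` in time
`t`, as long as this does not exceed the radius. -/
theorem norm_trajectory_sub_le {E : Type} [NormedAddCommGroup E] [NormedSpace ℝ E] {y : ℝ → E}
    {ξ : E → E} {R M a : ℝ} (hR : 0 < R) (hM : ∀ z ∈ Metric.ball (y 0) R, ‖ξ z‖ < M)
    (hy : ∀ t ∈ Set.Icc 0 a, HasDerivAt y (ξ (y t)) t) (ha : M * a ≤ R) :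
    ∀ t ∈ Set.Icc 0 a, ‖y t - y 0‖ ≤ M * t := by
  have hMpos : 0 < M := (norm_nonneg _).trans_lt (hM _ (Metric.mem_ball_self hR))
  refine image_norm_le_of_norm_deriv_right_lt_deriv_boundary (f := fun t => y t - y 0)
    (f' := fun t => ξ (y t)) (B := fun t => M * t) (B' := fun _ => M)
    (fun t ht => ((hy t ht).continuousAt.sub continuousAt_const).continuousWithinAt)
    (fun t ht => ((hy t ⟨ht.1, ht.2.le⟩).sub_const _).hasDerivWithinAt) (by simp)
    (fun t => by simpa using (hasDerivAt_id t).const_mul M) fun t ht h => hM _ ?_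
  rw [Metric.mem_ball, dist_eq_norm, h]
  exact (mul_lt_mul_of_pos_left ht.2 hMpos).trans_le ha

theorem norm_trajectory_sub_sub_le {E : Type} [NormedAddCommGroup E] [NormedSpace ℝ E] {y : ℝ → E}
    {ξ : E → E} {R M L a : ℝ} (hR : 0 < R) (hM : ∀ z ∈ Metric.ball (y 0) R, ‖ξ z‖ < M)
    (hL : ∀ z ∈ Metric.ball (y 0) R, ‖ξ z - ξ (y 0)‖ ≤ L * ‖z - y 0‖)
    (hy : ∀ t ∈ Set.Icc 0 a, HasDerivAt y (ξ (y t)) t) (ha : M * a < R) (hL0 : 0 ≤ L) :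
    ∀ t ∈ Set.Icc 0 a, ‖y t - y 0 - t • ξ (y 0)‖ ≤ L * M * t ^ 2 := by
  have hMpos : 0 < M := (norm_nonneg _).trans_lt (hM _ (Metric.mem_ball_self hR))
  intro t ht
  have h1 := norm_trajectory_sub_le hR hM hy ha.le
  have h2 := (convex_Icc 0 t).norm_image_sub_le_of_norm_hasDerivWithin_le
    (f := fun s => y s - y 0 - s • ξ (y 0)) (f' := fun s => ξ (y s) - ξ (y 0)) (C := L * (M * t))
    (fun s hs => by
      have := ((hy s ⟨hs.1, hs.2.trans ht.2⟩).sub_const (y 0)).sub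
        ((hasDerivAt_id s).smul_const (ξ (y 0)))
      simp only [one_smul] at this
      exact this.hasDerivWithinAt) (fun s hs => by
      have h3 := h1 s ⟨hs.1, hs.2.trans ht.2⟩
      have h4 : M * s ≤ M * t := by gcongr; exact hs.2
      have h5 : M * t ≤ M * a := by gcongr; exact ht.2
      refine (hL _ ?_).trans (by gcongr; exact h3.trans h4)
      rw [Metric.mem_ball, dist_eq_norm]; linarith)
    (Set.left_mem_Icc.2 ht.1) (Set.right_mem_Icc.2 ht.1)
  simp only [sub_self, zero_smul, sub_zero, Real.norm_eq_abs, abs_of_nonneg ht.1] at h2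
  exact h2.trans (le_of_eq (by ring))

variable {d : ℕ} {X : Set (Fin d → ℂ)} {φ : ℝ → HolAut X} {ξ : (Fin d → ℂ) → (Fin d → ℂ)}

theorem IsOneParameterGroup.map_zero (h : IsOneParameterGroup φ ξ) : φ 0 = 1 := by
  have := h.map_add 0 0
  rw [add_zero] at this
  exact (mul_eq_left.1 this.symm)

theorem IsOneParameterGroup.zero_apply (h : IsOneParameterGroup φ ξ) (x : Fin d → ℂ) :
    (φ 0).1 x = x := by
  rw [h.map_zero]; rfl

theorem IsOneParameterGroup.neg (h : IsOneParameterGroup φ ξ) :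
    IsOneParameterGroup (fun t => φ (-t)) (-ξ) where
  eq_zero x hx := by simp [h.eq_zero x hx]
  holomorphic := h.holomorphic.neg
  map_add s t := by rw [neg_add, h.map_add]
  hasDerivAt x hx t := by
    have := (h.hasDerivAt x hx (-t)).scomp t (hasDerivAt_neg t)
    rw [neg_one_smul] at this
    exact this

theorem IsOneParameterGroup.symm_apply (h : IsOneParameterGroup φ ξ) (t : ℝ) (x : Fin d → ℂ) :
    (φ t).1.symm x = (φ (-t)).1 x := by
  have h1 : φ t * φ (-t) = 1 := by rw [← h.map_add, add_neg_cancel, h.map_zero]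
  have h2 : φ (-t) = (φ t)⁻¹ := eq_inv_of_mul_eq_one_right h1
  rw [h2]; rfl

/-- The flow is `y + s ξ(y) + O(s²)` locally uniformly in `y`. -/
theorem IsOneParameterGroup.flow_estimate (h : IsOneParameterGroup φ ξ) (hX : IsOpen X)
    {x : Fin d → ℂ} (hx : x ∈ X) : ∃ r > 0, ∃ δ > 0, ∃ K, Metric.ball x r ⊆ X ∧
      ∀ y ∈ Metric.ball x r, ∀ s : ℝ, |s| < δ → ‖(φ s).1 y - y - s • ξ y‖ ≤ K * s ^ 2 := by
  obtain ⟨R, hR, M, hRX, hM⟩ := h.holomorphic.exists_ball_bound hX hx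
  obtain ⟨R', hR', L, hRX', hL⟩ :=
    (h.holomorphic.fderiv_holomorphic hX).exists_ball_bound hX hx
  set r := min R R' / 2 with hr
  have hr0 : 0 < r := by positivity
  have hM0 : 0 ≤ M := (norm_nonneg _).trans (hM x (Metric.mem_ball_self hR))
  have hL0 : 0 ≤ L := (norm_nonneg _).trans (hL x (Metric.mem_ball_self hR'))
  have hsub : ∀ y ∈ Metric.ball x r, Metric.ball y r ⊆ Metric.ball x R ∩ Metric.ball x R' := by
    intro y hy z hz
    rw [Metric.mem_ball] at hy hz
    have h1 := dist_triangle z y x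
    have h2 := min_le_left R R'
    have h3 := min_le_right R R'
    constructor <;> rw [Metric.mem_ball] <;> linarith
  -- the estimate for positive times, in a form that applies to `ξ` and to `-ξ`
  have key : ∀ (ψ : ℝ → HolAut X) (η : (Fin d → ℂ) → (Fin d → ℂ)), IsOneParameterGroup ψ η →
      (∀ y, ‖η y‖ = ‖ξ y‖) → (∀ y, ‖fderiv ℂ η y‖ = ‖fderiv ℂ ξ y‖) → ∀ y ∈ Metric.ball x r,
      ∀ s : ℝ, 0 ≤ s → s < r / (M + 1) →
      ‖(ψ s).1 y - y - s • η y‖ ≤ L * (M + 1) * s ^ 2 := by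
    intro ψ η hψ hη hη' y hy s hs0 hs
    have hyX : y ∈ X := hRX (hsub y hy (Metric.mem_ball_self hr0)).1
    have h0 := hψ.zero_apply y
    have := norm_trajectory_sub_sub_le (y := fun t => (ψ t).1 y) (ξ := η) (R := r) (M := M + 1)
      (L := L) (a := s) hr0 (fun z hz => by
        rw [h0] at hz
        rw [hη]
        linarith [hM z (hsub y hy hz).1]) (fun z hz => by
        rw [h0] at hz ⊢
        refine (convex_ball y r).norm_image_sub_le_of_norm_fderiv_le (𝕜 := ℂ) (fun w hw => ?_)
          (fun w hw => ?_) (Metric.mem_ball_self hr0) hz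
        · exact hψ.holomorphic.differentiableAt (hX.mem_nhds (hRX (hsub y hy hw).1))
        · rw [hη']
          exact hL _ (hsub y hy hw).2)
      (fun t _ => hψ.hasDerivAt y hyX t) (by rw [lt_div_iff₀ (by positivity)] at hs; linarith) hL0
      s ⟨hs0, le_rfl⟩
    rwa [h0] at this
  refine ⟨r, hr0, r / (M + 1), by positivity, L * (M + 1),
    fun y hy => hRX (hsub y hy (Metric.mem_ball_self hr0)).1, fun y hy s hs => ?_⟩
  rcases le_total 0 s with h0 | h0
  · exact key φ ξ h (fun _ => rfl) (fun _ => rfl) y hy s h0 (by rwa [abs_of_nonneg h0] at hs)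
  · have := key _ _ h.neg (fun y => by simp) (fun y => by rw [fderiv_neg, norm_neg]) y hy (-s)
      (by linarith) (by rwa [abs_of_nonpos h0] at hs)
    simpa using this

/-- By Cauchy's estimate, the expansion of the flow to first order in time can be differentiated in
space. -/
theorem IsOneParameterGroup.fderiv_flow_estimate (h : IsOneParameterGroup φ ξ) (hX : IsOpen X)
    {x : Fin d → ℂ} (hx : x ∈ X) : ∃ r > 0, ∃ δ > 0, ∃ K, Metric.ball x r ⊆ X ∧
      ∀ y ∈ Metric.ball x r, ∀ s : ℝ, |s| < δ →
        ‖fderiv ℂ (φ s).1 y - ContinuousLinearMap.id ℂ _ - s • fderiv ℂ ξ y‖ ≤ K * s ^ 2 := by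
  obtain ⟨r, hr, δ, hδ, K, hrX, hK⟩ := h.flow_estimate hX hx
  refine ⟨r / 2, by positivity, δ, hδ, 4 * K / r, (Metric.ball_subset_ball (by linarith)).trans hrX,
    fun y hy s hs => ?_⟩
  have hsub : Metric.ball y (r / 2) ⊆ Metric.ball x r := by
    intro z hz
    rw [Metric.mem_ball] at hy hz ⊢
    linarith [dist_triangle z y x]
  have hd : ∀ z ∈ Metric.ball x r, HasFDerivAt (𝕜 := ℂ) (fun z => (φ s).1 z - z - (s : ℂ) • ξ z)
      (fderiv ℂ (φ s).1 z - ContinuousLinearMap.id ℂ _ - (s : ℂ) • fderiv ℂ ξ z) z := fun z hz =>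
    ((((φ s).differentiableAt hX (hrX hz)).hasFDerivAt).sub (hasFDerivAt_id z)).sub
      ((h.holomorphic.differentiableAt (hX.mem_nhds (hrX hz))).hasFDerivAt.const_smul (s : ℂ))
  have h1 := norm_fderiv_le_of_bounded_on_ball (half_pos hr)
    (fun z hz => (hd z (hsub hz)).differentiableAt.differentiableWithinAt) (M := K * s ^ 2)
    (fun z hz => by
      have := hK z (hsub hz) s hs
      rwa [Complex.coe_smul])
  rw [(hd y (hsub (Metric.mem_ball_self (half_pos hr)))).fderiv] at h1
  exact h1.trans (le_of_eq (by field_simp; ring))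

theorem hasDerivAt_of_quadratic_estimate {E : Type} [NormedAddCommGroup E] [NormedSpace ℝ E]
    {f : ℝ → E} {v f0 : E} (hf0 : f 0 = f0) {δ K : ℝ} (hδ : 0 < δ)
    (h : ∀ s : ℝ, |s| < δ → ‖f s - f0 - s • v‖ ≤ K * s ^ 2) : HasDerivAt f v 0 := by
  rw [hasDerivAt_iff_hasFDerivAt]
  refine hasFDerivAt_of_quadratic_bound hδ (K := K) fun u hu => ?_
  have := h u hu
  simpa [hf0] using this

theorem IsOneParameterGroup.hasDerivAt_fderiv (h : IsOneParameterGroup φ ξ) (hX : IsOpen X)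
    {x : Fin d → ℂ} (hx : x ∈ X) : HasDerivAt (fun s => fderiv ℂ (φ s).1 x) (fderiv ℂ ξ x) 0 := by
  obtain ⟨r, hr, δ, hδ, K, -, hK⟩ := h.fderiv_flow_estimate hX hx
  refine hasDerivAt_of_quadratic_estimate (f0 := ContinuousLinearMap.id ℂ _) ?_ hδ
    fun s hs => hK x (Metric.mem_ball_self hr) s hs
  have : ((φ 0).1 : (Fin d → ℂ) → (Fin d → ℂ)) = id := funext fun y => h.zero_apply y
  rw [this, fderiv_id]

/-- The derivative of `Ad(exp(tξ)) η` at `t = 0`. -/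
theorem IsOneParameterGroup.hasDerivAt_adAct (h : IsOneParameterGroup φ ξ) (hX : IsOpen X)
    {η : (Fin d → ℂ) → (Fin d → ℂ)} (hη : DifferentiableOn ℂ η X) (hη0 : ∀ y, y ∉ X → η y = 0)
    (x : Fin d → ℂ) :
    HasDerivAt (fun t => adAct (φ t) η x) (fieldBracket X η ξ x) 0 := by
  by_cases hx : x ∈ X
  · obtain ⟨r, hr, δ, hδ, K, hrX, hK⟩ := h.fderiv_flow_estimate hX hx
    have hy : HasDerivAt (fun t => (φ (-t)).1 x) (-ξ x) 0 := by
      have := h.neg.hasDerivAt x hx 0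
      rw [h.neg.zero_apply] at this
      exact this
    have hηy : HasDerivAt (fun t => η ((φ (-t)).1 x)) (fderiv ℂ η x (-ξ x)) 0 := by
      have h1 : HasFDerivAt η ((fderiv ℂ η x).restrictScalars ℝ) ((φ (-0)).1 x) := by
        rw [neg_zero, h.zero_apply]
        exact (hη.differentiableAt (hX.mem_nhds hx)).hasFDerivAt.restrictScalars ℝ
      exact h1.comp_hasDerivAt (f := fun t => (φ (-t)).1 x) 0 hy
    have hy0 : Filter.Tendsto (fun t => (φ (-t)).1 x) (𝓝 0) (𝓝 x) := by
      have := hy.continuousAt.tendsto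
      simpa [h.zero_apply] using this
    have hηc : Filter.Tendsto (fun t => η ((φ (-t)).1 x)) (𝓝 0) (𝓝 (η x)) :=
      (hη.differentiableAt (hX.mem_nhds hx)).continuousAt.tendsto.comp hy0
    have hDc : Filter.Tendsto (fun t => fderiv ℂ ξ ((φ (-t)).1 x)) (𝓝 0) (𝓝 (fderiv ℂ ξ x)) :=
      (((h.holomorphic.fderiv_holomorphic hX).differentiableAt
        (hX.mem_nhds hx)).continuousAt.tendsto).comp hy0
    have hap : Filter.Tendsto (fun t => fderiv ℂ ξ ((φ (-t)).1 x) (η ((φ (-t)).1 x))) (𝓝 0)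
        (𝓝 (fderiv ℂ ξ x (η x))) :=
      ((isBoundedBilinearMap_apply (𝕜 := ℂ) (E := Fin d → ℂ) (F := Fin d → ℂ)).continuous.tendsto
        (fderiv ℂ ξ x, η x)).comp (hDc.prodMk_nhds hηc)
    -- split off the part of the Jacobian that is linear in `t`
    have h1 : HasDerivAt (fun t : ℝ => t • (fderiv ℂ ξ ((φ (-t)).1 x) (η ((φ (-t)).1 x))))
        (fderiv ℂ ξ x (η x)) 0 := by
      rw [hasDerivAt_iff_tendsto_slope]
      refine (hap.mono_left nhdsWithin_le_nhds).congr' ?_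
      filter_upwards [self_mem_nhdsWithin] with t ht
      rw [slope_def_module, zero_smul, sub_zero, sub_zero, smul_smul,
        inv_mul_cancel₀ (by simpa using ht), one_smul]
    have h2 : HasDerivAt (fun t : ℝ => (fderiv ℂ (φ t).1 ((φ (-t)).1 x)
        - ContinuousLinearMap.id ℂ (Fin d → ℂ)
        - t • fderiv ℂ ξ ((φ (-t)).1 x)) (η ((φ (-t)).1 x))) 0 0 := by
      have hev : ∀ᶠ t in 𝓝 (0 : ℝ), (φ (-t)).1 x ∈ Metric.ball x r ∧
          ‖η ((φ (-t)).1 x)‖ < ‖η x‖ + 1 :=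
        (hy0.eventually (Metric.ball_mem_nhds x hr)).and
          (hηc.norm.eventually (gt_mem_nhds (by linarith)))
      obtain ⟨δ', hδ', hev⟩ := Metric.eventually_nhds_iff_ball.1 hev
      refine hasDerivAt_of_quadratic_estimate (f0 := 0) (δ := min δ δ') (K := K * (‖η x‖ + 1)) ?_
        (lt_min hδ hδ') fun s hs => ?_
      · have : ((φ 0).1 : (Fin d → ℂ) → (Fin d → ℂ)) = id := funext fun y => h.zero_apply y
        have h0 : ∀ (A B : (Fin d → ℂ) →L[ℂ] (Fin d → ℂ)) (v : Fin d → ℂ),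
            (A - A - (0 : ℝ) • B) v = 0 := fun A B v => by
          rw [zero_smul ℝ B]; simp
        rw [this, fderiv_id]
        exact h0 _ _ _
      · obtain ⟨h4, h5⟩ := hev s (by
          rw [Metric.mem_ball, dist_zero_right]; exact hs.trans_le (min_le_right _ _))
        rw [smul_zero, sub_zero, sub_zero]
        refine (ContinuousLinearMap.le_opNorm _ _).trans ?_
        have h6 := hK _ h4 s (hs.trans_le (min_le_left _ _))
        calc _ ≤ K * s ^ 2 * (‖η x‖ + 1) := by
              gcongr
              exact (norm_nonneg _).trans h6
          _ = _ := by ring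
    have h3 := (hηy.add h1).add h2
    refine (h3.congr_deriv ?_).congr_of_eventuallyEq (Filter.Eventually.of_forall fun t => ?_)
    · rw [fieldBracket, Set.indicator_of_mem hx, VectorField.lieBracket]
      simp; abel
    · simp only [adAct, h.symm_apply, Pi.add_apply]
      simp
  · have h1 : ∀ t, adAct (φ t) η x = 0 := fun t => by
      have h2 : (φ t).1.symm x ∉ X := fun h3 => hx (by
        have := (φ t).mapsTo h3
        rwa [Equiv.apply_symm_apply] at this)
      rw [adAct, hη0 _ h2, _root_.map_zero]
    rw [fieldBracket, Set.indicator_of_notMem hx]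
    exact (hasDerivAt_const (0 : ℝ) (0 : Fin d → ℂ)).congr_of_eventuallyEq
      (Filter.Eventually.of_forall h1)

end Flows

/-! ### The Lie algebra of a split solvable group acts freely -/

section LieAlgebras

theorem hasDerivAt_leviForm_curve {E : Type} [NormedAddCommGroup E] [NormedSpace ℂ E] {g : E → ℝ}
    {γ a b : ℝ → E} {γ' a' b' : E} {t : ℝ} (hg : DifferentiableAt ℝ (leviFormL g) (γ t))
    (hγ : HasDerivAt γ γ' t) (ha : HasDerivAt a a' t) (hb : HasDerivAt b b' t) :
    HasDerivAt (fun s => leviForm g (γ s) (a s) (b s))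
      (fderiv ℝ (leviFormL g) (γ t) γ' (a t) (b t) + leviForm g (γ t) a' (b t)
        + leviForm g (γ t) (a t) b') t := by
  have h1 : HasDerivAt (fun s => leviFormL g (γ s)) (fderiv ℝ (leviFormL g) (γ t) γ') t :=
    HasFDerivAt.comp_hasDerivAt (F := E) (E := E →L[ℝ] E →L[ℝ] ℝ) (l := leviFormL g) t
      hg.hasFDerivAt hγ
  have h3 := (h1.clm_apply ha).clm_apply hb
  refine h3.congr_deriv ?_
  simp only [add_apply]
  rfl

theorem tendsto_clm_apply {α E F : Type} [NormedAddCommGroup E] [NormedSpace ℝ E]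
    [NormedAddCommGroup F] [NormedSpace ℝ F] {l : Filter α} {B : α → E →L[ℝ] F} {u : α → E}
    {B₀ : E →L[ℝ] F} {u₀ : E} (hB : Filter.Tendsto B l (𝓝 B₀)) (hu : Filter.Tendsto u l (𝓝 u₀)) :
    Filter.Tendsto (fun a => B a (u a)) l (𝓝 (B₀ u₀)) :=
  ((isBoundedBilinearMap_apply (𝕜 := ℝ) (E := E) (F := F)).continuous.tendsto (B₀, u₀)).comp
    (hB.prodMk_nhds hu)

section

variable {α E : Type} [NormedAddCommGroup E] [NormedSpace ℂ E] {g : E → ℝ} {s : Set E}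

theorem leviForm_smul_left (c : ℝ) (x u v : E) : leviForm g x (c • u) v = c * leviForm g x u v := by
  rw [← leviFormL_apply, ← leviFormL_apply, (leviFormL g x).map_smul]; rfl

theorem leviForm_smul_right (c : ℝ) (x u v : E) :
    leviForm g x u (c • v) = c * leviForm g x u v := by
  rw [← leviFormL_apply, ← leviFormL_apply, (leviFormL g x u).map_smul]; rfl

theorem tendsto_leviForm (hs : IsOpen s) (hg : ContDiffOn ℝ ω g s) {x u₀ v₀ : E} (hx : x ∈ s)
    {l : Filter α} {p u v : α → E} (hp : Filter.Tendsto p l (𝓝 x)) (hu : Filter.Tendsto u l (𝓝 u₀))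
    (hv : Filter.Tendsto v l (𝓝 v₀)) :
    Filter.Tendsto (fun a => leviForm g (p a) (u a) (v a)) l (𝓝 (leviForm g x u₀ v₀)) := by
  have h2 : ContinuousAt (leviFormL g) x :=
    ((contDiffOn_leviFormL hs hg).contDiffAt (hs.mem_nhds hx)).continuousAt
  exact tendsto_clm_apply (tendsto_clm_apply (h2.tendsto.comp hp) hu) hv

theorem contDiffOn_leviForm_apply (hs : IsOpen s) (hg : ContDiffOn ℝ ω g s) (u v : E) :
    ContDiffOn ℝ ω (fun y => leviForm g y u v) s := by
  have h2 : ContDiffOn ℝ ω (fderiv ℝ (fderiv ℝ g)) s :=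
    (hg.fderiv_of_isOpen hs (m := ω) (by simp)).fderiv_of_isOpen hs (by simp)
  unfold leviForm
  exact ((h2.clm_apply contDiffOn_const).clm_apply contDiffOn_const).neg.add
    ((h2.clm_apply contDiffOn_const).clm_apply contDiffOn_const)

theorem fderiv_leviForm_apply (hs : IsOpen s) (hg : ContDiffOn ℝ ω g s) {x : E} (hx : x ∈ s)
    (q u v : E) :
    fderiv ℝ (fun y => leviForm g y u v) x q = fderiv ℝ (leviFormL g) x q u v := by
  have h1 : DifferentiableAt ℝ (fun y => leviForm g y u v) x :=
    ((contDiffOn_leviForm_apply hs hg u v).contDiffAt (hs.mem_nhds hx)).differentiableAt (by simp)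
  have h2 : DifferentiableAt ℝ (leviFormL g) x :=
    ((contDiffOn_leviFormL hs hg).contDiffAt (hs.mem_nhds hx)).differentiableAt (by simp)
  have h3 : HasDerivAt (fun t : ℝ => x + t • q) q 0 := by
    have := ((hasDerivAt_id (0 : ℝ)).smul_const q).const_add x
    rwa [one_smul] at this
  have h4 := hasDerivAt_leviForm_curve (g := g) (γ := fun t : ℝ => x + t • q) (t := 0)
    (by simpa using h2) h3 (hasDerivAt_const 0 u) (hasDerivAt_const 0 v)
  have h5 := (hasDerivAt_line h1 (u := q)).unique h4
  rw [h5, zero_smul, add_zero, ← leviFormL_apply, ← leviFormL_apply, map_zero, map_zero]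
  simp

theorem tendsto_fderiv_leviFormL (hs : IsOpen s) (hg : ContDiffOn ℝ ω g s) {x q₀ : E} (hx : x ∈ s)
    {l : Filter α} {p q : α → E} (hp : Filter.Tendsto p l (𝓝 x)) (hq : Filter.Tendsto q l (𝓝 q₀))
    (u v : E) :
    Filter.Tendsto (fun a => fderiv ℝ (leviFormL g) (p a) (q a) u v) l
      (𝓝 (fderiv ℝ (leviFormL g) x q₀ u v)) := by
  have h2 : ContinuousAt (fderiv ℝ (fun y => leviForm g y u v)) x :=
    (((contDiffOn_leviForm_apply hs hg u v).contDiffAt (hs.mem_nhds hx)).fderiv_right (m := ω)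
      (by simp)).continuousAt
  have h3 := tendsto_clm_apply (h2.tendsto.comp hp) hq
  rw [fderiv_leviForm_apply hs hg hx] at h3
  refine h3.congr' ?_
  filter_upwards [hp.eventually (hs.mem_nhds hx)] with a ha
  exact fderiv_leviForm_apply hs hg ha _ _ _

end

variable {d : ℕ} {X : Set (Fin d → ℂ)}

theorem lieAlg_mono {Γ Γ' : Subgroup (HolAut X)} (h : Γ ≤ Γ') : lieAlg Γ ≤ lieAlg Γ' :=
  Submodule.span_mono fun _ ⟨φ, hφ, hφΓ⟩ => ⟨φ, hφ, fun t => h (hφΓ t)⟩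

theorem holomorphic_of_mem_lieAlg {Γ : Subgroup (HolAut X)} {ξ : (Fin d → ℂ) → (Fin d → ℂ)}
    (hξ : ξ ∈ lieAlg Γ) : DifferentiableOn ℂ ξ X := by
  induction hξ using Submodule.span_induction with
  | mem ξ h => obtain ⟨φ, hφ, -⟩ := h; exact hφ.holomorphic
  | zero => exact differentiableOn_const _
  | add ξ η _ _ h1 h2 => exact h1.add h2
  | smul c ξ _ h => exact h.const_smul c

theorem eq_zero_of_mem_lieAlg_of_notMem {Γ : Subgroup (HolAut X)}
    {ξ : (Fin d → ℂ) → (Fin d → ℂ)} (hξ : ξ ∈ lieAlg Γ) {x : Fin d → ℂ} (hx : x ∉ X) : ξ x = 0 := by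
  induction hξ using Submodule.span_induction with
  | mem ξ h => obtain ⟨φ, hφ, -⟩ := h; exact hφ.eq_zero x hx
  | zero => rfl
  | add ξ η _ _ h1 h2 => rw [Pi.add_apply, h1, h2, add_zero]
  | smul c ξ _ h => rw [Pi.smul_apply, h, smul_zero]

theorem adAct_add (g : HolAut X) (ξ η : (Fin d → ℂ) → (Fin d → ℂ)) :
    adAct g (ξ + η) = adAct g ξ + adAct g η := by
  ext1 x; exact map_add _ _ _

theorem adAct_smul (g : HolAut X) (c : ℝ) (ξ : (Fin d → ℂ) → (Fin d → ℂ)) :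
    adAct g (c • ξ) = c • adAct g ξ := by
  ext1 x
  exact ContinuousLinearMap.map_smul_of_tower (fderiv ℂ g.1 (g.1.symm x)) c (ξ (g.1.symm x))

theorem adAct_zero (g : HolAut X) : adAct g (0 : (Fin d → ℂ) → (Fin d → ℂ)) = 0 := by
  ext1 x; exact map_zero _

/-- The bracket with `ξ ∈ lieSet Γ` preserves each finite-dimensional space of vector fields that is
stable under `Ad(Γ)`. -/
theorem fieldBracket_mem_of_adAct_mem (hX : IsOpen X) {Γ : Subgroup (HolAut X)}
    {V : Submodule ℝ ((Fin d → ℂ) → (Fin d → ℂ))} [FiniteDimensional ℝ V]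
    (hV : ∀ b ∈ Γ, ∀ η ∈ V, adAct b η ∈ V) {ξ η : (Fin d → ℂ) → (Fin d → ℂ)} (hξ : ξ ∈ lieSet Γ)
    (hη : η ∈ V) (hηd : DifferentiableOn ℂ η X) (hη0 : ∀ y, y ∉ X → η y = 0) :
    fieldBracket X η ξ ∈ V := by
  obtain ⟨φ, hφ, hφΓ⟩ := hξ
  have hcl : IsClosed (V : Set ((Fin d → ℂ) → (Fin d → ℂ))) := V.closed_of_finiteDimensional
  have h0 : adAct (φ 0) η = η := by
    have := hφ.map_zero
    rw [this]
    ext1 x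
    have : ((1 : HolAut X).1 : (Fin d → ℂ) → (Fin d → ℂ)) = id := rfl
    change fderiv ℂ (1 : HolAut X).1 x (η x) = η x
    rw [this, fderiv_id]; rfl
  refine hcl.mem_of_tendsto (b := 𝓝[≠] (0 : ℝ)) (f := fun t : ℝ => t⁻¹ • (adAct (φ t) η - η))
    (tendsto_pi_nhds.2 fun x => ?_) (Filter.Eventually.of_forall fun t =>
      V.smul_mem _ (V.sub_mem (hV _ (hφΓ t) _ hη) hη))
  have h2 := (hφ.hasDerivAt_adAct hX hηd hη0 x).tendsto_slope
  refine h2.congr fun t => ?_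
  rw [slope_def_module, h0, sub_zero]; rfl

/-- The Lie derivative of the Bergman form along a field of the Lie algebra vanishes. -/
theorem bergmanForm_infinitesimal_invariance (hX : IsOpen X) (hs : SeparatesJets X)
    {Γ : Subgroup (HolAut X)} {ξ : (Fin d → ℂ) → (Fin d → ℂ)} (hξ : ξ ∈ lieAlg Γ) {x : Fin d → ℂ}
    (hx : x ∈ X) (u v : Fin d → ℂ) :
    fderiv ℝ (leviFormL (bergmanPotential X)) x (ξ x) u v
      + bergmanForm X x (fderiv ℂ ξ x u) v + bergmanForm X x u (fderiv ℂ ξ x v) = 0 := by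
  have hG := contDiffOn_leviFormL hX (contDiffOn_bergmanPotential hX hs)
  have hB : ∀ u v, bergmanForm X x u v = leviFormL (bergmanPotential X) x u v := fun _ _ => rfl
  have hGd : DifferentiableAt ℝ (leviFormL (bergmanPotential X)) x :=
    (hG.contDiffAt (hX.mem_nhds hx)).differentiableAt (by simp)
  simp only [hB]
  induction hξ using Submodule.span_induction with
  | zero =>
    have : fderiv ℂ (0 : (Fin d → ℂ) → (Fin d → ℂ)) x = 0 := fderiv_const_apply (0 : Fin d → ℂ)
    rw [this]; simp
  | add ξ η h1 h2 h3 h4 =>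
    have h1' := (holomorphic_of_mem_lieAlg h1).differentiableAt (hX.mem_nhds hx)
    have h2' := (holomorphic_of_mem_lieAlg h2).differentiableAt (hX.mem_nhds hx)
    rw [fderiv_add h1' h2']
    simp only [Pi.add_apply, map_add, add_apply]
    linarith
  | smul c ξ h1 h2 =>
    have h1' := (holomorphic_of_mem_lieAlg h1).differentiableAt (hX.mem_nhds hx)
    rw [fderiv_const_smul h1' c]
    simp only [Pi.smul_apply, map_smul, smul_apply, smul_eq_mul]
    linear_combination c * h2
  | mem ξ h =>
    obtain ⟨φ, hφ, -⟩ := h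
    have h0 : ((φ 0).1 : (Fin d → ℂ) → (Fin d → ℂ)) = id := funext fun y => hφ.zero_apply y
    have hA : ∀ w : Fin d → ℂ, HasDerivAt (fun s => fderiv ℂ (φ s).1 x w) (fderiv ℂ ξ x w) 0 :=
      fun w => ((ContinuousLinearMap.apply ℂ (Fin d → ℂ) w).restrictScalars ℝ).hasFDerivAt
        |>.comp_hasDerivAt (0 : ℝ) (hφ.hasDerivAt_fderiv hX hx)
    have hx' : HasDerivAt (fun s => (φ s).1 x) (ξ x) 0 := by
      have := hφ.hasDerivAt x hx 0
      rwa [hφ.zero_apply] at this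
    have h3 := hasDerivAt_leviForm_curve (g := bergmanPotential X) (γ := fun s => (φ s).1 x)
      (by rw [hφ.zero_apply]; exact hGd) hx' (hA u) (hA v)
    have h4 : (fun s => leviForm (bergmanPotential X) ((φ s).1 x) (fderiv ℂ (φ s).1 x u)
        (fderiv ℂ (φ s).1 x v)) = fun _ => bergmanForm X x u v := by
      funext s
      exact bergmanForm_holAut hX hs (φ s) hx u v
    rw [h4] at h3
    have h5 := h3.unique (hasDerivAt_const (0 : ℝ) _)
    simp only [h0, fderiv_id, id, ContinuousLinearMap.id_apply] at h5
    exact h5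

/-- The bracket with a field of the Lie algebra preserves each finite-dimensional `Ad(Γ)`-stable space
of vector fields. -/
theorem fieldBracket_mem_of_mem_lieAlg (hX : IsOpen X) {Γ : Subgroup (HolAut X)}
    {V : Submodule ℝ ((Fin d → ℂ) → (Fin d → ℂ))} [FiniteDimensional ℝ V]
    (hV : ∀ b ∈ Γ, ∀ η ∈ V, adAct b η ∈ V) {ξ η : (Fin d → ℂ) → (Fin d → ℂ)} (hξ : ξ ∈ lieAlg Γ)
    (hη : η ∈ V) (hηd : DifferentiableOn ℂ η X) (hη0 : ∀ y, y ∉ X → η y = 0) :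
    fieldBracket X η ξ ∈ V := by
  induction hξ using Submodule.span_induction with
  | mem ξ h => exact fieldBracket_mem_of_adAct_mem hX hV h hη hηd hη0
  | zero =>
    convert! V.zero_mem using 1
    ext1 x
    by_cases hx : x ∈ X
    · rw [fieldBracket, Set.indicator_of_mem hx, VectorField.lieBracket]
      have : fderiv ℂ (0 : (Fin d → ℂ) → (Fin d → ℂ)) x = 0 := fderiv_const_apply (0 : Fin d → ℂ)
      rw [this]; simp
    · rw [fieldBracket, Set.indicator_of_notMem hx]; rfl
  | add ξ ξ' h1 h2 h3 h4 =>
    convert! V.add_mem h3 h4 using 1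
    ext1 x
    by_cases hx : x ∈ X
    · have h1' := (holomorphic_of_mem_lieAlg h1).differentiableAt (hX.mem_nhds hx)
      have h2' := (holomorphic_of_mem_lieAlg h2).differentiableAt (hX.mem_nhds hx)
      simp only [fieldBracket, Pi.add_apply, Set.indicator_of_mem hx, VectorField.lieBracket]
      rw [fderiv_add h1' h2', add_apply, map_add]
      abel
    · simp only [fieldBracket, Pi.add_apply, Set.indicator_of_notMem hx, add_zero]
  | smul c ξ h1 h2 =>
    convert! V.smul_mem c h2 using 1
    ext1 x
    by_cases hx : x ∈ X
    · have h1' := (holomorphic_of_mem_lieAlg h1).differentiableAt (hX.mem_nhds hx)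
      simp only [fieldBracket, Pi.smul_apply, Set.indicator_of_mem hx, VectorField.lieBracket]
      rw [fderiv_const_smul h1' c, smul_apply, ContinuousLinearMap.map_smul_of_tower, smul_sub]
    · simp only [fieldBracket, Pi.smul_apply, Set.indicator_of_notMem hx, smul_zero]

theorem adAct_mem_span {b : HolAut X} {s : Set ((Fin d → ℂ) → (Fin d → ℂ))}
    {V : Submodule ℝ ((Fin d → ℂ) → (Fin d → ℂ))} (h : ∀ η ∈ s, adAct b η ∈ V)
    {η : (Fin d → ℂ) → (Fin d → ℂ)} (hη : η ∈ Submodule.span ℝ s) : adAct b η ∈ V := by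
  induction hη using Submodule.span_induction with
  | mem η hη => exact h η hη
  | zero => rw [adAct_zero]; exact V.zero_mem
  | add η η' _ _ h1 h2 => rw [adAct_add]; exact V.add_mem h1 h2
  | smul c η _ h1 => rw [adAct_smul]; exact V.smul_mem c h1

/-- The linear part of `ξ ∈ lieAlg B` at a zero is skew for the Bergman metric and triangular with
real entries in a flag that spans the tangent space over `ℂ`; so it vanishes. -/
theorem fderiv_eq_zero_of_mem_lieAlg (hX : IsSiegelDomain X) {B : Subgroup (HolAut X)}
    (hB : IsConnectedSplitSolvable B) {ξ : (Fin d → ℂ) → (Fin d → ℂ)} (hξ : ξ ∈ lieAlg B)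
    {x : Fin d → ℂ} (hx : x ∈ X) (h0 : ξ x = 0) : fderiv ℂ ξ x = 0 := by
  have hXo := hX.isOpen
  have hs := hX.separatesJets
  have hρ : ContDiffAt ℝ ω (bergmanPotential X) x :=
    (contDiffOn_bergmanPotential hXo hs).contDiffAt (hXo.mem_nhds hx)
  obtain ⟨-, n, e, he⟩ := hB
  set A := fderiv ℂ ξ x with hA
  have hskew : ∀ u v, bergmanForm X x (A u) v + bergmanForm X x u (A v) = 0 := by
    intro u v
    have := bergmanForm_infinitesimal_invariance hXo hs hξ hx u v
    rw [h0, map_zero] at this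
    simpa using this
  have hb : ∀ u v, bergmanForm X x u v = leviFormL (bergmanPotential X) x u v := fun _ _ => rfl
  have hJ : ∀ u v, bergmanForm X x (Complex.I • u) (Complex.I • v) = bergmanForm X x u v :=
    fun u v => leviForm_smul_I hρ u v
  have hanti : ∀ u v, bergmanForm X x u v = - bergmanForm X x v u := leviForm_antisymm _ _
  have hAe : ∀ i, A ((e i : (Fin d → ℂ) → (Fin d → ℂ)) x) = 0 := by
    intro i
    induction i using WellFoundedLT.induction with
    | ind i ih =>
    set V : Submodule ℝ ((Fin d → ℂ) → (Fin d → ℂ)) :=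
      Submodule.span ℝ ((fun j => (e j : (Fin d → ℂ) → (Fin d → ℂ))) '' Set.Iic i) with hV
    have : FiniteDimensional ℝ V := FiniteDimensional.span_of_finite ℝ (Set.toFinite _)
    have hVB : ∀ b ∈ B, ∀ η ∈ V, adAct b η ∈ V := fun b hbB η hη =>
      adAct_mem_span (by
        rintro η ⟨j, hj, rfl⟩
        exact Submodule.span_mono (Set.image_mono (Set.Iic_subset_Iic.2 hj)) (he b hbB j)) hη
    have hbr := fieldBracket_mem_of_mem_lieAlg hXo hVB hξ
      (Submodule.subset_span ⟨i, Set.mem_Iic.2 le_rfl, rfl⟩)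
      (holomorphic_of_mem_lieAlg (e i).2) (fun y hy => eq_zero_of_mem_lieAlg_of_notMem (e i).2 hy)
    have hval : ∀ η ∈ V, ∃ (a : ℝ) (w : Fin d → ℂ),
        η x = a • (e i : (Fin d → ℂ) → (Fin d → ℂ)) x + w ∧ A w = 0 := by
      intro η hη
      induction hη using Submodule.span_induction with
      | mem η hη =>
        obtain ⟨j, hj, rfl⟩ := hη
        rcases (Set.mem_Iic.1 hj).lt_or_eq with h | rfl
        · exact ⟨0, _, by simp, ih j h⟩
        · exact ⟨1, 0, by simp, map_zero _⟩
      | zero => exact ⟨0, 0, by simp, map_zero _⟩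
      | add η η' _ _ h1 h2 =>
        obtain ⟨a, w, h1, h1'⟩ := h1
        obtain ⟨a', w', h2, h2'⟩ := h2
        exact ⟨a + a', w + w', by rw [Pi.add_apply, h1, h2, add_smul]; abel, by
          rw [map_add, h1', h2', add_zero]⟩
      | smul c η _ h1 =>
        obtain ⟨a, w, h1, h1'⟩ := h1
        exact ⟨c * a, c • w, by rw [Pi.smul_apply, h1, smul_add, mul_smul], by
          rw [ContinuousLinearMap.map_smul_of_tower, h1', smul_zero]⟩
    obtain ⟨a, w, haw, hw⟩ := hval _ hbr
    set v := (e i : (Fin d → ℂ) → (Fin d → ℂ)) x with hv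
    rw [fieldBracket, Set.indicator_of_mem hx, VectorField.lieBracket, h0, map_zero, sub_zero,
      ← hA] at haw
    by_contra hne
    have hpos := bergmanForm_pos hXo hs hx hne
    -- `A v = a v + w` with `A w = 0`; by skewness `A v` is orthogonal to `v` and to `w` for the metric
    -- `ω(·, i·)`, hence to itself
    have e1 : bergmanForm X x (A v) (Complex.I • v) = 0 := by
      have h1 := hskew v (Complex.I • v)
      rw [map_smul] at h1
      have h2 := hJ v (Complex.I • A v)
      rw [smul_smul, Complex.I_mul_I, neg_one_smul] at h2
      have h3 : bergmanForm X x (Complex.I • v) (-(A v)) = bergmanForm X x (A v) (Complex.I • v) := by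
        rw [hanti, hb, map_neg, neg_apply, neg_neg]; rfl
      linarith
    have e2 : bergmanForm X x (A v) (Complex.I • w) = 0 := by
      have h1 := hskew v (Complex.I • w)
      rw [map_smul, hw, smul_zero, hb v 0, map_zero] at h1
      linarith
    have e3 : bergmanForm X x (A v) (Complex.I • A v) = 0 := by
      have h1 : Complex.I • A v = a • (Complex.I • v) + Complex.I • w := by
        conv_lhs => rw [haw, smul_add, smul_comm]
      rw [h1, hb, map_add, map_smul, ← hb, ← hb, e1, e2]; simp
    rw [e3] at hpos
    exact lt_irrefl _ hpos
  refine hX.eq_zero_of_apply_lieSet hx fun η hη => ?_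
  have h1 : η ∈ lieAlg (⊤ : Subgroup (HolAut X)) := Submodule.subset_span hη
  have h2 : η = _ := (congrArg Subtype.val (e.sum_repr ⟨η, h1⟩)).symm
  rw [h2, Submodule.coe_sum, Finset.sum_apply, map_sum]
  refine Finset.sum_eq_zero fun i _ => ?_
  rw [Submodule.coe_smul, Pi.smul_apply, ContinuousLinearMap.map_smul_of_tower, hAe, smul_zero]

/-- A field of the Lie algebra with vanishing one-jet at `x` is zero.  On a complex line through `x`
with coordinate `ζ` write `Dξ = ζⁿ g` with `g 0 ≠ 0`, `n ≥ 1`.  Infinitesimal invariance of the Bergman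
form shows in the limit `ζ → 0` in all directions that `λ g 0` is skew for all complex numbers `λ`,
which forces `g 0 = 0`. -/
theorem eq_zero_of_mem_lieAlg_of_jet_eq_zero (hX : IsOpen X) (hc : Convex ℝ X)
    (hs : SeparatesJets X) {Γ : Subgroup (HolAut X)} {ξ : (Fin d → ℂ) → (Fin d → ℂ)}
    (hξ : ξ ∈ lieAlg Γ) {x : Fin d → ℂ} (hx : x ∈ X) (h0 : ξ x = 0) (h1 : fderiv ℂ ξ x = 0) :
    ξ = 0 := by
  have hρ := contDiffOn_bergmanPotential hX hs
  have hξd := holomorphic_of_mem_lieAlg hξ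
  ext1 y
  by_cases hy : y ∈ X
  swap
  · exact eq_zero_of_mem_lieAlg_of_notMem hξ hy
  set c := y - x with hcd
  set ℓ : ℂ → (Fin d → ℂ) := fun ζ => x + ζ • c with hℓ
  have hℓ0 : ℓ 0 = x := by simp [hℓ]
  have hℓd : ∀ ζ, HasDerivAt ℓ c ζ := fun ζ => by
    have := ((hasDerivAt_id ζ).smul_const c).const_add x
    rwa [one_smul] at this
  have hℓc : Continuous ℓ := continuous_iff_continuousAt.2 fun ζ => (hℓd ζ).continuousAt
  set S := ℓ ⁻¹' X with hS
  have hSo : IsOpen S := hX.preimage hℓc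
  have hSc : Convex ℝ S := by
    intro a ha b hb p q hp hq hpq
    have := hc ha hb hp hq hpq
    change ℓ (p • a + q • b) ∈ X
    convert! this using 1
    simp only [hℓ]
    have e : x = p • x + q • x := by rw [← add_smul, hpq, one_smul]
    conv_lhs => rw [e]
    simp only [smul_add, add_smul, smul_assoc]
    abel
  have h0S : (0 : ℂ) ∈ S := by change ℓ 0 ∈ X; rwa [hℓ0]
  set A : ℂ → ((Fin d → ℂ) →L[ℂ] (Fin d → ℂ)) := fun ζ => fderiv ℂ ξ (ℓ ζ) with hA
  have hAd : DifferentiableOn ℂ A S :=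
    (hξd.fderiv_holomorphic hX).comp (fun ζ _ => (hℓd ζ).differentiableAt.differentiableWithinAt)
      (Set.mapsTo_preimage _ _)
  have hAan : AnalyticOnNhd ℂ A S := hAd.analyticOnNhd hSo
  have hder : ∀ ζ ∈ S, HasDerivAt (fun ζ => ξ (ℓ ζ)) (A ζ c) ζ := fun ζ hζ =>
    (hξd.differentiableAt (hX.mem_nhds hζ)).hasFDerivAt.comp_hasDerivAt ζ (hℓd ζ)
  have key : ∀ᶠ ζ in 𝓝 0, A ζ = 0 := by
    by_contra hne
    obtain ⟨n, g, hg, hg0, hgA⟩ :=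
      ((hAan 0 h0S).exists_eventuallyEq_pow_smul_nonzero_iff).2 hne
    simp only [sub_zero] at hgA
    have hn : n ≠ 0 := by
      rintro rfl
      apply hg0
      have := hgA.self_of_nhds
      rw [pow_zero, one_smul] at this
      rw [← this, hA]
      simp only [hℓ0, h1]
    -- `ξ` vanishes along the line to order `n + 1`
    have hgb : ∀ᶠ ζ in 𝓝 0, ‖g ζ‖ < ‖g 0‖ + 1 :=
      hg.continuousAt.norm.eventually (gt_mem_nhds (by linarith))
    obtain ⟨r, hr, hrball⟩ := Metric.eventually_nhds_iff_ball.1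
      (hgA.and (hgb.and (hSo.mem_nhds h0S)))
    have hξb : ∀ ζ ∈ Metric.ball (0 : ℂ) r, ‖ξ (ℓ ζ)‖ ≤ (‖g 0‖ + 1) * ‖c‖ * ‖ζ‖ ^ (n + 1) := by
      intro ζ hζ
      have hsub : Metric.closedBall (0 : ℂ) ‖ζ‖ ⊆ Metric.ball 0 r := by
        refine Metric.closedBall_subset_ball ?_
        simpa using hζ
      have h2 := (convex_closedBall (0 : ℂ) ‖ζ‖).norm_image_sub_le_of_norm_hasDerivWithin_le
        (f := fun ζ => ξ (ℓ ζ)) (f' := fun ζ => A ζ c) (C := (‖g 0‖ + 1) * ‖c‖ * ‖ζ‖ ^ n)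
        (fun z hz => (hder z (hrball z (hsub hz)).2.2).hasDerivWithinAt) (fun z hz => by
          refine (ContinuousLinearMap.le_opNorm _ _).trans ?_
          obtain ⟨h3, h4, -⟩ := hrball z (hsub hz)
          have h5 : ‖z‖ ≤ ‖ζ‖ := by simpa using hz
          rw [h3, norm_smul, norm_pow]
          calc ‖z‖ ^ n * ‖g z‖ * ‖c‖ ≤ ‖ζ‖ ^ n * (‖g 0‖ + 1) * ‖c‖ := by gcongr
            _ = _ := by ring)
        (Metric.mem_closedBall_self (norm_nonneg _)) (y := ζ) (by simp)
      rw [hℓ0, h0, sub_zero, sub_zero] at h2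
      exact h2.trans (le_of_eq (by ring))
    have hlim : ∀ (w : ℂ) (u v : Fin d → ℂ), bergmanForm X x (w ^ n • g 0 u) v
        + bergmanForm X x u (w ^ n • g 0 v) = 0 := by
      intro w u v
      have ht : Filter.Tendsto (fun t : ℝ => (t : ℂ) * w) (𝓝[>] 0) (𝓝 0) := by
        have : Continuous fun t : ℝ => (t : ℂ) * w := by fun_prop
        have := (this.tendsto 0).mono_left (nhdsWithin_le_nhds (s := Set.Ioi 0))
        simpa using this
      have hp : Filter.Tendsto (fun t : ℝ => ℓ ((t : ℂ) * w)) (𝓝[>] 0) (𝓝 x) := by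
        have := (hℓc.tendsto 0).comp ht
        rwa [hℓ0] at this
      have hgt : ∀ u, Filter.Tendsto (fun t : ℝ => w ^ n • g ((t : ℂ) * w) u) (𝓝[>] 0)
          (𝓝 (w ^ n • g 0 u)) := fun u =>
        (((ContinuousLinearMap.apply ℂ (Fin d → ℂ) u).continuous.tendsto _).comp
          (hg.continuousAt.tendsto.comp ht)).const_smul _
      have hq : Filter.Tendsto (fun t : ℝ => (t ^ n)⁻¹ • ξ (ℓ ((t : ℂ) * w))) (𝓝[>] 0) (𝓝 0) := by
        have hb : Filter.Tendsto (fun t : ℝ => (‖g 0‖ + 1) * ‖c‖ * ‖w‖ ^ (n + 1) * t) (𝓝[>] 0)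
            (𝓝 0) := by
          have : Continuous fun t : ℝ => (‖g 0‖ + 1) * ‖c‖ * ‖w‖ ^ (n + 1) * t := by fun_prop
          have := (this.tendsto 0).mono_left (nhdsWithin_le_nhds (s := Set.Ioi 0))
          simpa using this
        refine squeeze_zero_norm' ?_ hb
        filter_upwards [ht.eventually (Metric.ball_mem_nhds 0 hr), self_mem_nhdsWithin] with t h2 h3
        have h3 : 0 < t := h3
        have h4 := hξb _ h2
        rw [norm_mul, Complex.norm_real, Real.norm_of_nonneg h3.le] at h4
        rw [norm_smul, norm_inv, norm_pow, Real.norm_of_nonneg h3.le, inv_mul_le_iff₀ (by positivity)]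
        exact h4.trans (le_of_eq (by ring))
      have hsum := ((tendsto_fderiv_leviFormL hX hρ hx hp hq u v).add
        (tendsto_leviForm hX hρ hx hp (hgt u) (tendsto_const_nhds (x := v)))).add
        (tendsto_leviForm hX hρ hx hp (tendsto_const_nhds (x := u)) (hgt v))
      have hz : Filter.Tendsto (fun _ : ℝ => (0 : ℝ)) (𝓝[>] 0) (𝓝 0) := tendsto_const_nhds
      have hev : ∀ᶠ t : ℝ in 𝓝[>] 0, (0 : ℝ) = fderiv ℝ (leviFormL (bergmanPotential X))
          (ℓ ((t : ℂ) * w)) ((t ^ n)⁻¹ • ξ (ℓ ((t : ℂ) * w))) u v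
          + leviForm (bergmanPotential X) (ℓ ((t : ℂ) * w)) (w ^ n • g ((t : ℂ) * w) u) v
          + leviForm (bergmanPotential X) (ℓ ((t : ℂ) * w)) u (w ^ n • g ((t : ℂ) * w) v) := by
        filter_upwards [ht.eventually (Metric.ball_mem_nhds 0 hr), self_mem_nhdsWithin] with t h2 h3
        have h3 : 0 < t := h3
        obtain ⟨h4, -, h5⟩ := hrball _ h2
        have h6 := bergmanForm_infinitesimal_invariance hX hs hξ h5 u v
        have h7 : ∀ u, fderiv ℂ ξ (ℓ ((t : ℂ) * w)) u = t ^ n • (w ^ n • g ((t : ℂ) * w) u) := by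
          intro u
          have : fderiv ℂ ξ (ℓ ((t : ℂ) * w)) = _ := h4
          rw [this, mul_pow, smul_apply, mul_smul, ← Complex.ofReal_pow, Complex.coe_smul]
        rw [h7, h7, bergmanForm_eq_leviForm, bergmanForm_eq_leviForm, leviForm_smul_left,
          leviForm_smul_right] at h6
        rw [map_smul, smul_apply, smul_apply, smul_eq_mul]
        have h8 : t ^ n ≠ 0 := by positivity
        field_simp
        linear_combination -h6
      have hf := tendsto_nhds_unique (hz.congr' hev) hsum
      rw [map_zero] at hf
      simp only [zero_apply, zero_add] at hf
      exact hf.symm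
    -- both `g 0` and `i g 0` are skew, the latter by approaching `0` in a direction `w` with `wⁿ = i`
    obtain ⟨w, hw⟩ := IsAlgClosed.exists_pow_nat_eq Complex.I (Nat.pos_of_ne_zero hn)
    have hb : ∀ u v, bergmanForm X x u v = leviFormL (bergmanPotential X) x u v := fun _ _ => rfl
    apply hg0
    ext1 u
    by_contra hu
    have hu' : Complex.I • g 0 u ≠ 0 := by simpa using hu
    have e1 : ∀ v, bergmanForm X x (Complex.I • g 0 u) v = 0 := by
      intro v
      have h2 := hlim w u v
      have h3 := hlim 1 (Complex.I • u) v
      rw [hw] at h2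
      rw [one_pow, one_smul, one_smul, map_smul] at h3
      have h4 : bergmanForm X x u (Complex.I • g 0 v) = - bergmanForm X x (Complex.I • u) (g 0 v) := by
        have : bergmanForm X x (Complex.I • u) (Complex.I • Complex.I • g 0 v)
            = bergmanForm X x u (Complex.I • g 0 v) :=
          leviForm_smul_I (hρ.contDiffAt (hX.mem_nhds hx)) _ _
        rw [← this, smul_smul, Complex.I_mul_I, neg_one_smul, hb, map_neg]; rfl
      linarith
    have := bergmanForm_pos hX hs hx hu'
    rw [e1] at this
    exact lt_irrefl _ this
  have hA0 := hAan.eqOn_zero_of_preconnected_of_eventuallyEq_zero hSc.isPreconnected h0S key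
  have h1S : (1 : ℂ) ∈ S := by
    change x + (1 : ℂ) • c ∈ X
    rw [one_smul, hcd, add_sub_cancel]; exact hy
  have h2 := hSc.norm_image_sub_le_of_norm_hasDerivWithin_le (f := fun ζ => ξ (ℓ ζ))
    (f' := fun ζ => A ζ c) (C := 0) (fun z hz => (hder z hz).hasDerivWithinAt) (fun z hz => by
      rw [hA0 hz]; simp) h0S h1S
  rw [hℓ0, h0, sub_zero, zero_mul] at h2
  have h3 : ℓ 1 = y := by simp [hℓ, hcd]
  rw [h3] at h2
  exact norm_le_zero_iff.1 h2

/-- A split solvable group acts freely at the level of Lie algebras: a field with a zero has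
vanishing one-jet there. -/
theorem eq_zero_of_mem_lieAlg_of_apply_eq_zero (hX : IsSiegelDomain X) {B : Subgroup (HolAut X)}
    (hB : IsConnectedSplitSolvable B) {ξ : (Fin d → ℂ) → (Fin d → ℂ)} (hξ : ξ ∈ lieAlg B)
    {x : Fin d → ℂ} (hx : x ∈ X) (h0 : ξ x = 0) : ξ = 0 :=
  eq_zero_of_mem_lieAlg_of_jet_eq_zero hX.isOpen hX.convex hX.separatesJets hξ hx h0
    (fderiv_eq_zero_of_mem_lieAlg hX hB hξ hx h0)

end LieAlgebras

/-! ### Trajectories depending on a parameter -/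

section ParameterODE

variable {E P : Type} [NormedAddCommGroup E] [NormedSpace ℝ E] [NormedAddCommGroup P]
  [NormedSpace ℝ P]

/-- Uniform second order Taylor bounds on a ball for a family `x ↦ V x p` of vector fields that
depends linearly on the parameter `p`. -/
structure IsTaylorBounded (V : E → P →L[ℝ] E) (q : E) (r M : ℝ) : Prop where
  nonneg : 0 ≤ M
  norm_le : ∀ x ∈ Metric.ball q r, ‖V x‖ ≤ M
  differentiableAt : ∀ x ∈ Metric.ball q r, DifferentiableAt ℝ V x
  norm_fderiv_le : ∀ x ∈ Metric.ball q r, ‖fderiv ℝ V x‖ ≤ M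
  taylor : ∀ x ∈ Metric.ball q r, ∀ y ∈ Metric.ball q r,
    ‖V y - V x - fderiv ℝ V x (y - x)‖ ≤ M * ‖y - x‖ ^ 2

variable {V : E → P →L[ℝ] E} {q : E} {r M : ℝ}

theorem IsTaylorBounded.mono (h : IsTaylorBounded V q r M) {r' : ℝ} (hr : r' ≤ r) :
    IsTaylorBounded V q r' M where
  nonneg := h.nonneg
  norm_le x hx := h.norm_le x (Metric.ball_subset_ball hr hx)
  differentiableAt x hx := h.differentiableAt x (Metric.ball_subset_ball hr hx)
  norm_fderiv_le x hx := h.norm_fderiv_le x (Metric.ball_subset_ball hr hx)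
  taylor x hx y hy :=
    h.taylor x (Metric.ball_subset_ball hr hx) y (Metric.ball_subset_ball hr hy)

theorem IsTaylorBounded.norm_sub_le (h : IsTaylorBounded V q r M) {x y : E}
    (hx : x ∈ Metric.ball q r) (hy : y ∈ Metric.ball q r) : ‖V y - V x‖ ≤ M * ‖y - x‖ :=
  (convex_ball q r).norm_image_sub_le_of_norm_fderiv_le h.differentiableAt h.norm_fderiv_le hx hy

theorem ContinuousAt.eventually_norm_lt {T G : Type} [TopologicalSpace T] [NormedAddCommGroup G]
    {f : T → G} {x : T} (h : ContinuousAt f x) : ∀ᶠ y in 𝓝 x, ‖f y‖ < ‖f x‖ + 1 :=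
  h.norm.eventually (gt_mem_nhds (lt_add_one _))

theorem exists_isTaylorBounded (hV : ContDiffAt ℝ 2 V q) :
    ∃ r > 0, ∃ M, IsTaylorBounded V q r M := by
  have h1 : ContDiffAt ℝ 1 (fderiv ℝ V) q := hV.fderiv_right (by norm_num)
  obtain ⟨K, s, hs, hK⟩ := ContDiffAt.exists_lipschitzOnWith (F' := E →L[ℝ] P →L[ℝ] E) h1
  have h1c : ContinuousAt (fderiv ℝ V) q := h1.continuousAt
  have e1 : ∀ᶠ x in 𝓝 q, DifferentiableAt ℝ V x :=
    (hV.eventually (by simp)).mono fun x hx => hx.differentiableAt (by norm_num)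
  have e3 : ∀ᶠ x in 𝓝 q, ‖V x‖ < ‖V q‖ + 1 :=
    hV.continuousAt.norm.eventually (gt_mem_nhds (by linarith))
  have e4 : ∀ᶠ x in 𝓝 q, ‖fderiv ℝ V x‖ < ‖fderiv ℝ V q‖ + 1 :=
    ContinuousAt.eventually_norm_lt (G := E →L[ℝ] P →L[ℝ] E) h1c
  obtain ⟨r, hr, h⟩ := Metric.eventually_nhds_iff_ball.1 (e1.and (e3.and (e4.and hs)))
  have a1 := norm_nonneg (V q)
  have a2 := norm_nonneg (fderiv ℝ V q)
  have a3 := K.2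
  set M := ‖V q‖ + ‖fderiv ℝ V q‖ + K + 1 with hM
  have hM0 : 0 ≤ M := by positivity
  refine ⟨r, hr, M, hM0, fun x hx => ?_, fun x hx => (h x hx).1, fun x hx => ?_,
    fun x hx y hy => ?_⟩
  · have := (h x hx).2.1
    change 0 ≤ (K : ℝ) at a3
    linarith
  · have := (h x hx).2.2.1
    change 0 ≤ (K : ℝ) at a3
    linarith
  · -- on the ball of radius `‖y - x‖` around `x` the derivative varies by at most `M ‖y - x‖`
    have hb : ∀ z ∈ segment ℝ x y, ‖fderiv ℝ V z - fderiv ℝ V x‖ ≤ M * ‖y - x‖ := by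
      intro z hz
      have hzb : z ∈ Metric.ball q r := (convex_ball q r).segment_subset hx hy hz
      have h3 := hK.dist_le_mul _ (h z hzb).2.2.2 _ (h x hx).2.2.2
      rw [dist_eq_norm, dist_eq_norm] at h3
      refine h3.trans ?_
      gcongr
      · rw [hM]; linarith
      · exact norm_sub_le_of_mem_segment hz
    have h4 := (convex_segment x y).norm_image_sub_le_of_norm_hasFDerivWithin_le' (f := V)
      (fun z hz => ((h z ((convex_ball q r).segment_subset hx hy hz)).1.hasFDerivAt).hasFDerivWithinAt)
      hb (left_mem_segment ℝ x y) (right_mem_segment ℝ x y)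
    exact h4.trans (le_of_eq (by ring))

/-- Existence of the trajectories of `x ↦ V x a` on a fixed time interval, for small `a`. -/
theorem IsTaylorBounded.exists_trajectory [CompleteSpace E] (h : IsTaylorBounded V q r M) {a : P}
    (ha : (M + 1) * ‖a‖ < r / 4) (hr : 0 < r) :
    ∃ y : ℝ → E, y 0 = q ∧ ∀ t ∈ Set.Icc (0 : ℝ) 1, HasDerivAt y (V (y t) a) t := by
  have hM := h.nonneg
  have hPL : IsPicardLindelof (fun _ x => V x a) (tmin := -2) (tmax := 2)
      ⟨0, by norm_num, by norm_num⟩ q (Real.toNNReal (r / 2)) 0 (Real.toNNReal (M * ‖a‖))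
      (Real.toNNReal (M * ‖a‖)) := by
    have hr2 : ((Real.toNNReal (r / 2) : NNReal) : ℝ) = r / 2 := Real.coe_toNNReal _ (by positivity)
    have hMa : ((Real.toNNReal (M * ‖a‖) : NNReal) : ℝ) = M * ‖a‖ :=
      Real.coe_toNNReal _ (by positivity)
    have hsub : Metric.closedBall q (r / 2) ⊆ Metric.ball q r :=
      Metric.closedBall_subset_ball (by linarith)
    refine IsPicardLindelof.of_time_independent (fun x hx => ?_) ?_ ?_
    · rw [hMa]
      rw [hr2] at hx
      exact (V x).le_of_opNorm_le (h.norm_le x (hsub hx)) a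
    · refine LipschitzOnWith.of_dist_le_mul fun x hx y hy => ?_
      rw [hr2] at hx hy
      rw [dist_eq_norm, dist_eq_norm, hMa]
      have h1 := (V x - V y).le_of_opNorm_le (h.norm_sub_le (hsub hy) (hsub hx)) a
      exact h1.trans (le_of_eq (by ring))
    · rw [hMa, hr2]
      norm_num
      have := norm_nonneg a
      nlinarith
  obtain ⟨y, hy0, hy⟩ := hPL.exists_eq_forall_mem_Icc_hasDerivWithinAt₀
  refine ⟨y, hy0, fun t ht => ?_⟩
  have : t ∈ Set.Icc (-2 : ℝ) 2 := ⟨by linarith [ht.1], by linarith [ht.2]⟩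
  exact (hy t this).hasDerivAt (Icc_mem_nhds (by linarith [ht.1]) (by linarith [ht.2]))

/-- Trajectories of `x ↦ V x a` with small `a` stay close to the starting point up to time `1`. -/
theorem IsTaylorBounded.trajectory_bound (h : IsTaylorBounded V q r M) {a : P}
    (ha : (M + 1) * ‖a‖ < r) (hr : 0 < r) {y : ℝ → E} (hy0 : y 0 = q)
    (hy : ∀ t ∈ Set.Icc (0 : ℝ) 1, HasDerivAt y (V (y t) a) t) :
    ∀ t ∈ Set.Icc (0 : ℝ) 1, ‖y t - q‖ ≤ (M + 1) * ‖a‖ * t := by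
  intro t ht
  rcases eq_or_ne a 0 with rfl | ha0
  · have h1 := (convex_Icc (0 : ℝ) 1).norm_image_sub_le_of_norm_hasDerivWithin_le (C := 0)
      (fun s hs => (hy s hs).hasDerivWithinAt) (fun s _ => by simp) (x := 0) (by simp) ht
    rw [hy0] at h1
    simpa using h1
  · have := norm_trajectory_sub_le (y := y) (ξ := fun x => V x a) (R := r)
      (M := (M + 1) * ‖a‖) (a := 1) hr (fun z hz => by
        rw [hy0] at hz
        have h1 := (V z).le_of_opNorm_le (h.norm_le z hz) a
        have h2 := norm_pos_iff.2 ha0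
        linarith) hy (by linarith) t ht
    rwa [hy0] at this

theorem gronwallBound_zero_eq (K ε : ℝ) : gronwallBound 0 K ε 1 = ε * gronwallBound 0 K 1 1 := by
  unfold gronwallBound
  split_ifs <;> ring

/-- First variation of the trajectories: `κ` is the solution of the variational equation, written in
the frame `V`. -/
theorem IsTaylorBounded.variation (h : IsTaylorBounded V q r M) {a b : P} {C : ℝ}
    (ha : ‖a‖ ≤ 1) (hb : ‖b‖ ≤ 1) (hMC : M * (C * ‖b‖) < r / 2)
    {y z : ℝ → E} {κ κ' : ℝ → P} (hyz : y 0 = z 0) (hκ0 : κ 0 = 0)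
    (hy : ∀ t ∈ Set.Icc (0 : ℝ) 1, HasDerivAt y (V (y t) a) t)
    (hz : ∀ t ∈ Set.Icc (0 : ℝ) 1, HasDerivAt z (V (z t) (a + b)) t)
    (hκ : ∀ t ∈ Set.Icc (0 : ℝ) 1, HasDerivAt κ (κ' t) t)
    (hyr : ∀ t ∈ Set.Icc (0 : ℝ) 1, y t ∈ Metric.ball q (r / 2))
    (hzr : ∀ t ∈ Set.Icc (0 : ℝ) 1, z t ∈ Metric.ball q r)
    (hκb : ∀ t ∈ Set.Icc (0 : ℝ) 1, ‖κ t‖ ≤ C * ‖b‖)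
    (hvar : ∀ t ∈ Set.Icc (0 : ℝ) 1, V (y t) (κ' t) = V (y t) b
      + fderiv ℝ V (y t) (V (y t) (κ t)) a - fderiv ℝ V (y t) (V (y t) a) (κ t)) :
    ‖z 1 - (y 1 + V (y 1) (κ 1))‖ ≤
      (M * (M * C) + 2 * M * (M * C) ^ 2) * gronwallBound 0 (2 * M) 1 1 * ‖b‖ ^ 2 := by
  have hM := h.nonneg
  have hball : ∀ t ∈ Set.Icc (0 : ℝ) 1, y t ∈ Metric.ball q r := fun t ht => by
    have h1 := hyr t ht
    have h2 := dist_nonneg (x := y t) (y := q)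
    rw [Metric.mem_ball] at h1 ⊢
    linarith
  set w : ℝ → E := fun t => y t + V (y t) (κ t) with hw
  have hVκ : ∀ t ∈ Set.Icc (0 : ℝ) 1, ‖V (y t) (κ t)‖ ≤ M * (C * ‖b‖) := fun t ht =>
    ((V (y t)).le_of_opNorm_le_of_le (h.norm_le _ (hball t ht)) (hκb t ht))
  have hwr : ∀ t ∈ Set.Icc (0 : ℝ) 1, w t ∈ Metric.ball q r := fun t ht => by
    have h1 := hyr t ht
    have h2 := hVκ t ht
    rw [Metric.mem_ball, dist_eq_norm] at h1 ⊢
    have h3 := norm_add_le (y t - q) (V (y t) (κ t))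
    have h4 : w t - q = (y t - q) + V (y t) (κ t) := by simp only [hw]; abel
    rw [h4]; linarith
  have hwd : ∀ t ∈ Set.Icc (0 : ℝ) 1, HasDerivAt w
      (V (y t) a + (fderiv ℝ V (y t) (V (y t) a) (κ t) + V (y t) (κ' t))) t := fun t ht => by
    have h1 : HasDerivAt (fun t => V (y t)) (fderiv ℝ V (y t) (V (y t) a)) t :=
      ((h.differentiableAt _ (hball t ht)).hasFDerivAt).comp_hasDerivAt t (hy t ht)
    exact (hy t ht).add (h1.clm_apply (hκ t ht))
  have hwe : ∀ t ∈ Set.Ico (0 : ℝ) 1,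
      dist (V (y t) a + (fderiv ℝ V (y t) (V (y t) a) (κ t) + V (y t) (κ' t))) (V (w t) (a + b))
        ≤ (M * (M * C) + 2 * M * (M * C) ^ 2) * ‖b‖ ^ 2 := fun t ht' => by
    have ht : t ∈ Set.Icc (0 : ℝ) 1 := ⟨ht'.1, ht'.2.le⟩
    have h1 := h.taylor _ (hball t ht) _ (hwr t ht)
    have h2 : w t - y t = V (y t) (κ t) := by simp [hw]
    rw [h2] at h1
    have h3 := (V (w t) - V (y t) - fderiv ℝ V (y t) (V (y t) (κ t))).le_of_opNorm_le h1 (a + b)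
    have h4 : ‖fderiv ℝ V (y t) (V (y t) (κ t)) b‖ ≤ M * (M * (C * ‖b‖)) * ‖b‖ :=
      ContinuousLinearMap.le_of_opNorm_le _
        (ContinuousLinearMap.le_of_opNorm_le_of_le _ (h.norm_fderiv_le _ (hball t ht)) (hVκ t ht)) b
    have h5 : ‖a + b‖ ≤ 2 := (norm_add_le a b).trans (by linarith)
    have h6 : V (y t) a + (fderiv ℝ V (y t) (V (y t) a) (κ t) + V (y t) (κ' t)) - V (w t) (a + b)
        = -((V (w t) - V (y t) - fderiv ℝ V (y t) (V (y t) (κ t))) (a + b)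
          + fderiv ℝ V (y t) (V (y t) (κ t)) b) := by
      rw [hvar t ht]
      simp only [sub_apply, map_add]
      abel
    rw [dist_eq_norm, h6, norm_neg]
    refine (norm_add_le _ _).trans ?_
    have h7 : M * ‖V (y t) (κ t)‖ ^ 2 * ‖a + b‖ ≤ M * (M * (C * ‖b‖)) ^ 2 * 2 := by
      gcongr
      exact hVκ t ht
    nlinarith
  have h2M : ((Real.toNNReal (2 * M) : NNReal) : ℝ) = 2 * M := Real.coe_toNNReal _ (by positivity)
  have hlip : ∀ t ∈ Set.Ico (0 : ℝ) 1, LipschitzOnWith (Real.toNNReal (2 * M))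
      (fun x => V x (a + b)) (Metric.ball q r) := fun t _ => by
    refine LipschitzOnWith.of_dist_le_mul fun x hx x' hx' => ?_
    rw [dist_eq_norm, dist_eq_norm, h2M]
    have h1 := (V x - V x').le_of_opNorm_le_of_le (h.norm_sub_le hx' hx)
      ((norm_add_le a b).trans (by linarith : ‖a‖ + ‖b‖ ≤ 2))
    exact h1.trans (le_of_eq (by ring))
  have hI : ∀ t ∈ Set.Ico (0 : ℝ) 1, t ∈ Set.Icc (0 : ℝ) 1 := fun t ht => ⟨ht.1, ht.2.le⟩
  have := dist_le_of_approx_trajectories_ODE_of_mem (f := z) (g := w) (δ := 0) (εf := 0) hlip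
    (fun t ht => (hz t ht).continuousAt.continuousWithinAt)
    (fun t ht => (hz t (hI t ht)).hasDerivWithinAt) (fun t _ => by simp)
    (fun t ht => hzr t (hI t ht))
    (fun t ht => (hwd t ht).continuousAt.continuousWithinAt)
    (fun t ht => (hwd t (hI t ht)).hasDerivWithinAt) hwe (fun t ht => hwr t (hI t ht))
    (by simp [hw, hκ0, hyz]) 1 (by simp)
  rw [dist_eq_norm, sub_zero, zero_add, h2M, gronwallBound_zero_eq] at this
  exact this.trans (le_of_eq (by ring))

end ParameterODE

/-! ### Generic real analytic level sets -/

section CRDerivative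

variable {E : Type} [NormedAddCommGroup E] [NormedSpace ℂ E] {k : ℕ}

/-- The inclusion `ℝᵏ → ℂᵏ`. -/
def ofRealPi (k : ℕ) : (Fin k → ℝ) →L[ℝ] (Fin k → ℂ) :=
  ContinuousLinearMap.pi fun j => Complex.ofRealCLM.comp (ContinuousLinearMap.proj j)

/-- The complex linear map `v ↦ L v - i L (i v)` associated with a real linear map `L : E → ℝᵏ`,
as a function of `L`. -/
def complexPart (k : ℕ) : (E →L[ℝ] (Fin k → ℝ)) →L[ℝ] (E →L[ℝ] (Fin k → ℂ)) :=
  ContinuousLinearMap.compL ℝ E (Fin k → ℝ) (Fin k → ℂ) (ofRealPi k)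
    - (ContinuousLinearMap.compL ℝ E (Fin k → ℝ) (Fin k → ℂ)
        ((mulI (Fin k → ℂ)).comp (ofRealPi k))).comp
      ((ContinuousLinearMap.compL ℝ E E (Fin k → ℝ)).flip (mulI E))

/-- The complex linear map `2 ∂f = df - i df ∘ J`.  On the zero set of `f` its kernel is
`T M ∩ J T M`. -/
def crDeriv (f : E → (Fin k → ℝ)) (x : E) : E →L[ℝ] (Fin k → ℂ) := complexPart k (fderiv ℝ f x)

variable {f : E → (Fin k → ℝ)} {x : E}

theorem crDeriv_apply (v : E) (j : Fin k) :
    crDeriv f x v j = (fderiv ℝ f x v j : ℂ) - Complex.I * (fderiv ℝ f x (Complex.I • v) j : ℂ) :=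
  rfl

theorem crDeriv_smul_I (v : E) : crDeriv f x (Complex.I • v) = Complex.I • crDeriv f x v := by
  ext j
  rw [Pi.smul_apply, crDeriv_apply, crDeriv_apply, smul_smul, Complex.I_mul_I, neg_one_smul, map_neg,
    smul_eq_mul, mul_sub, ← mul_assoc, Complex.I_mul_I]
  simp; ring

/-- The kernel of `crDeriv f x` is the largest complex subspace of the kernel of `df`. -/
theorem crDeriv_eq_zero_iff {v : E} :
    crDeriv f x v = 0 ↔ fderiv ℝ f x v = 0 ∧ fderiv ℝ f x (Complex.I • v) = 0 := by
  constructor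
  · intro h
    constructor
    · ext j
      have := congrArg Complex.re (congrFun h j)
      rw [crDeriv_apply] at this
      simpa using this
    · ext j
      have := congrArg Complex.im (congrFun h j)
      rw [crDeriv_apply] at this
      simpa using this
  · rintro ⟨h1, h2⟩
    ext j
    rw [crDeriv_apply, h1, h2]; simp

theorem complex_smul_eq {G : Type} [AddCommGroup G] [Module ℂ G] (c : ℂ) (v : G) :
    c • v = c.re • v + c.im • (Complex.I • v) := by
  conv_lhs => rw [← Complex.re_add_im c, add_smul, mul_smul, Complex.coe_smul, Complex.coe_smul]

/-- `crDeriv f x` as a complex linear map. -/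
def crDerivₗ (f : E → (Fin k → ℝ)) (x : E) : E →ₗ[ℂ] (Fin k → ℂ) where
  toFun := crDeriv f x
  map_add' := map_add _
  map_smul' c v := by
    rw [complex_smul_eq c v, map_add, map_smul, map_smul, crDeriv_smul_I, RingHom.id_apply,
      complex_smul_eq c (crDeriv f x v)]

theorem fderiv_surjective_of_crDeriv (h : Function.Surjective (crDeriv f x)) :
    Function.Surjective (fderiv ℝ f x) := by
  intro c
  obtain ⟨v, hv⟩ := h fun j => (c j : ℂ)
  refine ⟨v, funext fun j => ?_⟩
  have := congrArg Complex.re (congrFun hv j)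
  rw [crDeriv_apply] at this
  simpa using this

/-- For a surjective `crDeriv f x`, the distribution has complex rank `dim E - k`. -/
theorem finrank_ker_crDerivₗ [FiniteDimensional ℂ E] (h : Function.Surjective (crDeriv f x)) :
    Module.finrank ℂ (LinearMap.ker (crDerivₗ f x)) + k = Module.finrank ℂ E := by
  have h1 := (crDerivₗ f x).finrank_range_add_finrank_ker
  have h2 : LinearMap.range (crDerivₗ f x) = ⊤ := LinearMap.range_eq_top.2 h
  rw [h2, finrank_top, Module.finrank_fin_fun] at h1
  omega

theorem contDiffOn_crDeriv {s : Set E} (hs : IsOpen s) (hf : ContDiffOn ℝ ω f s) :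
    ContDiffOn ℝ ω (crDeriv f) s :=
  (complexPart k).contDiff.comp_contDiffOn (hf.fderiv_of_isOpen hs (m := ω) (by simp))

/-- Projections `P x` onto the kernels of `crDeriv f x`, for `x` in an open set `U`, along the common
complement `R ℂᵏ`; at `q ∈ U` the map `R` is a right inverse of `crDeriv f q`. -/
structure IsCRFrame (f : E → (Fin k → ℝ)) (U : Set E) (q : E) (P : E → E →L[ℝ] E)
    (R : (Fin k → ℂ) →ₗ[ℂ] E) : Prop where
  isOpen : IsOpen U
  mem : q ∈ U
  contDiffOn : ContDiffOn ℝ ω P U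
  right_inv : ∀ c, crDeriv f q (R c) = c
  apply_R : ∀ x ∈ U, ∀ c, P x (R c) = 0
  crDeriv_apply : ∀ x ∈ U, ∀ v, crDeriv f x (P x v) = 0
  apply_of_mem_ker : ∀ x ∈ U, ∀ v, crDeriv f x v = 0 → P x v = v
  apply_apply : ∀ x ∈ U, ∀ y ∈ U, ∀ v, P x (P y v) = P x v
  smul_I : ∀ x ∈ U, ∀ v, P x (Complex.I • v) = Complex.I • P x v
  surjective : ∀ x ∈ U, Function.Surjective (crDeriv f x)

/-- Near a point with surjective `crDeriv f q` there is a real analytic family of complex linear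
projections onto the kernels, along the image of a fixed right inverse. -/
theorem exists_isCRFrame [FiniteDimensional ℂ E] {X : Set E} (hX : IsOpen X)
    (hf : ContDiffOn ℝ ω f X) {q : E} (hq : q ∈ X) (hs : Function.Surjective (crDeriv f q)) :
    ∃ U ⊆ X, ∃ P R, IsCRFrame f U q P R := by
  obtain ⟨R, hR⟩ := (crDerivₗ f q).exists_rightInverse_of_surjective (LinearMap.range_eq_top.2 hs)
  have hR' : ∀ c, crDeriv f q (R c) = c := fun c => LinearMap.congr_fun hR c
  set R' : (Fin k → ℂ) →L[ℝ] E := (LinearMap.toContinuousLinearMap R).restrictScalars ℝ with hR'd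
  have hRR : ∀ c, R' c = R c := fun c => rfl
  set T : E → ((Fin k → ℂ) →L[ℝ] (Fin k → ℂ)) := fun x => (crDeriv f x).comp R' with hT
  have hTc : ContDiffOn ℝ ω T X := (contDiffOn_crDeriv hX hf).clm_comp contDiffOn_const
  set U := X ∩ T ⁻¹' {a | IsUnit a} with hU
  have hUo : IsOpen U := hTc.continuousOn.isOpen_inter_preimage hX Units.isOpen
  have hTq : T q = 1 := by ext1 c; exact hR' c
  set B : E → ((Fin k → ℂ) →L[ℝ] (Fin k → ℂ)) := fun x => Ring.inverse (T x) with hB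
  have hBc : ContDiffOn ℝ ω B U := fun x hx => by
    obtain ⟨u, hu⟩ := hx.2
    have h1 : ContDiffAt ℝ ω Ring.inverse (T x) := by rw [← hu]; exact contDiffAt_ringInverse ℝ u
    exact (h1.comp x (hTc.contDiffAt (hX.mem_nhds hx.1))).contDiffWithinAt
  have hBT : ∀ x ∈ U, ∀ c, B x (T x c) = c := fun x hx c => by
    have := Ring.inverse_mul_cancel (T x) hx.2
    exact congrArg (fun A : (Fin k → ℂ) →L[ℝ] (Fin k → ℂ) => A c) this
  have hTB : ∀ x ∈ U, ∀ c, T x (B x c) = c := fun x hx c => by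
    have := Ring.mul_inverse_cancel (T x) hx.2
    exact congrArg (fun A : (Fin k → ℂ) →L[ℝ] (Fin k → ℂ) => A c) this
  have hTI : ∀ x c, T x (Complex.I • c) = Complex.I • T x c := fun x c => by
    change crDeriv f x (R (Complex.I • c)) = Complex.I • crDeriv f x (R c)
    rw [map_smul, crDeriv_smul_I]
  have hBI : ∀ x ∈ U, ∀ c, B x (Complex.I • c) = Complex.I • B x c := fun x hx c => by
    have h1 := hBT x hx (Complex.I • B x c)
    rwa [hTI, hTB x hx] at h1
  set P : E → E →L[ℝ] E := fun x =>
    ContinuousLinearMap.id ℝ E - R'.comp ((B x).comp (crDeriv f x)) with hP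
  have hPa : ∀ x v, P x v = v - R (B x (crDeriv f x v)) := fun _ _ => rfl
  have hPR : ∀ x ∈ U, ∀ c, P x (R c) = 0 := fun x hx c => by
    have := hBT x hx c
    change B x (crDeriv f x (R c)) = c at this
    rw [hPa, this, sub_self]
  refine ⟨U, Set.inter_subset_left, P, R, hUo, ⟨hq, by
    change IsUnit (T q); rw [hTq]; exact isUnit_one⟩, ?_, hR', hPR, fun x hx v => ?_,
    fun x hx v hv => ?_, fun x hx y hy v => ?_, fun x hx v => ?_, fun x hx c => ?_⟩
  · exact contDiffOn_const.sub (contDiffOn_const.clm_comp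
      (hBc.clm_comp ((contDiffOn_crDeriv hX hf).mono Set.inter_subset_left)))
  · have := hTB x hx (crDeriv f x v)
    change crDeriv f x (R _) = _ at this
    rw [hPa, map_sub, this, sub_self]
  · rw [hPa, hv, map_zero, map_zero, sub_zero]
  · rw [hPa y v, map_sub, hPR x hx, sub_zero]
  · rw [hPa, hPa, crDeriv_smul_I, hBI x hx, map_smul, smul_sub]
  · exact ⟨R (B x c), hTB x hx c⟩

end CRDerivative

section LevelSets

variable {d k : ℕ} {X : Set (Fin d → ℂ)} {f : (Fin d → ℂ) → (Fin k → ℝ)} {M : Set (Fin d → ℂ)}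

/-- `M` is the zero set in `X` of a real analytic map `f` whose complex differential is surjective
along `M`: a generic real analytic CR submanifold. -/
structure IsGenericLevelSet (X : Set (Fin d → ℂ)) (f : (Fin d → ℂ) → (Fin k → ℝ))
    (M : Set (Fin d → ℂ)) : Prop where
  isOpen : IsOpen X
  contDiffOn : ContDiffOn ℝ ω f X
  mem_iff : ∀ x, x ∈ M ↔ x ∈ X ∧ f x = 0
  surjective : ∀ x ∈ M, Function.Surjective (crDeriv f x)

namespace IsGenericLevelSet

variable (hM : IsGenericLevelSet X f M)
include hM

theorem subset : M ⊆ X := fun x hx => ((hM.mem_iff x).1 hx).1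

theorem contDiffAt {x : Fin d → ℂ} (hx : x ∈ X) : ContDiffAt ℝ ω f x :=
  hM.contDiffOn.contDiffAt (hM.isOpen.mem_nhds hx)

theorem exists_frame {q : Fin d → ℂ} (hq : q ∈ M) : ∃ U ⊆ X, ∃ P R, IsCRFrame f U q P R :=
  exists_isCRFrame hM.isOpen hM.contDiffOn (hM.subset hq) (hM.surjective q hq)

theorem isAnalyticSubmanifold : IsAnalyticSubmanifold ℝ M := by
  refine ⟨k, fun p hp => ?_⟩
  obtain ⟨U, hUX, P, R, hU⟩ := hM.exists_frame hp
  refine ⟨U, hU.isOpen, hU.mem, f, fun x hx => (hM.contDiffAt (hUX hx)).analyticAt,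
    fun x hx => fderiv_surjective_of_crDeriv (hU.surjective x hx), ?_⟩
  ext x
  simp only [Set.mem_inter_iff, Set.mem_ofPred_eq, hM.mem_iff]
  exact ⟨fun h => ⟨h.2, h.1.2⟩, fun h => ⟨⟨hUX h.1, h.2⟩, h.1⟩⟩

theorem fderiv_eq_zero_of_mem_tangentVectors {x v : Fin d → ℂ} (hx : x ∈ M)
    (hv : v ∈ tangentVectors M x) : fderiv ℝ f x v = 0 := by
  obtain ⟨γ, h0, hγM, hγ⟩ := hv
  have hf : HasFDerivAt f (fderiv ℝ f x) (γ 0) := by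
    rw [h0]; exact ((hM.contDiffAt (hM.subset hx)).differentiableAt (by simp)).hasFDerivAt
  have h1 := hf.comp_hasDerivAt (0 : ℝ) hγ
  have h2 : (f ∘ γ) =ᶠ[𝓝 0] fun _ => 0 := hγM.mono fun t ht => ((hM.mem_iff _).1 ht).2
  exact h1.unique ((hasDerivAt_const (0 : ℝ) (0 : Fin k → ℝ)).congr_of_eventuallyEq h2)

/-- Vectors in the kernel of `df` are tangent to the level set, by the implicit function theorem. -/
theorem mem_tangentVectors {x v : Fin d → ℂ} (hx : x ∈ M) (hv : fderiv ℝ f x v = 0) :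
    v ∈ tangentVectors M x := by
  have hst : HasStrictFDerivAt f (fderiv ℝ f x) x :=
    (hM.contDiffAt (hM.subset hx)).hasStrictFDerivAt (by simp)
  have hsurj : (fderiv ℝ f x).range = ⊤ :=
    LinearMap.range_eq_top.2 (fderiv_surjective_of_crDeriv (hM.surjective x hx))
  have hfx : f x = 0 := ((hM.mem_iff x).1 hx).2
  set w : (fderiv ℝ f x).ker := ⟨v, hv⟩ with hw
  set g := hst.implicitFunction f _ hsurj (f x) with hg
  have hline : HasDerivAt (fun t : ℝ => t • w) w 0 := by
    have := (hasDerivAt_id (0 : ℝ)).smul_const w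
    rwa [one_smul] at this
  have hgd : HasDerivAt (fun t : ℝ => g (t • w)) v 0 := by
    have h1 : HasFDerivAt g (fderiv ℝ f x).ker.subtypeL ((0 : ℝ) • w) := by
      rw [zero_smul]; exact (hst.to_implicitFunction hsurj).hasFDerivAt
    exact h1.comp_hasDerivAt (f := fun t : ℝ => t • w) 0 hline
  have hg0 : g ((0 : ℝ) • w) = x := by rw [zero_smul]; exact hst.implicitFunction_apply_image hsurj
  refine ⟨fun t => g (t • w), hg0, ?_, hgd⟩
  have ht0 : Filter.Tendsto (fun t : ℝ => t • w) (𝓝 0) (𝓝 0) := by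
    have := hline.continuousAt.tendsto
    rwa [zero_smul] at this
  have h1 : ∀ᶠ t : ℝ in 𝓝 0, f (g (t • w)) = f x :=
    ((tendsto_const_nhds (x := f x)).prodMk_nhds ht0).eventually (hst.map_implicitFunction_eq hsurj)
  have h2 : ∀ᶠ t : ℝ in 𝓝 0, g (t • w) ∈ X := by
    have h3 := hgd.continuousAt.tendsto
    rw [hg0] at h3
    exact h3.eventually (hM.isOpen.mem_nhds (hM.subset hx))
  filter_upwards [h1, h2] with t ht1 ht2
  exact (hM.mem_iff _).2 ⟨ht2, ht1.trans hfx⟩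

/-- The distribution `TM ∩ J TM` of a generic level set is the kernel of `crDeriv f`. -/
theorem mem_leviDistribution_iff {x v : Fin d → ℂ} (hx : x ∈ M) :
    v ∈ leviDistribution M x ↔ crDeriv f x v = 0 := by
  rw [crDeriv_eq_zero_iff]
  constructor
  · rintro ⟨h1, w, hw, rfl⟩
    refine ⟨hM.fderiv_eq_zero_of_mem_tangentVectors hx h1, ?_⟩
    have := hM.fderiv_eq_zero_of_mem_tangentVectors hx hw
    simp only [smul_smul, Complex.I_mul_I, neg_one_smul, map_neg, this, neg_zero]
  · rintro ⟨h1, h2⟩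
    refine ⟨hM.mem_tangentVectors hx h1, -(Complex.I • v), hM.mem_tangentVectors hx ?_, ?_⟩
    · rw [map_neg, h2, neg_zero]
    · simp only [smul_neg, smul_smul, Complex.I_mul_I, neg_one_smul, neg_neg]

theorem leviDistribution_eq {x : Fin d → ℂ} (hx : x ∈ M) :
    leviDistribution M x = (LinearMap.ker (crDerivₗ f x) : Set (Fin d → ℂ)) := by
  ext v
  exact hM.mem_leviDistribution_iff hx

/-- The projections of a fixed basis of the kernel at `p` form a real analytic frame near `p`. -/
theorem isAnalyticDistribution : IsAnalyticDistribution M (leviDistribution M) := by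
  refine ⟨2 * (d - k), fun p hp => ?_⟩
  obtain ⟨U, hUX, P, R, hU⟩ := hM.exists_frame hp
  have hfr : Module.finrank ℝ (LinearMap.ker (crDerivₗ f p)) = 2 * (d - k) := by
    have := finrank_ker_crDerivₗ (hM.surjective p hp)
    rw [Module.finrank_fin_fun] at this
    rw [finrank_real_of_complex]; omega
  let b := Module.finBasisOfFinrankEq ℝ (LinearMap.ker (crDerivₗ f p)) hfr
  have hPpP : ∀ x ∈ U, ∀ v, crDeriv f p v = 0 → P p (P x v) = v := fun x hx v hv => by
    rw [hU.apply_apply p hU.mem x hx, hU.apply_of_mem_ker p hU.mem v hv]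
  refine ⟨U, hU.isOpen, hU.mem, fun i x => P x (b i), fun i x hx => ?_, fun x hx => ⟨?_, ?_⟩⟩
  · exact ((hU.contDiffOn.contDiffAt (hU.isOpen.mem_nhds hx)).clm_apply contDiffAt_const).analyticAt
  · have h1 : LinearIndependent ℝ fun i => ((b i : LinearMap.ker (crDerivₗ f p)) : Fin d → ℂ) :=
      b.linearIndependent.map' ((LinearMap.ker (crDerivₗ f p)).subtype.restrictScalars ℝ)
        (LinearMap.ker_eq_bot.2 Subtype.val_injective)
    refine LinearIndependent.of_comp (P p).toLinearMap ?_
    convert! h1 using 2 with i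
    exact hPpP x hx.2 _ (b i).2
  · rw [hM.leviDistribution_eq hx.1]
    refine Set.Subset.antisymm ?_ ?_
    · have : Submodule.span ℝ (Set.range fun i => P x (b i))
          ≤ (LinearMap.ker (crDerivₗ f x)).restrictScalars ℝ := by
        rw [Submodule.span_le]
        rintro _ ⟨i, rfl⟩
        exact hU.crDeriv_apply x hx.2 _
      exact this
    · intro w hw
      have hw' : crDeriv f x w = 0 := hw
      set v : LinearMap.ker (crDerivₗ f p) := ⟨P p w, hU.crDeriv_apply p hU.mem w⟩ with hv
      have h1 : w = P x v := by
        rw [hv, hU.apply_apply x hx.2 p hU.mem, hU.apply_of_mem_ker x hx.2 w hw']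
      have h2 : (v : Fin d → ℂ) = ∑ i, b.repr v i • ((b i : LinearMap.ker (crDerivₗ f p)) : Fin d → ℂ) := by
        refine (congrArg Subtype.val (b.sum_repr v)).symm.trans ?_
        rw [Submodule.coe_sum]
        rfl
      rw [h1, h2, map_sum]
      refine Submodule.sum_mem _ fun i _ => ?_
      rw [map_smul]
      exact Submodule.smul_mem _ _ (Submodule.subset_span ⟨i, rfl⟩)

end IsGenericLevelSet

end LevelSets

/-! ### Levi flat level sets -/

section LeviFlat

variable {d k : ℕ} {X : Set (Fin d → ℂ)} {f : (Fin d → ℂ) → (Fin k → ℝ)} {M : Set (Fin d → ℂ)}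

/-- The Levi form of the level set of `f` through `x` vanishes on the kernel of `crDeriv f x`. -/
def LeviVanishesAt (f : (Fin d → ℂ) → (Fin k → ℝ)) (x : Fin d → ℂ) : Prop :=
  ∀ u v, crDeriv f x u = 0 → crDeriv f x v = 0 →
    fderiv ℝ (fderiv ℝ f) x u (Complex.I • v) = fderiv ℝ (fderiv ℝ f) x v (Complex.I • u)

namespace IsGenericLevelSet

variable (hM : IsGenericLevelSet X f M)
include hM

theorem differentiableAt_fderiv {x : Fin d → ℂ} (hx : x ∈ X) :
    DifferentiableAt ℝ (fderiv ℝ f) x :=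
  ((hM.contDiffAt hx).fderiv_right (m := ω) (by simp)).differentiableAt (by simp)

/-- Differentiation of the identity `df(ζ) = 0` along a curve. -/
theorem fderiv_fderiv_of_curve {x u : Fin d → ℂ} (hx : x ∈ X) {ζ : (Fin d → ℂ) → (Fin d → ℂ)}
    (hζ : DifferentiableAt ℝ ζ x) {γ : ℝ → (Fin d → ℂ)} (h0 : γ 0 = x) (hγ : HasDerivAt γ u 0)
    (hζM : ∀ᶠ t in 𝓝 0, fderiv ℝ f (γ t) (ζ (γ t)) = 0) :
    fderiv ℝ (fderiv ℝ f) x u (ζ x) + fderiv ℝ f x (fderiv ℝ ζ x u) = 0 := by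
  have h1 : HasFDerivAt (fderiv ℝ f) (fderiv ℝ (fderiv ℝ f) x) (γ 0) := by
    rw [h0]; exact (hM.differentiableAt_fderiv hx).hasFDerivAt
  have h2 : HasFDerivAt ζ (fderiv ℝ ζ x) (γ 0) := by rw [h0]; exact hζ.hasFDerivAt
  have h3 := (h1.comp_hasDerivAt (0 : ℝ) hγ).clm_apply (h2.comp_hasDerivAt (0 : ℝ) hγ)
  have h4 : (fun t => (fderiv ℝ f ∘ γ) t ((ζ ∘ γ) t)) =ᶠ[𝓝 0] fun _ => 0 := hζM
  have h5 := h3.unique ((hasDerivAt_const (0 : ℝ) (0 : Fin k → ℝ)).congr_of_eventuallyEq h4)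
  simpa [h0] using h5

/-- Differentiation of the identity `df(ζ) = 0` along `M`. -/
theorem fderiv_fderiv_of_section {x u : Fin d → ℂ} (hx : x ∈ M) {ζ : (Fin d → ℂ) → (Fin d → ℂ)}
    (hζ : DifferentiableAt ℝ ζ x) (hζM : ∀ᶠ y in 𝓝 x, y ∈ M → fderiv ℝ f y (ζ y) = 0)
    (hu : u ∈ tangentVectors M x) :
    fderiv ℝ (fderiv ℝ f) x u (ζ x) + fderiv ℝ f x (fderiv ℝ ζ x u) = 0 := by
  obtain ⟨γ, h0, hγM, hγ⟩ := hu
  have hc : Filter.Tendsto γ (𝓝 0) (𝓝 x) := by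
    have := hγ.continuousAt.tendsto
    rwa [h0] at this
  exact hM.fderiv_fderiv_of_curve (hM.subset hx) hζ h0 hγ <| by
    filter_upwards [hγM, hc.eventually hζM] with t h5 h6
    exact h6 h5

/-- Where the Levi form vanishes, the bracket of two sections of the distribution is a section. -/
theorem crDeriv_lieBracket {x : Fin d → ℂ} (hx : x ∈ M) (hL : LeviVanishesAt f x)
    {ξ η : (Fin d → ℂ) → (Fin d → ℂ)} (hξ : DifferentiableAt ℝ ξ x) (hη : DifferentiableAt ℝ η x)
    (hξM : ∀ᶠ y in 𝓝 x, y ∈ M → crDeriv f y (ξ y) = 0)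
    (hηM : ∀ᶠ y in 𝓝 x, y ∈ M → crDeriv f y (η y) = 0) :
    crDeriv f x (VectorField.lieBracket ℝ ξ η x) = 0 := by
  have hJ : ∀ ζ : (Fin d → ℂ) → (Fin d → ℂ), DifferentiableAt ℝ ζ x → ∀ u,
      fderiv ℝ (fun y => Complex.I • ζ y) x u = Complex.I • fderiv ℝ ζ x u := fun ζ hζ u => by
    have h1 : HasFDerivAt (fun y => Complex.I • ζ y) (Complex.I • fderiv ℝ ζ x) x :=
      hζ.hasFDerivAt.const_smul Complex.I
    rw [h1.fderiv]; rfl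
  have hJd : ∀ ζ : (Fin d → ℂ) → (Fin d → ℂ), DifferentiableAt ℝ ζ x →
      DifferentiableAt ℝ (fun y => Complex.I • ζ y) x := fun ζ hζ => hζ.const_smul Complex.I
  have hξx := hξM.self_of_nhds hx
  have hηx := hηM.self_of_nhds hx
  have tξ := hM.mem_tangentVectors hx (crDeriv_eq_zero_iff.1 hξx).1
  have tη := hM.mem_tangentVectors hx (crDeriv_eq_zero_iff.1 hηx).1
  have e1 := hM.fderiv_fderiv_of_section hx hη
    (hηM.mono fun y hy h => (crDeriv_eq_zero_iff.1 (hy h)).1) tξ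
  have e2 := hM.fderiv_fderiv_of_section hx hξ
    (hξM.mono fun y hy h => (crDeriv_eq_zero_iff.1 (hy h)).1) tη
  have e3 := hM.fderiv_fderiv_of_section hx (hJd η hη)
    (hηM.mono fun y hy h => (crDeriv_eq_zero_iff.1 (hy h)).2) tξ
  have e4 := hM.fderiv_fderiv_of_section hx (hJd ξ hξ)
    (hξM.mono fun y hy h => (crDeriv_eq_zero_iff.1 (hy h)).2) tη
  rw [hJ η hη] at e3
  rw [hJ ξ hξ] at e4
  have hsymm : fderiv ℝ (fderiv ℝ f) x (ξ x) (η x) = fderiv ℝ (fderiv ℝ f) x (η x) (ξ x) :=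
    (hM.contDiffAt (hM.subset hx)).isSymmSndFDerivAt (by simp) _ _
  rw [crDeriv_eq_zero_iff, VectorField.lieBracket, smul_sub, map_sub, map_sub]
  constructor
  · rw [eq_neg_of_add_eq_zero_right e1, eq_neg_of_add_eq_zero_right e2, hsymm, sub_self]
  · rw [eq_neg_of_add_eq_zero_right e3, eq_neg_of_add_eq_zero_right e4, hL _ _ hξx hηx, sub_self]

/-- A generic level set with vanishing Levi form has an involutive distribution. -/
theorem isInvolutive (hL : ∀ x ∈ M, LeviVanishesAt f x) :
    IsInvolutive M (leviDistribution M) := by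
  intro U hU ξ η hξ hη hξM hηM x hx
  rw [hM.mem_leviDistribution_iff hx.1]
  refine hM.crDeriv_lieBracket hx.1 (hL x hx.1)
    ((hξ.contDiffAt (hU.mem_nhds hx.2)).differentiableAt (by simp))
    ((hη.contDiffAt (hU.mem_nhds hx.2)).differentiableAt (by simp)) ?_ ?_
  · filter_upwards [hU.mem_nhds hx.2] with y hy hyM
    exact (hM.mem_leviDistribution_iff hyM).1 (hξM y ⟨hyM, hy⟩)
  · filter_upwards [hU.mem_nhds hx.2] with y hy hyM
    exact (hM.mem_leviDistribution_iff hyM).1 (hηM y ⟨hyM, hy⟩)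

/-- The fields `x ↦ P x u` commute along `M`: their bracket is tangent to the distribution and has no
component in it, because `P q (P x u) = P q u` does not depend on `x`. -/
theorem fderiv_frame_comm {U : Set (Fin d → ℂ)} {q : Fin d → ℂ}
    {P : (Fin d → ℂ) → (Fin d → ℂ) →L[ℝ] (Fin d → ℂ)} {R : (Fin k → ℂ) →ₗ[ℂ] (Fin d → ℂ)}
    (hU : IsCRFrame f U q P R) {x : Fin d → ℂ} (hx : x ∈ M) (hxU : x ∈ U)
    (hL : LeviVanishesAt f x) (u v : Fin d → ℂ) :
    fderiv ℝ P x (P x u) v = fderiv ℝ P x (P x v) u := by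
  have hPd : DifferentiableAt ℝ P x :=
    (hU.contDiffOn.contDiffAt (hU.isOpen.mem_nhds hxU)).differentiableAt (by simp)
  have hd : ∀ w, HasFDerivAt (fun y => P y w) ((fderiv ℝ P x).flip w) x := fun w => by
    have := hPd.hasFDerivAt.clm_apply (hasFDerivAt_const w x)
    refine this.congr_fderiv ?_
    ext1 z; simp
  set z := VectorField.lieBracket ℝ (fun y => P y u) (fun y => P y v) x with hz
  have hzv : z = fderiv ℝ P x (P x u) v - fderiv ℝ P x (P x v) u := by
    rw [hz, VectorField.lieBracket, (hd u).fderiv, (hd v).fderiv]; rfl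
  have hsec : ∀ w, ∀ᶠ y in 𝓝 x, y ∈ M → crDeriv f y (P y w) = 0 := fun w => by
    filter_upwards [hU.isOpen.mem_nhds hxU] with y hy _
    exact hU.crDeriv_apply y hy w
  have hz0 : crDeriv f x z = 0 :=
    hM.crDeriv_lieBracket hx hL (hd u).differentiableAt (hd v).differentiableAt (hsec u) (hsec v)
  have hq : ∀ c w, P q (fderiv ℝ P x c w) = 0 := fun c w => by
    have h1 := (P q).hasFDerivAt.comp x (hd w)
    have h2 : (fun y => P q (P y w)) =ᶠ[𝓝 x] fun _ => P q w := by
      filter_upwards [hU.isOpen.mem_nhds hxU] with y hy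
      exact hU.apply_apply q hU.mem y hy w
    have h3 := h1.unique ((hasFDerivAt_const (P q w) x).congr_of_eventuallyEq h2)
    exact congrArg (fun A : (Fin d → ℂ) →L[ℝ] (Fin d → ℂ) => A c) h3
  have h4 : z = 0 := by
    rw [← hU.apply_of_mem_ker x hxU z hz0, ← hU.apply_apply x hxU q hU.mem, hzv, map_sub, hq, hq,
      sub_zero, map_zero]
  rw [hzv] at h4
  exact sub_eq_zero.1 h4

/-- The plaque through `q`, as the image of the map `a ↦ Y a 1` with differential `P (Y a 1)`: it
follows the trajectories of the fields `x ↦ P x a` from `q` for unit time. -/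
theorem exists_plaque_map {U : Set (Fin d → ℂ)} {q : Fin d → ℂ}
    {P : (Fin d → ℂ) → (Fin d → ℂ) →L[ℝ] (Fin d → ℂ)} {R : (Fin k → ℂ) →ₗ[ℂ] (Fin d → ℂ)}
    (hU : IsCRFrame f U q P R) (hUX : U ⊆ X) (hq : q ∈ M) (hL : ∀ x ∈ M, LeviVanishesAt f x)
    {r K : ℝ} (hr : 0 < r) (hT : IsTaylorBounded P q r K) (hrU : Metric.ball q r ⊆ U) :
    ∃ ρ > 0, ∃ Y : (Fin d → ℂ) → ℝ → (Fin d → ℂ), ∀ a ∈ Metric.ball (0 : Fin d → ℂ) ρ,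
      Y a 0 = q ∧ (∀ t ∈ Set.Icc (0 : ℝ) 1, HasDerivAt (Y a) (P (Y a t) a) t ∧
        Y a t ∈ M ∧ Y a t ∈ Metric.ball q (r / 2) ∧ P q (Y a t - q) = t • P q a) ∧
      HasFDerivAt (fun b => Y b 1) (P (Y a 1)) a := by
  have hK := hT.nonneg
  set ρ := min 1 (r / 4) / (2 * (K + 1)) with hρ
  have hρ0 : 0 < ρ := by positivity
  have hρ1 : ρ ≤ 1 := by
    rw [hρ, div_le_one (by positivity)]
    exact (min_le_left _ _).trans (by linarith)
  have hρr : ∀ a : Fin d → ℂ, ‖a‖ < ρ → (K + 1) * ‖a‖ < r / 4 := fun a ha => by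
    have h1 : (K + 1) * ρ = min 1 (r / 4) / 2 := by rw [hρ]; field_simp
    have h2 := min_le_right 1 (r / 4)
    have h3 : (K + 1) * ‖a‖ < (K + 1) * ρ := by gcongr
    linarith
  have hex : ∀ a : Fin d → ℂ, ∃ y : ℝ → (Fin d → ℂ), ‖a‖ < ρ →
      y 0 = q ∧ ∀ t ∈ Set.Icc (0 : ℝ) 1, HasDerivAt y (P (y t) a) t := fun a => by
    by_cases ha : ‖a‖ < ρ
    · obtain ⟨y, hy⟩ := hT.exists_trajectory (hρr a ha) hr
      exact ⟨y, fun _ => hy⟩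
    · exact ⟨fun _ => 0, fun h => absurd h ha⟩
  choose Y hY using hex
  have hYr : ∀ a, ‖a‖ < ρ → ∀ t ∈ Set.Icc (0 : ℝ) 1, Y a t ∈ Metric.ball q (r / 2) := by
    intro a ha t ht
    have h1 := hT.trajectory_bound ((hρr a ha).trans (by linarith)) hr (hY a ha).1 (hY a ha).2 t ht
    have h2 := hρr a ha
    have h3 : (K + 1) * ‖a‖ * t ≤ (K + 1) * ‖a‖ * 1 := by gcongr; exact ht.2
    rw [Metric.mem_ball, dist_eq_norm]
    linarith
  have hhalf : Metric.ball q (r / 2) ⊆ Metric.ball q r := Metric.ball_subset_ball (by linarith)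
  have hYM : ∀ a, ‖a‖ < ρ → ∀ t ∈ Set.Icc (0 : ℝ) 1, Y a t ∈ M := by
    intro a ha t ht
    have hYX : ∀ s ∈ Set.Icc (0 : ℝ) 1, Y a s ∈ X := fun s hs => hUX (hrU (hhalf (hYr a ha s hs)))
    have h1 := (convex_Icc (0 : ℝ) 1).norm_image_sub_le_of_norm_hasDerivWithin_le (C := 0)
      (f := fun s => f (Y a s)) (f' := fun _ => 0) (fun s hs => by
        have h2 := ((hM.contDiffAt (hYX s hs)).differentiableAt (by simp)).hasFDerivAt.comp_hasDerivAt
          s ((hY a ha).2 s hs)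
        rw [(crDeriv_eq_zero_iff.1 (hU.crDeriv_apply _ (hrU (hhalf (hYr a ha s hs))) a)).1] at h2
        exact h2.hasDerivWithinAt) (fun s _ => by simp) (x := 0) (by simp) ht
    rw [(hY a ha).1, ((hM.mem_iff q).1 hq).2, sub_zero, zero_mul] at h1
    exact (hM.mem_iff _).2 ⟨hYX t ht, norm_le_zero_iff.1 h1⟩
  have hYP : ∀ a, ‖a‖ < ρ → ∀ t ∈ Set.Icc (0 : ℝ) 1, P q (Y a t - q) = t • P q a := by
    intro a ha t ht
    have h1 := (convex_Icc (0 : ℝ) 1).norm_image_sub_le_of_norm_hasDerivWithin_le (C := 0)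
      (f := fun s => P q (Y a s - q) - s • P q a) (f' := fun _ => 0) (fun s hs => by
        have h2 := ((P q).hasFDerivAt.comp_hasDerivAt s (((hY a ha).2 s hs).sub_const q)).sub
          ((hasDerivAt_id s).smul_const (P q a))
        rw [hU.apply_apply q hU.mem _ (hrU (hhalf (hYr a ha s hs))), one_smul, sub_self] at h2
        exact h2.hasDerivWithinAt) (fun s _ => by simp) (x := 0) (by simp) ht
    rw [(hY a ha).1, sub_self, map_zero, zero_smul, sub_zero, sub_zero, zero_mul] at h1
    exact sub_eq_zero.1 (norm_le_zero_iff.1 h1)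
  refine ⟨ρ, hρ0, Y, fun a ha => ?_⟩
  rw [mem_ball_zero_iff] at ha
  refine ⟨(hY a ha).1, fun t ht => ⟨(hY a ha).2 t ht, hYM a ha t ht, hYr a ha t ht,
    hYP a ha t ht⟩, ?_⟩
  refine hasFDerivAt_of_quadratic_bound (r := ρ - ‖a‖) (by linarith)
    (K := (K * (K * 1) + 2 * K * (K * 1) ^ 2) * gronwallBound 0 (2 * K) 1 1) fun b hb => ?_
  have hab : ‖a + b‖ < ρ := (norm_add_le a b).trans_lt (by linarith)
  have hbρ : ‖b‖ < ρ := by linarith [norm_nonneg a]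
  have hv := hT.variation (a := a) (b := b) (C := 1) (y := Y a) (z := Y (a + b))
    (κ := fun t => t • b) (κ' := fun _ => b) (by linarith) (by linarith)
    (by have := hρr b hbρ; have := norm_nonneg b; linarith)
    (by rw [(hY a ha).1, (hY _ hab).1]) (zero_smul _ _) (hY a ha).2 (hY _ hab).2
    (fun t _ => by have := (hasDerivAt_id t).smul_const b; rwa [one_smul] at this)
    (hYr a ha) (fun t ht => hhalf (hYr _ hab t ht)) (fun t ht => by
      rw [norm_smul, Real.norm_of_nonneg ht.1]
      have := norm_nonneg b
      have := ht.2
      gcongr)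
    (fun t ht => by
      have hc := hM.fderiv_frame_comm hU (hYM a ha t ht) (hrU (hhalf (hYr a ha t ht)))
        (hL _ (hYM a ha t ht)) a b
      rw [map_smul, map_smul, map_smul, smul_apply, hc]
      abel)
  simp only [one_smul] at hv
  rw [sub_sub]
  exact hv

end IsGenericLevelSet

end LeviFlat

/-! ### Plaques and leaves of a Levi flat level set -/

section Leaves

variable {d k : ℕ} {X : Set (Fin d → ℂ)} {f : (Fin d → ℂ) → (Fin k → ℝ)} {M : Set (Fin d → ℂ)}

/-- A plaque of the foliation of a Levi flat level set: `a ↦ Y a 1` parametrizes it over the kernel of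
`crDeriv f q`, and `x ↦ P q (x - q)` is the inverse chart. -/
structure IsPlaque (f : (Fin d → ℂ) → (Fin k → ℝ)) (M U : Set (Fin d → ℂ)) (q : Fin d → ℂ)
    (P : (Fin d → ℂ) → (Fin d → ℂ) →L[ℝ] (Fin d → ℂ)) (Y : (Fin d → ℂ) → ℝ → (Fin d → ℂ))
    (ρ r : ℝ) : Prop where
  pos : 0 < ρ
  ball_subset : Metric.ball q r ⊆ U
  start : ∀ a ∈ Metric.ball (0 : Fin d → ℂ) ρ, Y a 0 = q
  hasDerivAt : ∀ a ∈ Metric.ball (0 : Fin d → ℂ) ρ, ∀ t ∈ Set.Icc (0 : ℝ) 1,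
    HasDerivAt (Y a) (P (Y a t) a) t
  mem : ∀ a ∈ Metric.ball (0 : Fin d → ℂ) ρ, ∀ t ∈ Set.Icc (0 : ℝ) 1, Y a t ∈ M
  mem_ball : ∀ a ∈ Metric.ball (0 : Fin d → ℂ) ρ, ∀ t ∈ Set.Icc (0 : ℝ) 1,
    Y a t ∈ Metric.ball q r
  apply_sub : ∀ a ∈ Metric.ball (0 : Fin d → ℂ) ρ, ∀ t ∈ Set.Icc (0 : ℝ) 1,
    P q (Y a t - q) = t • P q a
  hasFDerivAt : ∀ a ∈ Metric.ball (0 : Fin d → ℂ) ρ,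
    HasFDerivAt (fun b => Y b 1) (P (Y a 1)) a
  lipschitz : ∃ K, ∀ x ∈ Metric.ball q r, ∀ y ∈ Metric.ball q r, ‖P y - P x‖ ≤ K * ‖y - x‖

namespace IsPlaque

variable {U : Set (Fin d → ℂ)} {q : Fin d → ℂ}
    {P : (Fin d → ℂ) → (Fin d → ℂ) →L[ℝ] (Fin d → ℂ)} {R : (Fin k → ℂ) →ₗ[ℂ] (Fin d → ℂ)}
    {Y : (Fin d → ℂ) → ℝ → (Fin d → ℂ)} {ρ r : ℝ}

theorem one_mem : (1 : ℝ) ∈ Set.Icc (0 : ℝ) 1 := ⟨zero_le_one, le_rfl⟩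

/-- The plaque is the zero set of the holomorphic submersion `x ↦ crDeriv f q (x - Γ (P q (x - q)))`
for `Γ a = Y a 1`: its differential is complex linear, since the projections `P x` are. -/
theorem isAnalyticSubmanifold (hU : IsCRFrame f U q P R) (hP : IsPlaque f M U q P Y ρ r) :
    IsAnalyticSubmanifold ℂ {x | P q (x - q) ∈ Metric.ball 0 ρ ∧ Y (P q (x - q)) 1 = x} := by
  set N := {x | P q (x - q) ∈ Metric.ball 0 ρ} with hN
  have hNo : IsOpen N := Metric.isOpen_ball.preimage (f := fun x => P q (x - q)) (by fun_prop)
  set F : (Fin d → ℂ) → (Fin k → ℂ) := fun x => crDeriv f q (x - Y (P q (x - q)) 1) with hF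
  have hFd : ∀ x ∈ N, ∃ F' : (Fin d → ℂ) →L[ℂ] (Fin k → ℂ), HasFDerivAt F F' x ∧
      ∀ c, F' (R c) = c := fun x hx => by
    set y := Y (P q (x - q)) 1 with hy
    have hyU : y ∈ U := hP.ball_subset (hP.mem_ball _ hx 1 one_mem)
    let L : (Fin d → ℂ) →ₗ[ℂ] (Fin k → ℂ) :=
      { toFun := fun v => crDeriv f q (v - P y v)
        map_add' := fun u v => by
          rw [← map_add, map_add (P y), add_sub_add_comm]
        map_smul' := fun c v => by
          have h1 : P y (c • v) = c • P y v := by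
            rw [complex_smul_eq c v, map_add, ContinuousLinearMap.map_smul,
              ContinuousLinearMap.map_smul, hU.smul_I y hyU, complex_smul_eq c (P y v)]
          rw [RingHom.id_apply, h1, ← smul_sub]
          exact (crDerivₗ f q).map_smul c _ }
    refine ⟨LinearMap.toContinuousLinearMap L, ?_, fun c => ?_⟩
    · have h1 : HasFDerivAt (fun z => P q (z - q)) (P q) x :=
        (P q).hasFDerivAt.comp x ((hasFDerivAt_id x).sub_const q)
      have h2 := (hP.hasFDerivAt _ hx).comp x h1
      have h3 := (crDeriv f q).hasFDerivAt.comp x ((hasFDerivAt_id x).sub h2)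
      refine hasFDerivAt_of_restrictScalars ℝ h3 ?_
      ext1 v
      change crDeriv f q (v - P y v) = crDeriv f q (v - P y (P q v))
      rw [hU.apply_apply y hyU q hU.mem]
    · change crDeriv f q (R c - P y (R c)) = c
      rw [hU.apply_R y hyU, sub_zero, hU.right_inv]
  choose! F' hF' hF's using hFd
  refine ⟨k, fun p hp => ⟨N, hNo, hp.1, F, ?_, fun x hx c => ⟨R c, ?_⟩, ?_⟩⟩
  · exact DifferentiableOn.analyticOnNhd_of_finiteDimensional hNo
      fun x hx => (hF' x hx).differentiableAt.differentiableWithinAt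
  · rw [(hF' x hx).fderiv, hF's x hx]
  · ext x
    constructor
    · rintro ⟨⟨h1, h2⟩, -⟩
      refine ⟨h1, ?_⟩
      change crDeriv f q (x - Y (P q (x - q)) 1) = 0
      rw [h2, sub_self, map_zero]
    · rintro ⟨h1, h2⟩
      refine ⟨⟨h1, ?_⟩, h1⟩
      have h3 := hU.apply_of_mem_ker q hU.mem _ h2
      have h4 := hP.apply_sub _ h1 1 one_mem
      rw [one_smul, hU.apply_apply q hU.mem q hU.mem] at h4
      rw [← sub_sub_sub_cancel_right x _ q, map_sub, h4, sub_self, sub_sub_sub_cancel_right] at h3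
      exact (sub_eq_zero.1 h3.symm).symm

end IsPlaque

namespace IsGenericLevelSet

variable (hM : IsGenericLevelSet X f M)
include hM

/-- Through each point of a level set with vanishing Levi form there are arbitrarily small plaques. -/
theorem exists_isPlaque {U : Set (Fin d → ℂ)} {q : Fin d → ℂ}
    {P : (Fin d → ℂ) → (Fin d → ℂ) →L[ℝ] (Fin d → ℂ)} {R : (Fin k → ℂ) →ₗ[ℂ] (Fin d → ℂ)}
    (hU : IsCRFrame f U q P R) (hUX : U ⊆ X) (hq : q ∈ M) (hL : ∀ x ∈ M, LeviVanishesAt f x)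
    {O : Set (Fin d → ℂ)} (hO : IsOpen O) (hqO : q ∈ O) :
    ∃ r > 0, Metric.ball q r ⊆ O ∧ ∃ Y ρ, IsPlaque f M U q P Y ρ r := by
  obtain ⟨r₀, hr₀, K, hT⟩ := exists_isTaylorBounded
    ((hU.contDiffOn.contDiffAt (hU.isOpen.mem_nhds hU.mem)).of_le (by simp : (2 : ℕ∞ω) ≤ ω))
  obtain ⟨r₁, hr₁, hball⟩ := Metric.isOpen_iff.1 (hU.isOpen.inter hO) q ⟨hU.mem, hqO⟩
  set r := min r₀ r₁ with hr
  have hr0 : 0 < r := lt_min hr₀ hr₁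
  have hrb : Metric.ball q r ⊆ U ∩ O :=
    (Metric.ball_subset_ball (min_le_right _ _)).trans hball
  have hhalf : Metric.ball q (r / 2) ⊆ Metric.ball q r := Metric.ball_subset_ball (by linarith)
  have hTr := hT.mono (min_le_left r₀ r₁)
  obtain ⟨ρ, hρ, Y, hY⟩ := hM.exists_plaque_map hU hUX hq hL hr0 hTr
    (hrb.trans Set.inter_subset_left)
  refine ⟨r / 2, by linarith, hhalf.trans (hrb.trans Set.inter_subset_right), Y, ρ, hρ,
    hhalf.trans (hrb.trans Set.inter_subset_left), fun a ha => (hY a ha).1,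
    fun a ha t ht => ((hY a ha).2.1 t ht).1, fun a ha t ht => ((hY a ha).2.1 t ht).2.1,
    fun a ha t ht => ((hY a ha).2.1 t ht).2.2.1, fun a ha t ht => ((hY a ha).2.1 t ht).2.2.2,
    fun a ha => (hY a ha).2.2, K, fun x hx y hy => hTr.norm_sub_le (hhalf hx) (hhalf hy)⟩

variable {U : Set (Fin d → ℂ)} {q : Fin d → ℂ}
    {P : (Fin d → ℂ) → (Fin d → ℂ) →L[ℝ] (Fin d → ℂ)} {R : (Fin k → ℂ) →ₗ[ℂ] (Fin d → ℂ)}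
    {Y : (Fin d → ℂ) → ℝ → (Fin d → ℂ)} {ρ r : ℝ}

/-- A `C¹` curve tangent to the distribution that starts at `q` stays in the graph of the plaque,
because the curve and its image under the plaque map solve the same differential equation. -/
theorem leaf_subset_plaque (hU : IsCRFrame f U q P R) (hP : IsPlaque f M U q P Y ρ r)
    {x : Fin d → ℂ}
    (hx : x ∈ leaf (leviDistribution M)
      (M ∩ {x | x ∈ Metric.ball q r ∧ P q (x - q) ∈ Metric.ball 0 ρ}) q) :
    Y (P q (x - q)) 1 = x := by
  obtain ⟨γ, hγ, h0, h1, hγN⟩ := hx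
  obtain ⟨K, hK⟩ := hP.lipschitz
  rw [contDiffOn_one_iff_derivWithin (uniqueDiffOn_Icc_zero_one)] at hγ
  set δ := derivWithin γ (Set.Icc 0 1) with hδ
  obtain ⟨C, hC⟩ := isCompact_Icc.exists_bound_of_continuousOn hγ.2
  have hγd : ∀ t ∈ Set.Icc (0 : ℝ) 1, HasDerivWithinAt γ (P (γ t) (δ t)) (Set.Icc 0 1) t := by
    intro t ht
    have hNt := hγN t ht
    have := (hM.mem_leviDistribution_iff hNt.1.1).1 hNt.2
    rw [hU.apply_of_mem_ker _ (hP.ball_subset hNt.1.2.1) _ this]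
    exact (hγ.1 t ht).hasDerivWithinAt
  have hzd : ∀ t ∈ Set.Icc (0 : ℝ) 1, HasDerivWithinAt (fun s => Y (P q (γ s - q)) 1)
      (P (Y (P q (γ t - q)) 1) (δ t)) (Set.Icc 0 1) t := by
    intro t ht
    have hNt := hγN t ht
    have h2 := (P q).hasFDerivAt.comp_hasDerivWithinAt t ((hγd t ht).sub_const q)
    have h3 := (hP.hasFDerivAt _ hNt.1.2.2).comp_hasDerivWithinAt t h2
    refine h3.congr_deriv ?_
    have hm := hP.ball_subset (hP.mem_ball _ hNt.1.2.2 1 IsPlaque.one_mem)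
    rw [hU.apply_apply q hU.mem _ (hP.ball_subset hNt.1.2.1), hU.apply_apply _ hm q hU.mem]
  have hlip : ∀ t ∈ Set.Ico (0 : ℝ) 1, LipschitzOnWith (Real.toNNReal (|K| * C))
      (fun x => P x (δ t)) (Metric.ball q r) := by
    intro t ht
    have hCt := hC t ⟨ht.1, ht.2.le⟩
    refine LipschitzOnWith.of_dist_le_mul fun x hx y hy => ?_
    rw [Real.coe_toNNReal _ (by positivity [(norm_nonneg _).trans hCt]), dist_eq_norm, dist_eq_norm]
    have h2 : ‖P x (δ t) - P y (δ t)‖ ≤ (|K| * ‖x - y‖) * C :=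
      (P x - P y).le_of_opNorm_le_of_le ((hK y hy x hx).trans (by gcongr; exact le_abs_self K)) hCt
    exact h2.trans (le_of_eq (by ring))
  have hIci : ∀ {g : ℝ → (Fin d → ℂ)} {g' : Fin d → ℂ} {t : ℝ}, t ∈ Set.Ico (0 : ℝ) 1 →
      HasDerivWithinAt g g' (Set.Icc 0 1) t → HasDerivWithinAt g g' (Set.Ici t) t := by
    intro g g' t ht h
    exact h.mono_of_mem_nhdsWithin (Icc_mem_nhdsGE_of_mem ht)
  have hq0 : Y 0 1 = q := by
    have h0ρ : (0 : Fin d → ℂ) ∈ Metric.ball (0 : Fin d → ℂ) ρ := Metric.mem_ball_self hP.pos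
    have h2 := (convex_Icc (0 : ℝ) 1).norm_image_sub_le_of_norm_hasDerivWithin_le (C := 0)
      (f := Y 0) (f' := fun _ => 0) (fun s hs => by
        have h3 := hP.hasDerivAt 0 h0ρ s hs
        rw [map_zero] at h3
        exact h3.hasDerivWithinAt) (fun s _ => by simp) (x := 0) (y := 1) (by simp) (by simp)
    rw [hP.start 0 h0ρ, zero_mul] at h2
    exact sub_eq_zero.1 (norm_le_zero_iff.1 h2)
  have huniq := ODE_solution_unique_of_mem_Icc_right (v := fun t x => P x (δ t))
    (s := fun _ => Metric.ball q r) hlip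
    (f := fun s => Y (P q (γ s - q)) 1) (g := γ)
    (fun t ht => (hzd t ht).continuousWithinAt)
    (fun t ht => hIci ht (hzd t ⟨ht.1, ht.2.le⟩))
    (fun t ht => hP.mem_ball _ (hγN t ⟨ht.1, ht.2.le⟩).1.2.2 1 IsPlaque.one_mem)
    (fun t ht => (hγd t ht).continuousWithinAt)
    (fun t ht => hIci ht (hγd t ⟨ht.1, ht.2.le⟩))
    (fun t ht => (hγN t ⟨ht.1, ht.2.le⟩).1.2.1)
    (by simp only [h0, sub_self, map_zero, hq0])
  have := huniq IsPlaque.one_mem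
  simp only [h1] at this
  exact this

/-- A point of the plaque is joined to `q` by a trajectory of the field `x ↦ P x a`. -/
theorem plaque_subset_leaf (hU : IsCRFrame f U q P R) (hP : IsPlaque f M U q P Y ρ r)
    {x : Fin d → ℂ} (hx : P q (x - q) ∈ Metric.ball 0 ρ) (h : Y (P q (x - q)) 1 = x) :
    x ∈ leaf (leviDistribution M)
      (M ∩ {x | x ∈ Metric.ball q r ∧ P q (x - q) ∈ Metric.ball 0 ρ}) q := by
  set a := P q (x - q) with ha
  have hPa : P q a = a := hU.apply_apply q hU.mem q hU.mem _
  have hd := hP.hasDerivAt a hx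
  have hdw : ∀ t ∈ Set.Icc (0 : ℝ) 1, derivWithin (Y a) (Set.Icc 0 1) t = P (Y a t) a :=
    fun t ht => (hd t ht).hasDerivWithinAt.derivWithin (uniqueDiffOn_Icc_zero_one t ht)
  have hc : ContinuousOn (Y a) (Set.Icc 0 1) := fun t ht => (hd t ht).continuousAt.continuousWithinAt
  refine ⟨Y a, ?_, hP.start a hx, h, fun t ht => ⟨⟨hP.mem a hx t ht, hP.mem_ball a hx t ht, ?_⟩, ?_⟩⟩
  · rw [contDiffOn_one_iff_derivWithin uniqueDiffOn_Icc_zero_one]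
    refine ⟨fun t ht => (hd t ht).differentiableAt.differentiableWithinAt, ?_⟩
    refine ContinuousOn.congr ?_ hdw
    exact (hU.contDiffOn.continuousOn.comp hc
      fun t ht => hP.ball_subset (hP.mem_ball a hx t ht)).clm_apply continuousOn_const
  · rw [hP.apply_sub a hx t ht, hPa, mem_ball_zero_iff, norm_smul, Real.norm_of_nonneg ht.1]
    rw [mem_ball_zero_iff] at hx
    nlinarith [norm_nonneg a, ht.2]
  · rw [hdw t ht, hM.mem_leviDistribution_iff (hP.mem a hx t ht)]
    exact hU.crDeriv_apply _ (hP.ball_subset (hP.mem_ball a hx t ht)) a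

/-- In a suitable neighbourhood, the leaf through `q` is the plaque through `q`. -/
theorem leaf_eq_plaque (hU : IsCRFrame f U q P R) (hP : IsPlaque f M U q P Y ρ r) :
    leaf (leviDistribution M)
      (M ∩ {x | x ∈ Metric.ball q r ∧ P q (x - q) ∈ Metric.ball 0 ρ}) q
    = {x | P q (x - q) ∈ Metric.ball 0 ρ ∧ Y (P q (x - q)) 1 = x} := by
  ext x
  refine ⟨fun hx => ⟨?_, hM.leaf_subset_plaque hU hP hx⟩,
    fun hx => hM.plaque_subset_leaf hU hP hx.1 hx.2⟩
  obtain ⟨γ, -, -, h1, hγN⟩ := hx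
  have := (hγN 1 IsPlaque.one_mem).1.2.2
  rwa [h1] at this

/-- The plaque has the distribution as its tangent spaces. -/
theorem tangentVectors_plaque (hU : IsCRFrame f U q P R) (hP : IsPlaque f M U q P Y ρ r)
    {y : Fin d → ℂ} (hy : P q (y - q) ∈ Metric.ball 0 ρ) (h : Y (P q (y - q)) 1 = y) :
    tangentVectors {x | P q (x - q) ∈ Metric.ball 0 ρ ∧ Y (P q (x - q)) 1 = x} y
      = leviDistribution M y := by
  have hyM : y ∈ M := by rw [← h]; exact hP.mem _ hy 1 IsPlaque.one_mem
  have hyU : y ∈ U := hP.ball_subset (by rw [← h]; exact hP.mem_ball _ hy 1 IsPlaque.one_mem)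
  ext v
  rw [hM.mem_leviDistribution_iff hyM]
  constructor
  · rintro ⟨γ, h0, hγL, hγ⟩
    have h2 := (P q).hasFDerivAt.comp_hasDerivAt (0 : ℝ) (hγ.sub_const q)
    have h3 : HasFDerivAt (fun b => Y b 1) (P y) (P q (γ 0 - q)) := by
      rw [h0]
      have := hP.hasFDerivAt _ hy
      rwa [h] at this
    have h4 := h3.comp_hasDerivAt (0 : ℝ) h2
    rw [hU.apply_apply y hyU q hU.mem] at h4
    have h5 := h4.unique (hγ.congr_of_eventuallyEq (hγL.mono fun t ht => ht.2))
    rw [← h5]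
    exact hU.crDeriv_apply y hyU v
  · intro hv
    set a := P q (y - q) with ha
    have hPa : P q a = a := hU.apply_apply q hU.mem q hU.mem _
    have hl : HasDerivAt (fun t : ℝ => a + t • P q v) (P q v) 0 := by
      have := ((hasDerivAt_id (0 : ℝ)).smul_const (P q v)).const_add a
      rwa [one_smul] at this
    have hl0 : a + (0 : ℝ) • P q v = a := by rw [zero_smul, add_zero]
    refine ⟨fun t => Y (a + t • P q v) 1, ?_, ?_, ?_⟩
    · change Y (a + (0 : ℝ) • P q v) 1 = y
      rw [hl0, h]
    · have h2 := hl.continuousAt.tendsto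
      rw [hl0] at h2
      filter_upwards [h2.eventually (Metric.isOpen_ball.mem_nhds hy)] with t ht
      have h3 := hP.apply_sub _ ht 1 IsPlaque.one_mem
      rw [one_smul, map_add, map_smul, hPa, hU.apply_apply q hU.mem q hU.mem] at h3
      refine ⟨?_, ?_⟩
      · rw [h3]; exact ht
      · rw [h3]
    · have h2 : HasFDerivAt (fun b => Y b 1) (P y) (a + (0 : ℝ) • P q v) := by
        have := hP.hasFDerivAt _ hy
        rwa [h, ← hl0] at this
      have h3 := h2.comp_hasDerivAt (0 : ℝ) hl
      rwa [hU.apply_apply y hyU q hU.mem, hU.apply_of_mem_ker y hyU v hv] at h3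

/-- A generic level set whose Levi form vanishes is Levi flat. -/
theorem isLeviFlat (hL : ∀ x ∈ M, LeviVanishesAt f x) : IsLeviFlat M where
  distribution := hM.isAnalyticDistribution
  involutive := hM.isInvolutive hL
  leaves := by
    intro p _ q hq O hO hqO
    have hqM : q ∈ M := by
      obtain ⟨γ, -, -, h1, hγ⟩ := hq
      rw [← h1]; exact (hγ 1 IsPlaque.one_mem).1
    obtain ⟨U, hUX, P, R, hU⟩ := hM.exists_frame hqM
    obtain ⟨r, hr, hrO, Y, ρ, hP⟩ := hM.exists_isPlaque hU hUX hqM hL hO hqO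
    refine ⟨{x | x ∈ Metric.ball q r ∧ P q (x - q) ∈ Metric.ball 0 ρ}, ?_, ?_,
      fun x hx => hrO hx.1, ?_, ?_⟩
    · exact Metric.isOpen_ball.inter (Metric.isOpen_ball.preimage (f := fun x => P q (x - q))
        (by fun_prop))
    · refine ⟨Metric.mem_ball_self hr, ?_⟩
      rw [sub_self, map_zero]; exact Metric.mem_ball_self hP.pos
    · rw [hM.leaf_eq_plaque hU hP]
      exact hP.isAnalyticSubmanifold hU
    · rw [hM.leaf_eq_plaque hU hP]
      exact fun y hy => hM.tangentVectors_plaque hU hP hy.1 hy.2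

end IsGenericLevelSet

end Leaves

/-! ### Analytic continuation of the vanishing of the Levi form -/

section AnalyticContinuation

variable {d k : ℕ} {X : Set (Fin d → ℂ)} {f : (Fin d → ℂ) → (Fin k → ℝ)} {M : Set (Fin d → ℂ)}

namespace IsGenericLevelSet

variable (hM : IsGenericLevelSet X f M)
include hM

/-- A real analytic parametrization `ψ` of `M` near `p`, with the inverse chart `Ψ`.  The parameters
are taken in a ball of the whole space, on which `ψ` factors through a projection. -/
theorem exists_parametrization {p : Fin d → ℂ} (hp : p ∈ M) {N : Set (Fin d → ℂ)} (hN : N ∈ 𝓝 p) :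
    ∃ ε > 0, ∃ ψ Ψ : (Fin d → ℂ) → (Fin d → ℂ),
      (∀ w ∈ Metric.ball 0 ε, ContDiffAt ℝ ω ψ w ∧ ψ w ∈ M ∩ N) ∧
      ∀ᶠ x in 𝓝 p, x ∈ M → Ψ x ∈ Metric.ball 0 ε ∧ ψ (Ψ x) = x := by
  have hfp : f p = 0 := ((hM.mem_iff p).1 hp).2
  set L := fderiv ℝ f p with hLd
  have hLs : Function.Surjective L := fderiv_surjective_of_crDeriv (hM.surjective p hp)
  obtain ⟨R₀, hR₀⟩ := L.toLinearMap.exists_rightInverse_of_surjective (LinearMap.range_eq_top.2 hLs)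
  set R := LinearMap.toContinuousLinearMap R₀ with hR
  have hLR : ∀ c, L (R c) = c := fun c => LinearMap.congr_fun hR₀ c
  set Ψ : (Fin d → ℂ) → (Fin d → ℂ) := fun x => (x - p) + R (f x - L (x - p)) with hΨ
  have hLΨ : ∀ x, L (Ψ x) = f x := fun x => by
    rw [hΨ]; simp only [map_add, hLR]; abel
  have hΨp : Ψ p = 0 := by simp [hΨ, hfp]
  have hfc := hM.contDiffAt (hM.subset hp)
  have hΨc : ContDiffAt ℝ ω Ψ p :=
    (contDiffAt_id.sub contDiffAt_const).add (R.contDiff.contDiffAt.comp p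
      (hfc.sub (L.contDiff.contDiffAt.comp p (contDiffAt_id.sub contDiffAt_const))))
  have hΨd : HasFDerivAt Ψ
      ((ContinuousLinearEquiv.refl ℝ (Fin d → ℂ) : (Fin d → ℂ) →L[ℝ] (Fin d → ℂ))) p := by
    have h1 := (hasFDerivAt_id (𝕜 := ℝ) p).sub_const p
    have h2 := h1.add (R.hasFDerivAt.comp p
      ((hfc.differentiableAt (by simp)).hasFDerivAt.sub (L.hasFDerivAt.comp p h1)))
    refine h2.congr_fderiv ?_
    ext1 v
    change v + R (L v - L v) = v
    rw [sub_self, map_zero, add_zero]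
  have hΨs : HasStrictFDerivAt Ψ
      ((ContinuousLinearEquiv.refl ℝ (Fin d → ℂ) : (Fin d → ℂ) →L[ℝ] (Fin d → ℂ))) p :=
    hΨc.hasStrictFDerivAt' hΨd (by simp)
  set Φ := hΨs.localInverse Ψ _ p with hΦ
  have hΦc : ContDiffAt ℝ ω Φ 0 := by
    have := hΨc.to_localInverse hΨd (by simp)
    rwa [hΨp] at this
  have hΦ0 : Φ 0 = p := by
    have := hΨs.localInverse_apply_image
    rwa [hΨp] at this
  have hΨΦ : ∀ᶠ w in 𝓝 0, Ψ (Φ w) = w := by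
    have := hΨs.eventually_right_inverse
    rwa [hΨp] at this
  have hΦΨ : ∀ᶠ x in 𝓝 p, Φ (Ψ x) = x := hΨs.eventually_left_inverse
  set π : (Fin d → ℂ) →L[ℝ] (Fin d → ℂ) := ContinuousLinearMap.id ℝ (Fin d → ℂ) - R.comp L with hπ
  have hLπ : ∀ w, L (π w) = 0 := fun w => by
    change L (w - R (L w)) = 0
    rw [map_sub, hLR, sub_self]
  have hπk : ∀ w, L w = 0 → π w = w := fun w hw => by
    change w - R (L w) = w
    rw [hw, map_zero, sub_zero]
  have hπt : Filter.Tendsto π (𝓝 0) (𝓝 0) := by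
    have := π.continuous.tendsto 0
    rwa [map_zero] at this
  have hΦt : Filter.Tendsto Φ (𝓝 0) (𝓝 p) := by
    have := hΦc.continuousAt.tendsto
    rwa [hΦ0] at this
  have hXp : X ∩ N ∈ 𝓝 p := Filter.inter_mem (hM.isOpen.mem_nhds (hM.subset hp)) hN
  have hev : ∀ᶠ w in 𝓝 0, ContDiffAt ℝ ω Φ w ∧ Ψ (Φ w) = w ∧ Φ w ∈ X ∩ N :=
    (hΦc.eventually (by simp)).and (hΨΦ.and (hΦt.eventually hXp))
  obtain ⟨ε, hε, hball⟩ := Metric.eventually_nhds_iff_ball.1 (hπt.eventually hev)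
  refine ⟨ε, hε, fun w => Φ (π w), Ψ, fun w hw => ?_, ?_⟩
  · obtain ⟨h1, h2, h3⟩ := hball w hw
    refine ⟨h1.comp w π.contDiff.contDiffAt, (hM.mem_iff _).2 ⟨h3.1, ?_⟩, h3.2⟩
    rw [← hLΨ, h2, hLπ]
  · have hΨt : Filter.Tendsto Ψ (𝓝 p) (𝓝 0) := by
      have := hΨc.continuousAt.tendsto
      rwa [hΨp] at this
    filter_upwards [hΨt.eventually (Metric.ball_mem_nhds 0 hε), hΦΨ] with x h1 h2 hx
    refine ⟨h1, ?_⟩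
    rw [hπk, h2]
    rw [hLΨ, ((hM.mem_iff x).1 hx).2]

/-- Near each point of `M` the Levi form vanishes identically or has nowhere dense zero set: in a real
analytic parametrization of `M`, its coefficients with respect to an analytic frame of the
distribution are real analytic functions on a ball. -/
theorem eventually_leviVanishesAt_or {p : Fin d → ℂ} (hp : p ∈ M) :
    ∃ N ∈ 𝓝 p, (∃ x ∈ N, x ∈ M ∧ ∀ᶠ y in 𝓝 x, y ∈ M → LeviVanishesAt f y) →
      ∀ y ∈ N, y ∈ M → LeviVanishesAt f y := by
  obtain ⟨U, hUX, P, R, hU⟩ := hM.exists_frame hp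
  obtain ⟨ε, hε, ψ, Ψ, hψ, hΨ⟩ := hM.exists_parametrization hp (hU.isOpen.mem_nhds hU.mem)
  refine ⟨_, hΨ, ?_⟩
  rintro ⟨x, hxN, hxM, hx⟩ y hyN hyM
  obtain ⟨hxε, hψx⟩ := hxN hxM
  obtain ⟨hyε, hψy⟩ := hyN hyM
  set Q : (Fin d → ℂ) → (Fin d → ℂ) → (Fin d → ℂ) → (Fin k → ℝ) := fun u v x =>
    fderiv ℝ (fderiv ℝ f) x (P x u) (Complex.I • P x v)
      - fderiv ℝ (fderiv ℝ f) x (P x v) (Complex.I • P x u) with hQ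
  have hQc : ∀ u v, ∀ x ∈ U, ContDiffAt ℝ ω (Q u v) x := fun u v x hx => by
    have h1 : ContDiffAt ℝ ω (fderiv ℝ (fderiv ℝ f)) x :=
      ((hM.contDiffAt (hUX hx)).fderiv_right (m := ω) (by simp)).fderiv_right (m := ω) (by simp)
    have h2 : ∀ w, ContDiffAt ℝ ω (fun y => P y w) x := fun w =>
      (hU.contDiffOn.contDiffAt (hU.isOpen.mem_nhds hx)).clm_apply contDiffAt_const
    exact ((h1.clm_apply (h2 u)).clm_apply ((h2 v).const_smul _)).sub
      ((h1.clm_apply (h2 v)).clm_apply ((h2 u).const_smul _))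
  have hQ0 : ∀ u v, ∀ x ∈ U, LeviVanishesAt f x → Q u v x = 0 := fun u v x hx hL =>
    sub_eq_zero.2 (hL _ _ (hU.crDeriv_apply x hx u) (hU.crDeriv_apply x hx v))
  have han : ∀ u v, AnalyticOnNhd ℝ (fun w => Q u v (ψ w)) (Metric.ball 0 ε) := fun u v w hw =>
    ((hQc u v _ (hψ w hw).2.2).comp w (hψ w hw).1).analyticAt
  intro u v hu hv
  have hz : (fun w => Q u v (ψ w)) =ᶠ[𝓝 (Ψ x)] 0 := by
    have hc := (hψ _ hxε).1.continuousAt.tendsto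
    rw [hψx] at hc
    filter_upwards [hc.eventually hx, Metric.isOpen_ball.mem_nhds hxε] with w h1 h2
    exact hQ0 u v _ (hψ w h2).2.2 (h1 (hψ w h2).2.1)
  have h0 := (han u v).eqOn_zero_of_preconnected_of_eventuallyEq_zero
    (convex_ball _ _).isPreconnected hxε hz hyε
  have hyU : y ∈ U := by rw [← hψy]; exact (hψ _ hyε).2.2
  simp only [hψy, hQ, hU.apply_of_mem_ker y hyU u hu, hU.apply_of_mem_ker y hyU v hv] at h0
  exact sub_eq_zero.1 h0

/-- Analytic continuation: on a connected generic level set the Levi form vanishes identically once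
it vanishes near one point. -/
theorem leviVanishesAt_of_eventually (hc : IsPreconnected M) {x₀ : Fin d → ℂ} (hx₀ : x₀ ∈ M)
    (h : ∀ᶠ x in 𝓝 x₀, x ∈ M → LeviVanishesAt f x) : ∀ x ∈ M, LeviVanishesAt f x := by
  set u := {x | ∀ᶠ y in 𝓝 x, y ∈ M → LeviVanishesAt f y} with hu
  set v := {x | ∀ᶠ y in 𝓝 x, y ∈ M → y ∉ u} with hv
  have huo : IsOpen u := isOpen_setOfPred_eventually_nhds
  have hvo : IsOpen v := isOpen_setOfPred_eventually_nhds
  have hcov : M ⊆ u ∪ v := fun p hp => by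
    obtain ⟨N, hN, hd⟩ := hM.eventually_leviVanishesAt_or hp
    by_cases hx : ∃ x ∈ N, x ∈ M ∧ ∀ᶠ y in 𝓝 x, y ∈ M → LeviVanishesAt f y
    · exact Or.inl (Filter.mem_of_superset hN fun y hy => hd hx y hy)
    · exact Or.inr (Filter.mem_of_superset hN fun y hy hyM hyu => hx ⟨y, hy, hyM, hyu⟩)
  have hdis : M ∩ (u ∩ v) = ∅ := by
    rw [Set.eq_empty_iff_forall_notMem]
    rintro x ⟨hx, hxu, hxv⟩
    exact hxv.self_of_nhds hx hxu
  rcases isPreconnected_iff_subset_of_disjoint.1 hc u v huo hvo hcov hdis with h1 | h1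
  · exact fun x hx => (h1 hx).self_of_nhds hx
  · exact absurd h ((h1 hx₀).self_of_nhds hx₀)

end IsGenericLevelSet

end AnalyticContinuation

/-! ### Exponential coordinates of a Lie algebra of vector fields -/

section ExponentialCoordinates

/-- The solution `K` of `K' = 1 + C K`, `K 0 = 0`, that is `K t = ∫₀ᵗ exp (s C) ds`. -/
theorem exists_integral_exp {A : Type} [NormedRing A] [NormedAlgebra ℝ A] [CompleteSpace A] (C : A) :
    ∃ K : ℝ → A, K 0 = 0 ∧ ∀ t, HasDerivAt K (1 + C * K t) t := by
  have hc : Continuous fun t : ℝ => NormedSpace.exp (t • C) :=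
    continuous_iff_continuousAt.2 fun t => (hasDerivAt_exp_smul_const' C t).continuousAt
  set K : ℝ → A := fun t => ∫ s in (0 : ℝ)..t, NormedSpace.exp (s • C) with hK
  have hKd : ∀ t, HasDerivAt K (NormedSpace.exp (t • C)) t := fun t =>
    intervalIntegral.integral_hasDerivAt_right (hc.intervalIntegrable _ _)
      (hc.stronglyMeasurableAtFilter _ _) hc.continuousAt
  have hK0 : K 0 = 0 := intervalIntegral.integral_same
  have hd : ∀ t, HasDerivAt (fun t => C * K t - NormedSpace.exp (t • C)) 0 t := fun t => by
    have h1 := ((hKd t).const_mul C).sub (hasDerivAt_exp_smul_const' C t)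
    rwa [sub_self] at h1
  refine ⟨K, hK0, fun t => ?_⟩
  have h1 := is_const_of_deriv_eq_zero (fun t => (hd t).differentiableAt) (fun t => (hd t).deriv) t 0
  rw [hK0, mul_zero, zero_smul, NormedSpace.exp_zero, zero_sub, sub_eq_iff_eq_add] at h1
  have h2 : (1 : A) + C * K t = NormedSpace.exp (t • C) := by rw [h1]; abel
  rw [h2]
  exact hKd t

/-- The solution of `K' = 1 + C K`, `K 0 = 0` is close to `t` for small `C`, by Gronwall's inequality. -/
theorem norm_sub_smul_one_le {A : Type} [NormedRing A] [NormedAlgebra ℝ A] [NormOneClass A] {C : A}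
    (hC : ‖C‖ ≤ 1) {K : ℝ → A} (hK0 : K 0 = 0) (hK : ∀ t, HasDerivAt K (1 + C * K t) t) :
    ∀ t ∈ Set.Icc (0 : ℝ) 1, ‖K t - t • 1‖ ≤ 2 * ‖C‖ := by
  intro t ht
  have hd : ∀ t, HasDerivAt (fun t => K t - t • (1 : A)) (C * K t) t := fun t => by
    have h1 := (hK t).sub ((hasDerivAt_id t).smul_const (1 : A))
    rw [one_smul, add_sub_cancel_left] at h1
    exact h1
  have hb := norm_le_gronwallBound_of_norm_deriv_right_le (f := fun t => K t - t • (1 : A))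
    (f' := fun t => C * K t) (δ := 0) (K := 1) (ε := ‖C‖) (a := 0) (b := 1)
    (fun t _ => (hd t).continuousAt.continuousWithinAt) (fun t _ => (hd t).hasDerivWithinAt)
    (by simp [hK0]) (fun s hs => by
      have h1 : C * K s = C * (K s - s • (1 : A)) + s • C := by
        rw [mul_sub, mul_smul_comm, mul_one]; abel
      have h2 : ‖C * (K s - s • (1 : A))‖ ≤ 1 * ‖K s - s • (1 : A)‖ :=
        (norm_mul_le _ _).trans (by gcongr)
      have h3 : ‖s • C‖ ≤ ‖C‖ := by
        rw [norm_smul, Real.norm_of_nonneg hs.1]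
        exact mul_le_of_le_one_left (norm_nonneg _) hs.2.le
      rw [h1]
      exact (norm_add_le _ _).trans (add_le_add h2 h3)) t ht
  refine hb.trans ?_
  rw [sub_zero]
  refine (gronwallBound_mono le_rfl (norm_nonneg _) zero_le_one ht.2).trans ?_
  rw [gronwallBound_of_K_ne_0 one_ne_zero]
  have h1 : Real.exp 1 < 3 := Real.exp_one_lt_d9.trans (by norm_num)
  have := norm_nonneg C
  norm_num
  nlinarith

variable {E P : Type} [NormedAddCommGroup E] [NormedSpace ℂ E] [NormedAddCommGroup P]
  [NormedSpace ℝ P]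

/-- The vector fields `x ↦ V x b` on `X` depend linearly on `b`, are holomorphic, and form a Lie
algebra with bracket `br`. -/
structure IsFieldAlgebra (X : Set E) (V : E → P →L[ℝ] E) (br : P →L[ℝ] P →L[ℝ] P) : Prop where
  isOpen : IsOpen X
  contDiffOn : ContDiffOn ℝ ω V X
  smul_I : ∀ x ∈ X, ∀ u b, fderiv ℝ V x (Complex.I • u) b = Complex.I • fderiv ℝ V x u b
  bracket : ∀ x ∈ X, ∀ a b, fderiv ℝ V x (V x b) a - fderiv ℝ V x (V x a) b = V x (br a b)

namespace IsFieldAlgebra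

variable {X : Set E} {V : E → P →L[ℝ] E} {br : P →L[ℝ] P →L[ℝ] P} (hV : IsFieldAlgebra X V br)
include hV

theorem contDiffAt {x : E} (hx : x ∈ X) : ContDiffAt ℝ ω V x :=
  hV.contDiffOn.contDiffAt (hV.isOpen.mem_nhds hx)

theorem hasFDerivAt {x : E} (hx : x ∈ X) : HasFDerivAt V (fderiv ℝ V x) x :=
  ((hV.contDiffAt hx).differentiableAt (by simp)).hasFDerivAt

/-- If the fields span a complex subspace at one point of a trajectory, then they do so along the
trajectory, because the flow is holomorphic and preserves the Lie algebra. -/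
theorem smul_I_mem_of_trajectory [CompleteSpace P] {a : P} {y : ℝ → E}
    (hy : ∀ t ∈ Set.Icc (0 : ℝ) 1, HasDerivAt y (V (y t) a) t ∧ y t ∈ X)
    (h0 : ∀ b, ∃ c, Complex.I • V (y 0) b = V (y 0) c) :
    ∀ b, ∃ c, Complex.I • V (y 1) b = V (y 1) c := by
  set C := br a with hC
  set e : ℝ → P →L[ℝ] P := fun t => NormedSpace.exp (t • C) with he
  have hed : ∀ t, HasDerivAt e (C * e t) t := fun t => hasDerivAt_exp_smul_const' C t
  have hyc : ContinuousOn y (Set.Icc 0 1) := fun t ht =>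
    (hy t ht).1.continuousAt.continuousWithinAt
  have hDc : ContinuousOn (fun t => (fderiv ℝ V (y t)).flip a) (Set.Icc 0 1) := by
    have h1 : ContinuousOn (fderiv ℝ V) X :=
      (hV.contDiffOn.fderiv_of_isOpen hV.isOpen (m := ω) (by simp)).continuousOn
    have h2 : Continuous fun A : E →L[ℝ] P →L[ℝ] E => A.flip a :=
      (ContinuousLinearMap.flipₗᵢ ℝ E P E).continuous.clm_apply continuous_const
    exact h2.comp_continuousOn (h1.comp hyc fun t ht => (hy t ht).2)
  obtain ⟨K, hK⟩ := isCompact_Icc.exists_bound_of_continuousOn hDc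
  -- `t ↦ V (y t) (exp (t C) b)` is transported by the differential of the flow
  have hG : ∀ b, ∀ t ∈ Set.Icc (0 : ℝ) 1, HasDerivAt (fun t => V (y t) (e t b))
      (fderiv ℝ V (y t) (V (y t) (e t b)) a) t := fun b t ht => by
    have h1 := ((hV.hasFDerivAt (hy t ht).2).comp_hasDerivAt t (hy t ht).1).clm_apply
      ((hed t).clm_apply (hasDerivAt_const t b))
    refine h1.congr_deriv ?_
    have h2 := hV.bracket _ (hy t ht).2 a (e t b)
    rw [map_zero, add_zero, sub_eq_iff_eq_add.1 h2, add_comm]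
    rfl
  have hinv : ∀ t b, e t (NormedSpace.exp (-(t • C)) b) = b := fun t b => by
    let _ : NormedAlgebra ℚ (P →L[ℝ] P) := .restrictScalars ℚ ℝ (P →L[ℝ] P)
    have h1 : NormedSpace.exp (t • C) * NormedSpace.exp (-(t • C)) = 1 := by
      rw [← NormedSpace.exp_add_of_commute ((Commute.refl _).neg_right), add_neg_cancel,
        NormedSpace.exp_zero]
    exact congrArg (fun A : P →L[ℝ] P => A b) h1
  have he0 : ∀ b, e 0 b = b := fun b => by
    simp only [he, zero_smul, NormedSpace.exp_zero]; rfl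
  intro b
  set b' := NormedSpace.exp (-((1 : ℝ) • C)) b with hb'
  obtain ⟨c, hc⟩ := h0 b'
  have hzero := eq_zero_of_abs_deriv_le_mul_abs_self_of_eq_zero_right (K := K) (a := 0) (b := 1)
    (f := fun t => Complex.I • V (y t) (e t b') - V (y t) (e t c))
    (f' := fun t => fderiv ℝ V (y t) (Complex.I • V (y t) (e t b') - V (y t) (e t c)) a)
    (fun t ht => (((hG b' t ht).continuousAt.const_smul _).sub
      (hG c t ht).continuousAt).continuousWithinAt)
    (fun t ht => by
      have ht' : t ∈ Set.Icc (0 : ℝ) 1 := ⟨ht.1, ht.2.le⟩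
      have h1 := ((hG b' t ht').const_smul Complex.I).sub (hG c t ht')
      rw [← hV.smul_I _ (hy t ht').2] at h1
      refine (h1.congr_deriv ?_).hasDerivWithinAt
      rw [map_sub]; rfl)
    (by simp only [he0, hc, sub_self])
    (fun t ht => ((fderiv ℝ V (y t)).flip a).le_of_opNorm_le (hK t ⟨ht.1, ht.2.le⟩) _) 1 (by simp)
  refine ⟨e 1 c, ?_⟩
  have h1 := sub_eq_zero.1 hzero
  rwa [hb', hinv] at h1

/-- The exponential map `a ↦ y a 1` at `x₀` has the differential `V ∘ T` with a surjective `T`.  In the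
frame `V` the variational equation along a trajectory has the constant coefficients
`κ' = b + [a, κ]`, so that `T a = ∫₀¹ exp (s ad a) ds` up to the sign convention of the bracket. -/
theorem exists_hasFDerivAt_exp [CompleteSpace P] {x₀ : E} (hx₀ : x₀ ∈ X) {y : P → ℝ → E}
    (hy0 : ∀ a, y a 0 = x₀)
    (hy : ∀ a, ∀ t ∈ Set.Icc (0 : ℝ) 1, HasDerivAt (y a) (V (y a t) a) t) :
    ∃ ρ > 0, ∃ T : P → P →L[ℝ] P, ∀ a ∈ Metric.ball 0 ρ, y a 1 ∈ X ∧
      HasFDerivAt (fun c => y c 1) ((V (y a 1)).comp (T a)) a ∧ Function.Surjective (T a) ∧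
      ‖T a - 1‖ ≤ 2 * (‖br‖ * ‖a‖) := by
  rcases subsingleton_or_nontrivial P with hP | hP
  · refine ⟨1, one_pos, fun _ => 1, fun a _ => ?_⟩
    have ha : y a 1 = x₀ := by
      have h2 := (convex_Icc (0 : ℝ) 1).norm_image_sub_le_of_norm_hasDerivWithin_le (C := 0)
        (f := y a) (f' := fun _ => 0) (fun s hs => by
          have h3 := hy a s hs
          rw [Subsingleton.elim a 0, map_zero] at h3
          rw [Subsingleton.elim a 0]
          exact h3.hasDerivWithinAt) (fun s _ => by simp) (x := 0) (y := 1) (by simp) (by simp)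
      rw [hy0, zero_mul] at h2
      exact sub_eq_zero.1 (norm_le_zero_iff.1 h2)
    refine ⟨by rw [ha]; exact hx₀, ?_, fun b => ⟨b, rfl⟩, ?_⟩
    · refine HasFDerivAt.congr_fderiv ((hasFDerivAt_const (y a 1) a).congr_of_eventuallyEq ?_) ?_
      · exact Filter.Eventually.of_forall fun c => by rw [Subsingleton.elim c a]
      · ext1 v; rw [Subsingleton.elim v 0, map_zero, map_zero]
    · rw [sub_self, norm_zero]; positivity
  obtain ⟨r₀, hr₀, M, hT₀⟩ := exists_isTaylorBounded
    ((hV.contDiffAt hx₀).of_le (by simp : (2 : ℕ∞ω) ≤ ω))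
  obtain ⟨r₁, hr₁, hball⟩ := Metric.isOpen_iff.1 hV.isOpen x₀ hx₀
  set r := min r₀ r₁ with hr
  have hr0 : 0 < r := lt_min hr₀ hr₁
  have hT := hT₀.mono (min_le_left r₀ r₁)
  have hrX : Metric.ball x₀ r ⊆ X := (Metric.ball_subset_ball (min_le_right _ _)).trans hball
  have hM := hT.nonneg
  have hbr := norm_nonneg br
  -- the first bound keeps the trajectories in the ball, the second makes `T a` a perturbation of `1`
  set ρ := min (min 1 (r / 4) / (2 * (M + 1))) (1 / (4 * (‖br‖ + 1))) with hρ
  have hρ0 : 0 < ρ := by positivity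
  have hρa : ρ * (2 * (M + 1)) ≤ min 1 (r / 4) := by
    rw [← le_div_iff₀ (by positivity)]; exact min_le_left _ _
  have hρb : ρ * (4 * (‖br‖ + 1)) ≤ 1 := by
    rw [← le_div_iff₀ (by positivity)]; exact min_le_right _ _
  have hρ1 : ρ ≤ 1 := by nlinarith [min_le_left 1 (r / 4)]
  have hρr : ∀ a : P, ‖a‖ < ρ → (M + 1) * ‖a‖ < r / 8 := fun a ha => by
    have h1 := min_le_right 1 (r / 4)
    nlinarith
  have hyr : ∀ a, ‖a‖ < ρ → ∀ t ∈ Set.Icc (0 : ℝ) 1, y a t ∈ Metric.ball x₀ (r / 2) := by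
    intro a ha t ht
    have h2 := hρr a ha
    have h1 := hT.trajectory_bound (by linarith) hr0 (hy0 a) (hy a) t ht
    have h3 : (M + 1) * ‖a‖ * t ≤ (M + 1) * ‖a‖ * 1 := by gcongr; exact ht.2
    rw [Metric.mem_ball, dist_eq_norm]
    linarith
  have hhalf : Metric.ball x₀ (r / 2) ⊆ Metric.ball x₀ r := Metric.ball_subset_ball (by linarith)
  have hbra : ∀ a, ‖a‖ < ρ → ‖br a‖ < 1 / 4 := fun a ha => by
    have h1 := br.le_opNorm a
    have h2 : ‖br‖ * ‖a‖ ≤ ‖br‖ * ρ := by gcongr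
    nlinarith
  choose K hK0 hK using fun a => exists_integral_exp (br a)
  have hK1 : ∀ a, ‖a‖ < ρ → ∀ t ∈ Set.Icc (0 : ℝ) 1, ‖K a t - t • 1‖ ≤ 2 * ‖br a‖ := fun a ha =>
    norm_sub_smul_one_le (by linarith [hbra a ha]) (hK0 a) (hK a)
  refine ⟨ρ, hρ0, fun a => K a 1, fun a ha => ?_⟩
  rw [mem_ball_zero_iff] at ha
  have h11 : (1 : ℝ) ∈ Set.Icc (0 : ℝ) 1 := ⟨zero_le_one, le_rfl⟩
  have hKa := hK1 a ha 1 h11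
  rw [one_smul] at hKa
  refine ⟨hrX (hhalf (hyr a ha 1 h11)), ?_, ?_, ?_⟩
  · refine hasFDerivAt_of_quadratic_bound (r := ρ - ‖a‖) (by linarith)
      (K := (M * (M * 2) + 2 * M * (M * 2) ^ 2) * gronwallBound 0 (2 * M) 1 1) fun b hb => ?_
    have hab : ‖a + b‖ < ρ := (norm_add_le a b).trans_lt (by linarith)
    have hbρ : ‖b‖ < ρ := by linarith [norm_nonneg a]
    have hv := hT.variation (a := a) (b := b) (C := 2) (y := y a) (z := y (a + b))
      (κ := fun t => K a t b) (κ' := fun t => b + br a (K a t b)) (by linarith) (by linarith)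
      (by have := hρr b hbρ; have := norm_nonneg b; nlinarith)
      (by rw [hy0, hy0]) (by rw [hK0]; rfl) (hy a) (hy _)
      (fun t _ => by
        have := (hK a t).clm_apply (hasDerivAt_const t b)
        refine this.congr_deriv ?_
        rw [map_zero, add_zero]; rfl)
      (hyr a ha) (fun t ht => hhalf (hyr _ hab t ht)) (fun t ht => by
        refine (K a t).le_of_opNorm_le ?_ b
        have h1 := hK1 a ha t ht
        have h2 : ‖t • (1 : P →L[ℝ] P)‖ ≤ 1 := by
          rw [norm_smul, norm_one, mul_one, Real.norm_of_nonneg ht.1]; exact ht.2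
        have h3 := norm_add_le (K a t - t • 1) (t • (1 : P →L[ℝ] P))
        rw [sub_add_cancel] at h3
        linarith [hbra a ha])
      (fun t ht => by
        rw [map_add, ← hV.bracket _ (hrX (hhalf (hyr a ha t ht)))]
        abel)
    rw [sub_sub]
    exact hv
  · have h1 : ‖1 - K a 1‖ < 1 := by rw [norm_sub_rev]; linarith [hbra a ha]
    have h2 : IsUnit (K a 1) := by
      have := isUnit_one_sub_of_norm_lt_one h1
      rwa [sub_sub_cancel] at this
    intro b
    refine ⟨Ring.inverse (K a 1) b, ?_⟩
    exact congrArg (fun A : P →L[ℝ] P => A b) (Ring.mul_inverse_cancel _ h2)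
  · exact hKa.trans (by gcongr; exact br.le_opNorm a)

end IsFieldAlgebra

end ExponentialCoordinates

/-! ### Exponential images in a generic level set -/

section OrbitsInLevelSets

variable {d k : ℕ} {X : Set (Fin d → ℂ)} {f : (Fin d → ℂ) → (Fin k → ℝ)} {M : Set (Fin d → ℂ)}
  {P : Type} [NormedAddCommGroup P] [NormedSpace ℝ P]
  {V : (Fin d → ℂ) → P →L[ℝ] (Fin d → ℂ)} {br : P →L[ℝ] P →L[ℝ] P}

namespace IsGenericLevelSet

variable (hM : IsGenericLevelSet X f M)
include hM

/-- If an injective family of fields takes values in the distribution at `y`, and spans it at `x₀`,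
then it spans it at `y`, because the distribution has constant rank. -/
theorem exists_apply_eq_of_injective {x₀ y : Fin d → ℂ} (hx₀ : x₀ ∈ M) (hy : y ∈ M)
    (hi₀ : Function.Injective (V x₀)) (hi : Function.Injective (V y))
    (hW : ∀ v, crDeriv f x₀ v = 0 → ∃ b, V x₀ b = v) (hVy : ∀ b, crDeriv f y (V y b) = 0)
    (hV₀ : ∀ b, crDeriv f x₀ (V x₀ b) = 0) {v : Fin d → ℂ} (hv : crDeriv f y v = 0) :
    ∃ b, V y b = v := by
  have hfr : ∀ x ∈ M, Module.finrank ℝ (LinearMap.ker (crDerivₗ f x)) = 2 * (d - k) := by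
    intro x hx
    have := finrank_ker_crDerivₗ (hM.surjective x hx)
    rw [Module.finrank_fin_fun] at this
    rw [finrank_real_of_complex]; omega
  have h1 : LinearMap.range (V x₀).toLinearMap
      = (LinearMap.ker (crDerivₗ f x₀)).restrictScalars ℝ := by
    refine le_antisymm ?_ fun v hv => hW v hv
    rintro _ ⟨b, rfl⟩
    exact hV₀ b
  have h2 : LinearMap.range (V y).toLinearMap ≤ (LinearMap.ker (crDerivₗ f y)).restrictScalars ℝ := by
    rintro _ ⟨b, rfl⟩
    exact hVy b
  have h3 : Module.finrank ℝ P = 2 * (d - k) := by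
    rw [← hfr x₀ hx₀, ← LinearMap.finrank_range_of_inj hi₀]
    exact congrArg (fun S : Submodule ℝ (Fin d → ℂ) => Module.finrank ℝ S) h1
  have h4 := Submodule.eq_of_le_of_finrank_eq h2 <| by
    rw [LinearMap.finrank_range_of_inj hi, h3]
    exact (hfr y hy).symm
  have h5 : v ∈ LinearMap.range (V y).toLinearMap := by rw [h4]; exact hv
  exact h5

/-- A Lie algebra of holomorphic fields that spans the distribution at `x₀`, and whose exponential
image of `x₀` lies in `M`, forces the Levi form to vanish along this image.  The fields span the
distribution at each point of the image, and the Levi form of two of them is the value of `df` on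
`i` times their bracket, which again belongs to the algebra. -/
theorem leviVanishesAt_exp [CompleteSpace P] (hV : IsFieldAlgebra X V br) {x₀ : Fin d → ℂ} (hx₀ : x₀ ∈ M)
    {y : P → ℝ → (Fin d → ℂ)} (hy0 : ∀ a, y a 0 = x₀)
    (hy : ∀ a, ∀ t ∈ Set.Icc (0 : ℝ) 1, HasDerivAt (y a) (V (y a t) a) t ∧ y a t ∈ X)
    (hyM : ∀ a, y a 1 ∈ M) (hi : ∀ x ∈ X, Function.Injective (V x))
    (hW : ∀ v, crDeriv f x₀ v = 0 ↔ ∃ b, V x₀ b = v) :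
    y 0 1 = x₀ ∧ HasStrictFDerivAt (fun a => y a 1) (V x₀) 0 ∧
      ∀ᶠ a in 𝓝 0, LeviVanishesAt f (y a 1) := by
  obtain ⟨ρ, hρ, T, hT⟩ := hV.exists_hasFDerivAt_exp (hM.subset hx₀) hy0 fun a t ht => (hy a t ht).1
  have hE0 : y 0 1 = x₀ := by
    have h2 := (convex_Icc (0 : ℝ) 1).norm_image_sub_le_of_norm_hasDerivWithin_le (C := 0)
      (f := y 0) (f' := fun _ => 0) (fun s hs => by
        have h3 := (hy 0 s hs).1
        rw [map_zero] at h3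
        exact h3.hasDerivWithinAt) (fun s _ => by simp) (x := 0) (y := 1) (by simp) (by simp)
    rw [hy0, zero_mul] at h2
    exact sub_eq_zero.1 (norm_le_zero_iff.1 h2)
  have hball : Metric.ball (0 : P) ρ ∈ 𝓝 0 := Metric.ball_mem_nhds 0 hρ
  refine ⟨hE0, ?_, ?_⟩
  · have hTt : Filter.Tendsto T (𝓝 0) (𝓝 1) := by
      rw [tendsto_iff_norm_sub_tendsto_zero]
      refine squeeze_zero' (g := fun a => 2 * (‖br‖ * ‖a‖)) (Filter.Eventually.of_forall
        fun _ => norm_nonneg _) (Filter.eventually_of_mem hball fun a ha => (hT a ha).2.2.2) ?_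
      have : Continuous fun a : P => 2 * (‖br‖ * ‖a‖) := by fun_prop
      simpa using this.tendsto 0
    have hT0 : T 0 = 1 := by
      have h1 := (hT 0 (Metric.mem_ball_self hρ)).2.2.2
      rw [norm_zero, mul_zero, mul_zero] at h1
      exact sub_eq_zero.1 (norm_le_zero_iff.1 h1)
    have hc : ContinuousAt (fun a => (V (y a 1)).comp (T a)) 0 := by
      have h1 : ContinuousAt (fun a => V (y a 1)) 0 := by
        have h2 : ContinuousAt V (y 0 1) := by
          rw [hE0]; exact (hV.contDiffAt (hM.subset hx₀)).continuousAt
        exact ContinuousAt.comp (f := fun a => y a 1) h2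
          (hT 0 (Metric.mem_ball_self hρ)).2.1.continuousAt
      have h2 : ContinuousAt T 0 := by
        have := hTt
        rw [← hT0] at this
        exact this
      exact h1.clm_comp h2
    have h1 := hasStrictFDerivAt_of_hasFDerivAt_of_continuousAt
      (Filter.eventually_of_mem hball fun a ha => (hT a ha).2.1) hc
    rw [hE0, hT0] at h1
    exact h1
  -- the fields are tangent to `M` along the image, and so are their multiples by `i`
  have hA : ∀ a ∈ Metric.ball 0 ρ, ∀ b, fderiv ℝ f (y a 1) (V (y a 1) b) = 0 := by
    intro a ha b
    obtain ⟨c, rfl⟩ := (hT a ha).2.2.1 b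
    have h1 := ((hM.contDiffAt (hT a ha).1).differentiableAt (by simp)).hasFDerivAt.comp a
      (hT a ha).2.1
    have h2 : (f ∘ fun c => y c 1) = fun _ => 0 := funext fun c => ((hM.mem_iff _).1 (hyM c)).2
    rw [h2] at h1
    exact congrArg (fun A : P →L[ℝ] (Fin k → ℝ) => A c)
      (h1.unique (hasFDerivAt_const (0 : Fin k → ℝ) a))
  have hker₀ : ∀ b, crDeriv f x₀ (V x₀ b) = 0 := fun b => (hW _).2 ⟨b, rfl⟩
  have hB : ∀ a ∈ Metric.ball 0 ρ, ∀ b, crDeriv f (y a 1) (V (y a 1) b) = 0 := by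
    intro a ha b
    obtain ⟨c, hc⟩ := hV.smul_I_mem_of_trajectory (hy a) (fun b => by
      obtain ⟨c, hc⟩ := (hW (Complex.I • V x₀ b)).1 (by rw [crDeriv_smul_I, hker₀, smul_zero])
      exact ⟨c, by rw [hy0, hc]⟩) b
    rw [crDeriv_eq_zero_iff, hc]
    exact ⟨hA a ha b, hA a ha c⟩
  refine Filter.eventually_of_mem hball fun a ha => ?_
  intro u v hu hv
  have hyX := (hT a ha).1
  have hspan : ∀ {v}, crDeriv f (y a 1) v = 0 → ∃ b, V (y a 1) b = v := fun hv =>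
    hM.exists_apply_eq_of_injective hx₀ (hyM a) (hi _ (hM.subset hx₀)) (hi _ hyX)
      (fun v hv => (hW v).1 hv) (hB a ha) hker₀ hv
  obtain ⟨b, rfl⟩ := hspan hu
  obtain ⟨c, rfl⟩ := hspan hv
  have hVd : ∀ b, HasFDerivAt (fun x => V x b) ((fderiv ℝ V (y a 1)).flip b) (y a 1) := fun b => by
    have := (hV.hasFDerivAt hyX).clm_apply (hasFDerivAt_const b (y a 1))
    refine this.congr_fderiv ?_
    ext1 z; simp
  -- differentiation of `df (i V c) = 0` in the direction `V b`
  have key : ∀ b c, fderiv ℝ (fderiv ℝ f) (y a 1) (V (y a 1) b) (Complex.I • V (y a 1) c)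
      + fderiv ℝ f (y a 1) (Complex.I • fderiv ℝ V (y a 1) (V (y a 1) b) c) = 0 := by
    intro b c
    obtain ⟨b', hb'⟩ := (hT a ha).2.2.1 b
    have hl : HasDerivAt (fun t : ℝ => a + t • b') b' 0 := by
      have := ((hasDerivAt_id (0 : ℝ)).smul_const b').const_add a
      rwa [one_smul] at this
    have hl0 : a + (0 : ℝ) • b' = a := by rw [zero_smul, add_zero]
    have h1 : HasFDerivAt (fun c => y c 1) ((V (y a 1)).comp (T a)) (a + (0 : ℝ) • b') := by
      rw [hl0]; exact (hT a ha).2.1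
    have h2 : HasDerivAt (fun t : ℝ => y (a + t • b') 1) (V (y a 1) b) 0 := by
      have h3 := h1.comp_hasDerivAt (0 : ℝ) hl
      rw [ContinuousLinearMap.comp_apply, hb'] at h3
      exact h3
    have h3 : HasFDerivAt (fun x => Complex.I • V x c)
        (Complex.I • (fderiv ℝ V (y a 1)).flip c) (y a 1) := (hVd c).const_smul Complex.I
    have h4 := hM.fderiv_fderiv_of_curve hyX h3.differentiableAt (γ := fun t => y (a + t • b') 1)
      (by simp only [hl0]) h2 (by
        have h5 := hl.continuousAt.tendsto
        rw [hl0] at h5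
        filter_upwards [h5.eventually (Metric.isOpen_ball.mem_nhds ha)] with t ht
        exact (crDeriv_eq_zero_iff.1 (hB _ ht c)).2)
    rw [h3.fderiv] at h4
    exact h4
  rw [eq_neg_of_add_eq_zero_left (key b c), eq_neg_of_add_eq_zero_left (key c b), neg_inj,
    ← sub_eq_zero, ← map_sub, ← smul_sub, hV.bracket _ hyX]
  exact (crDeriv_eq_zero_iff.1 (hB a ha _)).2

end IsGenericLevelSet

end OrbitsInLevelSets

/-! ### Primitives of real analytic one-forms -/

section Primitive

variable {E F : Type} [NormedAddCommGroup E] [NormedSpace ℝ E] [NormedAddCommGroup F]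
  [NormedSpace ℝ F] [CompleteSpace F]

/-- A function whose derivative is real analytic is real analytic: its power series is obtained from
that of the derivative by integration along rays. -/
theorem analyticAt_of_fderiv {f : E → F} {x : E} {s : Set E} (hs : IsOpen s) (hx : x ∈ s)
    (hf : DifferentiableOn ℝ f s) (hA : AnalyticAt ℝ (fderiv ℝ f) x) : AnalyticAt ℝ f x := by
  obtain ⟨p, R, hp⟩ := hA
  obtain ⟨ε, hε, hεs⟩ := Metric.isOpen_iff.1 hs x hx
  obtain ⟨R', hR'0, hR'⟩ : ∃ R' : NNReal, 0 < R' ∧ (R' : ENNReal) < min R (ENNReal.ofReal ε) := by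
    obtain ⟨R', h1, h2⟩ := ENNReal.lt_iff_exists_nnreal_btwn.1
      (lt_min hp.r_pos (ENNReal.ofReal_pos.2 hε))
    exact ⟨R', by exact_mod_cast h1, h2⟩
  have hR'R : (R' : ENNReal) < R := hR'.trans_le (min_le_left _ _)
  have hR'ε : (R' : ℝ) < ε := by
    have := hR'.trans_le (min_le_right _ _)
    rwa [ENNReal.lt_ofReal_iff_toReal_lt (by simp), ENNReal.coe_toReal] at this
  obtain ⟨C, hC0, hC⟩ := p.norm_mul_pow_le_of_lt_radius (hR'R.trans_le hp.r_le)
  set q : FormalMultilinearSeries ℝ E (E →L[ℝ] F) := fun n => ((n : ℝ) + 1)⁻¹ • p n with hq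
  set r := q.unshift (f x) with hr
  have hqn : ∀ n, ‖q n‖ ≤ ‖p n‖ := fun n => by
    refine ContinuousMultilinearMap.opNorm_le_bound (norm_nonneg _) fun m => ?_
    change ‖((n : ℝ) + 1)⁻¹ • p n m‖ ≤ _
    rw [norm_smul, norm_inv, Real.norm_of_nonneg (by positivity)]
    refine (mul_le_of_le_one_left (norm_nonneg _) (inv_le_one_of_one_le₀ ?_)).trans
      ((p n).le_opNorm m)
    have : (0 : ℝ) ≤ n := n.cast_nonneg
    linarith
  refine ⟨r, R', ?_, by exact_mod_cast hR'0, fun {y} hy => ?_⟩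
  · refine r.le_radius_of_bound (max ‖f x‖ (C * R')) fun n => ?_
    rcases n with _ | n
    · rw [pow_zero, mul_one]
      refine le_max_of_le_left ?_
      simp only [hr, FormalMultilinearSeries.unshift, LinearIsometryEquiv.norm_map, le_refl]
    · refine le_max_of_le_right ?_
      simp only [hr, FormalMultilinearSeries.unshift, LinearIsometryEquiv.norm_map]
      rw [pow_succ, ← mul_assoc]
      gcongr
      exact (mul_le_mul_of_nonneg_right (hqn n) (by positivity)).trans (hC n)
  · have hyR : ‖y‖ < R' := by simpa using hy
    have hmem : ∀ t ∈ Set.Icc (0 : ℝ) 1, ‖t • y‖ < R' := fun t ht => by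
      rw [norm_smul, Real.norm_of_nonneg ht.1]
      exact (mul_le_of_le_one_left (norm_nonneg _) ht.2).trans_lt hyR
    have hmems : ∀ t ∈ Set.Icc (0 : ℝ) 1, x + t • y ∈ s := fun t ht => hεs <| by
      rw [Metric.mem_ball, dist_eq_norm, add_sub_cancel_left]
      exact (hmem t ht).trans hR'ε
    have hmemR : ∀ t ∈ Set.Icc (0 : ℝ) 1, t • y ∈ Metric.eball (0 : E) R := fun t ht => by
      have h1 := hmem t ht
      rw [mem_eball_zero_iff]
      refine lt_trans ?_ hR'R
      rw [enorm_eq_nnnorm]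
      exact_mod_cast h1
    have hd : ∀ t ∈ Set.uIcc (0 : ℝ) 1, HasDerivAt (fun t : ℝ => f (x + t • y))
        (fderiv ℝ f (x + t • y) y) t := fun t ht => by
      rw [Set.uIcc_of_le zero_le_one] at ht
      have h1 : HasDerivAt (fun t : ℝ => x + t • y) y t := by
        have := ((hasDerivAt_id t).smul_const y).const_add x
        rwa [one_smul] at this
      exact ((hf.differentiableAt (hs.mem_nhds (hmems t ht))).hasFDerivAt).comp_hasDerivAt t h1
    have hcont : ContinuousOn (fun t : ℝ => fderiv ℝ f (x + t • y) y) (Set.uIcc 0 1) := by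
      rw [Set.uIcc_of_le zero_le_one]
      refine ContinuousOn.clm_apply ?_ continuousOn_const
      refine hp.continuousOn.comp (by fun_prop) fun t ht => ?_
      have := hmemR t ht
      rw [mem_eball_zero_iff] at this
      rwa [Metric.mem_eball, edist_eq_enorm_sub, add_sub_cancel_left]
    have hFTC := intervalIntegral.integral_eq_sub_of_hasDerivAt hd hcont.intervalIntegrable
    simp only [one_smul, zero_smul, add_zero] at hFTC
    have hsum := intervalIntegral.hasSum_integral_of_dominated_convergence (μ := volume)
      (F := fun (n : ℕ) (t : ℝ) => t ^ n • (p n (fun _ => y)) y)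
      (f := fun t => fderiv ℝ f (x + t • y) y) (a := 0) (b := 1)
      (fun n _ => ‖(p n) fun _ => y‖ * ‖y‖)
      (fun n => (by fun_prop : Continuous fun t : ℝ => t ^ n • (p n (fun _ => y)) y)
        |>.aestronglyMeasurable)
      (fun n => Filter.Eventually.of_forall fun t ht => by
        rw [Set.uIoc_of_le zero_le_one] at ht
        rw [norm_smul, norm_pow, Real.norm_of_nonneg ht.1.le]
        exact (mul_le_of_le_one_left (norm_nonneg _) (pow_le_one₀ ht.1.le ht.2)).trans
          (ContinuousLinearMap.le_opNorm _ _))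
      (Filter.Eventually.of_forall fun t _ => by
        refine Summable.mul_right _ (p.summable_norm_apply ?_)
        have := hmemR 1 (by simp)
        rw [one_smul] at this
        exact Metric.eball_subset_eball hp.r_le this)
      intervalIntegrable_const
      (Filter.Eventually.of_forall fun t ht => by
        rw [Set.uIoc_of_le zero_le_one] at ht
        have h1 := hp.hasSum (hmemR t ⟨ht.1.le, ht.2⟩)
        have h2 := h1.mapL (ContinuousLinearMap.apply ℝ F y)
        simpa [ContinuousMultilinearMap.map_smul_univ] using h2)
    rw [hFTC] at hsum
    rw [← hasSum_nat_add_iff' 1]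
    simp only [Finset.range_one, Finset.sum_singleton]
    have h0 : (r 0 fun _ => y) = f x := by
      simp [hr, FormalMultilinearSeries.unshift]
    rw [h0]
    convert! hsum using 2 with n
    have h1 : (r (n + 1) fun _ => y) = ((n : ℝ) + 1)⁻¹ • (p n fun _ => y) y := rfl
    rw [h1, intervalIntegral.integral_smul_const, integral_pow]
    simp

end Primitive

/-! ### The zero level of a momentum map -/

section MomentumLevel

variable {d : ℕ} {X : Set (Fin d → ℂ)}

/-- `exp (t Ad(g) ξ) = g exp (t ξ) g⁻¹`. -/
theorem IsOneParameterGroup.conj {φ : ℝ → HolAut X} {ξ : (Fin d → ℂ) → (Fin d → ℂ)}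
    (h : IsOneParameterGroup φ ξ) (hX : IsOpen X) (g : HolAut X) :
    IsOneParameterGroup (fun t => g * φ t * g⁻¹) (adAct g ξ) where
  eq_zero x hx := by
    have h1 : g.1.symm x ∉ X := fun h1 => hx <| by
      have := g.mapsTo h1
      rwa [Equiv.apply_symm_apply] at this
    have h2 := h.eq_zero _ h1
    change fderiv ℂ g.1 (g.1.symm x) (ξ (g.1.symm x)) = 0
    exact (congrArg _ h2).trans (_root_.map_zero _)
  holomorphic := by
    have h1 : DifferentiableOn ℂ (fderiv ℂ g.1) X :=
      DifferentiableOn.fderiv_holomorphic hX g.2.2.1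
    have h2 : DifferentiableOn ℂ g.1.symm X := g.2.2.2
    exact (h1.comp h2 g.symm_mapsTo).clm_apply (h.holomorphic.comp h2 g.symm_mapsTo)
  map_add s t := by rw [h.map_add]; group
  hasDerivAt x hx t := by
    have h1 := h.hasDerivAt (g.1.symm x) (g.symm_mapsTo hx) t
    have h2 : (φ t).1 (g.1.symm x) ∈ X := (φ t).mapsTo (g.symm_mapsTo hx)
    have h3 := ((g.differentiableAt hX h2).hasFDerivAt.restrictScalars ℝ).comp_hasDerivAt t h1
    have h4 : g.1.symm (((g * φ t * g⁻¹ : HolAut X)).1 x) = (φ t).1 (g.1.symm x) :=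
      g.1.symm_apply_apply _
    have h5 : adAct g ξ (((g * φ t * g⁻¹ : HolAut X)).1 x)
        = fderiv ℂ g.1 ((φ t).1 (g.1.symm x)) (ξ ((φ t).1 (g.1.symm x))) := by
      change fderiv ℂ g.1 (g.1.symm (((g * φ t * g⁻¹ : HolAut X)).1 x))
        (ξ (g.1.symm (((g * φ t * g⁻¹ : HolAut X)).1 x))) = _
      exact congrArg (fun z => fderiv ℂ g.1 z (ξ z)) h4
    exact h3.congr_deriv h5.symm

variable {H : Subgroup (HolAut X)}

/-- The adjoint action of a group preserves its Lie algebra. -/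
theorem adAct_mem_lieAlg (hX : IsOpen X) {h : HolAut X} (hh : h ∈ H)
    {ξ : (Fin d → ℂ) → (Fin d → ℂ)} (hξ : ξ ∈ lieAlg H) : adAct h ξ ∈ lieAlg H :=
  adAct_mem_span (fun η hη => by
    obtain ⟨φ, hφ, hφH⟩ := hη
    exact Submodule.subset_span ⟨_, hφ.conj hX h,
      fun t => H.mul_mem (H.mul_mem hh (hφH t)) (H.inv_mem hh)⟩) hξ

theorem adAct_adAct_inv (hX : IsOpen X) (h : HolAut X) {ξ : (Fin d → ℂ) → (Fin d → ℂ)}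
    (hξ0 : ∀ x, x ∉ X → ξ x = 0) : adAct h (adAct h⁻¹ ξ) = ξ := by
  ext1 x
  by_cases hx : x ∈ X
  · have h1 := congrArg (fun A : (Fin d → ℂ) →L[ℂ] (Fin d → ℂ) => A (ξ x))
      (HolAut.fderiv_symm_comp h⁻¹ hX hx)
    have h2 : h.1 (h.1.symm x) = x := h.1.apply_symm_apply x
    change fderiv ℂ h.1 (h.1.symm x) (fderiv ℂ h.1.symm (h.1 (h.1.symm x))
      (ξ (h.1 (h.1.symm x)))) = ξ x
    exact (congrArg (fun z => fderiv ℂ h.1 (h.1.symm x) (fderiv ℂ h.1.symm z (ξ z))) h2).trans h1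
  · have h1 : h.1 (h.1.symm x) = x := h.1.apply_symm_apply x
    change fderiv ℂ h.1 (h.1.symm x) (fderiv ℂ h.1.symm (h.1 (h.1.symm x))
      (ξ (h.1 (h.1.symm x)))) = ξ x
    have h2 : ξ (h.1 (h.1.symm x)) = 0 := (congrArg ξ h1).trans (hξ0 x hx)
    refine (congrArg (fun z => fderiv ℂ h.1 (h.1.symm x)
      (fderiv ℂ h.1.symm (h.1 (h.1.symm x)) z)) h2).trans ?_
    exact ((congrArg _ (map_zero _)).trans (map_zero _)).trans (hξ0 x hx).symm

theorem IsConnectedSplitSolvable.finite_lieAlg {B : Subgroup (HolAut X)}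
    (hB : IsConnectedSplitSolvable B) (H : Subgroup (HolAut X)) : Module.Finite ℝ (lieAlg H) := by
  obtain ⟨-, n, e, -⟩ := hB
  have := Module.Finite.of_basis e
  exact Submodule.finiteDimensional_of_le (lieAlg_mono (le_top : H ≤ ⊤))

/-- The Lie algebra has a basis of generators of one-parameter groups. -/
theorem exists_basis_mem_lieSet (H : Subgroup (HolAut X)) [Module.Finite ℝ (lieAlg H)] :
    ∃ k, ∃ b : Module.Basis (Fin k) ℝ (lieAlg H), ∀ j, (b j).1 ∈ lieSet H := by
  have : Module.Finite ℝ (Submodule.span ℝ (lieSet H)) := ‹Module.Finite ℝ (lieAlg H)›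
  obtain ⟨ξ, hξ, hspan, hli⟩ := Submodule.exists_fun_fin_finrank_span_eq ℝ (lieSet H)
  have hm : ∀ j, ξ j ∈ lieAlg H := fun j => Submodule.subset_span (hξ j)
  have hli' : LinearIndependent ℝ fun j => (⟨ξ j, hm j⟩ : lieAlg H) :=
    LinearIndependent.of_comp (lieAlg H).subtype hli
  refine ⟨_, Module.Basis.mk hli' ?_, fun j => ?_⟩
  · rintro ⟨η, hη⟩ -
    have h1 : η ∈ Submodule.span ℝ (Set.range ξ) := by rw [hspan]; exact hη
    have h2 : Submodule.map (lieAlg H).subtype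
        (Submodule.span ℝ (Set.range fun j => (⟨ξ j, hm j⟩ : lieAlg H)))
          = Submodule.span ℝ (Set.range ξ) := by
      rw [Submodule.map_span, ← Set.range_comp]; rfl
    rw [← h2] at h1
    obtain ⟨z, hz, hzη⟩ := h1
    have h3 : z = ⟨η, hη⟩ := Subtype.ext hzη
    rwa [← h3]
  · rw [Module.Basis.mk_apply]; exact hξ j

/-- The components of a momentum map with respect to a basis of the Lie algebra. -/
def momentumCoord {k : ℕ} (b : Module.Basis (Fin k) ℝ (lieAlg H))
    (μ : (Fin d → ℂ) → Module.Dual ℝ (lieAlg H)) (x : Fin d → ℂ) : Fin k → ℝ :=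
  fun j => μ x (b j)

variable {k : ℕ} {b : Module.Basis (Fin k) ℝ (lieAlg H)}
  {μ : (Fin d → ℂ) → Module.Dual ℝ (lieAlg H)}

theorem momentumCoord_eq_zero_iff {x : Fin d → ℂ} : momentumCoord b μ x = 0 ↔ μ x = 0 := by
  refine ⟨fun h => b.ext fun j => congrFun h j, fun h => ?_⟩
  ext j
  rw [momentumCoord, h]; rfl

namespace IsMomentumMap

variable (hμ : IsMomentumMap H μ)
include hμ

/-- Momentum maps are real analytic, since their differentials are given by the Bergman form. -/
theorem contDiffOn_momentumCoord (hX : IsSiegelDomain X) :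
    ContDiffOn ℝ ω (momentumCoord b μ) X := by
  refine contDiffOn_pi.2 fun j x hx => ?_
  refine (analyticAt_of_fderiv hX.isOpen hx (fun y hy =>
    (hμ.differentiableAt (b j) y hy).differentiableWithinAt) ?_).contDiffAt.contDiffWithinAt
  have h1 : ContDiffAt ℝ ω (fun y => leviFormL (bergmanPotential X) y ((b j).1 y)) x :=
    ((contDiffOn_leviFormL hX.isOpen
      (contDiffOn_bergmanPotential hX.isOpen hX.separatesJets)).contDiffAt
        (hX.isOpen.mem_nhds hx)).clm_apply
      (((holomorphic_of_mem_lieAlg (b j).2).contDiffOn_real hX.isOpen).contDiffAt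
        (hX.isOpen.mem_nhds hx))
  refine h1.analyticAt.congr ?_
  filter_upwards [hX.isOpen.mem_nhds hx] with y hy
  ext1 v
  exact (hμ.fderiv_eq (b j) y hy v).symm

theorem fderiv_momentumCoord {x : Fin d → ℂ} (hx : x ∈ X) (v : Fin d → ℂ) (j : Fin k) :
    fderiv ℝ (momentumCoord b μ) x v j = bergmanForm X x ((b j).1 x) v := by
  rw [← hμ.fderiv_eq (b j) x hx v]
  have h1 : HasFDerivAt (momentumCoord b μ)
      (ContinuousLinearMap.pi fun j => fderiv ℝ (fun y => μ y (b j)) x) x :=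
    hasFDerivAt_pi.2 fun j => (hμ.differentiableAt (b j) x hx).hasFDerivAt
  rw [h1.fderiv]; rfl

/-- The zero level is invariant under `H`. -/
theorem apply_mem_zeroLevel (hX : IsOpen X) {h : HolAut X} (hh : h ∈ H) {x : Fin d → ℂ}
    (hx : x ∈ zeroLevel μ) : h.1 x ∈ zeroLevel μ := by
  refine ⟨h.mapsTo hx.1, LinearMap.ext fun η => ?_⟩
  have h1 := hμ.equivariant h hh ⟨adAct h⁻¹ η.1, adAct_mem_lieAlg hX (H.inv_mem hh) η.2⟩ η
    (adAct_adAct_inv hX h fun x hx => eq_zero_of_mem_lieAlg_of_notMem η.2 hx).symm x hx.1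
  rw [h1, hx.2]; rfl

/-- The `H`-orbits in the zero level are isotropic. -/
theorem bergmanForm_apply_apply (hX : IsOpen X) {x : Fin d → ℂ} (hx : x ∈ zeroLevel μ)
    (ξ : lieAlg H) {η : (Fin d → ℂ) → (Fin d → ℂ)} (hη : η ∈ lieSet H) :
    bergmanForm X x (ξ.1 x) (η x) = 0 := by
  obtain ⟨φ, hφ, hφH⟩ := hη
  rw [← hμ.fderiv_eq ξ x hx.1]
  have h1 : HasFDerivAt (fun y => μ y ξ) (fderiv ℝ (fun y => μ y ξ) x) ((φ 0).1 x) := by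
    have := (hμ.differentiableAt ξ x hx.1).hasFDerivAt
    have h2 := hφ.zero_apply x
    exact h2.symm ▸ this
  have h2 : HasDerivAt (fun t => (φ t).1 x) (η x) 0 := by
    have := hφ.hasDerivAt x hx.1 0
    exact this.congr_deriv (congrArg η (hφ.zero_apply x))
  have h3 := h1.comp_hasDerivAt (0 : ℝ) h2
  have h4 : ((fun y => μ y ξ) ∘ fun t => (φ t).1 x) = fun _ => 0 := funext fun t => by
    have := (hμ.apply_mem_zeroLevel hX (hφH t) hx).2
    exact LinearMap.congr_fun this ξ
  rw [h4] at h3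
  exact h3.unique (hasDerivAt_const (0 : ℝ) (0 : ℝ))

end IsMomentumMap

end MomentumLevel

/-! ### The zero level is a generic level set -/

section MomentumLevelGeneric

variable {d : ℕ} {X : Set (Fin d → ℂ)} {H B : Subgroup (HolAut X)} {k : ℕ}
  {b : Module.Basis (Fin k) ℝ (lieAlg H)} {μ : (Fin d → ℂ) → Module.Dual ℝ (lieAlg H)}

namespace IsMomentumMap

variable (hμ : IsMomentumMap H μ)
include hμ

/-- A vector `η x` tangent to the `H`-orbit vanishes if the differential of the momentum coordinates
kills `i η x`: this differential has the component `ω(η x, i η x)`, and the Bergman metric is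
definite. -/
theorem eq_zero_of_fderiv_momentumCoord_smul_I (hX : IsSiegelDomain X) {x : Fin d → ℂ} (hx : x ∈ X)
    {η : lieAlg H} (h : fderiv ℝ (momentumCoord b μ) x (Complex.I • η.1 x) = 0) : η.1 x = 0 := by
  by_contra hne
  have h1 := bergmanForm_pos hX.isOpen hX.separatesJets hx hne
  have h2 : ∀ ξ : lieAlg H, fderiv ℝ (fun y => μ y ξ) x (Complex.I • η.1 x) = 0 := by
    intro ξ
    have h3 : (leviFormL (bergmanPotential X) x).flip (Complex.I • η.1 x) (ξ.1 x) = 0 := by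
      have h4 : ξ.1 x = ∑ j, b.repr ξ j • (b j).1 x := by
        have := congrArg (fun ζ : lieAlg H => ζ.1 x) (b.sum_repr ξ)
        refine this.symm.trans ?_
        simp only [Submodule.coe_sum, Finset.sum_apply]
        rfl
      rw [h4, map_sum]
      refine Finset.sum_eq_zero fun j _ => ?_
      rw [map_smul]
      have h5 := congrFun h j
      rw [hμ.fderiv_momentumCoord hx] at h5
      have h6 : (leviFormL (bergmanPotential X) x).flip (Complex.I • η.1 x) ((b j).1 x) = 0 := h5
      rw [h6, smul_zero]
    rw [hμ.fderiv_eq ξ x hx]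
    exact h3
  rw [← hμ.fderiv_eq η x hx, h2 η] at h1
  exact lt_irrefl _ h1

/-- On the zero level the `H`-orbits are tangent to the level set. -/
theorem fderiv_momentumCoord_apply (hX : IsOpen X) (hb : ∀ j, (b j).1 ∈ lieSet H) {x : Fin d → ℂ}
    (hx : x ∈ zeroLevel μ) (η : lieAlg H) : fderiv ℝ (momentumCoord b μ) x (η.1 x) = 0 := by
  ext j
  rw [hμ.fderiv_momentumCoord hx.1]
  have h1 : (leviFormL (bergmanPotential X) x (η.1 x)) ((b j).1 x) = 0 :=
    hμ.bergmanForm_apply_apply hX hx η (hb j)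
  rw [bergmanForm_eq_leviForm, leviForm_antisymm, ← leviFormL_apply, h1, neg_zero]; rfl

/-- The fields of the Lie algebra of `H` and their multiples by `i` are transversal to the
distribution on the zero level. -/
theorem injective_crDeriv_sum (hX : IsSiegelDomain X) (hB : IsConnectedSplitSolvable B)
    (hHB : H ≤ B) (hb : ∀ j, (b j).1 ∈ lieSet H) {x : Fin d → ℂ} (hx : x ∈ zeroLevel μ)
    {p q : Fin k → ℝ} (h : crDeriv (momentumCoord b μ) x (∑ j, p j • (b j).1 x
      + Complex.I • ∑ j, q j • (b j).1 x) = 0) : p = 0 ∧ q = 0 := by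
  have hval : ∀ c : Fin k → ℝ, ∑ j, c j • (b j).1 x = (∑ j, c j • b j : lieAlg H).1 x := fun c => by
    simp only [Submodule.coe_sum, Finset.sum_apply]
    rfl
  have hfree : ∀ c : Fin k → ℝ, (∑ j, c j • b j : lieAlg H).1 x = 0 → c = 0 := fun c hc => by
    have h1 := eq_zero_of_mem_lieAlg_of_apply_eq_zero hX hB
      (lieAlg_mono hHB (∑ j, c j • b j : lieAlg H).2) hx.1 hc
    have h2 : ∑ j, c j • b j = 0 := Subtype.ext h1
    exact funext (Fintype.linearIndependent_iff.1 b.linearIndependent c h2)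
  rw [hval, hval, crDeriv_eq_zero_iff] at h
  obtain ⟨h1, h2⟩ := h
  rw [map_add, hμ.fderiv_momentumCoord_apply hX.isOpen hb hx, zero_add] at h1
  rw [smul_add, smul_smul, Complex.I_mul_I, neg_one_smul, map_add, map_neg,
    hμ.fderiv_momentumCoord_apply hX.isOpen hb hx, neg_zero, add_zero] at h2
  exact ⟨hfree p (hμ.eq_zero_of_fderiv_momentumCoord_smul_I hX hx.1 h2),
    hfree q (hμ.eq_zero_of_fderiv_momentumCoord_smul_I hX hx.1 h1)⟩

/-- By counting dimensions, the fields of the Lie algebra of `H` and their multiples by `i` span a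
complement of the distribution on the zero level. -/
theorem exists_crDeriv_sum_eq (hX : IsSiegelDomain X) (hB : IsConnectedSplitSolvable B)
    (hHB : H ≤ B) (hb : ∀ j, (b j).1 ∈ lieSet H) {x : Fin d → ℂ} (hx : x ∈ zeroLevel μ)
    (c : Fin k → ℂ) : ∃ p q : Fin k → ℝ, crDeriv (momentumCoord b μ) x (∑ j, p j • (b j).1 x
      + Complex.I • ∑ j, q j • (b j).1 x) = c := by
  set L : (Fin k → ℂ) →ₗ[ℂ] (Fin k → ℂ) := (crDerivₗ (momentumCoord b μ) x).comp
    (Fintype.linearCombination ℂ fun j => (b j).1 x) with hL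
  have hLz : ∀ z, L z = crDeriv (momentumCoord b μ) x (∑ j, (z j).re • (b j).1 x
      + Complex.I • ∑ j, (z j).im • (b j).1 x) := fun z => by
    change crDeriv (momentumCoord b μ) x (∑ j, z j • (b j).1 x) = _
    congr 1
    rw [Finset.smul_sum, ← Finset.sum_add_distrib]
    refine Finset.sum_congr rfl fun j _ => ?_
    rw [complex_smul_eq (z j), smul_comm]
  have hinj : Function.Injective L := by
    rw [injective_iff_map_eq_zero]
    intro z hz
    rw [hLz] at hz
    obtain ⟨h1, h2⟩ := hμ.injective_crDeriv_sum hX hB hHB hb hx hz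
    ext j
    exact Complex.ext (congrFun h1 j) (congrFun h2 j)
  obtain ⟨z, hz⟩ := (LinearMap.injective_iff_surjective.1 hinj) c
  exact ⟨fun j => (z j).re, fun j => (z j).im, (hLz z).symm.trans hz⟩

/-- The zero level of a momentum map is a generic level set of the momentum coordinates. -/
theorem isGenericLevelSet (hX : IsSiegelDomain X) (hB : IsConnectedSplitSolvable B)
    (hHB : H ≤ B) (hb : ∀ j, (b j).1 ∈ lieSet H) :
    IsGenericLevelSet X (momentumCoord b μ) (zeroLevel μ) where
  isOpen := hX.isOpen
  contDiffOn := hμ.contDiffOn_momentumCoord hX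
  mem_iff x := by rw [momentumCoord_eq_zero_iff]; rfl
  surjective x hx c := by
    obtain ⟨p, q, h⟩ := hμ.exists_crDeriv_sum_eq hX hB hHB hb hx c
    exact ⟨_, h⟩

/-- Equivariance: an element of `H` transforms the momentum coordinates linearly, by the coadjoint
action. -/
theorem exists_momentumCoord_comp (hX : IsOpen X) {h : HolAut X} (hh : h ∈ H) :
    ∃ A : Fin k → Fin k → ℝ, ∀ x ∈ X, ∀ j,
      momentumCoord b μ (h.1 x) j = ∑ i, A j i * momentumCoord b μ x i := by
  refine ⟨fun j i => b.repr ⟨adAct h⁻¹ (b j).1, adAct_mem_lieAlg hX (H.inv_mem hh) (b j).2⟩ i,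
    fun x hx j => ?_⟩
  have h1 := hμ.equivariant h hh ⟨adAct h⁻¹ (b j).1, adAct_mem_lieAlg hX (H.inv_mem hh) (b j).2⟩ (b j)
    (adAct_adAct_inv hX h fun x hx => eq_zero_of_mem_lieAlg_of_notMem (b j).2 hx).symm x hx
  refine h1.trans ?_
  conv_lhs => rw [← b.sum_repr ⟨adAct h⁻¹ (b j).1, adAct_mem_lieAlg hX (H.inv_mem hh) (b j).2⟩]
  rw [map_sum]
  refine Finset.sum_congr rfl fun i _ => ?_
  rw [map_smul]; rfl

end IsMomentumMap

end MomentumLevelGeneric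

/-! ### Invariance of the Levi form of the zero level -/

section LeviInvariance

/-- The Levi form of a linear function of a vector-valued map `f`. -/
theorem leviForm_clm_comp {E G : Type} [NormedAddCommGroup E] [NormedSpace ℂ E]
    [NormedAddCommGroup G] [NormedSpace ℝ G] {f : E → G} {x : E} (hf : ContDiffAt ℝ ω f x)
    (L : G →L[ℝ] ℝ) (u v : E) :
    leviForm (fun y => L (f y)) x u v = L (- fderiv ℝ (fderiv ℝ f) x u (Complex.I • v)
      + fderiv ℝ (fderiv ℝ f) x v (Complex.I • u)) := by
  have h1 : fderiv ℝ (fun y => L (f y)) =ᶠ[𝓝 x] fun y =>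
      ContinuousLinearMap.compL ℝ E G ℝ L (fderiv ℝ f y) := by
    filter_upwards [hf.eventually (by simp)] with y hy
    exact (L.hasFDerivAt.comp y (hy.differentiableAt (by simp)).hasFDerivAt).fderiv
  have h2 : DifferentiableAt ℝ (fderiv ℝ f) x :=
    (hf.fderiv_right (m := ω) (by simp)).differentiableAt (by simp)
  have h3 := ((ContinuousLinearMap.compL ℝ E G ℝ L).hasFDerivAt.comp x h2.hasFDerivAt).fderiv
  have h4 : ∀ u w, fderiv ℝ (fderiv ℝ (fun y => L (f y))) x u w
      = L (fderiv ℝ (fderiv ℝ f) x u w) := fun u w => by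
    rw [h1.fderiv_eq]
    exact congrArg (fun A : E →L[ℝ] E →L[ℝ] ℝ => A u w) h3
  unfold leviForm
  rw [h4, h4, map_add, map_neg]

variable {d k : ℕ} {X : Set (Fin d → ℂ)} {f : (Fin d → ℂ) → (Fin k → ℝ)}

/-- Vanishing of the Levi form is preserved by an automorphism `g` of `X` that transforms the
defining functions `f` linearly. -/
theorem LeviVanishesAt.apply (hX : IsOpen X) (hf : ContDiffOn ℝ ω f X) (g : HolAut X)
    {A A' : (Fin k → ℝ) →L[ℝ] (Fin k → ℝ)} (hA : ∀ x ∈ X, f (g.1 x) = A (f x))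
    (hA' : ∀ x ∈ X, f (g.1.symm x) = A' (f x)) {y : Fin d → ℂ} (hy : y ∈ X)
    (hL : LeviVanishesAt f y) : LeviVanishesAt f (g.1 y) := by
  obtain ⟨z, hz⟩ : ∃ z, z = g.1 y := ⟨_, rfl⟩
  have hzX : z ∈ X := by rw [hz]; exact g.mapsTo hy
  have hsz : g.1.symm z = y := by rw [hz]; exact g.1.symm_apply_apply y
  rw [← hz]
  set ψ : (Fin d → ℂ) → (Fin d → ℂ) := fun x => g.1.symm x with hψ
  have hψd : DifferentiableOn ℂ ψ X := g.2.2.2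
  have hψX : Set.MapsTo ψ X X := g.symm_mapsTo
  have hψz : ψ z = y := hsz
  have hfy : ContDiffAt ℝ ω f y := hf.contDiffAt (hX.mem_nhds hy)
  have hfz : ContDiffAt ℝ ω f z := hf.contDiffAt (hX.mem_nhds hzX)
  have hd : ∀ w, fderiv ℝ f y (fderiv ℂ ψ z w) = A' (fderiv ℝ f z w) := fun w => by
    have h1 : HasFDerivAt f (fderiv ℝ f y) (ψ z) := by
      rw [hψz]; exact (hfy.differentiableAt (by simp)).hasFDerivAt
    have h2 := h1.comp z
      ((hψd.differentiableAt (hX.mem_nhds hzX)).hasFDerivAt.restrictScalars ℝ)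
    have h3 := (A'.hasFDerivAt.comp z (hfz.differentiableAt (by simp)).hasFDerivAt)
    have h4 : (f ∘ ψ) =ᶠ[𝓝 z] A' ∘ f := by
      filter_upwards [hX.mem_nhds hzX] with x hx
      exact hA' x hx
    exact congrArg (fun T : (Fin d → ℂ) →L[ℝ] (Fin k → ℝ) => T w)
      (h2.unique (h3.congr_of_eventuallyEq h4))
  have hker : ∀ w, crDeriv f z w = 0 → crDeriv f y (fderiv ℂ ψ z w) = 0 := fun w hw => by
    rw [crDeriv_eq_zero_iff] at hw ⊢
    rw [← map_smul, hd, hd, hw.1, hw.2, map_zero]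
    exact ⟨rfl, rfl⟩
  intro u v hu hv
  have hLy := hL _ _ (hker u hu) (hker v hv)
  ext j
  set L : (Fin k → ℝ) →L[ℝ] ℝ := ContinuousLinearMap.proj j with hLd
  have h1 := leviForm_clm_comp hfz L u v
  have h2 : (fun x => L (f x)) =ᶠ[𝓝 z] fun x => (fun y => (L.comp A) (f y)) (ψ x) := by
    filter_upwards [hX.mem_nhds hzX] with x hx
    have h3 := hA (ψ x) (hψX hx)
    have h4 : g.1 (ψ x) = x := g.1.apply_symm_apply x
    exact (congrArg L ((congrArg f h4).symm.trans h3))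
  have hgy : ContDiffAt ℝ ω (fun y => (L.comp A) (f y)) (ψ z) := by
    rw [hψz]; exact (L.comp A).contDiff.contDiffAt.comp y hfy
  rw [leviForm_congr h2, leviForm_comp_holomorphic hX hψd hzX hgy, hψz,
    leviForm_clm_comp hfy, hLy, neg_add_cancel, map_zero] at h1
  rw [map_add, map_neg] at h1
  exact (neg_add_eq_zero.1 h1.symm)

/-- On the zero level of a momentum map, vanishing of the Levi form is an `H`-invariant condition. -/
theorem IsMomentumMap.leviVanishesAt_apply {H : Subgroup (HolAut X)}
    {b : Module.Basis (Fin k) ℝ (lieAlg H)} {μ : (Fin d → ℂ) → Module.Dual ℝ (lieAlg H)}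
    (hμ : IsMomentumMap H μ) (hX : IsSiegelDomain X) {h : HolAut X} (hh : h ∈ H) {y : Fin d → ℂ}
    (hy : y ∈ X) (hL : LeviVanishesAt (momentumCoord b μ) y) :
    LeviVanishesAt (momentumCoord b μ) (h.1 y) := by
  have key : ∀ g ∈ H, ∃ A : (Fin k → ℝ) →L[ℝ] (Fin k → ℝ), ∀ x ∈ X,
      momentumCoord b μ (g.1 x) = A (momentumCoord b μ x) := by
    intro g hg
    obtain ⟨A, hA⟩ := hμ.exists_momentumCoord_comp (b := b) hX.isOpen hg
    refine ⟨ContinuousLinearMap.pi fun j => ∑ i, A j i • ContinuousLinearMap.proj i,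
      fun x hx => funext fun j => ?_⟩
    rw [hA x hx]
    simp
  obtain ⟨A, hA⟩ := key h hh
  obtain ⟨A', hA'⟩ := key h⁻¹ (H.inv_mem hh)
  exact hL.apply hX.isOpen (hμ.contDiffOn_momentumCoord hX) h hA hA' hy

end LeviInvariance

/-! ### Joint differentiability of flows in time and space -/

section Flows

variable {d : ℕ} {X : Set (Fin d → ℂ)} {φ : ℝ → HolAut X} {ξ : (Fin d → ℂ) → (Fin d → ℂ)}

/-- Joint strict differentiability of the flow in time and space. -/
theorem IsOneParameterGroup.hasStrictFDerivAt (h : IsOneParameterGroup φ ξ) (hX : IsOpen X)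
    {x : Fin d → ℂ} (hx : x ∈ X) :
    HasStrictFDerivAt (fun p : ℝ × (Fin d → ℂ) => (φ p.1).1 p.2)
      ((ContinuousLinearMap.toSpanSingleton ℝ (ξ x)).coprod (ContinuousLinearMap.id ℝ (Fin d → ℂ)))
      (0, x) := by
  set F : ℝ → (Fin d → ℂ) → (Fin d → ℂ) := fun t y => (φ t).1 y with hF
  have hF0 : F 0 x = x := h.zero_apply x
  have hx' : ∀ᶠ p : ℝ × (Fin d → ℂ) in 𝓝 (0, x), p.2 ∈ X :=
    continuousAt_snd.eventually (hX.mem_nhds hx)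
  have hlim : ∀ {G : Type} [NormedAddCommGroup G] [NormedSpace ℝ G] (Φ : ℝ → (Fin d → ℂ) → G)
      (g g' : (Fin d → ℂ) → G), ContinuousAt g x → ContinuousAt g' x →
      (∃ r > 0, ∃ δ > 0, ∃ K : ℝ, ∀ y ∈ Metric.ball x r, ∀ s : ℝ, |s| < δ →
        ‖Φ s y - g y - s • g' y‖ ≤ K * s ^ 2) →
      Filter.Tendsto (fun p : ℝ × (Fin d → ℂ) => Φ p.1 p.2) (𝓝 (0, x)) (𝓝 (g x)) := by
    intro G _ _ Φ g g' hg hg' ⟨r, hr, δ, hδ, K, hK⟩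
    have h1 : Filter.Tendsto (fun p : ℝ × (Fin d → ℂ) => Φ p.1 p.2 - g p.2 - p.1 • g' p.2)
        (𝓝 (0, x)) (𝓝 0) := by
      rw [tendsto_zero_iff_norm_tendsto_zero]
      refine squeeze_zero' (g := fun p : ℝ × (Fin d → ℂ) => K * p.1 ^ 2)
        (Filter.Eventually.of_forall fun _ => norm_nonneg _) ?_ ?_
      · have h2 : ∀ᶠ p : ℝ × (Fin d → ℂ) in 𝓝 (0, x), p.2 ∈ Metric.ball x r :=
          continuousAt_snd.eventually (Metric.ball_mem_nhds x hr)
        have h3 : ∀ᶠ p : ℝ × (Fin d → ℂ) in 𝓝 (0, x), |p.1| < δ := by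
          have : ContinuousAt (fun p : ℝ × (Fin d → ℂ) => |p.1|) (0, x) := by fun_prop
          exact this.eventually (gt_mem_nhds (by simpa using hδ))
        filter_upwards [h2, h3] with p hp2 hp3
        exact hK _ hp2 _ hp3
      · have : Continuous fun p : ℝ × (Fin d → ℂ) => K * p.1 ^ 2 := by fun_prop
        simpa using this.tendsto (0, x)
    have h2 : Filter.Tendsto (fun p : ℝ × (Fin d → ℂ) => g p.2) (𝓝 (0, x)) (𝓝 (g x)) :=
      hg.tendsto.comp continuousAt_snd
    have h3 : Filter.Tendsto (fun p : ℝ × (Fin d → ℂ) => g' p.2) (𝓝 (0, x)) (𝓝 (g' x)) :=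
      hg'.tendsto.comp continuousAt_snd
    have h4 : Filter.Tendsto (fun p : ℝ × (Fin d → ℂ) => p.1) (𝓝 (0, x)) (𝓝 0) := continuousAt_fst
    have h5 := (h1.add h2).add (h4.smul h3)
    rw [zero_add, zero_smul, add_zero] at h5
    refine h5.congr fun p => ?_
    abel
  have hξc : ContinuousAt ξ x := (h.holomorphic.differentiableAt (hX.mem_nhds hx)).continuousAt
  have hFc : Filter.Tendsto (fun p : ℝ × (Fin d → ℂ) => F p.1 p.2) (𝓝 (0, x)) (𝓝 x) := by
    obtain ⟨r, hr, δ, hδ, K, -, hK⟩ := h.flow_estimate hX hx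
    exact hlim F id ξ continuousAt_id hξc ⟨r, hr, δ, hδ, K, hK⟩
  have hDc : Filter.Tendsto (fun p : ℝ × (Fin d → ℂ) => fderiv ℂ (φ p.1).1 p.2) (𝓝 (0, x))
      (𝓝 (ContinuousLinearMap.id ℂ (Fin d → ℂ))) := by
    obtain ⟨r, hr, δ, hδ, K, -, hK⟩ := h.fderiv_flow_estimate hX hx
    exact hlim (fun t y => fderiv ℂ (φ t).1 y) (fun _ => ContinuousLinearMap.id ℂ (Fin d → ℂ))
      (fderiv ℂ ξ) continuousAt_const
      ((h.holomorphic.fderiv_holomorphic hX).differentiableAt (hX.mem_nhds hx)).continuousAt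
      ⟨r, hr, δ, hδ, K, hK⟩
  have hst := hasStrictFDerivAt_uncurry_coprod (𝕜 := ℝ) (u := ((0 : ℝ), x)) (f := F)
    (f₁ := fun t y => ContinuousLinearMap.toSpanSingleton ℝ (ξ (F t y)))
    (f₂ := fun t y => (fderiv ℂ (φ t).1 y).restrictScalars ℝ)
    (hx'.mono fun p hp => (h.hasDerivAt p.2 hp p.1).hasFDerivAt)
    (hx'.mono fun p hp => ((φ p.1).differentiableAt hX hp).hasFDerivAt.restrictScalars ℝ)
    (by
      have h1 : Filter.Tendsto (fun p : ℝ × (Fin d → ℂ) => ξ (F p.1 p.2)) (𝓝 (0, x)) (𝓝 (ξ x)) :=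
        hξc.tendsto.comp hFc
      have h2 := ((ContinuousLinearMap.toSpanSingletonCLE (𝕜 := ℝ)
        (E := Fin d → ℂ)).continuous.tendsto (ξ x)).comp h1
      rw [ContinuousAt]
      have h3 : F 0 x = x := hF0
      change Filter.Tendsto (fun p : ℝ × (Fin d → ℂ) => ContinuousLinearMap.toSpanSingleton ℝ
        (ξ (F p.1 p.2))) _ (𝓝 (ContinuousLinearMap.toSpanSingleton ℝ (ξ (F 0 x))))
      rw [h3]
      exact h2)
    (by
      have h2 := ((ContinuousLinearMap.restrictScalarsL ℂ (Fin d → ℂ) (Fin d → ℂ) ℝ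
        ℝ).continuous.tendsto (ContinuousLinearMap.id ℂ (Fin d → ℂ))).comp hDc
      have h3 : fderiv ℂ (φ 0).1 x = ContinuousLinearMap.id ℂ (Fin d → ℂ) := by
        have : ((φ 0).1 : (Fin d → ℂ) → (Fin d → ℂ)) = id := funext fun y => h.zero_apply y
        rw [this, fderiv_id]
      rw [ContinuousAt]
      change Filter.Tendsto (fun p : ℝ × (Fin d → ℂ) => (fderiv ℂ (φ p.1).1 p.2).restrictScalars ℝ) _
        (𝓝 ((fderiv ℂ (φ 0).1 x).restrictScalars ℝ))
      rw [h3]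
      exact h2)
  refine hst.congr_fderiv ?_
  have h3 : fderiv ℂ (φ 0).1 x = ContinuousLinearMap.id ℂ (Fin d → ℂ) := by
    have : ((φ 0).1 : (Fin d → ℂ) → (Fin d → ℂ)) = id := funext fun y => h.zero_apply y
    rw [this, fderiv_id]
  change (ContinuousLinearMap.toSpanSingleton ℝ (ξ (F 0 x))).coprod
    ((fderiv ℂ (φ 0).1 x).restrictScalars ℝ) = _
  rw [h3, hF0]; rfl

end Flows

/-! ### Translates covering a neighbourhood in the zero level -/

section Covering

variable {d k : ℕ} {X : Set (Fin d → ℂ)}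

/-- The product `φ j₁ (t j₁) ⋯ φ jᵣ (t jᵣ)` over the list `l = [j₁, …, jᵣ]`. -/
def flowProd (φ : Fin k → ℝ → HolAut X) (l : List (Fin k)) (t : Fin k → ℝ) : HolAut X :=
  (l.map fun j => φ j (t j)).prod

variable {φ : Fin k → ℝ → HolAut X} {ξ : Fin k → (Fin d → ℂ) → (Fin d → ℂ)}

theorem flowProd_mem {H : Subgroup (HolAut X)} (hφ : ∀ j t, φ j t ∈ H) (l : List (Fin k))
    (t : Fin k → ℝ) : flowProd φ l t ∈ H := by
  refine H.list_prod_mem fun g hg => ?_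
  obtain ⟨j, -, rfl⟩ := List.mem_map.1 hg
  exact hφ j _

theorem flowProd_zero (hφ : ∀ j, IsOneParameterGroup (φ j) (ξ j)) (l : List (Fin k)) :
    flowProd φ l 0 = 1 := by
  refine List.prod_eq_one fun g hg => ?_
  obtain ⟨j, -, rfl⟩ := List.mem_map.1 hg
  exact (hφ j).map_zero

/-- The strict derivative at `(0, x)` of a product of one-parameter groups, jointly in the times and
in the point. -/
theorem exists_hasStrictFDerivAt_flowProd (hX : IsOpen X)
    (hφ : ∀ j, IsOneParameterGroup (φ j) (ξ j)) {x : Fin d → ℂ} (hx : x ∈ X) (l : List (Fin k)) :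
    ∃ D : (Fin k → ℝ) × (Fin d → ℂ) →L[ℝ] (Fin d → ℂ),
      HasStrictFDerivAt (fun p : (Fin k → ℝ) × (Fin d → ℂ) => (flowProd φ l p.1).1 p.2) D (0, x) ∧
      ∀ τ v, D (τ, v) = (l.map fun j => τ j • ξ j x).sum + v := by
  induction l with
  | nil =>
    refine ⟨ContinuousLinearMap.snd ℝ _ _, hasStrictFDerivAt_snd, fun τ v => ?_⟩
    simp
  | cons j l ih =>
    obtain ⟨D, hD, hDv⟩ := ih
    set Θ : (Fin k → ℝ) × (Fin d → ℂ) → (Fin d → ℂ) := fun p => (flowProd φ l p.1).1 p.2 with hΘ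
    have hΘ0 : Θ (0, x) = x := by
      change (flowProd φ l 0).1 x = x
      rw [flowProd_zero hφ]; rfl
    have h1 : HasStrictFDerivAt (fun p : (Fin k → ℝ) × (Fin d → ℂ) => p.1 j)
        ((ContinuousLinearMap.proj j).comp (ContinuousLinearMap.fst ℝ _ _)) (0, x) :=
      ((ContinuousLinearMap.proj (R := ℝ) (φ := fun _ : Fin k => ℝ) j).comp
        (ContinuousLinearMap.fst ℝ (Fin k → ℝ) (Fin d → ℂ))).hasStrictFDerivAt
    have h2 : HasStrictFDerivAt (fun p : ℝ × (Fin d → ℂ) => (φ j p.1).1 p.2)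
        ((ContinuousLinearMap.toSpanSingleton ℝ (ξ j x)).coprod
          (ContinuousLinearMap.id ℝ (Fin d → ℂ))) ((0 : Fin k → ℝ) j, Θ (0, x)) := by
      rw [hΘ0]; exact (hφ j).hasStrictFDerivAt hX hx
    refine ⟨_, h2.comp (0, x) (h1.prodMk hD), fun τ v => ?_⟩
    have h3 := hDv τ v
    change τ j • ξ j x + D (τ, v) = _
    rw [h3, List.map_cons, List.sum_cons, add_assoc]

variable {H B : Subgroup (HolAut X)} {b : Module.Basis (Fin k) ℝ (lieAlg H)}
  {μ : (Fin d → ℂ) → Module.Dual ℝ (lieAlg H)}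

/-- The translates under `H` of a submanifold of the zero level whose tangent space at `x₀` is the
distribution cover a neighbourhood of `x₀` in the zero level; so the Levi form vanishes there if it
vanishes on the submanifold. -/
theorem IsMomentumMap.eventually_leviVanishesAt (hμ : IsMomentumMap H μ) (hX : IsSiegelDomain X)
    (hB : IsConnectedSplitSolvable B) (hHB : H ≤ B) (hb : ∀ j, (b j).1 ∈ lieSet H)
    {x₀ : Fin d → ℂ} (hx₀ : x₀ ∈ zeroLevel μ)
    {P : Type} [NormedAddCommGroup P] [NormedSpace ℝ P] [CompleteSpace P]
    {e : P → (Fin d → ℂ)} {V₀ : P →L[ℝ] (Fin d → ℂ)} (he0 : e 0 = x₀)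
    (he : HasStrictFDerivAt e V₀ 0) (heM : ∀ a, e a ∈ zeroLevel μ)
    (hL : ∀ᶠ a in 𝓝 0, LeviVanishesAt (momentumCoord b μ) (e a))
    (hW : ∀ v, crDeriv (momentumCoord b μ) x₀ v = 0 → ∃ a, V₀ a = v) :
    ∀ᶠ x in 𝓝 x₀, x ∈ zeroLevel μ → LeviVanishesAt (momentumCoord b μ) x := by
  set f := momentumCoord b μ with hf
  have hM : IsGenericLevelSet X f (zeroLevel μ) := hμ.isGenericLevelSet hX hB hHB hb
  choose φ hφ hφH using hb
  obtain ⟨D, hD, hDv⟩ := exists_hasStrictFDerivAt_flowProd hX.isOpen hφ hx₀.1 (List.finRange k)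
  have hDv' : ∀ τ v, D (τ, v) = ∑ j, τ j • (b j).1 x₀ + v := fun τ v => by
    rw [hDv, Fin.sum_univ_def]
  set Θ : (Fin k → ℝ) × P → (Fin d → ℂ) := fun p => (flowProd φ (List.finRange k) p.1).1 (e p.2)
    with hΘ
  have hΘ0 : Θ 0 = x₀ := by
    change (flowProd φ (List.finRange k) 0).1 (e 0) = x₀
    rw [flowProd_zero hφ, he0]; rfl
  have hΘd : HasStrictFDerivAt Θ (D.comp ((ContinuousLinearMap.fst ℝ (Fin k → ℝ) P).prod
      (V₀.comp (ContinuousLinearMap.snd ℝ (Fin k → ℝ) P)))) 0 := by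
    have h1 : HasStrictFDerivAt e V₀ (0 : (Fin k → ℝ) × P).2 := he
    have h2 := h1.comp (0 : (Fin k → ℝ) × P) hasStrictFDerivAt_snd
    have h3 : HasStrictFDerivAt (fun p : (Fin k → ℝ) × (Fin d → ℂ) =>
        (flowProd φ (List.finRange k) p.1).1 p.2) D ((0 : (Fin k → ℝ) × P).1, e 0) := by
      rw [he0]; exact hD
    exact h3.comp (0 : (Fin k → ℝ) × P) (hasStrictFDerivAt_fst.prodMk h2)
  -- the directions `i ξ(x₀)` are transversal to the zero level
  set N : (Fin k → ℝ) →L[ℝ] (Fin d → ℂ) :=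
    ∑ j, (ContinuousLinearMap.proj j).smulRight (Complex.I • (b j).1 x₀) with hN
  have hNc : ∀ c, N c = Complex.I • ∑ j, c j • (b j).1 x₀ := fun c => by
    rw [hN, sum_apply, Finset.smul_sum]
    refine Finset.sum_congr rfl fun j _ => ?_
    rw [smul_comm]; rfl
  have hb : ∀ j, (b j).1 ∈ lieSet H := fun j => ⟨φ j, hφ j, hφH j⟩
  set L := fderiv ℝ f x₀ with hLd
  have hker : LinearMap.ker ((L.comp N).toLinearMap) = ⊥ := by
    rw [LinearMap.ker_eq_bot']
    intro c hc
    have hc' : L (Complex.I • ∑ j, c j • (b j).1 x₀) = 0 := by rw [← hNc]; exact hc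
    have hval : ∑ j, c j • (b j).1 x₀ = (∑ j, c j • b j : lieAlg H).1 x₀ := by
      simp only [Submodule.coe_sum, Finset.sum_apply]
      rfl
    refine (hμ.injective_crDeriv_sum hX hB hHB hb hx₀ (p := 0) (q := c) ?_).2
    have h0 : ∑ j, (0 : Fin k → ℝ) j • (b j).1 x₀ = 0 :=
      Finset.sum_eq_zero fun j _ => zero_smul ℝ _
    rw [h0, zero_add, crDeriv_eq_zero_iff]
    refine ⟨hc', ?_⟩
    rw [smul_smul, Complex.I_mul_I, neg_one_smul, map_neg, hval,
      hμ.fderiv_momentumCoord_apply hX.isOpen hb hx₀, neg_zero]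
  obtain ⟨K, hK, hanti⟩ := LinearMap.exists_antilipschitzWith _ hker
  set Γ : ((Fin k → ℝ) × P) × (Fin k → ℝ) → (Fin d → ℂ) := fun p => Θ p.1 + N p.2 with hΓ
  have hΓ0 : Γ 0 = x₀ := by
    change Θ 0 + N 0 = x₀
    rw [hΘ0, map_zero, add_zero]
  have hΓd := (hΘd.comp (f := Prod.fst) (0 : ((Fin k → ℝ) × P) × (Fin k → ℝ))
    hasStrictFDerivAt_fst).add (N.hasStrictFDerivAt.comp (f := Prod.snd)
      (0 : ((Fin k → ℝ) × P) × (Fin k → ℝ)) hasStrictFDerivAt_snd)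
  have hnhds : Filter.map Γ (𝓝 0) = 𝓝 x₀ := by
    have h1 := hΓd.map_nhds_eq_of_surj (LinearMap.range_eq_top.2 fun v => by
      obtain ⟨p, q, hpq⟩ := hμ.exists_crDeriv_sum_eq hX hB hHB hb hx₀ (crDeriv f x₀ v)
      obtain ⟨a, ha⟩ := hW (v - (∑ j, p j • (b j).1 x₀ + Complex.I • ∑ j, q j • (b j).1 x₀)) (by
        rw [map_sub, hpq, sub_self])
      refine ⟨((p, a), q), ?_⟩
      change D (p, V₀ a) + N q = v
      rw [hDv', hNc, ha]
      abel)
    have h2 : 𝓝 (Γ 0) = 𝓝 x₀ := by rw [hΓ0]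
    exact h1.trans h2
  have hfst : HasStrictFDerivAt f L x₀ := (hM.contDiffAt hx₀.1).hasStrictFDerivAt (by simp)
  have hev : ∀ᶠ z in 𝓝 (0 : ((Fin k → ℝ) × P) × (Fin k → ℝ)),
      Γ z ∈ zeroLevel μ → LeviVanishesAt f (Γ z) := by
    have hpair : Filter.Tendsto (fun z : ((Fin k → ℝ) × P) × (Fin k → ℝ) => (Γ z, Θ z.1)) (𝓝 0)
        (𝓝 (x₀, x₀)) := by
      have h1 : Filter.Tendsto Γ (𝓝 0) (𝓝 x₀) := hnhds.le
      have h2 : Filter.Tendsto (fun z : ((Fin k → ℝ) × P) × (Fin k → ℝ) => Θ z.1) (𝓝 0)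
          (𝓝 x₀) := by
        have h3 := hΘd.hasFDerivAt.continuousAt.tendsto
        rw [hΘ0] at h3
        exact h3.comp continuousAt_fst
      exact h1.prodMk_nhds h2
    have hε : 0 < 1 / (2 * (K : ℝ) * (‖N‖ + 1)) := by
      have : (0 : ℝ) < K := hK
      positivity
    have hlo := hpair.eventually (hfst.isLittleO.bound hε)
    have hLe : ∀ᶠ z : ((Fin k → ℝ) × P) × (Fin k → ℝ) in 𝓝 0, LeviVanishesAt f (e z.1.2) := by
      have h1 : ContinuousAt (fun z : ((Fin k → ℝ) × P) × (Fin k → ℝ) => z.1.2) 0 := by fun_prop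
      exact h1.eventually hL
    filter_upwards [hlo, hLe] with z hz hze hzM
    have hΘM : Θ z.1 ∈ zeroLevel μ :=
      hμ.apply_mem_zeroLevel hX.isOpen (flowProd_mem hφH _ _) (heM z.1.2)
    have hc : z.2 = 0 := by
      have h1 : Γ z - Θ z.1 = N z.2 := add_sub_cancel_left _ _
      have hfΓ : f (Γ z) = 0 := ((hM.mem_iff _).1 hzM).2
      have hfΘ : f (Θ z.1) = 0 := ((hM.mem_iff _).1 hΘM).2
      simp only [h1, hfΓ, hfΘ, sub_self, zero_sub, norm_neg] at hz
      have h2 := hanti.le_mul_dist z.2 0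
      rw [dist_eq_norm, dist_eq_norm, map_zero, sub_zero, sub_zero] at h2
      have h3 : ‖(L.comp N) z.2‖ ≤ 1 / (2 * (K : ℝ) * (‖N‖ + 1)) * (‖N‖ * ‖z.2‖) :=
        hz.trans (mul_le_mul_of_nonneg_left (N.le_opNorm _) hε.le)
      have hK' : (0 : ℝ) < K := hK
      have h4 : (K : ℝ) * (1 / (2 * (K : ℝ) * (‖N‖ + 1)) * (‖N‖ * ‖z.2‖))
          = ‖N‖ / (‖N‖ + 1) * (‖z.2‖ / 2) := by
        field_simp
      have h5 : ‖N‖ / (‖N‖ + 1) ≤ 1 := by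
        rw [div_le_one (by positivity)]; linarith
      have h6 : ‖z.2‖ ≤ ‖z.2‖ / 2 := calc
        ‖z.2‖ ≤ K * ‖(L.comp N) z.2‖ := h2
        _ ≤ K * (1 / (2 * (K : ℝ) * (‖N‖ + 1)) * (‖N‖ * ‖z.2‖)) := by gcongr
        _ = ‖N‖ / (‖N‖ + 1) * (‖z.2‖ / 2) := h4
        _ ≤ 1 * (‖z.2‖ / 2) := by gcongr
        _ = ‖z.2‖ / 2 := one_mul _
      have h7 := norm_nonneg z.2
      exact norm_le_zero_iff.1 (by linarith)
    have hΓΘ : Γ z = Θ z.1 := by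
      change Θ z.1 + N z.2 = Θ z.1
      rw [hc, map_zero, add_zero]
    rw [hΓΘ]
    exact hμ.leviVanishesAt_apply hX (flowProd_mem hφH _ _) (heM z.1.2).1 hze
  rw [← hnhds]
  exact hev

end Covering

/-! ### Consequences of the Lie condition -/

section LieConditionConsequences

variable {d : ℕ} {X : Set (Fin d → ℂ)}

/-- The fields of a finite-dimensional space of vector fields, in the coordinates of a basis. -/
def fieldFrame {m : ℕ} (η : Fin m → (Fin d → ℂ) → (Fin d → ℂ)) (x : Fin d → ℂ) :
    (Fin m → ℝ) →L[ℝ] (Fin d → ℂ) :=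
  ∑ j, (ContinuousLinearMap.proj j : (Fin m → ℝ) →L[ℝ] ℝ).smulRight (η j x)

variable {m : ℕ} {η : Fin m → (Fin d → ℂ) → (Fin d → ℂ)}

theorem fieldFrame_apply (x : Fin d → ℂ) (b : Fin m → ℝ) :
    fieldFrame η x b = (∑ j, b j • η j) x := by
  rw [fieldFrame, sum_apply, Finset.sum_apply]; rfl

theorem contDiffOn_fieldFrame (hX : IsOpen X) (hη : ∀ j, DifferentiableOn ℂ (η j) X) :
    ContDiffOn ℝ ω (fieldFrame η) X :=
  ContDiffOn.sum fun j _ => contDiffOn_const.smulRight ((hη j).contDiffOn_real hX)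

theorem fderiv_fieldFrame (hX : IsOpen X) (hη : ∀ j, DifferentiableOn ℂ (η j) X) {x : Fin d → ℂ}
    (hx : x ∈ X) (u : Fin d → ℂ) (b : Fin m → ℝ) :
    fderiv ℝ (fieldFrame η) x u b = fderiv ℂ (∑ j, b j • η j) x u := by
  have h1 := ((contDiffOn_fieldFrame hX hη).contDiffAt (hX.mem_nhds hx)).differentiableAt (by simp)
  have h2 := h1.hasFDerivAt.clm_apply (hasFDerivAt_const b x)
  have h3 : DifferentiableAt ℂ (∑ j, b j • η j) x :=
    DifferentiableAt.sum fun j _ => ((hη j).differentiableAt (hX.mem_nhds hx)).const_smul (b j)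
  have h4 : (fun y => fieldFrame η y b) = ∑ j, b j • η j := funext fun y => fieldFrame_apply y b
  rw [← fderiv_real_eq h3, ← h4, h2.fderiv]
  simp

/-- A Lie algebra of holomorphic fields that are determined by their values at `x₀` has structure
constants in the coordinates of a basis. -/
theorem exists_isFieldAlgebra (hX : IsOpen X) (hη : ∀ j, DifferentiableOn ℂ (η j) X)
    (hbr : ∀ a b : Fin m → ℝ, ∃ c : Fin m → ℝ, fieldBracket X (∑ j, b j • η j) (∑ j, a j • η j)
      = ∑ j, c j • η j) {x₀ : Fin d → ℂ} (hx₀ : x₀ ∈ X)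
    (hi : Function.Injective (fieldFrame η x₀)) :
    ∃ br, IsFieldAlgebra X (fieldFrame η) br := by
  choose c hc using hbr
  have hV : ∀ x ∈ X, ∀ a b, fderiv ℝ (fieldFrame η) x (fieldFrame η x b) a
      - fderiv ℝ (fieldFrame η) x (fieldFrame η x a) b = fieldFrame η x (c a b) := by
    intro x hx a b
    rw [fderiv_fieldFrame hX hη hx, fderiv_fieldFrame hX hη hx, fieldFrame_apply, fieldFrame_apply,
      fieldFrame_apply, ← hc, fieldBracket, Set.indicator_of_mem hx]
    rfl
  let br₀ : (Fin m → ℝ) →ₗ[ℝ] (Fin m → ℝ) →ₗ[ℝ] (Fin m → ℝ) := LinearMap.mk₂ ℝ c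
    (fun a a' b => hi <| by
      rw [map_add, ← hV x₀ hx₀, ← hV x₀ hx₀, ← hV x₀ hx₀]
      simp only [map_add, add_apply]
      abel)
    (fun r a b => hi <| by
      rw [map_smul, ← hV x₀ hx₀, ← hV x₀ hx₀]
      simp only [map_smul, smul_apply, smul_sub])
    (fun a b b' => hi <| by
      rw [map_add, ← hV x₀ hx₀, ← hV x₀ hx₀, ← hV x₀ hx₀]
      simp only [map_add, add_apply]
      abel)
    (fun r a b => hi <| by
      rw [map_smul, ← hV x₀ hx₀, ← hV x₀ hx₀]
      simp only [map_smul, smul_apply, smul_sub])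
  refine ⟨LinearMap.toContinuousLinearMap
    (LinearMap.toContinuousLinearMap.toLinearMap.comp br₀), hX, contDiffOn_fieldFrame hX hη,
    fun x hx u b => ?_, hV⟩
  rw [fderiv_fieldFrame hX hη hx, fderiv_fieldFrame hX hη hx, map_smul]

variable {B H : Subgroup (HolAut X)} {μ : (Fin d → ℂ) → Module.Dual ℝ (lieAlg H)}

/-- Under the Lie condition the Levi form vanishes along `exp(s) x₀`, hence on the `H`-translates of
this set near `x₀`, hence everywhere. -/
theorem LieCondition.leviVanishesAt (hLie : LieCondition B μ) (hX : IsSiegelDomain X)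
    (hB : IsConnectedSplitSolvable B) (hHB : H ≤ B) (hμ : IsMomentumMap H μ) {k : ℕ}
    {b : Module.Basis (Fin k) ℝ (lieAlg H)} (hb : ∀ j, (b j).1 ∈ lieSet H) :
    ∀ x ∈ zeroLevel μ, LeviVanishesAt (momentumCoord b μ) x := by
  obtain ⟨hconn, x₀, hx₀, s, hsB, hsbr, hsW, hexp⟩ := hLie
  have hM := hμ.isGenericLevelSet (b := b) hX hB hHB hb
  have hsle : s ≤ lieAlg B := fun ξ hξ => Submodule.subset_span (hsB ξ hξ)
  have := hB.finite_lieAlg B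
  have hfin : Module.Finite ℝ s := Submodule.finiteDimensional_of_le hsle
  set e := Module.finBasis ℝ s with he
  set η : Fin (Module.finrank ℝ s) → (Fin d → ℂ) → (Fin d → ℂ) := fun j => (e j).1 with hηd
  have hsum : ∀ c : Fin (Module.finrank ℝ s) → ℝ, ∑ j, c j • η j ∈ s := fun c =>
    Submodule.sum_mem _ fun j _ => Submodule.smul_mem _ _ (e j).2
  have hrepr : ∀ ξ ∈ s, ∃ c : Fin (Module.finrank ℝ s) → ℝ, ∑ j, c j • η j = ξ := fun ξ hξ => by
    refine ⟨e.repr ⟨ξ, hξ⟩, ?_⟩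
    have := congrArg Subtype.val (e.sum_repr ⟨ξ, hξ⟩)
    refine Eq.trans ?_ this
    rw [Submodule.coe_sum]; rfl
  have hη : ∀ j, DifferentiableOn ℂ (η j) X := fun j => holomorphic_of_mem_lieAlg (hsle (e j).2)
  have hi : ∀ x ∈ X, Function.Injective (fieldFrame η x) := fun x hx => by
    rw [injective_iff_map_eq_zero]
    intro c hc
    rw [fieldFrame_apply] at hc
    have h1 := eq_zero_of_mem_lieAlg_of_apply_eq_zero hX hB (hsle (hsum c)) hx hc
    have h2 : ∑ j, c j • e j = 0 := Subtype.ext <| by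
      rw [Submodule.coe_sum]; exact h1
    exact funext (Fintype.linearIndependent_iff.1 e.linearIndependent c h2)
  obtain ⟨br, hbr⟩ := exists_isFieldAlgebra hX.isOpen hη (fun a b => by
    obtain ⟨c, hc⟩ := hrepr _ (hsbr _ (hsum b) _ (hsum a))
    exact ⟨c, hc.symm⟩) hx₀.1 (hi x₀ hx₀.1)
  choose φ hφ hφB using fun c => hsB _ (hsum c)
  have hW : ∀ v, crDeriv (momentumCoord b μ) x₀ v = 0 ↔ ∃ c, fieldFrame η x₀ c = v := fun v => by
    rw [← hM.mem_leviDistribution_iff hx₀, hsW]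
    constructor
    · rintro ⟨ξ, hξ, rfl⟩
      obtain ⟨c, rfl⟩ := hrepr ξ hξ
      exact ⟨c, fieldFrame_apply x₀ c⟩
    · rintro ⟨c, rfl⟩
      exact ⟨_, hsum c, (fieldFrame_apply x₀ c).symm⟩
  obtain ⟨h0, hst, hL⟩ := hM.leviVanishesAt_exp hbr hx₀ (y := fun c t => (φ c t).1 x₀)
    (fun c => (hφ c).zero_apply x₀)
    (fun c t _ => ⟨((hφ c).hasDerivAt x₀ hx₀.1 t).congr_deriv (fieldFrame_apply _ c).symm,
      (φ c t).mapsTo hx₀.1⟩)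
    (fun c => hexp _ (hsum c) (φ c) (hφ c)) hi hW
  exact hM.leviVanishesAt_of_eventually hconn.isPreconnected hx₀
    (hμ.eventually_leviVanishesAt hX hB hHB hb hx₀ h0 hst
      (fun c => hexp _ (hsum c) (φ c) (hφ c)) hL fun v hv => (hW v).1 hv)

end LieConditionConsequences

end

theorem proposition3p10 (d : ℕ) (X : Set (Fin d → ℂ)) (hX : IsSiegelDomain X)
    (hhom : IsHomogeneousDomain X)
    (B : Subgroup (HolAut X)) (hB : Maximal IsConnectedSplitSolvable B)
    (H : Subgroup (HolAut X)) (hHB : H ≤ B)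
    (hH : IsClosed ((↑) ⁻¹' (H : Set (HolAut X)) : Set B))
    (μ : (Fin d → ℂ) → Module.Dual ℝ (lieAlg H)) (hμ : IsMomentumMap H μ)
    (hLie : LieCondition B μ) :
    IsAnalyticSubmanifold ℝ (zeroLevel μ) ∧ IsLeviFlat (zeroLevel μ) := by
  have := hB.prop.finite_lieAlg H
  obtain ⟨k, b, hb⟩ := exists_basis_mem_lieSet H
  have hM := hμ.isGenericLevelSet hX hB.prop hHB hb
  exact ⟨hM.isAnalyticSubmanifold,
    hM.isLeviFlat (hLie.leviVanishesAt hX hB.prop hHB hμ hb)⟩
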